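/- **Setting.** Let $K$ be a division ring, $Q$ a finite quiver with head and tail maps $h,t$, and $\sigma_a\in\operatorname{Aut}(K)$ for each arrow $a$. The semilinear path algebra $K_\sigma Q$ is the ring generated by $K$, the trivial paths $e_v$ and the arrows, with the usual path relations, $e_v\lambda=\lambda e_v$ and $a\lambda=\sigma_a(\lambda)a$. Let $Sp$ be a set of loops ("special"; the other arrows are "ordinary"), let $q_s=x^2-\beta_s x+\gamma_s\in K[x;\sigma_s]$ for $s\in Sp$ (where $x\lambda=\sigma_s(\lambda)x$), and let $Z$ be a set of paths of length $\ge 2$ which do not start or end with a special loop and do not contain $s^2$ for $s \in Sp$. Assume that at most two arrows have any given head, at most two have any given tail, and for each ordinary arrow $a$ there is at most one arrow $c$ with $ca$ a path not in $Z$, and at most one arrow $c$ with $ac$ a path not in $Z$. Let $R=K_\sigma Q/(Z,\ s^2-\beta_s s+\gamma_s e_{h(s)}\ (s\in Sp))$. Assume that each $q_s$ is normal ($q_sK[x;\sigma_s]=K[x;\sigma_s]q_s$) and $\gamma_s\ne0$. **Words.** Letters are $a$, $a^{-1}$ ($a$ ordinary) and $s^*=(s^*)^{-1}$ ($s$ special),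 with the evident heads and tails. Fix signs $\pm1$ of letters such that distinct letters with the same head and sign are of the form $a^{-1},b$ with $ab\in Z$. A word $w$ with index set $I=\{0,\dots,n\}$ or $\mathbb Z$ consists of vertices $v_i$ $(i\in I)$, letters $w_i$ $(i-1,i\in I)$ with head $v_{i-1}$ and tail $v_i$, and a sign $\epsilon$, such that $w_i^{-1}$ and $w_{i+1}$ have opposite signs, $w_1$ has sign $\epsilon$ and $w_0^{-1}$ has sign $-\epsilon$ (where these letters exist). Inverses $w^{-1}$ are formed by inverting letters and reversing the order, with $(w^{-1})_i=(w_{-i})^{-1}$ if $I=\mathbb Z$, and the sign is changed for words of length $0$; the shift of a $\mathbb Z$-indexed word is given by $w[m]_i=w_{m+i}$, and $w[m]=w$ for finite words. Words $u,w$ are equivalent, $u\sim w$, if $u=w[m]$ or $u=w^{-1}[m]$ for some $m \in \mathbb Z$. A word $w$ is relation-admissible if neither $w$ nor $w^{-1}$ contains consecutive letters $r^*$ with $r\in Z$ ($r^*$ is $r$ with each special loop $s$ replaced by $s^*$), and a finite word $w$ is end-admissible if neither $ws^*$ nor $w^{-1}s^*$ is a word for any $s\in Sp$. A string is a finite relation-admissible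 end-admissible word; a band is a relation-admissible $\mathbb Z$-indexed word with $w=w[m]$ for some $m>0$, the least such $m$ being its period. A string $w$ is symmetric if $w=w^{-1}$, and a band $w$ is symmetric if $w^{-1}=w[m]$ for some $m \in \mathbb Z$; otherwise they are asymmetric. **Walks.** If $w_i=s^*$, the words $w_{>i}$ and $(w_{\le i-1})^{-1}$ are compared in the order in which $uy\cdots<u<ux^{-1}\cdots$ for ordinary arrows $x,y$ and finite words $u$; $i$ is a symmetry if they are equal. The walk $C=C_w$ is obtained from $w$ by replacing each $w_i=s^*$ by $s$ if $w_{>i}<(w_{\le i-1})^{-1}$ or if $i$ is a symmetry and $i\le0$, and by $s^{-1}$ otherwise. Its quiver has vertex set $I$, an arrow $i\to i-1$ labelled $a$ if $C_i=a$, and an arrow $i-1\to i$ labelled $a$ if $C_i=a^{-1}$. The $R$-module $M(C)$ has generators $b_i$ $(i\in I)$ and relations $e_{v_i}b_i=b_i$; $ab_i=b_j$ for each arrow $i\to j$ labelled $a$; and $ab_i=0$ if $a$ is ordinary, $t(a)=v_i$ and no arrow labelled $a$ starts at $i$. Choose $\pi_i\in\operatorname{Aut}(K)$ $(i\in I)$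 with $\pi_j=\sigma_a\pi_i$ for every arrow $i\to j$ labelled $a$. Then $K$ acts on the right of $M(C)$ by $b_i\lambda=\pi_i(\lambda)b_i$. **The rings $R_w$.** The following rings contain (the image of) $K$ and, extending this action of $K$, make $M(C_w)$ an $R$-$R_w$-bimodule. * Asymmetric string: $R_w=K$. * Symmetric string of length $n=2k+1$ with $w_{k+1}=s^*$: $R_w=K[x;\pi_k^{-1}\pi_{k+1}]/(x^2-\beta x+\gamma)$ with $\beta=\pi_k^{-1}(\beta_s)$, $\gamma=\pi_k^{-1}(\gamma_s)$, acting by $b_ix=b_{n-i}$ for $i\le k$ and $b_ix=b_i\beta-b_{n-i}\gamma$ for $i>k$. * Asymmetric band of period $n$: $R_w=K[x,x^{-1};\pi_0^{-1}\pi_{-n}]$, acting by $b_ix=b_{i-n}$. * Symmetric band, with $r+1$ the least positive symmetry, $-p$ the greatest non-positive symmetry, $w_{r+1}=s^*$ and $w_{-p}=t^*$: $R_w$ is the free product over $K$ of $R'=K[y;\pi_{-p}^{-1}\pi_{-p-1}]/(y^2-\beta'y+\gamma')$, with $\beta'=\pi_{-p}^{-1}(\beta_t)$ and $\gamma'=\pi_{-p}^{-1}(\gamma_t)$,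 and $R''=K[x;\pi_r^{-1}\pi_{r+1}]/(x^2-\beta x+\gamma)$, with $\beta=\pi_r^{-1}(\beta_s)$ and $\gamma=\pi_r^{-1}(\gamma_s)$. Here $b_ix=b_{2r+1-i}$ for $i\le r$ and $b_ix=b_i\beta-b_{2r+1-i}\gamma$ for $i>r$, while $b_iy=b_{-2p-1-i}$ for $i\ge-p$ and $b_iy=b_i\beta'-b_{-2p-1-i}\gamma'$ for $i<-p$. **The functors $F_C$.** Let $C=C_u$ for a string or band $u$. For an $R$-module $N$ let $T_C(N)=\operatorname{Hom}_R(M(C),N)$, a left $K$-module by $(\lambda\theta)(m)=\theta(m\lambda)$. If $u$ is a band, let $B^+_C(N)$ and $B^-_C(N)$ consist of the $\theta$ with $\theta(b_i)=0$ for $i\ll0$ and for $i\gg0$, respectively. If $u$ is a string of length $n$, let them consist of the $\theta$ with $\theta(b_0)\in 1^-_{v_0,-\epsilon}(N)$ and with $\theta(b_n)\in1^-_{v_n,-\epsilon'}(N)$, respectively, where $\epsilon,\epsilon'$ are the signs of $u$ and $u^{-1}$, and where $1^-_{v,\delta}(N)$ is $aN$ if there is an arrow $a$ with head $v$ such that the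 letter $a$ (or $a^*$, if $a$ is special) has sign $\delta$, and is $0$ otherwise. Let $F_C(N)=T_C(N)/(B^+_C(N)+B^-_C(N))$. **Theorem.** Let $u$ be a string or a band, let $W$ be a set of strings and bands, and for each $w\in W$ let $V_w$ be a left $R_w$-module which is finite-dimensional over $K$. Let $M=\bigoplus_{w\in W}M(C_w)\otimes_{R_w}V_w$ and $W_u=\{w\in W\mid w\sim u\}$. Then there are automorphisms $\pi_w$ of $K$ $(w\in W_u)$ and an isomorphism of left $K$-modules $$F_{C_u}(M)\;\cong\;\bigoplus_{w\in W_u}{}_{\pi_w}V_w,$$ where ${}_{\pi_w}V_w$ is the $K$-module obtained from $V_w$ by restriction along $\pi_w$. -/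

import Mathlib

open scoped TensorProduct DirectSum

noncomputable section

namespace SLC

/-! ### Modules restricted along ring homomorphisms -/

/-- The `A`-module obtained from the `B`-module `V` by restriction along `f : A →+* B`. For an
automorphism `f` of `A = B` this is the twist of `V` by `f`. -/
def Restrict {A B : Type*} [Semiring A] [Semiring B] (_f : A →+* B) (V : Type*) : Type _ := V

instance {A B : Type*} [Semiring A] [Semiring B] (f : A →+* B) (V : Type*) [AddCommGroup V] :
    AddCommGroup (Restrict f V) := inferInstanceAs (AddCommGroup V)

instance {A B : Type*} [Semiring A] [Semiring B] (f : A →+* B) (V : Type*) [AddCommGroup V]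
    [Module B V] : Module A (Restrict f V) := Module.compHom V f

/-! ### Skew polynomials, skew Laurent polynomials and their quotients -/

section Skew

variable {K : Type*} [DivisionRing K]

/-- A copy of `K` on which powers of a variable act through powers of `τ`; the skew monoid
algebras over it satisfy `x * a = τ a * x`. -/
def Tw (_τ : RingAut K) : Type _ := K

instance (τ : RingAut K) : DivisionRing (Tw τ) := inferInstanceAs (DivisionRing K)

instance (τ : RingAut K) : MulSemiringAction (Multiplicative ℕ) (Tw τ) :=
  MulSemiringAction.compHom (M := RingAut K) K (powersHom (RingAut K) τ)

instance (τ : RingAut K) : MulSemiringAction (Multiplicative ℤ) (Tw τ) :=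
  MulSemiringAction.compHom (M := RingAut K) K (zpowersHom (RingAut K) τ)

/-- The skew polynomial ring `K[x;τ]`, with `x * a = τ a * x`. -/
abbrev SkewPoly (τ : RingAut K) : Type _ := SkewPolynomial (Tw τ)

/-- The skew Laurent polynomial ring `K[x,x⁻¹;τ]`, with `x * a = τ a * x`. -/
abbrev SkewLaurent (τ : RingAut K) : Type _ := SkewMonoidAlgebra (Tw τ) (Multiplicative ℤ)

/-- Constants of `K[x;τ]`. -/
def skewC (τ : RingAut K) : K →+* SkewPoly τ :=
  (SkewPolynomial.CRingHom : Tw τ →+* SkewPoly τ)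

/-- Constants of `K[x,x⁻¹;τ]`. -/
def laurentC (τ : RingAut K) : K →+* SkewLaurent τ :=
  (SkewMonoidAlgebra.singleOneRingHom : Tw τ →+* SkewLaurent τ)

/-- The monic quadratic `x² - β x + γ` in `K[x;τ]`. -/
def quad (τ : RingAut K) (β γ : K) : SkewPoly τ :=
  SkewPolynomial.X ^ 2 - skewC τ β * SkewPolynomial.X + skewC τ γ

/-- An element `r` of a ring is normal if `r R = R r`. -/
def IsNormalElem {R : Type*} [Ring R] (r : R) : Prop :=
  Set.range (fun a => r * a) = Set.range (fun a => a * r)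

inductive QuadRel (τ : RingAut K) (β γ : K) : SkewPoly τ → SkewPoly τ → Prop
  | quad : QuadRel τ β γ (quad τ β γ) 0

/-- The quotient of `K[x;τ]` by the ideal generated by `x² - β x + γ`. -/
abbrev QuadRing (τ : RingAut K) (β γ : K) : Type _ := RingQuot (QuadRel τ β γ)

/-- The structural map from `K`. -/
def quadC (τ : RingAut K) (β γ : K) : K →+* QuadRing τ β γ :=
  (RingQuot.mkRingHom (QuadRel τ β γ)).comp (skewC τ)

/-- The coefficient of `x ^ n`. -/
def cf {τ : RingAut K} (p : SkewPoly τ) (n : ℕ) : K := SkewPolynomial.coeff p n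

/-- The monomial `b x ^ n`. -/
def mon (τ : RingAut K) (n : ℕ) (b : K) : SkewPoly τ :=
  SkewPolynomial.monomial (R := Tw τ) n b

lemma cf_mul_mon_add {τ : RingAut K} (p : SkewPoly τ) (m n : ℕ) (b : K) :
    cf (p * mon τ m b) (n + m) = cf p n * (τ ^ n) b :=
  SkewMonoidAlgebra.coeff_mul_single_aux (k := Tw τ) (G := Multiplicative ℕ)
    (x := Multiplicative.ofAdd m) (y := Multiplicative.ofAdd n) (r := (b : K)) p fun a => by
    rw [ofAdd_add]; exact mul_left_inj _

lemma cf_mul_mon_lt {τ : RingAut K} (p : SkewPoly τ) (m n : ℕ) (h : n < m) (b : K) :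
    cf (p * mon τ m b) n = 0 :=
  SkewMonoidAlgebra.coeff_mul_single_of_not_exists_mul (k := Tw τ) (G := Multiplicative ℕ)
    (g := Multiplicative.ofAdd m) (g' := Multiplicative.ofAdd n) (b : K) p fun d hd => by
    have := congrArg Multiplicative.toAdd hd
    simp only [toAdd_ofAdd, toAdd_mul] at this
    omega

lemma cf_add {τ : RingAut K} (p q : SkewPoly τ) (n : ℕ) : cf (p + q) n = cf p n + cf q n :=
  congrArg (fun f => f (Multiplicative.ofAdd n)) (SkewMonoidAlgebra.coeff_add p q)

lemma cf_sub {τ : RingAut K} (p q : SkewPoly τ) (n : ℕ) : cf (p - q) n = cf p n - cf q n :=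
  congrArg (fun f => f (Multiplicative.ofAdd n)) (SkewMonoidAlgebra.coeff_sub p q)

lemma quad_eq (τ : RingAut K) (β γ : K) :
    quad τ β γ = mon τ 2 1 - mon τ 1 β + mon τ 0 γ := by
  have h : skewC τ β * SkewPolynomial.X = mon τ 1 β := SkewPolynomial.C_mul_X_eq_monomial
  rw [quad, SkewPolynomial.X_pow_eq_monomial, h]
  rfl

lemma cf_mon {τ : RingAut K} (m n : ℕ) (b : K) : cf (mon τ m b) n = if m = n then b else 0 :=
  SkewPolynomial.coeff_monomial

lemma cf_eventually {τ : RingAut K} (p : SkewPoly τ) : ∃ N, ∀ n, N ≤ n → cf p n = 0 := by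
  refine ⟨(SkewPolynomial.support p).sup id + 1, fun n hn => ?_⟩
  by_contra h
  have : n ∈ SkewPolynomial.support p := SkewPolynomial.mem_support_iff.2 h
  have h2 : n ≤ (SkewPolynomial.support p).sup id := Finset.le_sup (f := id) this
  omega

/-- The consequences of normality of a monic quadratic that make `x` act on string and band
modules. -/
lemma normal_quad {τ : RingAut K} {β γ : K} (h : IsNormalElem (quad τ β γ)) :
    τ β = β ∧ τ γ = γ ∧ (∀ a, β * a = τ a * β) ∧ ∀ a, γ * a = τ (τ a) * γ := by
  have key : ∀ (p : SkewPoly τ) (n : ℕ), cf (p * quad τ β γ) (n + 2) =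
      cf p n - cf p (n + 1) * (τ ^ (n + 1)) β + cf p (n + 2) * (τ ^ (n + 2)) γ := by
    intro p n
    have h1 := cf_mul_mon_add p 2 n 1
    have h2 := cf_mul_mon_add p 1 (n + 1) β
    have h3 := cf_mul_mon_add p 0 (n + 2) γ
    rw [quad_eq, mul_add, mul_sub, cf_add, cf_sub, h1, h2, map_one, mul_one, ← h3]
  have key1 : ∀ p : SkewPoly τ, cf (p * quad τ β γ) 1 = - (cf p 0 * β) + cf p 1 * τ γ := by
    intro p
    have h2 := cf_mul_mon_add p 1 0 β
    have h3 := cf_mul_mon_add p 0 1 γ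
    rw [pow_one] at h3
    rw [quad_eq, mul_add, mul_sub, cf_add, cf_sub, cf_mul_mon_lt p 2 1 (by norm_num), zero_sub,
      ← h3]
    exact congrArg (fun z => - z + _) h2
  have key0 : ∀ p : SkewPoly τ, cf (p * quad τ β γ) 0 = cf p 0 * γ := by
    intro p
    have h3 := cf_mul_mon_add p 0 0 γ
    rw [quad_eq, mul_add, mul_sub, cf_add, cf_sub, cf_mul_mon_lt p 2 0 (by norm_num),
      cf_mul_mon_lt p 1 0 (by norm_num)]
    simpa using h3
  have van : ∀ (d : ℕ) (p : SkewPoly τ), (∀ n, d ≤ n → cf (p * quad τ β γ) (n + 2) = 0) →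
      ∀ n, d ≤ n → cf p n = 0 := by
    intro d p hp
    obtain ⟨N, hN⟩ := cf_eventually p
    have : ∀ k n, N ≤ n + k → d ≤ n → cf p n = 0 := by
      intro k
      induction k using Nat.strong_induction_on with
      | _ k ih =>
        intro n hn hd
        rcases Nat.eq_zero_or_pos k with rfl | hk
        · exact hN n hn
        · have h1 := ih (k - 1) (by omega) (n + 1) (by omega) (by omega)
          have h2 := ih (k - 1) (by omega) (n + 2) (by omega) (by omega)
          have h3 := key p n
          rw [hp n hd, h1, h2] at h3
          simpa using h3.symm
    exact fun n hn => this N n (by omega) hn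
  have cq : ∀ n, cf (quad τ β γ) n =
      (if 2 = n then 1 else 0) - (if 1 = n then β else 0) + if 0 = n then γ else 0 := by
    intro n; rw [quad_eq, cf_add, cf_sub, cf_mon, cf_mon, cf_mon]
  have sc : ∀ a, β * τ a = τ (τ a) * β ∧ γ * a = τ (τ a) * γ := by
    intro a
    obtain ⟨p, hp⟩ : quad τ β γ * mon τ 0 a ∈ Set.range (fun b => b * quad τ β γ) :=
      h ▸ ⟨_, rfl⟩
    change p * quad τ β γ = _ at hp
    have c : ∀ n, cf (p * quad τ β γ) n = cf (quad τ β γ) n * (τ ^ n) a := by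
      intro n; rw [hp]; exact cf_mul_mon_add _ 0 n a
    have p1 := van 1 p (fun n hn => by rw [c, cq]; simp; omega)
    have e2 := key p 0
    have e1 := key1 p
    have e0 := key0 p
    rw [c, cq] at e0 e1 e2
    rw [p1 (0 + 1) (by norm_num), p1 (0 + 2) (by norm_num)] at e2
    rw [p1 1 le_rfl] at e1
    simp [pow_two] at e0 e1 e2
    rw [← e2] at e0 e1
    exact ⟨e1, e0⟩
  have sx : τ β = β ∧ τ γ = γ := by
    obtain ⟨p, hp⟩ : quad τ β γ * mon τ 1 1 ∈ Set.range (fun b => b * quad τ β γ) :=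
      h ▸ ⟨_, rfl⟩
    change p * quad τ β γ = _ at hp
    have c : ∀ n, cf (p * quad τ β γ) (n + 1) = cf (quad τ β γ) n := by
      intro n; rw [hp, cf_mul_mon_add, map_one, mul_one]
    have c0 : cf (p * quad τ β γ) 0 = 0 := by rw [hp, cf_mul_mon_lt _ _ _ (by norm_num)]
    have p2 := van 2 p (fun n hn => by
      rw [c, cq, if_neg (by omega), if_neg (by omega), if_neg (by omega)]; simp)
    have e3 := key p 1
    have e2 := key p 0
    have e1 := key1 p
    have e0 := key0 p
    rw [c, cq] at e3 e2 e1
    rw [c0] at e0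
    rw [p2 (1 + 1) (by norm_num), p2 (1 + 2) (by norm_num)] at e3
    rw [p2 (0 + 2) (by norm_num)] at e2
    simp at e0 e1 e2 e3
    rw [← e3] at e1 e2
    rcases e0 with e0 | e0
    · rw [e0] at e1 e2
      simp at e1 e2
      exact ⟨e2.symm, e1.symm⟩
    · subst e0
      simp at e1
      rcases e1 with e1 | e1
      · rw [e1] at e2
        simp at e2
        exact ⟨e2.symm, by simp⟩
      · subst e1; simp
  refine ⟨sx.1, sx.2, fun a => ?_, fun a => (sc a).2⟩
  have := (sc (τ.symm a)).1
  simpa using this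

section Lift

variable {E : Type*} [Ring E]

lemma skew_comm_pow {τ : RingAut K} (κ : K →+* E) (ξ : E) (h : ∀ a, κ (τ a) * ξ = ξ * κ a)
    (m : ℕ) (a : K) : κ ((τ ^ m) a) * ξ ^ m = ξ ^ m * κ a := by
  induction m with
  | zero => simp
  | succ m ih =>
    calc κ ((τ ^ (m + 1)) a) * ξ ^ (m + 1) = (κ (τ ((τ ^ m) a)) * ξ) * ξ ^ m := by
          rw [pow_succ' τ, pow_succ' ξ, ← mul_assoc]; rfl
      _ = ξ ^ (m + 1) * κ a := by rw [h, mul_assoc, ih, ← mul_assoc, ← pow_succ']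

/-- Ring homomorphisms out of `K[x;τ]`. -/
def skewLift (τ : RingAut K) (κ : K →+* E) (ξ : E) (h : ∀ a, κ (τ a) * ξ = ξ * κ a) :
    SkewPoly τ →+* E :=
  SkewMonoidAlgebra.liftNCRingHom (k := Tw τ) (κ : Tw τ →+* E) (powersHom E ξ)
    (fun {a m} => skew_comm_pow κ ξ h (Multiplicative.toAdd m) a)

lemma skewLift_mon (τ : RingAut K) (κ : K →+* E) (ξ : E) (h : ∀ a, κ (τ a) * ξ = ξ * κ a)
    (n : ℕ) (b : K) : skewLift τ κ ξ h (mon τ n b) = κ b * ξ ^ n :=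
  SkewMonoidAlgebra.liftNC_single (k := Tw τ) (RingHom.toAddMonoidHom (show Tw τ →+* E from κ))
    (powersHom E ξ) (Multiplicative.ofAdd n) (b : K)

/-- Ring homomorphisms out of `K[x;τ]/(x² - β x + γ)`. -/
def quadLift (τ : RingAut K) (β γ : K) (κ : K →+* E) (ξ : E)
    (h : ∀ a, κ (τ a) * ξ = ξ * κ a) (hq : ξ * ξ - κ β * ξ + κ γ = 0) :
    QuadRing τ β γ →+* E :=
  RingQuot.lift ⟨skewLift τ κ ξ h, by
    rintro _ _ ⟨⟩
    rw [quad_eq, map_add, map_sub, skewLift_mon, skewLift_mon, skewLift_mon, map_zero]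
    simpa [pow_two] using hq⟩

lemma quadLift_C (τ : RingAut K) (β γ : K) (κ : K →+* E) (ξ : E)
    (h : ∀ a, κ (τ a) * ξ = ξ * κ a) (hq : ξ * ξ - κ β * ξ + κ γ = 0) (a : K) :
    quadLift τ β γ κ ξ h hq (quadC τ β γ a) = κ a := by
  unfold quadLift quadC
  rw [RingHom.comp_apply, RingQuot.lift_mkRingHom_apply]
  exact (skewLift_mon τ κ ξ h 0 a).trans (by simp)

/-- Ring homomorphisms out of `K[x,x⁻¹;τ]`. -/
def laurentLift (τ : RingAut K) (κ : K →+* E) (g : Multiplicative ℤ →* E)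
    (h : ∀ (m : ℤ) (a : K), κ ((τ ^ m) a) * g (Multiplicative.ofAdd m) =
      g (Multiplicative.ofAdd m) * κ a) : SkewLaurent τ →+* E :=
  SkewMonoidAlgebra.liftNCRingHom (k := Tw τ) (κ : Tw τ →+* E) g
    (fun {a m} => h (Multiplicative.toAdd m) a)

end Lift

end Skew

/-! ### Free products over `K` -/

section FreeProduct

variable {K S T : Type*} [Ring K] [Ring S] [Ring T]

inductive FreeProdRel (i : K →+* S) (j : K →+* T) :
    FreeAlgebra ℤ (S ⊕ T) → FreeAlgebra ℤ (S ⊕ T) → Prop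
  | addl (a b : S) : FreeProdRel i j (FreeAlgebra.ι ℤ (.inl (a + b)))
      (FreeAlgebra.ι ℤ (.inl a) + FreeAlgebra.ι ℤ (.inl b))
  | mull (a b : S) : FreeProdRel i j (FreeAlgebra.ι ℤ (.inl (a * b)))
      (FreeAlgebra.ι ℤ (.inl a) * FreeAlgebra.ι ℤ (.inl b))
  | onel : FreeProdRel i j (FreeAlgebra.ι ℤ (.inl 1)) 1
  | addr (a b : T) : FreeProdRel i j (FreeAlgebra.ι ℤ (.inr (a + b)))
      (FreeAlgebra.ι ℤ (.inr a) + FreeAlgebra.ι ℤ (.inr b))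
  | mulr (a b : T) : FreeProdRel i j (FreeAlgebra.ι ℤ (.inr (a * b)))
      (FreeAlgebra.ι ℤ (.inr a) * FreeAlgebra.ι ℤ (.inr b))
  | oner : FreeProdRel i j (FreeAlgebra.ι ℤ (.inr 1)) 1
  | glue (a : K) : FreeProdRel i j (FreeAlgebra.ι ℤ (.inl (i a))) (FreeAlgebra.ι ℤ (.inr (j a)))

/-- The free product (pushout of rings) `S *_K T`: the ring generated by `S` and `T`, subject to
the relations that hold in `S`, those that hold in `T`, and the identification of the two images
of `K`. -/
abbrev FreeProd (i : K →+* S) (j : K →+* T) : Type _ := RingQuot (FreeProdRel i j)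

/-- The map `S → S *_K T`. -/
def FreeProd.inl (i : K →+* S) (j : K →+* T) : S →+* FreeProd i j where
  toFun a := RingQuot.mkRingHom (FreeProdRel i j) (FreeAlgebra.ι ℤ (.inl a))
  map_one' := by rw [RingQuot.mkRingHom_rel FreeProdRel.onel, map_one]
  map_mul' a b := by rw [RingQuot.mkRingHom_rel (FreeProdRel.mull a b), map_mul]
  map_add' a b := by rw [RingQuot.mkRingHom_rel (FreeProdRel.addl a b), map_add]
  map_zero' := by
    have h := RingQuot.mkRingHom_rel (FreeProdRel.addl (i := i) (j := j) 0 0)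
    rw [add_zero, map_add] at h
    simpa using h

/-- Ring homomorphisms out of `S *_K T`. -/
def FreeProd.lift {E : Type*} [Ring E] (i : K →+* S) (j : K →+* T) (f : S →+* E) (g : T →+* E)
    (h : ∀ a, f (i a) = g (j a)) : FreeProd i j →+* E :=
  RingQuot.lift ⟨(FreeAlgebra.lift ℤ (Sum.elim f g) : FreeAlgebra ℤ (S ⊕ T) →ₐ[ℤ] E), by
    rintro _ _ (_ | _ | _ | _ | _ | _ | _) <;> simp [h]⟩

end FreeProduct

/-! ### Semilinear clannish algebras -/

/-- The letters of words: ordinary direct letters `a`, ordinary inverse letters `a⁻¹`, and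
`*`-letters `s^*`. -/
inductive Letter (Q₁ : Type*)
  | dir (a : Q₁)
  | inv (a : Q₁)
  | star (s : Q₁)

namespace Letter

variable {Q₀ Q₁ : Type*}

/-- Head of a letter. -/
def hd (head tail : Q₁ → Q₀) : Letter Q₁ → Q₀
  | dir a => head a
  | inv a => tail a
  | star s => head s

/-- Inverse of a letter. -/
def bar : Letter Q₁ → Letter Q₁
  | dir a => inv a
  | inv a => dir a
  | star s => star s

@[simp] lemma bar_bar (x : Letter Q₁) : x.bar.bar = x := by cases x <;> rfl

/-- Direct and inverse letters are allowed for ordinary arrows, `*`-letters for special loops. -/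
def Allowed (Sp : Set Q₁) : Letter Q₁ → Prop
  | dir a => a ∉ Sp
  | inv a => a ∉ Sp
  | star s => s ∈ Sp

end Letter

/-- The data defining a semilinear clannish algebra over `K`, on a quiver with vertices `Q₀` and
arrows `Q₁`, together with a choice of signs of letters. Paths are written as lists
`[a₁, …, aₙ]` with `tail aᵢ = head aᵢ₊₁`. The values of `β` and `γ` matter only on special loops. -/
structure Clannish (K Q₀ Q₁ : Type*) [DivisionRing K] where
  head : Q₁ → Q₀
  tail : Q₁ → Q₀
  /-- the automorphisms `σ_a` -/
  σ : Q₁ → RingAut K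
  /-- the special loops -/
  Sp : Set Q₁
  loop : ∀ s ∈ Sp, head s = tail s
  /-- `q_s = x² - β_s x + γ_s` -/
  β : Q₁ → K
  γ : Q₁ → K
  /-- the zero relations -/
  Z : Set (List Q₁)
  Z_path : ∀ r ∈ Z, r.IsChain (fun a b => tail a = head b)
  Z_length : ∀ r ∈ Z, 2 ≤ r.length
  Z_first : ∀ r ∈ Z, ∀ a ∈ r.head?, a ∉ Sp
  Z_last : ∀ r ∈ Z, ∀ a ∈ r.getLast?, a ∉ Sp
  Z_square : ∀ r ∈ Z, ∀ s ∈ Sp, ¬ [s, s] <:+: r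
  tail_le_two : ∀ v, {a | tail a = v}.encard ≤ 2
  head_le_two : ∀ v, {a | head a = v}.encard ≤ 2
  left_le_one : ∀ a, a ∉ Sp → {c | tail c = head a ∧ [c, a] ∉ Z}.Subsingleton
  right_le_one : ∀ a, a ∉ Sp → {c | tail a = head c ∧ [a, c] ∉ Z}.Subsingleton
  /-- the chosen signs of letters -/
  sgn : Letter Q₁ → ℤˣ
  sgn_spec : ∀ x y : Letter Q₁, x.Allowed Sp → y.Allowed Sp → x ≠ y →
    x.hd head tail = y.hd head tail → sgn x = sgn y →
    ∃ a b, [a, b] ∈ Z ∧ ((x = .inv a ∧ y = .dir b) ∨ (x = .dir b ∧ y = .inv a))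

namespace Clannish

variable {K Q₀ Q₁ : Type*} [DivisionRing K] (D : Clannish K Q₀ Q₁)

/-- `q_s` is normal in `K[x;σ_s]` for every special loop `s`. -/
def NormallyBound : Prop := ∀ s ∈ D.Sp, IsNormalElem (quad (D.σ s) (D.β s) (D.γ s))

/-- The constant term of `q_s` is non-zero for every special loop `s`. -/
def NonSingular : Prop := ∀ s ∈ D.Sp, D.γ s ≠ 0

/-- Head of a letter. -/
abbrev hd (x : Letter Q₁) : Q₀ := x.hd D.head D.tail

/-- The letter `a` for an ordinary arrow `a`, and `s^*` for a special loop `s`. -/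
def st (a : Q₁) : Letter Q₁ := by
  classical exact if a ∈ D.Sp then .star a else .dir a

section Algebra

variable [Fintype Q₀]

/-- Generators of the semilinear path algebra: elements of `K`, trivial paths, and arrows. -/
inductive Gen (K Q₀ Q₁ : Type*)
  | k (a : K)
  | e (v : Q₀)
  | arr (a : Q₁)

/-- The generator of the free ring given by an element of `K`. -/
abbrev gK (a : K) : FreeAlgebra ℤ (Gen K Q₀ Q₁) := FreeAlgebra.ι ℤ (Gen.k a)

/-- The generator of the free ring given by a trivial path. -/
abbrev gE (v : Q₀) : FreeAlgebra ℤ (Gen K Q₀ Q₁) := FreeAlgebra.ι ℤ (Gen.e v)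

/-- The generator of the free ring given by an arrow. -/
abbrev gA (a : Q₁) : FreeAlgebra ℤ (Gen K Q₀ Q₁) := FreeAlgebra.ι ℤ (Gen.arr a)

inductive PathRel : FreeAlgebra ℤ (Gen K Q₀ Q₁) → FreeAlgebra ℤ (Gen K Q₀ Q₁) → Prop
  | add (a b : K) : PathRel (gK (a + b)) (gK a + gK b)
  | mul (a b : K) : PathRel (gK (a * b)) (gK a * gK b)
  | one : PathRel (gK 1) 1
  | idem (v : Q₀) : PathRel (gE v * gE v) (gE v)
  | orth (v w : Q₀) (h : v ≠ w) : PathRel (gE v * gE w) 0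
  | sum : PathRel (∑ v : Q₀, gE v) 1
  | head (a : Q₁) : PathRel (gE (D.head a) * gA a) (gA a)
  | tail (a : Q₁) : PathRel (gA a * gE (D.tail a)) (gA a)
  | comm (v : Q₀) (l : K) : PathRel (gE v * gK l) (gK l * gE v)
  | semi (a : Q₁) (l : K) : PathRel (gA a * gK l) (gK (D.σ a l) * gA a)

/-- The semilinear path algebra `K_σ Q`. -/
abbrev PathAlg : Type _ := RingQuot (PathRel D)

/-- The map from `K` to the semilinear path algebra. -/
def pathK : K →+* D.PathAlg where
  toFun a := RingQuot.mkRingHom D.PathRel (gK a)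
  map_one' := by rw [RingQuot.mkRingHom_rel PathRel.one, map_one]
  map_mul' a b := by rw [RingQuot.mkRingHom_rel (PathRel.mul a b), map_mul]
  map_add' a b := by rw [RingQuot.mkRingHom_rel (PathRel.add a b), map_add]
  map_zero' := by
    have h := RingQuot.mkRingHom_rel (PathRel.add (D := D) 0 0)
    rw [add_zero, map_add] at h
    simpa using h

/-- The trivial path at `v`. -/
def pathE (v : Q₀) : D.PathAlg := RingQuot.mkRingHom D.PathRel (gE v)

/-- The arrow `a`. -/
def pathA (a : Q₁) : D.PathAlg := RingQuot.mkRingHom D.PathRel (gA a)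

inductive ClanRel : D.PathAlg → D.PathAlg → Prop
  | zero (r : List Q₁) (h : r ∈ D.Z) : ClanRel (r.map D.pathA).prod 0
  | quad (s : Q₁) (h : s ∈ D.Sp) : ClanRel
      (D.pathA s ^ 2 - D.pathK (D.β s) * D.pathA s + D.pathK (D.γ s) * D.pathE (D.head s)) 0

/-- The semilinear clannish algebra `R = K_σ Q / I`. -/
def Alg : Type _ := RingQuot (ClanRel D)

instance : Ring D.Alg := inferInstanceAs (Ring (RingQuot (ClanRel D)))

/-- The quotient map `K_σ Q → R`. -/
def quo : D.PathAlg →+* D.Alg := RingQuot.mkRingHom D.ClanRel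

/-- The map `K → R`. -/
def inK : K →+* D.Alg := D.quo.comp D.pathK

/-- The trivial path at `v`, in `R`. -/
def e (v : Q₀) : D.Alg := D.quo (D.pathE v)

/-- The arrow `a`, in `R`. -/
def arr (a : Q₁) : D.Alg := D.quo (D.pathA a)

lemma quo_rel {x y : D.PathAlg} (h : ClanRel D x y) : D.quo x = D.quo y := RingQuot.mkRingHom_rel h

lemma e_inK (v : Q₀) (l : K) : D.e v * D.inK l = D.inK l * D.e v := by
  have h := RingQuot.mkRingHom_rel (PathRel.comm (D := D) v l)
  rw [map_mul, map_mul] at h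
  have h2 := congrArg D.quo h
  rwa [map_mul, map_mul] at h2

lemma arr_inK (a : Q₁) (l : K) : D.arr a * D.inK l = D.inK (D.σ a l) * D.arr a := by
  have h := RingQuot.mkRingHom_rel (PathRel.semi (D := D) a l)
  rw [map_mul, map_mul] at h
  have h2 := congrArg D.quo h
  rwa [map_mul, map_mul] at h2

lemma arr_sq (s : Q₁) (h : s ∈ D.Sp) : D.arr s * D.arr s =
    D.inK (D.β s) * D.arr s - D.inK (D.γ s) * D.e (D.head s) := by
  have h := D.quo_rel (ClanRel.quad s h)
  rw [map_add, map_sub, map_mul, map_mul, map_pow, map_zero, pow_two] at h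
  have h' : D.arr s * D.arr s - D.inK (D.β s) * D.arr s + D.inK (D.γ s) * D.e (D.head s) = 0 := h
  rw [← sub_eq_zero, ← h']
  abel

end Algebra

/-! ### Words -/

/-- Index sets of words: `{0, …, n}` or `ℤ`. (Words indexed by `ℕ` and `-ℕ` occur below only as
the sequences of letters `Word.before`, `Word.after`.) -/
inductive Idx
  | fin (n : ℕ)
  | int

/-- The index set `I` as a subset of `ℤ`. -/
def Idx.I : Idx → Set ℤ
  | fin n => Set.Icc 0 n
  | int => Set.univ

/-- The set `I' = {i ∈ I | i - 1 ∈ I}`. -/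
def Idx.I' (J : Idx) : Set ℤ := {i | i ∈ J.I ∧ i - 1 ∈ J.I}

/-- A word, with vertices `vert i` for `i ∈ I` and letters `letter i` for `i ∈ I'`. The value
`none` is taken outside these sets. -/
@[ext] structure Word where
  idx : Idx
  vert : ℤ → Option Q₀
  letter : ℤ → Option (Letter Q₁)
  sign : ℤˣ
  vert_dom : ∀ i, (vert i).isSome ↔ i ∈ idx.I
  letter_dom : ∀ i, (letter i).isSome ↔ i ∈ idx.I'
  allowed : ∀ i x, letter i = some x → x.Allowed D.Sp
  head_eq : ∀ i x, letter i = some x → vert (i - 1) = some (D.hd x)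
  tail_eq : ∀ i x, letter i = some x → vert i = some (D.hd x.bar)
  opp : ∀ i x y, letter i = some x → letter (i + 1) = some y → D.sgn x.bar = - D.sgn y
  sign_one : ∀ x, letter 1 = some x → D.sgn x = sign
  sign_zero : ∀ x, letter 0 = some x → D.sgn x.bar = - sign

namespace Word

variable {D} (w : D.Word)

/-- `n` for words indexed by `{0, …, n}` and `-1` for words indexed by `ℤ`; inversion sends the
vertex `i` to the vertex `flip - i`. -/
def flip : ℤ := match w.idx with
  | .fin n => n
  | .int => -1

lemma mem_flip (i : ℤ) : w.flip - i ∈ w.idx.I ↔ i ∈ w.idx.I := by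
  unfold flip
  cases w.idx <;> simp [Idx.I]
  omega

/-- The inverse of a word. -/
def inv : D.Word where
  idx := w.idx
  vert i := w.vert (w.flip - i)
  letter i := (w.letter (w.flip + 1 - i)).map Letter.bar
  sign := match w.letter w.flip with
    | some x => D.sgn x.bar
    | none => - w.sign
  vert_dom i := by rw [w.vert_dom, mem_flip]
  letter_dom i := by
    rw [Option.isSome_map, w.letter_dom]
    simp only [Idx.I', Set.mem_ofPred_eq]
    rw [← w.mem_flip (i - 1), ← w.mem_flip i, and_comm]
    ring_nf
  allowed i x h := by
    obtain ⟨y, hy, rfl⟩ := Option.map_eq_some_iff.1 h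
    have := w.allowed _ _ hy
    cases y <;> exact this
  head_eq i x h := by
    obtain ⟨y, hy, rfl⟩ := Option.map_eq_some_iff.1 h
    rw [← w.tail_eq _ _ hy]; ring_nf
  tail_eq i x h := by
    obtain ⟨y, hy, rfl⟩ := Option.map_eq_some_iff.1 h
    rw [Letter.bar_bar, ← w.head_eq _ _ hy]; ring_nf
  opp i x y hx hy := by
    obtain ⟨x', hx', rfl⟩ := Option.map_eq_some_iff.1 hx
    obtain ⟨y', hy', rfl⟩ := Option.map_eq_some_iff.1 hy
    have := w.opp (w.flip + 1 - (i + 1)) y' x' hy' (by rw [← hx']; ring_nf)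
    rw [Letter.bar_bar, this, neg_neg]
  sign_one x h := by
    obtain ⟨y, hy, rfl⟩ := Option.map_eq_some_iff.1 h
    rw [show w.flip + 1 - 1 = w.flip by ring] at hy
    simp [hy]
  sign_zero x h := by
    obtain ⟨y, hy, rfl⟩ := Option.map_eq_some_iff.1 h
    rw [sub_zero] at hy
    have h1 : w.flip + 1 ∈ w.idx.I' := (w.letter_dom _).1 (by rw [hy]; rfl)
    obtain ⟨z, hz⟩ : ∃ z, w.letter w.flip = some z := by
      rw [← Option.isSome_iff_exists, w.letter_dom]
      unfold flip Idx.I' at *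
      revert h1
      cases w.idx <;> simp [Idx.I]
    have := w.opp _ _ _ hz hy
    simp [hz, this]

/-- The shift `w[n]`; it has no effect on finite words. -/
def shift (n : ℤ) : D.Word :=
  match h : w.idx with
  | .fin _ => w
  | .int =>
    { idx := .int
      vert := fun i => w.vert (n + i)
      letter := fun i => w.letter (n + i)
      sign := match w.letter (n + 1) with
        | some x => D.sgn x
        | none => w.sign
      vert_dom := fun i => by rw [w.vert_dom, h]; simp [Idx.I]
      letter_dom := fun i => by rw [w.letter_dom, h]; simp [Idx.I', Idx.I]
      allowed := fun i => w.allowed _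
      head_eq := fun i x hx => by rw [← w.head_eq _ _ hx]; ring_nf
      tail_eq := fun i => w.tail_eq _
      opp := fun i x y hx hy => w.opp _ x y hx (by rw [← hy]; ring_nf)
      sign_one := fun x hx => by simp [hx]
      sign_zero := fun x hx => by
        obtain ⟨z, hz⟩ : ∃ z, w.letter (n + 1) = some z := by
          rw [← Option.isSome_iff_exists, w.letter_dom, h]; simp [Idx.I', Idx.I]
        rw [add_zero] at hx
        simpa [hz] using w.opp _ _ _ hx hz }

/-- Equivalence of words. -/
def Equiv (u w : D.Word) : Prop := ∃ n : ℤ, u = w.shift n ∨ u = w.inv.shift n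

/-- `w` contains the sequence of letters `r^*` as a subword. -/
def Contains (r : List Q₁) : Prop :=
  ∃ i : ℤ, ∀ (k : ℕ) (h : k < r.length), w.letter (i + k) = some (D.st r[k])

/-- Relation-admissible words. -/
def RelAdmissible : Prop := ∀ r ∈ D.Z, ¬ w.Contains r ∧ ¬ w.inv.Contains r

/-- Right-end-admissible words: if `w` is finite there is no special loop `s` with `w s^*` a
word, that is, such that `w⁻¹` and `s^*` have the same head and opposite signs. -/
def RightEndAdmissible : Prop := ∀ n : ℕ, w.idx = .fin n →
  ¬ ∃ s ∈ D.Sp, w.inv.vert 0 = some (D.hd (.star s)) ∧ D.sgn (.star s) = - w.inv.sign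

/-- End-admissible words. -/
def EndAdmissible : Prop := w.RightEndAdmissible ∧ w.inv.RightEndAdmissible

/-- A string is a finite end-admissible relation-admissible word. -/
def IsString : Prop := (∃ n : ℕ, w.idx = .fin n) ∧ w.EndAdmissible ∧ w.RelAdmissible

/-- A band is a periodic relation-admissible `ℤ`-indexed word. -/
def IsBand : Prop := w.idx = .int ∧ w.RelAdmissible ∧ ∃ n : ℕ, 0 < n ∧ w.shift n = w

/-- The letters of the word `w_{>i}`. -/
def after (i : ℤ) : ℕ → Option (Letter Q₁) := fun k => w.letter (i + 1 + k)

/-- The letters of the word `(w_{≤i})⁻¹`. -/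
def before (i : ℤ) : ℕ → Option (Letter Q₁) := fun k => (w.letter (i - k)).map Letter.bar

/-- The order on words with the same head and sign: `f < g` if and only if `f = u y ⋯` and
`g = u x⁻¹ ⋯`, or `f = u y ⋯` and `g = u`, or `f = u` and `g = u x⁻¹ ⋯`, for a finite word `u` and
ordinary arrows `x` and `y`. -/
def SeqLt (f g : ℕ → Option (Letter Q₁)) : Prop :=
  ∃ k, (∀ j < k, f j = g j) ∧
    (((∃ y, f k = some (.dir y)) ∧ ∃ x, g k = some (.inv x)) ∨
      ((∃ y, f k = some (.dir y)) ∧ g k = none) ∨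
      (f k = none ∧ ∃ x, g k = some (.inv x)))

/-- `i` is a symmetry for `w`. -/
def IsSymmetry (i : ℤ) : Prop :=
  (∃ s, w.letter i = some (.star s)) ∧ w.before (i - 1) = w.after i

lemma letter_some_iff (i : ℤ) : (∃ x, w.letter i = some x) ↔ i ∈ w.idx.I' := by
  rw [← Option.isSome_iff_exists, w.letter_dom]

lemma letter_none_iff (i : ℤ) : w.letter i = none ↔ i ∉ w.idx.I' := by
  rw [← w.letter_dom]; cases w.letter i <;> simp

@[simp] lemma inv_idx : w.inv.idx = w.idx := rfl

@[simp] lemma inv_flip : w.inv.flip = w.flip := rfl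

lemma inv_letter (i : ℤ) : w.inv.letter i = (w.letter (w.flip + 1 - i)).map Letter.bar := rfl

lemma inv_vert (i : ℤ) : w.inv.vert i = w.vert (w.flip - i) := rfl

lemma flip_fin {n : ℕ} (h : w.idx = .fin n) : w.flip = n := by
  unfold flip; rw [h]

lemma flip_int (h : w.idx = .int) : w.flip = -1 := by
  unfold flip; rw [h]

lemma mem_I'_fin {n : ℕ} (h : w.idx = .fin n) (i : ℤ) : i ∈ w.idx.I' ↔ 1 ≤ i ∧ i ≤ n := by
  rw [h]
  simp only [Idx.I', Idx.I, Set.mem_ofPred_eq, Set.mem_Icc]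
  omega

lemma mem_I'_int (h : w.idx = .int) (i : ℤ) : i ∈ w.idx.I' := by
  rw [h]; simp [Idx.I', Idx.I]

/-- `ℤ`-indexed words are determined by their letters. -/
lemma ext_int {u w : D.Word} (hu : u.idx = .int) (hw : w.idx = .int)
    (h : ∀ i, u.letter i = w.letter i) : u = w := by
  have hx : ∀ i, ∃ x, w.letter i = some x := fun i => (w.letter_some_iff i).2 (w.mem_I'_int hw i)
  have hl : u.letter = w.letter := funext h
  refine Word.ext (by rw [hu, hw]) ?_ hl ?_
  · funext i
    obtain ⟨x, hx⟩ := hx i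
    rw [w.tail_eq i x hx, u.tail_eq i x (by rw [h, hx])]
  · obtain ⟨x, hx⟩ := hx 1
    rw [← w.sign_one x hx, ← u.sign_one x (by rw [h, hx])]

lemma shift_idx (n : ℤ) : (w.shift n).idx = w.idx := by
  unfold shift
  split
  · rfl
  · rename_i h; exact h.symm

lemma shift_letter (h : w.idx = .int) (n i : ℤ) : (w.shift n).letter i = w.letter (n + i) := by
  unfold shift
  split
  · rename_i h'; rw [h] at h'; cases h'
  · rfl

lemma units_ne_neg (u : ℤˣ) : u ≠ -u := by
  intro h
  have := congrArg (fun v : ℤˣ => (v : ℤ)) h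
  rcases Int.units_eq_one_or u with rfl | rfl <;> simp at this

/-- Consecutive letters are never inverse to one another. -/
lemma not_bar_consecutive (i : ℤ) (x : Letter Q₁) (h : w.letter i = some x) :
    w.letter (i + 1) ≠ some x.bar := fun h' => units_ne_neg _ (w.opp i x x.bar h h')

lemma star_of_bar_self {x : Letter Q₁} (h : x.bar = x) : ∃ s, x = .star s := by
  cases x with
  | dir a => cases h
  | inv a => cases h
  | star s => exact ⟨s, rfl⟩

lemma inv_inv_sign {n : ℕ} (h : w.idx = .fin n) : w.inv.inv.sign = w.sign := by
  have hf := w.flip_fin h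
  change (match w.inv.letter w.inv.flip with
    | some x => D.sgn x.bar
    | none => - w.inv.sign) = w.sign
  rw [inv_letter, inv_flip, hf, show (n : ℤ) + 1 - n = 1 by ring]
  rcases hx : w.letter 1 with _ | x
  · simp only [Option.map_none]
    change - (match w.letter w.flip with
      | some x => D.sgn x.bar
      | none => - w.sign) = w.sign
    have h0 : w.letter w.flip = none := by
      rw [letter_none_iff, w.mem_I'_fin h] at hx ⊢
      omega
    rw [h0]; simp
  · simp [w.sign_one x hx]

/-- A reflection symmetry of the letters about `c`. -/
lemma IsSymmetry.reflect {w : D.Word} {c : ℤ} (h : w.IsSymmetry c) (j : ℤ) :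
    w.letter (2 * c - j) = (w.letter j).map Letter.bar := by
  obtain ⟨⟨s, hs⟩, h⟩ := h
  have key : ∀ k : ℕ, (w.letter (c - 1 - k)).map Letter.bar = w.letter (c + 1 + k) :=
    fun k => congrFun h k
  rcases lt_trichotomy j c with hj | rfl | hj
  · obtain ⟨k, hk⟩ := Int.eq_ofNat_of_zero_le (show 0 ≤ c - 1 - j by omega)
    have := key k
    rw [show c - 1 - (k : ℤ) = j by omega, show c + 1 + (k : ℤ) = 2 * c - j by omega] at this
    exact this.symm
  · rw [show 2 * j - j = j by ring, hs]; rfl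
  · obtain ⟨k, hk⟩ := Int.eq_ofNat_of_zero_le (show 0 ≤ j - 1 - c by omega)
    have := key k
    rw [show c - 1 - (k : ℤ) = 2 * c - j by omega, show c + 1 + (k : ℤ) = j by omega] at this
    rw [← this, Option.map_map]
    simp [Function.comp_def]

lemma isSymmetry_of_reflect {c : ℤ} {x : Letter Q₁} (hx : w.letter c = some x)
    (h : ∀ j, w.letter (2 * c - j) = (w.letter j).map Letter.bar) : w.IsSymmetry c := by
  refine ⟨?_, ?_⟩
  · have := h c
    rw [show 2 * c - c = c by ring, hx] at this
    obtain ⟨s, rfl⟩ := star_of_bar_self (Option.some.inj this).symm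
    exact ⟨s, hx⟩
  · funext k
    change (w.letter (c - 1 - k)).map Letter.bar = w.letter (c + 1 + k)
    rw [← h]; ring_nf

lemma SeqLt.asymm {f g : ℕ → Option (Letter Q₁)} (h : SeqLt f g) (h' : SeqLt g f) : False := by
  obtain ⟨k, hk, h⟩ := h
  obtain ⟨k', hk', h'⟩ := h'
  rcases lt_trichotomy k k' with hlt | rfl | hlt
  · have e := hk' k hlt
    rcases h with ⟨⟨y, h1⟩, x, h2⟩ | ⟨⟨y, h1⟩, h2⟩ | ⟨h1, x, h2⟩ <;>
      rw [h1, h2] at e <;> simp at e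
  · rcases h with ⟨⟨y, h1⟩, x, h2⟩ | ⟨⟨y, h1⟩, h2⟩ | ⟨h1, x, h2⟩ <;>
      simp [h1, h2] at h'
  · have e := hk k' hlt
    rcases h' with ⟨⟨y, h1⟩, x, h2⟩ | ⟨⟨y, h1⟩, h2⟩ | ⟨h1, x, h2⟩ <;>
      rw [h1, h2] at e <;> simp at e

/-- The two words on either side of a `*`-letter are comparable. -/
lemma trichotomy (hw : w.EndAdmissible) {c : ℤ} {s : Q₁} (hc : w.letter c = some (.star s)) :
    SeqLt (w.before (c - 1)) (w.after c) ∨ w.before (c - 1) = w.after c ∨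
      SeqLt (w.after c) (w.before (c - 1)) := by
  classical
  by_cases hne : w.before (c - 1) = w.after c
  · exact Or.inr (Or.inl hne)
  have hex : ∃ k, w.before (c - 1) k ≠ w.after c k := by
    by_contra h; push Not at h; exact hne (funext h)
  obtain ⟨k, hk, hmin⟩ : ∃ k, w.before (c - 1) k ≠ w.after c k ∧
      ∀ j < k, w.before (c - 1) j = w.after c j :=
    ⟨Nat.find hex, Nat.find_spec hex, fun j hj => not_not.1 (Nat.find_min hex hj)⟩
  have hcI := (w.letter_some_iff c).1 ⟨_, hc⟩
  have hb : ∀ j, w.before (c - 1) j = (w.letter (c - 1 - j)).map Letter.bar := fun _ => rfl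
  have ha : ∀ j, w.after c j = w.letter (c + 1 + j) := fun _ => rfl
  obtain ⟨y, hy1, hy2⟩ : ∃ y, w.letter (c + k) = some y ∧ w.letter (c - k) = some y.bar := by
    rcases Nat.eq_zero_or_pos k with rfl | hpos
    · exact ⟨.star s, by simpa using hc, by simpa [Letter.bar] using hc⟩
    · have e := hmin (k - 1) (by omega)
      rw [hb, ha, show c - 1 - ((k - 1 : ℕ) : ℤ) = c - k by omega,
        show c + 1 + ((k - 1 : ℕ) : ℤ) = c + k by omega] at e
      rcases hy : w.letter (c + k) with _ | y
      · exfalso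
        rw [hy, Option.map_eq_none_iff] at e
        apply hk
        rw [hb, ha]
        rcases hidx : w.idx with n | _
        · rw [letter_none_iff, w.mem_I'_fin hidx] at e hy
          rw [w.mem_I'_fin hidx] at hcI
          have e1 : w.letter (c - 1 - k) = none := by
            rw [letter_none_iff, w.mem_I'_fin hidx]; omega
          have e2 : w.letter (c + 1 + k) = none := by
            rw [letter_none_iff, w.mem_I'_fin hidx]; omega
          rw [e1, e2]; rfl
        · exact absurd (w.mem_I'_int hidx _) ((w.letter_none_iff _).1 hy)
      · rw [hy] at e
        obtain ⟨z, hz, rfl⟩ := Option.map_eq_some_iff.1 e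
        exact ⟨z.bar, rfl, by rw [Letter.bar_bar]; exact hz⟩
  have hA : ∀ z, w.after c k = some z → z.Allowed D.Sp ∧ D.hd z = D.hd y.bar ∧
      D.sgn z = - D.sgn y.bar := by
    intro z hz
    rw [ha, show c + 1 + (k : ℤ) = c + k + 1 by ring] at hz
    refine ⟨w.allowed _ _ hz, ?_, by rw [w.opp _ _ _ hy1 hz, neg_neg]⟩
    have := w.head_eq _ _ hz
    rw [add_sub_cancel_right, w.tail_eq _ _ hy1] at this
    exact (Option.some.inj this).symm
  have hB : ∀ z, w.before (c - 1) k = some z → z.Allowed D.Sp ∧ D.hd z = D.hd y.bar ∧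
      D.sgn z = - D.sgn y.bar := by
    intro z hz
    rw [hb] at hz
    obtain ⟨x, hx, rfl⟩ := Option.map_eq_some_iff.1 hz
    refine ⟨?_, ?_, ?_⟩
    · have := w.allowed _ _ hx
      cases x <;> exact this
    · have := w.head_eq _ _ hy2
      rw [show c - (k : ℤ) - 1 = c - 1 - k by ring, w.tail_eq _ _ hx] at this
      exact Option.some.inj this
    · exact w.opp _ _ _ hx (by rw [← hy2]; ring_nf)
  have hAend : w.after c k = none → ∀ t, (Letter.star t).Allowed D.Sp →
      D.hd (.star t) = D.hd y.bar → D.sgn (.star t) = - D.sgn y.bar → False := by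
    intro hn t ht1 ht2 ht3
    rw [ha, letter_none_iff] at hn
    have hk' := (w.letter_some_iff _).1 ⟨_, hy1⟩
    rcases hidx : w.idx with n | _
    · rw [w.mem_I'_fin hidx] at hn hk'
      have hn' : (n : ℤ) = c + k := by omega
      refine hw.1 n hidx ⟨t, ht1, ?_, ?_⟩
      · rw [inv_vert, w.flip_fin hidx, hn', sub_zero, w.tail_eq _ _ hy1, ht2]
      · rw [ht3]
        change _ = - (match w.letter w.flip with
          | some x => D.sgn x.bar
          | none => - w.sign)
        rw [w.flip_fin hidx, hn', hy1]
    · exact hn (w.mem_I'_int hidx _)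
  have hBend : w.before (c - 1) k = none → ∀ t, (Letter.star t).Allowed D.Sp →
      D.hd (.star t) = D.hd y.bar → D.sgn (.star t) = - D.sgn y.bar → False := by
    intro hn t ht1 ht2 ht3
    rw [hb, Option.map_eq_none_iff, letter_none_iff] at hn
    have hk' := (w.letter_some_iff _).1 ⟨_, hy2⟩
    rcases hidx : w.idx with n | _
    · rw [w.mem_I'_fin hidx] at hn hk'
      have hn' : c - k = 1 := by omega
      rw [hn'] at hy2
      refine hw.2 n hidx ⟨t, ht1, ?_, ?_⟩
      · rw [inv_vert, inv_vert, inv_flip, sub_zero, sub_self]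
        have := w.head_eq _ _ hy2
        rw [sub_self] at this
        rw [this, ht2]
      · rw [ht3, w.inv_inv_sign hidx, w.sign_one _ hy2]
    · exact hn (w.mem_I'_int hidx _)
  rcases hf : w.before (c - 1) k with _ | x <;> rcases hg : w.after c k with _ | z
  · exact absurd (hf.trans hg.symm) hk
  · obtain ⟨h1, h2, h3⟩ := hA z hg
    cases z with
    | dir a => exact Or.inr (Or.inr ⟨k, fun j hj => (hmin j hj).symm, Or.inr (Or.inl ⟨⟨a, hg⟩, hf⟩)⟩)
    | inv a => exact Or.inl ⟨k, hmin, Or.inr (Or.inr ⟨hf, a, hg⟩)⟩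
    | star t => exact (hBend hf t h1 h2 h3).elim
  · obtain ⟨h1, h2, h3⟩ := hB x hf
    cases x with
    | dir a => exact Or.inl ⟨k, hmin, Or.inr (Or.inl ⟨⟨a, hf⟩, hg⟩)⟩
    | inv a => exact Or.inr (Or.inr ⟨k, fun j hj => (hmin j hj).symm, Or.inr (Or.inr ⟨hg, a, hf⟩)⟩)
    | star t => exact (hAend hg t h1 h2 h3).elim
  · obtain ⟨h1, h2, h3⟩ := hA z hg
    obtain ⟨h1', h2', h3'⟩ := hB x hf
    have hxz : x ≠ z := by rintro rfl; exact hk (hf.trans hg.symm)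
    obtain ⟨a, b, -, ⟨rfl, rfl⟩ | ⟨rfl, rfl⟩⟩ :=
      D.sgn_spec x z h1' h1 hxz (h2'.trans h2.symm) (h3'.trans h3.symm)
    · exact Or.inr (Or.inr ⟨k, fun j hj => (hmin j hj).symm, Or.inl ⟨⟨b, hg⟩, a, hf⟩⟩)
    · exact Or.inl ⟨k, hmin, Or.inl ⟨⟨b, hf⟩, a, hg⟩⟩

/-- The letter `i`, if a `*`-letter `s^*`, is replaced by `s` in the canonically associated walk:
this holds if `i` is naturally direct, or is a symmetry with `i ≤ 0`. -/
def CanonDirect (i : ℤ) : Prop :=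
  SeqLt (w.after i) (w.before (i - 1)) ∨ (w.before (i - 1) = w.after i ∧ i ≤ 0)

lemma canonDirect_reflect (hw : w.EndAdmissible) {c : ℤ} (hc : w.IsSymmetry c)
    (hsym : ∀ j, w.IsSymmetry j → j ≠ c → (2 * c - j ≤ 0 ↔ ¬ j ≤ 0)) {j : ℤ} {s : Q₁}
    (hj : w.letter j = some (.star s)) (hjc : j ≠ c) :
    w.CanonDirect (2 * c - j) ↔ ¬ w.CanonDirect j := by
  have h1 : w.before (2 * c - j - 1) = w.after j := by
    funext k
    change (w.letter (2 * c - j - 1 - k)).map Letter.bar = w.letter (j + 1 + k)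
    rw [← hc.reflect]; ring_nf
  have h2 : w.after (2 * c - j) = w.before (j - 1) := by
    funext k
    change w.letter (2 * c - j + 1 + k) = (w.letter (j - 1 - k)).map Letter.bar
    rw [← hc.reflect]; ring_nf
  unfold CanonDirect
  rw [h1, h2]
  rcases w.trichotomy hw hj with h | h | h
  · have n1 : ¬ SeqLt (w.after j) (w.before (j - 1)) := fun h' => h.asymm h'
    have n2 : w.before (j - 1) ≠ w.after j := by rintro e; rw [e] at h; exact h.asymm h
    simp [h, n1, n2]
  · have := hsym j ⟨⟨s, hj⟩, h⟩ hjc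
    have n1 : ¬ SeqLt (w.after j) (w.after j) := fun h' => h'.asymm h'
    rw [h]
    simp [this, n1]
  · have n1 : ¬ SeqLt (w.before (j - 1)) (w.after j) := fun h' => h.asymm h'
    have n2 : w.after j ≠ w.before (j - 1) := by rintro e; rw [e] at h; exact h.asymm h
    simp [h, n1, n2]

/-- The four types of strings and bands, with the data that describe them: for a symmetric
string, its length `2 * k + 1` and its central letter; for an asymmetric band, its period `n`; for
a symmetric band, the adjacent symmetries `-p ≤ 0 < r + 1` and the letters there. -/
inductive Kind (w : D.Word) : Type _
  | asymString (h : w.IsString) (hw : w.inv ≠ w)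
  | symString (k : ℕ) (s : Q₁) (h : w.IsString) (hk : w.idx = .fin (2 * k + 1)) (hw : w.inv = w)
      (hs : w.letter (k + 1) = some (.star s))
  | asymBand (n : ℕ) (h : w.IsBand) (hn : IsLeast {n : ℕ | 0 < n ∧ w.shift n = w} n)
      (hw : ¬ ∃ m, w.inv = w.shift m)
  | symBand (p r : ℕ) (s t : Q₁) (h : w.IsBand) (hw : ∃ m, w.inv = w.shift m)
      (hr : IsLeast {i : ℤ | 0 < i ∧ w.IsSymmetry i} (r + 1))
      (hp : IsGreatest {i : ℤ | i ≤ 0 ∧ w.IsSymmetry i} (-p))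
      (hs : w.letter (r + 1) = some (.star s)) (ht : w.letter (-p) = some (.star t))

lemma IsBand.endAdmissible {w : D.Word} (h : w.IsBand) : w.EndAdmissible :=
  by
  constructor
  · intro n hn
    rw [h.1] at hn
    cases hn
  · intro n hn
    rw [inv_idx, h.1] at hn
    cases hn

lemma inv_eq_shift (h : w.idx = .int) {c : ℤ} (hc : w.IsSymmetry c) :
    w.inv = w.shift (2 * c) := by
  refine ext_int h (by rw [shift_idx, h]) fun i => ?_
  rw [inv_letter, w.flip_int h, w.shift_letter h, ← hc.reflect]
  ring_nf

lemma exists_kind (w : D.Word) (h : w.IsString ∨ w.IsBand) : Nonempty w.Kind := by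
  rcases h with h | h
  · by_cases hs : w.inv = w
    · obtain ⟨n, hn⟩ := h.1
      have hl : ∀ i, (w.letter (n + 1 - i)).map Letter.bar = w.letter i := by
        intro i
        conv_rhs => rw [← hs]
        rw [inv_letter, w.flip_fin hn]
      rcases Nat.even_or_odd' n with ⟨m, rfl | rfl⟩
      · exfalso
        rcases Nat.eq_zero_or_pos m with rfl | hm
        · have e : w.inv.sign = w.sign := by rw [hs]
          change (match w.letter w.flip with
            | some x => D.sgn x.bar
            | none => - w.sign) = w.sign at e
          have h0 : w.letter w.flip = none := by
            rw [letter_none_iff, w.mem_I'_fin hn, w.flip_fin hn]; omega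
          rw [h0] at e
          exact units_ne_neg _ e.symm
        · obtain ⟨x, hx⟩ := (w.letter_some_iff (m : ℤ)).2 ((w.mem_I'_fin hn _).2 (by omega))
          refine w.not_bar_consecutive m x hx ?_
          rw [← hl, show ((2 * m : ℕ) : ℤ) + 1 - (m + 1) = m by push_cast; ring, hx]
          rfl
      · obtain ⟨x, hx⟩ := (w.letter_some_iff ((m : ℤ) + 1)).2
          ((w.mem_I'_fin hn _).2 (by push_cast; omega))
        have e := hl (m + 1)
        rw [show ((2 * m + 1 : ℕ) : ℤ) + 1 - (m + 1) = m + 1 by push_cast; ring, hx] at e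
        obtain ⟨s, rfl⟩ := star_of_bar_self (Option.some.inj e)
        exact ⟨.symString m s h hn hs hx⟩
    · exact ⟨.asymString h hs⟩
  · by_cases hs : ∃ m, w.inv = w.shift m
    · obtain ⟨m, hm⟩ := hs
      have hl : ∀ i, (w.letter (-i)).map Letter.bar = w.letter (m + i) := by
        intro i
        rw [← w.shift_letter h.1, ← hm, inv_letter, w.flip_int h.1]
        ring_nf
      have hx : ∀ i, ∃ x, w.letter i = some x :=
        fun i => (w.letter_some_iff i).2 (w.mem_I'_int h.1 i)
      obtain ⟨j, hj⟩ : ∃ j, w.IsSymmetry j := by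
        rcases Int.even_or_odd' m with ⟨j, rfl | rfl⟩
        · obtain ⟨x, hx⟩ := hx j
          refine ⟨j, w.isSymmetry_of_reflect hx fun i => ?_⟩
          have := hl (-i)
          rw [neg_neg] at this
          rw [this, sub_eq_add_neg]
        · exfalso
          obtain ⟨x, hx⟩ := hx j
          refine w.not_bar_consecutive j x hx ?_
          have := hl (-j)
          rw [neg_neg, hx] at this
          rw [show j + 1 = 2 * j + 1 + -j by ring, ← this]
          rfl
      obtain ⟨n, hn0, hn⟩ := h.2.2
      have hper : ∀ i, w.letter (i + n) = w.letter i := by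
        intro i
        conv_rhs => rw [← hn]
        rw [w.shift_letter h.1, add_comm]
      have hper' : ∀ (t : ℕ) (i : ℤ), w.letter (i + t * n) = w.letter i := by
        intro t
        induction t with
        | zero => simp
        | succ t ih => intro i; rw [← ih i, ← hper (i + t * n)]; push_cast; ring_nf
      have htr : ∀ t : ℤ, w.IsSymmetry (j + t * n) := by
        intro t
        obtain ⟨x, hx⟩ := hx (j + t * n)
        refine w.isSymmetry_of_reflect hx fun i => ?_
        rw [← hj.reflect]
        rcases Int.eq_nat_or_neg t with ⟨k, rfl | rfl⟩
        · rw [← hper' (2 * k) (2 * j - i)]; push_cast; ring_nf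
        · rw [← hper' (2 * k) (2 * (j + -(k : ℤ) * n) - i)]; push_cast; ring_nf
      have hpos : (j.natAbs : ℤ) + 1 ≤ (j.natAbs + 1) * n := by nlinarith
      obtain ⟨r', hr1, hr2⟩ := Int.exists_least_of_bdd (P := fun i => 0 < i ∧ w.IsSymmetry i)
        ⟨0, fun z hz => hz.1.le⟩ ⟨j + (j.natAbs + 1) * n, by omega, htr _⟩
      obtain ⟨p', hp1, hp2⟩ := Int.exists_greatest_of_bdd
        (P := fun i => i ≤ 0 ∧ w.IsSymmetry i) ⟨0, fun z hz => hz.1⟩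
        ⟨j + (-(j.natAbs + 1)) * n, by linarith [neg_abs_le j, le_abs_self j, Int.natCast_natAbs j],
          htr _⟩
      obtain ⟨r, hr⟩ := Int.eq_ofNat_of_zero_le (show 0 ≤ r' - 1 by omega)
      obtain ⟨p, hp⟩ := Int.eq_ofNat_of_zero_le (show 0 ≤ -p' by omega)
      obtain rfl : r' = r + 1 := by omega
      obtain rfl : p' = -p := by omega
      obtain ⟨s, hs⟩ := hr1.2.1
      obtain ⟨t, ht⟩ := hp1.2.1
      exact ⟨.symBand p r s t h ⟨m, hm⟩ ⟨hr1, fun z hz => hr2 z hz⟩ ⟨hp1, fun z hz => hp2 z hz⟩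
        hs ht⟩
    · classical
      exact ⟨.asymBand (Nat.find h.2.2) h
        ⟨Nat.find_spec h.2.2, fun n hn => Nat.find_min' h.2.2 hn⟩ hs⟩

end Word

/-! ### Walks -/

/-- Letters of walks. -/
inductive WLetter (Q₁ : Type*)
  | dir (a : Q₁)
  | inv (a : Q₁)

/-- Inverse of a letter of a walk. -/
def WLetter.bar : WLetter Q₁ → WLetter Q₁
  | .dir a => .inv a
  | .inv a => .dir a

/-- The letter of a word which underlies a letter of a walk. -/
def under : WLetter Q₁ → Letter Q₁
  | .dir a => D.st a
  | .inv a => (D.st a).bar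

/-- A walk `C`, given by the word `C^*` and letters `a` or `a⁻¹`, with `a` ordinary or special. -/
structure Walk where
  word : D.Word
  letter : ℤ → Option (WLetter Q₁)
  spec : ∀ i, (letter i).map D.under = word.letter i

open Classical in
/-- The walk obtained from a word by choosing orientations of the `*`-letters: here the letter of
the canonically associated walk at the place `i` where the word has letter `x`. -/
def Word.orient (w : D.Word) (i : ℤ) : Letter Q₁ → WLetter Q₁
  | .dir a => .dir a
  | .inv a => .inv a
  | .star s => if w.CanonDirect i then .dir s else .inv s

/-- The walk canonically associated to a word. -/
def Word.canon (w : D.Word) : D.Walk where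
  word := w
  letter i := (w.letter i).map (w.orient D i)
  spec i := by
    rw [Option.map_map]
    rcases h : w.letter i with _ | x
    · rfl
    · have := w.allowed i x h
      simp only [Option.map_some, Function.comp_apply, Option.some.injEq]
      cases x with
      | dir a => exact if_neg this
      | inv a => exact congrArg Letter.bar (if_neg this)
      | star s =>
        unfold Word.orient
        dsimp only
        split
        · exact if_pos this
        · exact congrArg Letter.bar (if_pos this)

/-- There is an arrow `i → j` labelled `a` in the quiver of the walk. -/
def Walk.Arrow {D : Clannish K Q₀ Q₁} (C : D.Walk) (i j : ℤ) (a : Q₁) : Prop :=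
  (C.letter i = some (.dir a) ∧ j = i - 1) ∨ (C.letter j = some (.inv a) ∧ i = j - 1)

namespace Walk

variable {D} (C : D.Walk)

lemma Arrow.heads {C : D.Walk} {i j : ℤ} {a : Q₁} (h : C.Arrow i j a) :
    C.word.vert i = some (D.tail a) ∧ C.word.vert j = some (D.head a) := by
  have hst : D.hd (D.st a) = D.head a ∧ D.hd (D.st a).bar = D.tail a := by
    unfold st
    split
    · rename_i hs; exact ⟨rfl, D.loop a hs⟩
    · exact ⟨rfl, rfl⟩
  rcases h with ⟨h, rfl⟩ | ⟨h, rfl⟩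
  · have e := C.spec i
    rw [h] at e
    refine ⟨?_, ?_⟩
    · rw [C.word.tail_eq i _ e.symm]; exact congrArg some hst.2
    · rw [C.word.head_eq i _ e.symm]; exact congrArg some hst.1
  · have e := C.spec j
    rw [h] at e
    refine ⟨?_, ?_⟩
    · rw [C.word.head_eq j _ e.symm]; exact congrArg some hst.2
    · rw [C.word.tail_eq j _ e.symm]
      refine congrArg some ?_
      change D.hd (D.st a).bar.bar = _
      rw [Letter.bar_bar, hst.1]

lemma mem_of_vert {i : ℤ} {v : Q₀} (h : C.word.vert i = some v) : i ∈ C.word.idx.I := by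
  rw [← C.word.vert_dom, h]; rfl

/-- Neighbouring vertices of a walk are joined by an arrow. -/
lemma exists_arrow {i : ℤ} (h : i ∈ C.word.idx.I) (h' : i + 1 ∈ C.word.idx.I) :
    (∃ a, C.Arrow i (i + 1) a) ∨ ∃ a, C.Arrow (i + 1) i a := by
  obtain ⟨x, hx⟩ := (C.word.letter_some_iff (i + 1)).2 ⟨h', by simpa using h⟩
  have e := C.spec (i + 1)
  rw [hx] at e
  obtain ⟨y, hy, -⟩ := Option.map_eq_some_iff.1 e
  cases y with
  | dir a => exact Or.inr ⟨a, Or.inl ⟨hy, by ring⟩⟩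
  | inv a => exact Or.inl ⟨a, Or.inr ⟨hy, by ring⟩⟩

lemma idx_interval {i j k : ℤ} (hi : i ∈ C.word.idx.I) (hk : k ∈ C.word.idx.I) (h : i ≤ j)
    (h' : j ≤ k) : j ∈ C.word.idx.I := by
  revert hi hk
  cases C.word.idx with
  | fin n => simp only [Idx.I, Set.mem_Icc]; omega
  | int => simp [Idx.I]

/-- Induction along a walk. -/
lemma induct {S : ℤ → Prop} {k : ℤ} (hk : k ∈ C.word.idx.I) (h0 : S k)
    (h : ∀ i j a, C.Arrow i j a → (S i ↔ S j)) : ∀ i ∈ C.word.idx.I, S i := by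
  have up : ∀ m : ℕ, k + m ∈ C.word.idx.I → S (k + m) := by
    intro m
    induction m with
    | zero => intro _; simpa using h0
    | succ m ih =>
      intro hm
      push_cast at hm ⊢
      rw [← add_assoc] at hm ⊢
      have hm' := C.idx_interval hk hm (j := k + m) (by omega) (by omega)
      rcases C.exists_arrow hm' hm with ⟨a, ha⟩ | ⟨a, ha⟩
      · exact (h _ _ _ ha).1 (ih hm')
      · exact (h _ _ _ ha).2 (ih hm')
  have down : ∀ m : ℕ, k - m ∈ C.word.idx.I → S (k - m) := by
    intro m
    induction m with
    | zero => intro _; simpa using h0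
    | succ m ih =>
      intro hm
      push_cast at hm ⊢
      have hm' := C.idx_interval hm hk (j := k - m) (by omega) (by omega)
      have e : k - m = k - (m + 1 : ℤ) + 1 := by ring
      have ih := ih hm'
      rw [e] at ih hm'
      rcases C.exists_arrow hm hm' with ⟨a, ha⟩ | ⟨a, ha⟩
      · exact (h _ _ _ ha).2 ih
      · exact (h _ _ _ ha).1 ih
  intro i hi
  rcases le_total k i with hki | hki
  · obtain ⟨m, hm⟩ := Int.eq_ofNat_of_zero_le (sub_nonneg.2 hki)
    obtain rfl : i = k + m := by omega
    exact up m hi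
  · obtain ⟨m, hm⟩ := Int.eq_ofNat_of_zero_le (sub_nonneg.2 hki)
    obtain rfl : i = k - m := by omega
    exact down m hi

end Walk

section Twist

variable {D} (C : D.Walk)

/-- A choice of automorphisms `π_i` with `π_j = σ_a π_i` for each arrow `i → j` of the quiver of
`C` labelled `a`. (The values for `i` outside the index set play no role.) -/
structure TwistFamily where
  toFun : ℤ → RingAut K
  spec : ∀ i j a, C.Arrow i j a → toFun j = D.σ a * toFun i

variable {C} (π : TwistFamily C)

lemma TwistFamily.apply {i j : ℤ} {a : Q₁} (h : C.Arrow i j a) (l : K) :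
    π.toFun j l = D.σ a (π.toFun i l) := by
  rw [π.spec i j a h]; rfl

end Twist

/-! ### The modules `M(C)` -/

section ModuleM

variable {D} [Fintype Q₀] (C : D.Walk)

/-- The defining relations of `M(C)`. Generators are indexed by `ℤ`; those which do not come from
the index set of `C` are zero. -/
inductive MRel : (ℤ →₀ D.Alg) → Prop
  | out (i : ℤ) (h : C.word.vert i = none) : MRel (Finsupp.single i 1)
  | vertex (i : ℤ) (v : Q₀) (h : C.word.vert i = some v) :
      MRel (Finsupp.single i (D.e v) - Finsupp.single i 1)
  | arrow (i j : ℤ) (a : Q₁) (h : C.Arrow i j a) :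
      MRel (Finsupp.single i (D.arr a) - Finsupp.single j 1)
  | zero (i : ℤ) (a : Q₁) (ha : a ∉ D.Sp) (h : C.word.vert i = some (D.tail a))
      (h' : ∀ j, ¬ C.Arrow i j a) : MRel (Finsupp.single i (D.arr a))

/-- The `R`-module `M(C)`. -/
abbrev M : Type _ := (ℤ →₀ D.Alg) ⧸ Submodule.span D.Alg {x | MRel C x}

/-- The generators `b_i` of `M(C)`. -/
def b (i : ℤ) : M C := Submodule.Quotient.mk (Finsupp.single i 1)

lemma mk_single (i : ℤ) (r : D.Alg) :
    (Submodule.Quotient.mk (Finsupp.single i r) : M C) = r • b C i := by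
  unfold b
  rw [← Submodule.Quotient.mk_smul]
  simp

lemma MRel.eq_zero {x : ℤ →₀ D.Alg} (h : MRel C x) :
    (Submodule.Quotient.mk x : M C) = 0 :=
  (Submodule.Quotient.mk_eq_zero _).2 (Submodule.subset_span h)

lemma b_out {i : ℤ} (h : C.word.vert i = none) : b C i = 0 := (MRel.out i h).eq_zero

lemma b_vertex {i : ℤ} {v : Q₀} (h : C.word.vert i = some v) : D.e v • b C i = b C i := by
  have := (MRel.vertex i v h).eq_zero
  rw [Submodule.Quotient.mk_sub, mk_single, sub_eq_zero] at this
  exact this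

lemma b_arrow {i j : ℤ} {a : Q₁} (h : C.Arrow i j a) : D.arr a • b C i = b C j := by
  have := (MRel.arrow i j a h).eq_zero
  rw [Submodule.Quotient.mk_sub, mk_single, sub_eq_zero] at this
  exact this

lemma b_zero {i : ℤ} {a : Q₁} (ha : a ∉ D.Sp) (h : C.word.vert i = some (D.tail a))
    (h' : ∀ j, ¬ C.Arrow i j a) : D.arr a • b C i = 0 := by
  have := (MRel.zero i a ha h h').eq_zero
  rwa [mk_single] at this

variable {C} in
/-- The conditions under which `b_i ↦ f i` defines a homomorphism on `M(C)`. -/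
structure Compat (C : D.Walk) {N : Type*} [AddCommGroup N] [Module D.Alg N] (f : ℤ → N) :
    Prop where
  out : ∀ i, C.word.vert i = none → f i = 0
  vertex : ∀ i v, C.word.vert i = some v → D.e v • f i = f i
  arrow : ∀ i j a, C.Arrow i j a → D.arr a • f i = f j
  zero : ∀ i a, a ∉ D.Sp → C.word.vert i = some (D.tail a) → (∀ j, ¬ C.Arrow i j a) →
    D.arr a • f i = 0

/-- Homomorphisms out of `M(C)`. -/
def M.lift {N : Type*} [AddCommGroup N] [Module D.Alg N] (f : ℤ → N) (hf : Compat C f) :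
    M C →ₗ[D.Alg] N :=
  Submodule.liftQ _ (Finsupp.linearCombination D.Alg f) (by
    rw [Submodule.span_le]
    rintro x (⟨i, h⟩ | ⟨i, v, h⟩ | ⟨i, j, a, h⟩ | ⟨i, a, ha, h, h'⟩) <;>
      simp only [SetLike.mem_coe, LinearMap.mem_ker, map_sub, Finsupp.linearCombination_single,
        one_smul]
    · exact hf.out i h
    · rw [hf.vertex i v h, sub_self]
    · rw [hf.arrow i j a h, sub_self]
    · exact hf.zero i a ha h h')

@[simp] lemma M.lift_b {N : Type*} [AddCommGroup N] [Module D.Alg N] (f : ℤ → N)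
    (hf : Compat C f) (i : ℤ) : M.lift C f hf (b C i) = f i := by
  unfold M.lift b
  rw [← Submodule.mkQ_apply, ← LinearMap.comp_apply, Submodule.liftQ_mkQ]
  simp

lemma M.hom_ext {N : Type*} [AddCommGroup N] [Module D.Alg N] {f g : M C →ₗ[D.Alg] N}
    (h : ∀ i, f (b C i) = g (b C i)) : f = g := by
  refine Submodule.linearMap_qext _ (Finsupp.lhom_ext' fun i => LinearMap.ext_ring ?_)
  exact h i

variable {C} (π : TwistFamily C)

lemma e_smul (v : Q₀) (l : K) {N : Type*} [AddCommGroup N] [Module D.Alg N] (x : N) :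
    D.e v • D.inK l • x = D.inK l • D.e v • x := by
  rw [← mul_smul, ← mul_smul, e_inK]

lemma arr_smul (a : Q₁) (l : K) {N : Type*} [AddCommGroup N] [Module D.Alg N] (x : N) :
    D.arr a • D.inK l • x = D.inK (D.σ a l) • D.arr a • x := by
  rw [← mul_smul, ← mul_smul, arr_inK]

lemma kAct_compat (l : K) : Compat C fun i => D.inK (π.toFun i l) • b C i where
  out i h := by rw [b_out C h, smul_zero]
  vertex i v h := by rw [e_smul, b_vertex C h]
  arrow i j a h := by rw [arr_smul, b_arrow C h, π.apply h]
  zero i a ha h h' := by rw [arr_smul, b_zero C ha h h', smul_zero]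

/-- The right action of `K` on `M(C)`, with `b_i λ = π_i(λ) b_i`. -/
def kAct : K →+* (Module.End D.Alg (M C))ᵐᵒᵖ where
  toFun l := .op (M.lift C _ (kAct_compat π l))
  map_one' := MulOpposite.unop_injective (M.hom_ext C fun i => by simp)
  map_mul' l m := MulOpposite.unop_injective (M.hom_ext C fun i => by simp [mul_smul])
  map_zero' := MulOpposite.unop_injective (M.hom_ext C fun i => by simp)
  map_add' l m := MulOpposite.unop_injective (M.hom_ext C fun i => by simp [add_smul])

@[simp] lemma kAct_b (l : K) (i : ℤ) :
    (kAct π l).unop (b C i) = D.inK (π.toFun i l) • b C i :=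
  M.lift_b C _ (kAct_compat π l) i

end ModuleM

set_option linter.unusedSectionVars false

/-! ### Actions on `M(C)` coming from symmetries -/

section Actions

variable {D} [Fintype Q₀] {C : D.Walk}

variable (C) in
/-- Reflection `i ↦ k + k' - i` is a symmetry of the quiver of `C`, apart from one arrow `k → k'`
which is labelled by the special loop `s`; the vertices in `P` are those on the side of `k`. -/
structure IsMirror (s : Q₁) (k k' : ℤ) (P : Set ℤ) : Prop where
  special : s ∈ D.Sp
  side : ∀ i, k + k' - i ∈ P ↔ i ∉ P
  mem : k ∈ P
  central : C.Arrow k k' s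
  vert : ∀ i, C.word.vert (k + k' - i) = C.word.vert i
  arrow : ∀ i j a, C.Arrow i j a →
    (i = k ∧ j = k' ∧ a = s) ∨ (C.Arrow (k + k' - i) (k + k' - j) a ∧ (i ∈ P ↔ j ∈ P))

section Mirror

variable (π : TwistFamily C) {s : Q₁} {k k' : ℤ} {P : Set ℤ}

/-- The automorphism `π_k⁻¹ π_{k'} = π_k⁻¹ σ_s π_k` attached to a reflection. -/
def mirrorAut (_h : IsMirror C s k k' P) : RingAut K := (π.toFun k)⁻¹ * π.toFun k'

/-- The coefficient `π_k⁻¹(β_s)`. -/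
def mirrorβ (_h : IsMirror C s k k' P) : K := (π.toFun k)⁻¹ (D.β s)

/-- The coefficient `π_k⁻¹(γ_s)`. -/
def mirrorγ (_h : IsMirror C s k k' P) : K := (π.toFun k)⁻¹ (D.γ s)

variable (h : IsMirror C s k k' P)

lemma mirror_apply (l : K) : π.toFun k (mirrorAut π h l) = D.σ s (π.toFun k l) := by
  rw [← π.apply h.central]
  exact (π.toFun k).apply_symm_apply _

lemma mirror_β : π.toFun k (mirrorβ π h) = D.β s := (π.toFun k).apply_symm_apply _

lemma mirror_γ : π.toFun k (mirrorγ π h) = D.γ s := (π.toFun k).apply_symm_apply _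

lemma mirror_facts (hN : D.NormallyBound) (π : TwistFamily C)
    (h : IsMirror C s k k' P) : mirrorAut π h (mirrorβ π h) = mirrorβ π h ∧
    mirrorAut π h (mirrorγ π h) = mirrorγ π h ∧
    (∀ a, mirrorβ π h * a = mirrorAut π h a * mirrorβ π h) ∧
    ∀ a, mirrorγ π h * a = mirrorAut π h (mirrorAut π h a) * mirrorγ π h := by
  obtain ⟨h1, h2, h3, h4⟩ := normal_quad (hN s h.special)
  refine ⟨?_, ?_, fun a => ?_, fun a => ?_⟩ <;> apply (π.toFun k).injective <;>
    simp only [map_mul, mirror_apply, mirror_β, mirror_γ]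
  · exact h1
  · exact h2
  · exact h3 _
  · exact h4 _

lemma mirror_twist_aux : ∀ i ∈ C.word.idx.I,
    (i ∈ P → π.toFun (k + k' - i) = π.toFun i * mirrorAut π h) ∧
    (i ∉ P → π.toFun i = π.toFun (k + k' - i) * mirrorAut π h) := by
  have h0 : π.toFun k' = π.toFun k * mirrorAut π h := by unfold mirrorAut; group
  have hk' : k' ∉ P := by
    rw [← h.side, show k + k' - k' = k by ring]; exact h.mem
  have e1 : k + k' - k = k' := by ring
  have e2 : k + k' - k' = k := by ring
  have hk : (k ∈ P → π.toFun (k + k' - k) = π.toFun k * mirrorAut π h) ∧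
    (k ∉ P → π.toFun k = π.toFun (k + k' - k) * mirrorAut π h) :=
    ⟨fun _ => by rw [e1, h0], fun hc => absurd h.mem hc⟩
  refine C.induct (C.mem_of_vert h.central.heads.1) hk fun i j a ha => ?_
  rcases h.arrow i j a ha with ⟨rfl, rfl, rfl⟩ | ⟨hr, hP⟩
  · exact ⟨fun _ => ⟨fun hc => absurd hc hk', fun _ => by rw [e2, h0]⟩, fun _ => hk⟩
  · rw [hP, π.spec _ _ _ ha, π.spec _ _ _ hr, mul_assoc, mul_assoc, mul_right_inj, mul_right_inj]

lemma mirror_twist {i : ℤ} (hi : i ∈ C.word.idx.I) (hP : i ∈ P) (l : K) :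
    π.toFun (k + k' - i) l = π.toFun i (mirrorAut π h l) := by
  rw [(mirror_twist_aux π h i hi).1 hP]; rfl

lemma mirror_twist' {i : ℤ} (hi : i ∈ C.word.idx.I) (hP : i ∉ P) (l : K) :
    π.toFun i l = π.toFun (k + k' - i) (mirrorAut π h l) := by
  rw [(mirror_twist_aux π h i hi).2 hP]; rfl

open Classical in
/-- The images `b_{k+k'-i}` (for `i` on the side of `k`) and
`b_i π_k⁻¹(β_s) - b_{k+k'-i} π_k⁻¹(γ_s)` (otherwise) of `b_i`. -/
def mirrorFun (i : ℤ) : M C :=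
  if i ∈ P then b C (k + k' - i) else
    D.inK (π.toFun i (mirrorβ π h)) • b C i -
      D.inK (π.toFun (k + k' - i) (mirrorγ π h)) • b C (k + k' - i)

lemma mirrorFun_pos {i : ℤ} (hi : i ∈ P) : mirrorFun π h i = b C (k + k' - i) := if_pos hi

lemma mirrorFun_neg {i : ℤ} (hi : i ∉ P) : mirrorFun π h i =
    D.inK (π.toFun i (mirrorβ π h)) • b C i -
      D.inK (π.toFun (k + k' - i) (mirrorγ π h)) • b C (k + k' - i) := if_neg hi

lemma mirror_compat (hN : D.NormallyBound) (π : TwistFamily C)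
    (h : IsMirror C s k k' P) : Compat C (mirrorFun π h) where
  out i hi := by
    have hi' : C.word.vert (k + k' - i) = none := by rw [h.vert, hi]
    by_cases hP : i ∈ P
    · rw [mirrorFun_pos π h hP, b_out C hi']
    · rw [mirrorFun_neg π h hP, b_out C hi', b_out C hi, smul_zero, smul_zero, sub_zero]
  vertex i v hi := by
    have hi' : C.word.vert (k + k' - i) = some v := by rw [h.vert, hi]
    by_cases hP : i ∈ P
    · rw [mirrorFun_pos π h hP, b_vertex C hi']
    · rw [mirrorFun_neg π h hP, smul_sub, e_smul, e_smul, b_vertex C hi', b_vertex C hi]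
  arrow i j a ha := by
    rcases h.arrow i j a ha with ⟨rfl, rfl, rfl⟩ | ⟨hr, hP⟩
    · have hj : j ∉ P := by
        rw [← h.side, show i + j - j = i by ring]; exact h.mem
      obtain ⟨h1, -⟩ := normal_quad (hN a h.special)
      rw [mirrorFun_pos π h h.mem, mirrorFun_neg π h hj, show i + j - i = j by ring,
        show i + j - j = i by ring, π.apply ha, mirror_β, mirror_γ, h1, ← b_arrow C ha,
        ← mul_smul, D.arr_sq a h.special, sub_smul, mul_smul, mul_smul,
        b_vertex C (by rw [D.loop a h.special]; exact ha.heads.1)]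
    · by_cases hi : i ∈ P
      · rw [mirrorFun_pos π h hi, mirrorFun_pos π h (hP.1 hi), b_arrow C hr]
      · rw [mirrorFun_neg π h hi, mirrorFun_neg π h (fun hj => hi (hP.2 hj)), smul_sub, arr_smul,
          arr_smul, b_arrow C ha, b_arrow C hr, π.apply ha, π.apply hr]
  zero i a ha hv hno := by
    have hv' : C.word.vert (k + k' - i) = some (D.tail a) := by rw [h.vert, hv]
    have hno' : ∀ j, ¬ C.Arrow (k + k' - i) j a := by
      intro j hj
      rcases h.arrow _ _ _ hj with ⟨-, -, rfl⟩ | ⟨hr, -⟩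
      · exact ha h.special
      · rw [show k + k' - (k + k' - i) = i by ring] at hr
        exact hno _ hr
    by_cases hP : i ∈ P
    · rw [mirrorFun_pos π h hP, b_zero C ha hv' hno']
    · rw [mirrorFun_neg π h hP, smul_sub, arr_smul, arr_smul, b_zero C ha hv' hno',
        b_zero C ha hv hno, smul_zero, smul_zero, sub_zero]

/-- The endomorphism attached to a reflection. -/
def mirrorEnd (hN : D.NormallyBound) (π : TwistFamily C)
    (h : IsMirror C s k k' P) : M C →ₗ[D.Alg] M C := M.lift C (mirrorFun π h) (mirror_compat hN π h)

lemma mirrorEnd_b (hN : D.NormallyBound) (π : TwistFamily C)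
    (h : IsMirror C s k k' P) (i : ℤ) : mirrorEnd hN π h (b C i) = mirrorFun π h i :=
  M.lift_b C _ (mirror_compat hN π h) i

lemma mirror_comm (hN : D.NormallyBound) (π : TwistFamily C)
    (h : IsMirror C s k k' P) (l : K) : kAct π (mirrorAut π h l) * .op (mirrorEnd hN π h) =
    .op (mirrorEnd hN π h) * kAct π l := by
  obtain ⟨h1, h2, h3, h4⟩ := mirror_facts hN π h
  refine MulOpposite.unop_injective (M.hom_ext C fun i => ?_)
  simp only [MulOpposite.unop_mul, MulOpposite.unop_op, Module.End.mul_apply, kAct_b, map_smul,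
    mirrorEnd_b]
  rcases hv : C.word.vert i with _ | v
  · rw [(mirror_compat hN π h).out i hv, smul_zero, map_zero]
  have hi := C.mem_of_vert hv
  by_cases hP : i ∈ P
  · rw [mirrorFun_pos π h hP, kAct_b, mirror_twist π h hi hP]
  · rw [mirrorFun_neg π h hP, map_sub, map_smul, map_smul, kAct_b, kAct_b, smul_sub]
    simp only [← mul_smul, ← map_mul]
    rw [h3, h4, map_mul (π.toFun (k + k' - i)), mirror_twist' π h hi hP (mirrorAut π h l)]

lemma mirror_quad (hN : D.NormallyBound) (π : TwistFamily C)
    (h : IsMirror C s k k' P) : MulOpposite.op (mirrorEnd hN π h) * .op (mirrorEnd hN π h) -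
    kAct π (mirrorβ π h) * .op (mirrorEnd hN π h) + kAct π (mirrorγ π h) = 0 := by
  obtain ⟨h1, h2, h3, h4⟩ := mirror_facts hN π h
  refine MulOpposite.unop_injective (M.hom_ext C fun i => ?_)
  simp only [MulOpposite.unop_mul, MulOpposite.unop_op, MulOpposite.unop_add,
    MulOpposite.unop_sub, MulOpposite.unop_zero, LinearMap.add_apply, LinearMap.sub_apply,
    LinearMap.zero_apply, Module.End.mul_apply, kAct_b, map_smul, mirrorEnd_b]
  rcases hv : C.word.vert i with _ | v
  · rw [(mirror_compat hN π h).out i hv, b_out C hv, smul_zero, smul_zero, map_zero, sub_zero,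
      add_zero]
  have hi := C.mem_of_vert hv
  have e : k + k' - (k + k' - i) = i := by ring
  by_cases hP : i ∈ P
  · have hP' : k + k' - i ∉ P := fun hc => (h.side i).1 hc hP
    rw [mirrorFun_pos π h hP, mirrorEnd_b, mirrorFun_neg π h hP', e, mirror_twist π h hi hP, h1]
    abel
  · have hP' : k + k' - i ∈ P := (h.side i).2 hP
    rw [mirrorFun_neg π h hP, map_sub, map_smul, map_smul, mirrorEnd_b, mirrorEnd_b,
      mirrorFun_neg π h hP, mirrorFun_pos π h hP', e, mirror_twist' π h hi hP (mirrorγ π h), h2]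
    abel

/-- The ring `K[x;τ]/(π_k⁻¹(q_s(x)))`, where `τ = π_k⁻¹ σ_s π_k`. -/
abbrev MirrorRing : Type _ := QuadRing (mirrorAut π h) (mirrorβ π h) (mirrorγ π h)

/-- The structural map `K → K[x;τ]/(π_k⁻¹(q_s(x)))`. -/
abbrev mirrorC (h : IsMirror C s k k' P) : K →+* MirrorRing π h := quadC (mirrorAut π h) (mirrorβ π h) (mirrorγ π h)

/-- The right action of `K[x;τ]/(π_k⁻¹(q_s(x)))` on `M(C)`. -/
def mirrorAct (hN : D.NormallyBound) (π : TwistFamily C)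
    (h : IsMirror C s k k' P) : MirrorRing π h →+* (Module.End D.Alg (M C))ᵐᵒᵖ :=
  quadLift _ _ _ (kAct π) (.op (mirrorEnd hN π h)) (mirror_comm hN π h) (mirror_quad hN π h)

end Mirror

section Periodic

variable (C) in
/-- The walk `C` is unchanged by the shift by `n`. -/
structure IsPeriodic (n : ℤ) : Prop where
  int : C.word.idx = .int
  vert : ∀ i, C.word.vert (i - n) = C.word.vert i
  letter : ∀ i, C.letter (i - n) = C.letter i

variable (π : TwistFamily C) {n : ℤ}

/-- The automorphism `π_0⁻¹ π_{-n}` attached to a period. -/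
def periodAut (_h : IsPeriodic C n) : RingAut K := (π.toFun 0)⁻¹ * π.toFun (-n)

variable (h : IsPeriodic C n)

lemma period_arrow (h : IsPeriodic C n) (i j : ℤ) (a : Q₁) : C.Arrow (i - n) (j - n) a ↔ C.Arrow i j a := by
  unfold Walk.Arrow
  rw [h.letter, h.letter, show j - n = i - n - 1 ↔ j = i - 1 by omega,
    show i - n = j - n - 1 ↔ i = j - 1 by omega]

lemma period_all (h : IsPeriodic C n) (m : ℤ) : IsPeriodic C (n * m) := by
  refine ⟨h.int, ?_, ?_⟩
  · have key : ∀ m i, C.word.vert (i - n * m) = C.word.vert i := by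
      intro m
      induction m using Int.induction_on with
      | zero => simp
      | succ m ih => intro i; rw [← ih i, ← h.vert (i - n * m)]; ring_nf
      | pred m ih => intro i; rw [← ih i, ← h.vert (i - n * (-m - 1))]; ring_nf
    exact key m
  · have key : ∀ m i, C.letter (i - n * m) = C.letter i := by
      intro m
      induction m using Int.induction_on with
      | zero => simp
      | succ m ih => intro i; rw [← ih i, ← h.letter (i - n * m)]; ring_nf
      | pred m ih => intro i; rw [← ih i, ← h.letter (i - n * (-m - 1))]; ring_nf
    exact key m

lemma period_twist (i : ℤ) : π.toFun (i - n) = π.toFun i * periodAut π h := by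
  have h0 : ∀ i, i ∈ C.word.idx.I := fun i => by rw [h.int]; trivial
  refine C.induct (S := fun i => π.toFun (i - n) = π.toFun i * periodAut π h) (h0 0) ?_
    (fun i j a ha => ?_) i (h0 i)
  · unfold periodAut; rw [zero_sub]; group
  · rw [π.spec _ _ _ ha, π.spec _ _ _ ((period_arrow h i j a).2 ha), mul_assoc, mul_right_inj]

lemma period_twist_pow (m i : ℤ) : π.toFun (i - n * m) = π.toFun i * periodAut π h ^ m := by
  induction m using Int.induction_on generalizing i with
  | zero => simp
  | succ m ih =>
    rw [show i - n * (m + 1) = i - n * m - n by ring, period_twist π h, ih, zpow_add_one, mul_assoc]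
  | pred m ih =>
    have := period_twist π h (i - n * (-m - 1))
    rw [show i - n * (-m - 1) - n = i - n * (-m) by ring, ih] at this
    rw [zpow_sub_one, ← mul_assoc, this]; group

lemma shift_compat (h : IsPeriodic C n) : Compat C fun i => b C (i - n) where
  out i hi := b_out C (by rw [h.vert, hi])
  vertex i v hi := b_vertex C (by rw [h.vert, hi])
  arrow i j a ha := b_arrow C ((period_arrow h i j a).2 ha)
  zero i a ha hv hno := b_zero C ha (by rw [h.vert, hv]) fun j hj => hno (j + n) <| by
    rw [← period_arrow h]; rwa [show j + n - n = j by ring]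

/-- The endomorphisms `b_i ↦ b_{i - n m}`. -/
def shiftEnd (h : IsPeriodic C n) (m : ℤ) : M C →ₗ[D.Alg] M C :=
  M.lift C (fun i => b C (i - n * m)) (shift_compat (period_all h m))

lemma shiftEnd_b (h : IsPeriodic C n) (m i : ℤ) : shiftEnd h m (b C i) = b C (i - n * m) :=
  M.lift_b C _ (shift_compat (period_all h m)) i

/-- The right action of the powers of `x` on `M(C)`, with `b_i x = b_{i - n}`. -/
def shiftHom (h : IsPeriodic C n) : Multiplicative ℤ →* (Module.End D.Alg (M C))ᵐᵒᵖ where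
  toFun m := .op (shiftEnd h (Multiplicative.toAdd m))
  map_one' := MulOpposite.unop_injective (M.hom_ext C fun i => by
    simp [shiftEnd_b])
  map_mul' m l := MulOpposite.unop_injective (M.hom_ext C fun i => by
    simp only [MulOpposite.unop_mul, MulOpposite.unop_op, Module.End.mul_apply, shiftEnd_b,
      toAdd_mul]
    ring_nf)

/-- The right action of `K[x,x⁻¹;τ]` on `M(C)`. -/
def periodAct : SkewLaurent (periodAut π h) →+* (Module.End D.Alg (M C))ᵐᵒᵖ :=
  laurentLift _ (kAct π) (shiftHom h) fun m a => by
    refine MulOpposite.unop_injective (M.hom_ext C fun i => ?_)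
    change shiftEnd h m ((kAct π _).unop (b C i)) = (kAct π _).unop (shiftEnd h m (b C i))
    rw [shiftEnd_b, kAct_b, kAct_b, map_smul, shiftEnd_b, period_twist_pow π h]
    rfl

end Periodic

end Actions

/-! ### Symmetries of canonically associated walks -/

section Symmetry

variable {D} {w : D.Word}

lemma Word.canon_letter (i : ℤ) : w.canon.letter i = (w.letter i).map (w.orient D i) := rfl

lemma Word.canon_reflect (hw : w.EndAdmissible) {c : ℤ} (hc : w.IsSymmetry c)
    (hsym : ∀ j, w.IsSymmetry j → j ≠ c → (2 * c - j ≤ 0 ↔ ¬ j ≤ 0)) {j : ℤ} (hj : j ≠ c) :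
    w.canon.letter (2 * c - j) = (w.canon.letter j).map WLetter.bar := by
  rw [canon_letter, canon_letter, hc.reflect]
  rcases h : w.letter j with _ | x
  · rfl
  · simp only [Option.map_some, Option.some.injEq]
    cases x with
    | dir a => rfl
    | inv a => rfl
    | star s =>
      have := w.canonDirect_reflect hw hc hsym h hj
      simp only [Letter.bar, Word.orient]
      by_cases hd : w.CanonDirect j
      · rw [if_pos hd, if_neg (fun hc => (this.1 hc) hd)]; rfl
      · rw [if_neg hd, if_pos (this.2 hd)]; rfl

lemma Word.canonDirect_symmetry {c : ℤ} (hc : w.IsSymmetry c) : w.CanonDirect c ↔ c ≤ 0 := by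
  unfold CanonDirect
  rw [hc.2]
  have n1 : ¬ SeqLt (w.after c) (w.after c) := fun h => h.asymm h
  simp [n1]

lemma Word.vert_none_iff (i : ℤ) : w.vert i = none ↔ i ∉ w.idx.I := by
  rw [← w.vert_dom]; cases w.vert i <;> simp

lemma Word.mem_I_iff {c : ℤ} (hc : c ∈ w.idx.I') (i : ℤ) :
    i ∈ w.idx.I ↔ i ∈ w.idx.I' ∨ i + 1 ∈ w.idx.I' := by
  revert hc
  unfold Idx.I'
  cases w.idx with
  | fin n => simp only [Idx.I, Set.mem_ofPred_eq, Set.mem_Icc]; omega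
  | int => simp [Idx.I]

lemma Word.vert_reflect {c : ℤ} (hc : w.IsSymmetry c) (i : ℤ) :
    w.vert (2 * c - 1 - i) = w.vert i := by
  obtain ⟨s, hs⟩ := hc.1
  have hcI := (w.letter_some_iff c).1 ⟨_, hs⟩
  have refl_mem : ∀ j, 2 * c - j ∈ w.idx.I' ↔ j ∈ w.idx.I' := by
    intro j
    rw [← w.letter_dom, ← w.letter_dom, hc.reflect, Option.isSome_map]
  by_cases hi : i ∈ w.idx.I
  · rcases (w.mem_I_iff hcI i).1 hi with h | h
    · obtain ⟨x, hx⟩ := (w.letter_some_iff i).2 h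
      have e := hc.reflect i
      rw [hx] at e
      have := w.head_eq _ _ e
      rw [w.tail_eq _ _ hx, ← this]
      ring_nf
    · obtain ⟨x, hx⟩ := (w.letter_some_iff (i + 1)).2 h
      have e := hc.reflect (i + 1)
      rw [hx] at e
      have := w.tail_eq _ _ e
      have h2 := w.head_eq _ _ hx
      rw [Letter.bar_bar] at this
      rw [add_sub_cancel_right] at h2
      rw [h2, ← this]
      ring_nf
  · rw [(w.vert_none_iff i).2 hi, w.vert_none_iff, w.mem_I_iff hcI]
    rw [w.mem_I_iff hcI] at hi
    rw [show 2 * c - 1 - i = 2 * c - (i + 1) by ring, refl_mem,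
      show 2 * c - (i + 1) + 1 = 2 * c - i by ring, refl_mem]
    tauto

/-- The shape of arrows under reflection about the letter `c`. -/
lemma Word.arrow_reflect (hw : w.EndAdmissible) {c : ℤ} (hc : w.IsSymmetry c)
    (hsym : ∀ j, w.IsSymmetry j → j ≠ c → (2 * c - j ≤ 0 ↔ ¬ j ≤ 0)) {i j : ℤ} {a : Q₁}
    (h : w.canon.Arrow i j a) :
    (i = c ∧ j = c - 1 ∧ w.canon.letter c = some (.dir a)) ∨
      (i = c - 1 ∧ j = c ∧ w.canon.letter c = some (.inv a)) ∨
      (w.canon.Arrow (2 * c - 1 - i) (2 * c - 1 - j) a ∧ (i ≤ c - 1 ↔ j ≤ c - 1)) := by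
  rcases h with ⟨h, rfl⟩ | ⟨h, rfl⟩
  · by_cases hi : i = c
    · subst hi; exact Or.inl ⟨rfl, rfl, h⟩
    · refine Or.inr (Or.inr ⟨Or.inr ⟨?_, by ring⟩, by omega⟩)
      rw [show 2 * c - 1 - (i - 1) = 2 * c - i by ring, canon_reflect hw hc hsym hi, h]; rfl
  · by_cases hj : j = c
    · subst hj; exact Or.inr (Or.inl ⟨rfl, rfl, h⟩)
    · refine Or.inr (Or.inr ⟨Or.inl ⟨?_, by ring⟩, by omega⟩)
      rw [show 2 * c - 1 - (j - 1) = 2 * c - j by ring, canon_reflect hw hc hsym hj, h]; rfl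

lemma Word.mirror_inv (hw : w.EndAdmissible) {c : ℤ} (hc : w.IsSymmetry c)
    (hsym : ∀ j, w.IsSymmetry j → j ≠ c → (2 * c - j ≤ 0 ↔ ¬ j ≤ 0)) (hpos : 0 < c) {s : Q₁}
    (hs : w.letter c = some (.star s)) :
    IsMirror w.canon s (c - 1) c {i | i ≤ c - 1} := by
  have hl : w.canon.letter c = some (.inv s) := by
    rw [canon_letter, hs, Option.map_some, Word.orient,
      if_neg (by rw [canonDirect_symmetry hc]; omega)]
  have e : ∀ i, c - 1 + c - i = 2 * c - 1 - i := fun i => by ring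
  refine ⟨w.allowed _ _ hs, fun i => ?_, le_refl (c - 1), Or.inr ⟨hl, rfl⟩, fun i => ?_,
    fun i j a ha => ?_⟩
  · simp only [Set.mem_ofPred_eq]; omega
  · rw [e]; exact vert_reflect hc i
  · rw [e, e]
    rcases arrow_reflect hw hc hsym ha with ⟨-, -, h⟩ | ⟨h1, h2, h⟩ | h
    · rw [hl] at h; cases h
    · rw [hl] at h; cases h; exact Or.inl ⟨h1, h2, rfl⟩
    · exact Or.inr h

lemma Word.mirror_dir (hw : w.EndAdmissible) {c : ℤ} (hc : w.IsSymmetry c)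
    (hsym : ∀ j, w.IsSymmetry j → j ≠ c → (2 * c - j ≤ 0 ↔ ¬ j ≤ 0)) (hpos : c ≤ 0) {s : Q₁}
    (hs : w.letter c = some (.star s)) :
    IsMirror w.canon s c (c - 1) {i | c ≤ i} := by
  have hl : w.canon.letter c = some (.dir s) := by
    rw [canon_letter, hs, Option.map_some, Word.orient,
      if_pos (by rw [canonDirect_symmetry hc]; omega)]
  have e : ∀ i, c + (c - 1) - i = 2 * c - 1 - i := fun i => by ring
  refine ⟨w.allowed _ _ hs, fun i => ?_, le_refl c, Or.inl ⟨hl, rfl⟩, fun i => ?_,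
    fun i j a ha => ?_⟩
  · simp only [Set.mem_ofPred_eq]; omega
  · rw [e]; exact vert_reflect hc i
  · rw [e, e]
    rcases arrow_reflect hw hc hsym ha with ⟨h1, h2, h⟩ | ⟨-, -, h⟩ | ⟨h, h'⟩
    · rw [hl] at h; cases h; exact Or.inl ⟨h1, h2, rfl⟩
    · rw [hl] at h; cases h
    · refine Or.inr ⟨h, ?_⟩
      simp only [Set.mem_ofPred_eq]; omega

lemma Word.symmetry_reflect {c j : ℤ} (hc : w.IsSymmetry c) (hj : w.IsSymmetry j) :
    w.IsSymmetry (2 * c - j) := by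
  obtain ⟨s, hs⟩ := hj.1
  refine w.isSymmetry_of_reflect (x := .star s) (by rw [hc.reflect, hs]; rfl) fun i => ?_
  have h1 := hc.reflect (2 * j - (2 * c - i))
  rw [hj.reflect (2 * c - i), hc.reflect i, Option.map_map, Option.map_map] at h1
  rw [show 2 * (2 * c - j) - i = 2 * c - (2 * j - (2 * c - i)) by ring, h1]
  cases w.letter i <;> simp

/-- A symmetric string of length `2 k + 1` is reflected in the letter `k + 1`. -/
lemma Word.mirror_string {k : ℕ} {s : Q₁} (h : w.IsString) (hk : w.idx = .fin (2 * k + 1))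
    (hw : w.inv = w) (hs : w.letter (k + 1) = some (.star s)) :
    IsMirror w.canon s k (k + 1) {i | i ≤ k} := by
  have hl : ∀ i, w.letter (2 * (k + 1) - i) = (w.letter i).map Letter.bar := by
    intro i
    conv_lhs => rw [← hw]
    rw [inv_letter, w.flip_fin hk]
    push_cast
    ring_nf
  have hc : w.IsSymmetry (k + 1) := w.isSymmetry_of_reflect hs hl
  have hsym : ∀ j, w.IsSymmetry j → j ≠ (k : ℤ) + 1 → (2 * ((k : ℤ) + 1) - j ≤ 0 ↔ ¬ j ≤ 0) := by
    intro j hj hne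
    have hm : ∀ i, 2 * j - i ∈ w.idx.I' ↔ i ∈ w.idx.I' := fun i => by
      rw [← w.letter_dom, ← w.letter_dom, hj.reflect, Option.isSome_map]
    have hn : ((2 * k + 1 : ℕ) : ℤ) = 2 * k + 1 := by push_cast; ring
    have h1 := (hm 1).2 ((w.mem_I'_fin hk 1).2 ⟨le_rfl, by omega⟩)
    have h2 := (hm (2 * k + 1)).2 ((w.mem_I'_fin hk _).2 ⟨by omega, by omega⟩)
    rw [w.mem_I'_fin hk] at h1 h2
    push_cast at h1 h2
    omega
  have := mirror_inv h.2.1 hc hsym (by omega) hs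
  rwa [show (k : ℤ) + 1 - 1 = k by ring] at this

/-- A symmetric band is reflected in its least positive symmetry `r + 1`. -/
lemma Word.mirror_right {r : ℕ} {s : Q₁} (h : w.IsBand)
    (hr : IsLeast {i : ℤ | 0 < i ∧ w.IsSymmetry i} (r + 1))
    (hs : w.letter (r + 1) = some (.star s)) :
    IsMirror w.canon s r (r + 1) {i | i ≤ r} := by
  have := mirror_inv h.endAdmissible hr.1.2 (fun j hj hne => ?_) hr.1.1 hs
  · rwa [show (r : ℤ) + 1 - 1 = r by ring] at this
  · refine ⟨fun h1 => by omega, fun h1 => ?_⟩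
    by_contra h2
    have h3 : (r : ℤ) + 1 ≤ j := hr.2 ⟨by omega, hj⟩
    have h4 : (r : ℤ) + 1 ≤ 2 * (r + 1) - j := hr.2 ⟨by omega, symmetry_reflect hr.1.2 hj⟩
    omega

/-- A symmetric band is reflected in its greatest non-positive symmetry `-p`. -/
lemma Word.mirror_left {p : ℕ} {t : Q₁} (h : w.IsBand)
    (hp : IsGreatest {i : ℤ | i ≤ 0 ∧ w.IsSymmetry i} (-p))
    (ht : w.letter (-p) = some (.star t)) :
    IsMirror w.canon t (-p) (-p - 1) {i | -p ≤ i} := by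
  refine mirror_dir h.endAdmissible hp.1.2 (fun j hj hne => ?_) hp.1.1 ht
  refine ⟨fun h1 h2 => ?_, fun h1 => by omega⟩
  have h3 : j ≤ -(p : ℤ) := hp.2 ⟨h2, hj⟩
  have h4 : 2 * -(p : ℤ) - j ≤ -(p : ℤ) := hp.2 ⟨h1, symmetry_reflect hp.1.2 hj⟩
  omega

/-- The walk canonically associated to an asymmetric band is periodic. -/
lemma Word.periodic {n : ℕ} (h : w.IsBand) (hn : w.shift n = w)
    (hw : ¬ ∃ m, w.inv = w.shift m) : IsPeriodic w.canon n := by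
  have hl : ∀ i, w.letter (i - n) = w.letter i := by
    intro i
    conv_lhs => rw [← hn]
    rw [w.shift_letter h.1]
    ring_nf
  have hs : ∀ i, ¬ w.IsSymmetry i := fun i hi => hw ⟨_, w.inv_eq_shift h.1 hi⟩
  refine ⟨h.1, fun i => ?_, fun i => ?_⟩
  · obtain ⟨x, hx⟩ := (w.letter_some_iff i).2 (w.mem_I'_int h.1 i)
    change w.vert (i - n) = w.vert i
    rw [w.tail_eq i x hx, w.tail_eq (i - n) x (by rw [hl, hx])]
  · rw [canon_letter, canon_letter, hl]
    rcases hx : w.letter i with _ | x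
    · rfl
    · cases x with
      | dir a => rfl
      | inv a => rfl
      | star s =>
        have h1 : w.after (i - n) = w.after i := by
          funext k
          change w.letter (i - n + 1 + k) = w.letter (i + 1 + k)
          rw [← hl (i + 1 + k)]
          ring_nf
        have h2 : w.before (i - n - 1) = w.before (i - 1) := by
          funext k
          change (w.letter (i - n - 1 - k)).map Letter.bar = (w.letter (i - 1 - k)).map Letter.bar
          rw [← hl (i - 1 - k)]
          ring_nf
        have hne : w.before (i - 1) ≠ w.after i := fun e => hs i ⟨⟨s, hx⟩, e⟩
        have : w.CanonDirect (i - n) ↔ w.CanonDirect i := by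
          unfold CanonDirect
          rw [h1, h2]
          simp [hne]
        simp only [Option.map_some, Word.orient]
        by_cases hd : w.CanonDirect i
        · rw [if_pos hd, if_pos (this.2 hd)]
        · rw [if_neg hd, if_neg fun hc => hd (this.1 hc)]

end Symmetry

/-! ### Parameterizing rings -/

section Param

universe u v₀ v₁

variable {K : Type u} {Q₀ : Type v₀} {Q₁ : Type v₁} [DivisionRing K] {D : Clannish K Q₀ Q₁}
  [Fintype Q₀]

/-- A ring with a ring homomorphism from `K` and a right action on `M(C)` by endomorphisms of the
`R`-module `M(C)`, so that `M(C)` is a bimodule. -/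
structure ParamRing (C : D.Walk) where
  carrier : Type u
  [ring : Ring carrier]
  incl : K →+* carrier
  act : carrier →+* (Module.End D.Alg (M C))ᵐᵒᵖ

attribute [instance] ParamRing.ring

/-- The ring `R_w` with its action on `M(C_w)`, given the type of `w`. -/
def ofKind (hN : D.NormallyBound) (w : D.Word) (π : TwistFamily w.canon) :
    w.Kind → ParamRing w.canon
  | .asymString _ _ => ⟨K, RingHom.id K, kAct π⟩
  | .symString _ _ h hk hw hs =>
    ⟨MirrorRing π (Word.mirror_string h hk hw hs), mirrorC π _,
      mirrorAct hN π (Word.mirror_string h hk hw hs)⟩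
  | .asymBand _ h hn hw =>
    ⟨SkewLaurent (periodAut π (Word.periodic h hn.1.2 hw)), laurentC _,
      periodAct π (Word.periodic h hn.1.2 hw)⟩
  | .symBand _ _ _ _ h _ hr hp hs ht =>
    let i := mirrorC π (Word.mirror_left h hp ht)
    let j := mirrorC π (Word.mirror_right h hr hs)
    ⟨FreeProd i j, (FreeProd.inl i j).comp i,
      FreeProd.lift i j (mirrorAct hN π (Word.mirror_left h hp ht))
        (mirrorAct hN π (Word.mirror_right h hr hs))
        fun a => (quadLift_C _ _ _ _ _ _ _ a).trans (quadLift_C _ _ _ _ _ _ _ a).symm⟩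

/-- A string or a band. -/
structure StringOrBand (D : Clannish K Q₀ Q₁) where
  word : D.Word
  prop : word.IsString ∨ word.IsBand

/-- The canonically associated walk `C_w`. -/
abbrev StringOrBand.walk (w : D.StringOrBand) : D.Walk := w.word.canon

/-- The ring `R_w`, with its map from `K` and the bimodule structure of `M(C_w)`. -/
def StringOrBand.ringR (w : D.StringOrBand) (hN : D.NormallyBound) (π : TwistFamily w.walk) :
    ParamRing w.walk :=
  ofKind hN w.word π (Classical.choice (w.word.exists_kind w.prop))

/-- The `R`-module `M(C) ⊗_S V`, for `M(C)` an `R`-`S`-bimodule and `V` an `S`-module: the quotient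
of `M(C) ⊗_ℤ V` by the elements `m s ⊗ v - m ⊗ s v`. -/
def tensor {C : D.Walk} (S : ParamRing C) (V : Type*) [AddCommGroup V] [Module S.carrier V] :
    Type _ :=
  (M C ⊗[ℤ] V) ⧸ Submodule.span D.Alg
    {x : M C ⊗[ℤ] V | ∃ (m : M C) (s : S.carrier) (v : V),
      x = (S.act s).unop m ⊗ₜ[ℤ] v - m ⊗ₜ[ℤ] (s • v)}

instance {C : D.Walk} (S : ParamRing C) (V : Type*) [AddCommGroup V] [Module S.carrier V] :
    AddCommGroup (tensor S V) :=
  inferInstanceAs (AddCommGroup ((M C ⊗[ℤ] V) ⧸ Submodule.span D.Alg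
    {x : M C ⊗[ℤ] V | ∃ (m : M C) (s : S.carrier) (v : V),
      x = (S.act s).unop m ⊗ₜ[ℤ] v - m ⊗ₜ[ℤ] (s • v)}))

instance {C : D.Walk} (S : ParamRing C) (V : Type*) [AddCommGroup V] [Module S.carrier V] :
    Module D.Alg (tensor S V) :=
  inferInstanceAs (Module D.Alg ((M C ⊗[ℤ] V) ⧸ Submodule.span D.Alg
    {x : M C ⊗[ℤ] V | ∃ (m : M C) (s : S.carrier) (v : V),
      x = (S.act s).unop m ⊗ₜ[ℤ] v - m ⊗ₜ[ℤ] (s • v)}))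

end Param

/-! ### The functors `F_C` -/

section Functor

variable {D} [Fintype Q₀] {C : D.Walk}

/-- `T_C(N) = Hom_R(M(C), N)`. -/
def T (_π : TwistFamily C) (N : Type*) [AddCommGroup N] [Module D.Alg N] : Type _ :=
  M C →ₗ[D.Alg] N

variable (π : TwistFamily C) (N : Type*) [AddCommGroup N] [Module D.Alg N]

instance : AddCommGroup (T π N) := inferInstanceAs (AddCommGroup (M C →ₗ[D.Alg] N))

variable {π N} in
/-- An element of `T_C(N)` as a homomorphism. -/
def T.hom (θ : T π N) : M C →ₗ[D.Alg] N := θ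

variable {N} in
lemma comp_mul (θ : M C →ₗ[D.Alg] N) (l m : K) :
    θ.comp (kAct π (l * m)).unop = (θ.comp (kAct π m).unop).comp (kAct π l).unop :=
  M.hom_ext C fun i => by simp

variable {N} in
lemma comp_one (θ : M C →ₗ[D.Alg] N) : θ.comp (kAct π 1).unop = θ :=
  M.hom_ext C fun i => by simp

variable {N} in
lemma comp_zero (θ : M C →ₗ[D.Alg] N) : θ.comp (kAct π 0).unop = 0 :=
  M.hom_ext C fun i => by simp

variable {N} in
lemma comp_add (θ : M C →ₗ[D.Alg] N) (l m : K) :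
    θ.comp (kAct π (l + m)).unop = θ.comp (kAct π l).unop + θ.comp (kAct π m).unop :=
  M.hom_ext C fun i => by simp

/-- The `K`-module structure of `T_C(N)`: `(λ θ)(m) = θ(m λ)`. -/
instance : Module K (T π N) where
  smul l θ := θ.hom.comp (kAct π l).unop
  one_smul θ := comp_one π θ.hom
  mul_smul l m θ := comp_mul π θ.hom l m
  smul_zero _ := LinearMap.zero_comp _
  smul_add _ θ η := LinearMap.add_comp _ η.hom θ.hom
  add_smul l m θ := comp_add π θ.hom l m
  zero_smul θ := comp_zero π θ.hom

variable {π N} in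
/-- The value `θ(b_i)`. -/
def T.ev (θ : T π N) (i : ℤ) : N := θ.hom (b C i)

variable {π N} in
lemma T.ev_zero (i : ℤ) : (0 : T π N).ev i = 0 := rfl

variable {π N} in
lemma T.ev_add (θ η : T π N) (i : ℤ) : (θ + η).ev i = θ.ev i + η.ev i := rfl

variable {π N} in
lemma T.ev_smul (l : K) (θ : T π N) (i : ℤ) :
    (l • θ).ev i = D.inK (π.toFun i l) • θ.ev i := by
  change θ.hom ((kAct π l).unop (b C i)) = _
  rw [kAct_b, map_smul]; rfl

/-- The image `a N` of the action of an arrow. -/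
def imageArr (a : Q₁) : Submodule K (Restrict D.inK N) where
  carrier := Set.range fun y : N => D.arr a • y
  zero_mem' := ⟨0, smul_zero (A := N) (D.arr a)⟩
  add_mem' := by
    rintro _ _ ⟨y, rfl⟩ ⟨z, rfl⟩
    exact ⟨y + z, smul_add (A := N) (D.arr a) y z⟩
  smul_mem' := by
    rintro l _ ⟨y, rfl⟩
    refine ⟨D.inK ((D.σ a).symm l) • y, ?_⟩
    have h := arr_smul (D := D) a ((D.σ a).symm l) y
    rw [RingEquiv.apply_symm_apply] at h
    exact h

/-- The subspace `1_{v,δ}⁻(N)`: it is `a N` if there is an arrow `a` such that `1_{v,δ} a` is a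
walk, that is, with head `v` and sign `δ`, and zero otherwise. (By the choice of signs there is at
most one such arrow.) -/
def trivMinus (D : Clannish K Q₀ Q₁) (v : Q₀) (δ : ℤˣ) (N : Type*) [AddCommGroup N]
    [Module D.Alg N] : Submodule K (Restrict D.inK N) :=
  ⨆ a : {a : Q₁ // D.head a = v ∧ D.sgn (D.st a) = δ}, imageArr (D := D) N a

/-- `θ(b_i) ∈ 1_{v,δ}⁻(N)`, where `v` is the vertex `i` of `C`. -/
def endCond (i : ℤ) (δ : ℤˣ) : Submodule K (T π N) where
  carrier := {θ | ∀ v, C.word.vert i = some v → θ.ev i ∈ trivMinus D v δ N}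
  zero_mem' v _ := (trivMinus D v δ N).zero_mem
  add_mem' hθ hη v hv := by
    rw [T.ev_add]
    exact (trivMinus D v δ N).add_mem (hθ v hv) (hη v hv)
  smul_mem' l θ hθ v hv := by
    rw [T.ev_smul]
    exact (trivMinus D v δ N).smul_mem (π.toFun i l) (hθ v hv)

/-- `θ(b_i) = 0` for almost all `i` along a filter. -/
def vanish (f : Filter ℤ) : Submodule K (T π N) where
  carrier := {θ | ∀ᶠ i in f, θ.ev i = 0}
  zero_mem' := Filter.Eventually.of_forall fun _ => rfl
  add_mem' := by
    intro θ η hθ hη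
    filter_upwards [hθ, hη] with i h1 h2
    rw [T.ev_add, h1, h2, add_zero]
  smul_mem' := by
    intro l θ hθ
    filter_upwards [hθ] with i h1
    rw [T.ev_smul, h1, smul_zero]

/-- The subspace `B_C⁺(N)` of `T_C(N)`. -/
def Bplus : Submodule K (T π N) :=
  match C.word.idx with
  | .fin _ => endCond π N 0 (- C.word.sign)
  | .int => vanish π N Filter.atBot

/-- The subspace `B_C⁻(N)` of `T_C(N)`. -/
def Bminus : Submodule K (T π N) :=
  match C.word.idx with
  | .fin n => endCond π N n (- C.word.inv.sign)
  | .int => vanish π N Filter.atTop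

/-- `F_C(N) = T_C(N) / (B_C⁺(N) + B_C⁻(N))`. -/
abbrev F : Type _ := T π N ⧸ (Bplus π N ⊔ Bminus π N)

end Functor

end Clannish

end SLC

end

/-! The module is cut into pieces indexed by points. As a right `R_w`-module `M(C_w)` is free on
representatives of the vertices of `w` modulo its symmetries, so `M(C_w) ⊗ V_w` is a direct sum of
copies `b_j ⊗ V_w` of `V_w`, one for each representative `j` (`Folding`, `Folding.rep`,
`PointSystem.Rep.sum`). Two sequences of letters, the half-words, start at each point, one for each
sign. An ordinary arrow carries a piece bijectively to a neighbouring piece or kills it. A special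
loop mixes two neighbouring pieces and carries the one with the smaller outer half-word onto the one
with the larger. The loops in `C_u` point in the same sense, and this agreement is what makes the
arguments below work. The condition `γ_s ≠ 0` makes `s` invertible on such pairs, and normality lets
`β_s` and `γ_s` pass through the twists.

A homomorphism `θ` on `M(C_u)` is a family of values `θ(b_i)` related along the letters of `u`.
Order half-words lexicographically, direct letters before the end of a word before inverse letters.
By induction on the first difference, `θ(b_i)` has components only at points both of whose
half-words are at most those of `u` at `i` (`compatible_mem`). Conversely every element bounded in
this way can be continued along each letter (`exists_rel`), hence is a value of some `θ`
(`Word.exists_ev_eq`).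

The key statement is that `θ` lies in `B⁺ + B⁻` if and only if `θ(b_0)` has no component at points
whose half-words both equal those of `u` at `0` (`Word.mem_sup_iff`). The vanishing of matching
components propagates along letters (`matZero_rel`), so for `B⁺` and `B⁻` it can be tested at an end
of a string or far out on a band. For the converse, a component at a point with a strictly smaller
half-word is transported along `u` until the difference is in the very next letter. There it can be
continued by zero, or it lies in the image of an arrow at an end of `u`, so that it is a value of an
element of `B⁺ + B⁻` (`pr_mem_of_ltAt`, `Word.pr_mem_valSub`). Hence `θ(b_0)` is also the value of
an element of `B⁺ + B⁻`, and what remains vanishes at `b_0`: for a string it lies in `B⁺`, and for a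
band it can be cut there into two halves.

Consequently `F_C` is the sum of the pieces of the points matching `u` at `0`. Half-words at a
vertex determine a word up to equivalence, and vertices of `w` with the same half-words are
identified by the symmetries of `w`, so each `w ∼ u` contributes exactly one copy of `V_w` and no
other word contributes. Comparing the scalars at `b_0` and at the matching `b_j` gives the twist
`π_j⁻¹ π_0`.

That the pieces do not collapse rests on the `b_i` being independent over `K`. For this the algebra
is made to act on a space with basis the vertices (`PointSystem.algEnd`). A zero relation with
non-zero action would be spelled by the word (`prod_gen`), which relation-admissibility forbids. -/

noncomputable section
namespace SLC
namespace Clannish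

/-! ### The lexicographic order on half-infinite sequences of letters -/

section Sequences

variable {Q₁ : Type*}

/-- The order in which direct letters precede the end of a word, which precedes inverse letters. -/
def LetterLt (x y : Option (Letter Q₁)) : Prop :=
  ((∃ a, x = some (.dir a)) ∧ ∃ b, y = some (.inv b)) ∨ ((∃ a, x = some (.dir a)) ∧ y = none) ∨
    (x = none ∧ ∃ b, y = some (.inv b))

lemma LetterLt.trans {x y z : Option (Letter Q₁)} (h : LetterLt x y) (h' : LetterLt y z) :
    LetterLt x z := by
  rcases h with ⟨⟨a, rfl⟩, b, rfl⟩ | ⟨⟨a, rfl⟩, rfl⟩ | ⟨rfl, b, rfl⟩ <;>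
    simp_all [LetterLt]

lemma LetterLt.irrefl {x : Option (Letter Q₁)} (h : LetterLt x x) : False := by
  rcases h with ⟨⟨a, rfl⟩, b, h⟩ | ⟨⟨a, rfl⟩, h⟩ | ⟨rfl, b, h⟩ <;> simp at h

/-- `f < g`, where the sequences first differ at the place `k`. -/
def LtAt (k : ℕ) (f g : ℕ → Option (Letter Q₁)) : Prop :=
  (∀ j < k, f j = g j) ∧ LetterLt (f k) (g k)

/-- `f ≤ g`. -/
def SeqLe (f g : ℕ → Option (Letter Q₁)) : Prop := f = g ∨ ∃ k, LtAt k f g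

variable {f g h m : ℕ → Option (Letter Q₁)} {k l : ℕ}

lemma LtAt.le (h : LtAt k f g) : SeqLe f g := Or.inr ⟨k, h⟩

lemma LtAt.trans (h₁ : LtAt k f g) (h₂ : LtAt l g h) : LtAt (min k l) f h := by
  rcases lt_trichotomy k l with hkl | rfl | hkl
  · rw [min_eq_left hkl.le]
    exact ⟨fun j hj => (h₁.1 j hj).trans (h₂.1 j (hj.trans hkl)), h₂.1 k hkl ▸ h₁.2⟩
  · rw [min_self]
    exact ⟨fun j hj => (h₁.1 j hj).trans (h₂.1 j hj), h₁.2.trans h₂.2⟩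
  · rw [min_eq_right hkl.le]
    exact ⟨fun j hj => (h₁.1 j (hj.trans hkl)).trans (h₂.1 j hj), (h₁.1 l hkl).symm ▸ h₂.2⟩

lemma SeqLe.trans (h₁ : SeqLe f g) (h₂ : SeqLe g h) : SeqLe f h := by
  rcases h₁ with rfl | ⟨k, h₁⟩
  · exact h₂
  · rcases h₂ with rfl | ⟨l, h₂⟩
    · exact h₁.le
    · exact (h₁.trans h₂).le

/-- Enlarging the gap between two sequences can only move the first difference forward. The bound `l
≤ k`, here and in `LtAt.seqLe`, is what strong induction on the place of the first difference needs.
-/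
lemma SeqLe.ltAt (h₁ : SeqLe f g) (h₂ : LtAt k g h) : ∃ l ≤ k, LtAt l f h := by
  rcases h₁ with rfl | ⟨l, h₁⟩
  · exact ⟨k, le_rfl, h₂⟩
  · exact ⟨_, min_le_right _ _, h₁.trans h₂⟩

lemma LtAt.seqLe (h₁ : LtAt k f g) (h₂ : SeqLe g h) : ∃ l ≤ k, LtAt l f h := by
  rcases h₂ with rfl | ⟨l, h₂⟩
  · exact ⟨k, le_rfl, h₁⟩
  · exact ⟨_, min_le_left _ _, h₁.trans h₂⟩

/-- If `f` does not fall below `m` by the place `k`, then `f` and `m` agree up to and including `k`,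
so `m < h` there and `g ≤ m` gives `g < h`. This separates the two cases for oppositely directed
special loops in `pr_mem_of_ltAt`. -/
lemma LtAt.split (hf : SeqLe f m) (hg : SeqLe g m) (h₁ : LtAt k f h) :
    (∃ l ≤ k, LtAt l f m) ∨ ∃ l ≤ k, LtAt l g h := by
  rcases hf with rfl | ⟨l, hf⟩
  · exact Or.inr (hg.ltAt h₁)
  · rcases le_or_gt l k with hl | hl
    · exact Or.inl ⟨l, hl, hf⟩
    · refine Or.inr (hg.ltAt ⟨fun j hj => ?_, ?_⟩)
      · rw [← h₁.1 j hj, hf.1 j (hj.trans hl)]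
      · rw [← hf.1 k hl]; exact h₁.2

lemma LtAt.irrefl (h : LtAt k f f) : False := h.2.irrefl

lemma SeqLe.not_ltAt (h₁ : SeqLe f g) (h₂ : LtAt k g f) : False := by
  obtain ⟨l, -, h⟩ := h₁.ltAt h₂
  exact h.irrefl

lemma SeqLe.antisymm (h₁ : SeqLe f g) (h₂ : SeqLe g f) : f = g := by
  rcases h₂ with rfl | ⟨k, h₂⟩
  · rfl
  · exact (h₁.not_ltAt h₂).elim

/-- The tail of a sequence. -/
def tl (f : ℕ → Option (Letter Q₁)) : ℕ → Option (Letter Q₁) := fun k => f (k + 1)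

lemma ltAt_succ : LtAt (k + 1) f g ↔ f 0 = g 0 ∧ LtAt k (tl f) (tl g) := by
  constructor
  · rintro ⟨h₁, h₂⟩
    exact ⟨h₁ 0 (by omega), fun j hj => h₁ (j + 1) (by omega), h₂⟩
  · rintro ⟨h₀, h₁, h₂⟩
    refine ⟨fun j hj => ?_, h₂⟩
    cases j with
    | zero => exact h₀
    | succ j => exact h₁ j (by omega)

lemma eq_iff_tl : f = g ↔ f 0 = g 0 ∧ tl f = tl g := by
  constructor
  · rintro rfl; exact ⟨rfl, rfl⟩
  · rintro ⟨h₀, h₁⟩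
    funext k
    cases k with
    | zero => exact h₀
    | succ k => exact congrFun h₁ k

lemma seqLe_iff_tl (h₀ : f 0 = g 0) : SeqLe f g ↔ SeqLe (tl f) (tl g) := by
  unfold SeqLe
  rw [eq_iff_tl]
  simp only [h₀, true_and]
  refine or_congr Iff.rfl ⟨?_, ?_⟩
  · rintro ⟨k, hk⟩
    cases k with
    | zero => exact (LetterLt.irrefl (h₀ ▸ hk.2)).elim
    | succ k => exact ⟨k, (ltAt_succ.1 hk).2⟩
  · rintro ⟨k, hk⟩
    exact ⟨k + 1, ltAt_succ.2 ⟨h₀, hk⟩⟩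

lemma SeqLe.head (h : SeqLe f g) : f 0 = g 0 ∨ LetterLt (f 0) (g 0) := by
  rcases h with rfl | ⟨k, h⟩
  · exact Or.inl rfl
  · cases k with
    | zero => exact Or.inr h.2
    | succ k => exact Or.inl (h.1 0 (by omega))

end Sequences

/-! ### Systems of points -/

section Points

variable {K Q₀ Q₁ : Type*} [DivisionRing K]

/-- A set of points at vertices, where from each point at most one letter of each sign leads to
another point, and where special loops always lead somewhere. -/
structure PointSystem (D : Clannish K Q₀ Q₁) (P : Type*) where
  vtx : P → Option Q₀
  lt : P → ℤˣ → Option (Letter Q₁)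
  nx : P → ℤˣ → P
  allowed : ∀ {p δ x}, lt p δ = some x → x.Allowed D.Sp
  head : ∀ {p δ x}, lt p δ = some x → vtx p = some (D.hd x)
  sign : ∀ {p δ x}, lt p δ = some x → D.sgn x = δ
  back : ∀ {p δ x}, lt p δ = some x → lt (nx p δ) (D.sgn x.bar) = some x.bar
  back_nx : ∀ {p δ x}, lt p δ = some x → nx (nx p δ) (D.sgn x.bar) = p
  star : ∀ {p s}, s ∈ D.Sp → vtx p = some (D.head s) →
    lt p (D.sgn (.star s)) = some (.star s)

namespace PointSystem

variable {D : Clannish K Q₀ Q₁} {P P' : Type*} (S : PointSystem D P) (S' : PointSystem D P')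

/-- The sequence of letters starting at a point with a given sign. -/
def half : P → ℤˣ → ℕ → Option (Letter Q₁)
  | p, δ, 0 => S.lt p δ
  | p, δ, k + 1 => match S.lt p δ with
    | none => none
    | some x => half (S.nx p δ) (- D.sgn x.bar) k

lemma half_zero (p : P) (δ : ℤˣ) : S.half p δ 0 = S.lt p δ := rfl

lemma tl_half {p : P} {δ : ℤˣ} {x : Letter Q₁} (h : S.lt p δ = some x) :
    tl (S.half p δ) = S.half (S.nx p δ) (- D.sgn x.bar) := by
  funext k
  change (match S.lt p δ with
    | none => none
    | some x => S.half (S.nx p δ) (- D.sgn x.bar) k) = _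
  rw [h]

lemma half_none {p : P} {δ : ℤˣ} (h : S.lt p δ = none) : S.half p δ = fun _ => none := by
  funext k
  cases k with
  | zero => exact h
  | succ k =>
    change (match S.lt p δ with
      | none => none
      | some x => S.half (S.nx p δ) (- D.sgn x.bar) k) = _
    rw [h]

variable {S S'}

lemma vtx_nx {p : P} {δ : ℤˣ} {x : Letter Q₁} (h : S.lt p δ = some x) :
    S.vtx (S.nx p δ) = some (D.hd x.bar) := S.head (S.back h)

/-- Turning round at the neighbour, one crosses the letter back to `p` and goes on with the other
sign at `p`. -/
lemma tl_half_back {p : P} {δ : ℤˣ} {x : Letter Q₁} (h : S.lt p δ = some x) :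
    tl (S.half (S.nx p δ) (D.sgn x.bar)) = S.half p (-δ) := by
  rw [S.tl_half (S.back h), S.back_nx h, Letter.bar_bar, S.sign h]

lemma half_back_zero {p : P} {δ : ℤˣ} {x : Letter Q₁} (h : S.lt p δ = some x) :
    S.half (S.nx p δ) (D.sgn x.bar) 0 = some x.bar := S.back h

lemma lt_star_eq {p : P} {δ : ℤˣ} {s : Q₁} (h : S.lt p δ = some (.star s)) :
    D.sgn (.star s) = δ ∧ s ∈ D.Sp ∧ S.vtx p = some (D.head s) :=
  ⟨S.sign h, S.allowed h, S.head h⟩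

/-- `nx` is an involution along special loops. -/
lemma star_back {p : P} {δ : ℤˣ} {s : Q₁}
    (h : S.lt p δ = some (.star s)) :
    S.lt (S.nx p δ) δ = some (.star s) ∧ S.nx (S.nx p δ) δ = p := by
  have h1 := S.back h
  have h2 := S.back_nx h
  change S.lt (S.nx p δ) (D.sgn (.star s)) = some (.star s) at h1
  change S.nx (S.nx p δ) (D.sgn (.star s)) = p at h2
  rw [S.sign h] at h1 h2
  exact ⟨h1, h2⟩

lemma tl_half_star {p : P} {δ : ℤˣ} {s : Q₁}
    (h : S.lt p δ = some (.star s)) : tl (S.half p δ) = S.half (S.nx p δ) (-δ) := by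
  rw [S.tl_half h]
  change S.half _ (- D.sgn (.star s)) = _
  rw [S.sign h]

/-- Letters with the same head and sign are comparable. -/
lemma letter_cmp {p : P} {q : P'} {δ : ℤˣ} (hv : S.vtx p = S'.vtx q) :
    S.lt p δ = S'.lt q δ ∨ LetterLt (S.lt p δ) (S'.lt q δ) ∨
      LetterLt (S'.lt q δ) (S.lt p δ) := by
  rcases hx : S.lt p δ with _ | x <;> rcases hy : S'.lt q δ with _ | y
  · exact Or.inl rfl
  · cases y with
    | dir a => exact Or.inr (Or.inr (Or.inr (Or.inl ⟨⟨a, rfl⟩, rfl⟩)))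
    | inv a => exact Or.inr (Or.inl (Or.inr (Or.inr ⟨rfl, a, rfl⟩)))
    | star s =>
      -- A `*`-letter never competes with the end of a word: by `star` it is present at every point
      -- over its vertex.
      obtain ⟨h1, h2, h3⟩ := lt_star_eq hy
      have := S.star h2 (hv.trans h3)
      rw [h1, hx] at this
      cases this
  · cases x with
    | dir a => exact Or.inr (Or.inl (Or.inr (Or.inl ⟨⟨a, rfl⟩, rfl⟩)))
    | inv a => exact Or.inr (Or.inr (Or.inr (Or.inr ⟨rfl, a, rfl⟩)))
    | star s =>
      obtain ⟨h1, h2, h3⟩ := lt_star_eq hx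
      have := S'.star h2 (hv.symm.trans h3)
      rw [h1, hy] at this
      cases this
  · by_cases hxy : x = y
    · exact Or.inl (by rw [hxy])
    · have e : D.hd x = D.hd y := by
        have := (S.head hx).symm.trans (hv.trans (S'.head hy))
        exact Option.some.inj this
      obtain ⟨a, b, -, ⟨rfl, rfl⟩ | ⟨rfl, rfl⟩⟩ := D.sgn_spec x y (S.allowed hx) (S'.allowed hy)
        hxy e ((S.sign hx).trans (S'.sign hy).symm)
      · exact Or.inr (Or.inr (Or.inl ⟨⟨b, rfl⟩, a, rfl⟩))
      · exact Or.inr (Or.inl (Or.inl ⟨⟨b, rfl⟩, a, rfl⟩))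

/-- As long as the half-words agree, the points reached lie over the same vertex with the same sign,
so their next letters are comparable by `letter_cmp`. -/
lemma half_cmp_aux (k : ℕ) : ∀ {p : P} {q : P'} {δ : ℤˣ}, S.vtx p = S'.vtx q →
    (∀ j < k, S.half p δ j = S'.half q δ j) → S.half p δ k = S'.half q δ k ∨
      LtAt k (S.half p δ) (S'.half q δ) ∨ LtAt k (S'.half q δ) (S.half p δ) := by
  induction k with
  | zero =>
    intro p q δ hv _
    rcases letter_cmp (δ := δ) hv with h | h | h
    · exact Or.inl h
    · exact Or.inr (Or.inl ⟨fun j hj => absurd hj (by omega), h⟩)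
    · exact Or.inr (Or.inr ⟨fun j hj => absurd hj (by omega), h⟩)
  | succ k ih =>
    intro p q δ hv hj
    have h0 : S.lt p δ = S'.lt q δ := hj 0 (by omega)
    rcases hx : S.lt p δ with _ | x
    · left
      rw [S.half_none hx, S'.half_none (h0 ▸ hx)]
    · have hy : S'.lt q δ = some x := h0 ▸ hx
      have e1 := S.tl_half hx
      have e2 := S'.tl_half hy
      have := ih (p := S.nx p δ) (q := S'.nx q δ) (δ := - D.sgn x.bar)
        ((vtx_nx hx).trans (vtx_nx hy).symm) fun j hj' => by
          rw [← e1, ← e2]; exact hj (j + 1) (by omega)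
      rw [← e1, ← e2] at this
      rcases this with h | h | h
      · exact Or.inl h
      · exact Or.inr (Or.inl (ltAt_succ.2 ⟨h0, h⟩))
      · exact Or.inr (Or.inr (ltAt_succ.2 ⟨h0.symm, h⟩))

/-- Half-words with the same head and sign are comparable. -/
lemma half_cmp {p : P} {q : P'} (δ : ℤˣ) (hv : S.vtx p = S'.vtx q) :
    SeqLe (S.half p δ) (S'.half q δ) ∨ ∃ k, LtAt k (S'.half q δ) (S.half p δ) := by
  classical
  by_cases hne : S.half p δ = S'.half q δ
  · exact Or.inl (Or.inl hne)
  have hex : ∃ k, S.half p δ k ≠ S'.half q δ k := by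
    by_contra h; push Not at h; exact hne (funext h)
  have hmin : ∀ j < Nat.find hex, S.half p δ j = S'.half q δ j :=
    fun j hj => not_not.1 (Nat.find_min hex hj)
  rcases half_cmp_aux (Nat.find hex) hv hmin with h | h | h
  · exact absurd h (Nat.find_spec hex)
  · exact Or.inl h.le
  · exact Or.inr ⟨_, h⟩

/-- Sequences of letters are preserved under maps of systems of points. -/
lemma half_map (g : P → P') (hl : ∀ p δ, S.vtx p ≠ none → S'.lt (g p) δ = S.lt p δ)
    (hn : ∀ p δ x, S.lt p δ = some x → S'.nx (g p) δ = g (S.nx p δ)) {p : P}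
    (hp : S.vtx p ≠ none) (δ : ℤˣ) : S'.half (g p) δ = S.half p δ := by
  funext k
  induction k generalizing p δ with
  | zero => exact hl p δ hp
  | succ k ih =>
    rcases hx : S.lt p δ with _ | x
    · rw [S.half_none hx, S'.half_none (by rw [hl p δ hp, hx])]
    · have h1 := congrFun (S.tl_half hx) k
      have h2 := congrFun (S'.tl_half ((hl p δ hp).trans hx)) k
      rw [hn p δ x hx, ih (by rw [vtx_nx hx]; simp)] at h2
      exact h2.trans h1.symm

end PointSystem

end Points

end Clannish
end SLC
end

noncomputable section
namespace SLC
namespace Clannish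

/-! ### Relations in the algebra and the action of invertible scalars. -/

section AlgebraRelations

variable {K Q₀ Q₁ : Type*} [DivisionRing K] [Fintype Q₀] (D : Clannish K Q₀ Q₁)

lemma e_mul_ne {v w : Q₀} (hv : v ≠ w) : D.e v * D.e w = 0 := by
  have h := RingQuot.mkRingHom_rel (PathRel.orth (D := D) v w hv)
  rw [map_mul, map_zero] at h
  have h2 := congrArg D.quo h
  rwa [map_mul, map_zero] at h2

lemma arr_mul_e (a : Q₁) : D.arr a * D.e (D.tail a) = D.arr a := by
  have h := RingQuot.mkRingHom_rel (PathRel.tail (D := D) a)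
  rw [map_mul] at h
  have h2 := congrArg D.quo h
  rwa [map_mul] at h2

variable {D} {N : Type*} [AddCommGroup N] [Module D.Alg N]

lemma arr_arr_smul {s : Q₁} (hs : s ∈ D.Sp) {x : N} (hx : D.e (D.head s) • x = x) :
    D.arr s • D.arr s • x = D.inK (D.β s) • D.arr s • x - D.inK (D.γ s) • x := by
  rw [← mul_smul, D.arr_sq s hs, sub_smul, mul_smul, mul_smul, hx]

lemma inK_smul_inv {l : K} (hl : l ≠ 0) (x : N) : D.inK l⁻¹ • D.inK l • x = x := by
  rw [← mul_smul, ← map_mul, inv_mul_cancel₀ hl, map_one, one_smul]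

lemma inK_smul_eq_zero {l : K} (hl : l ≠ 0) {x : N} (h : D.inK l • x = 0) : x = 0 := by
  rw [← inK_smul_inv (D := D) hl x, h, smul_zero]

end AlgebraRelations

/-! ### Modules decomposed along a system of points -/

section Decomposition

variable {K Q₀ Q₁ : Type*} [DivisionRing K] [Fintype Q₀] {D : Clannish K Q₀ Q₁} {P I : Type*}

/-- A decomposition of an `R`-module indexed by a system of points, such that ordinary arrows
identify the summands of neighbouring points or act as zero, and special loops identify the
summands of the points which they join in a direction compatible with the order on half-words. -/
structure PointSystem.Rep (S : PointSystem D P) (N : Type*) [AddCommGroup N]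
    [Module D.Alg N] where
  pr : P → N →+ N
  pr_pr : ∀ p x, pr p (pr p x) = pr p x
  pr_ne : ∀ {p q}, p ≠ q → ∀ x, pr q (pr p x) = 0
  span : ∀ G : AddSubgroup N, (∀ p x, pr p x ∈ G) → ∀ x, x ∈ G
  none : ∀ {p}, S.vtx p = none → ∀ x, pr p x = 0
  smul : ∀ p l x, pr p (D.inK l • x) = D.inK l • pr p x
  vtx : ∀ {p v}, S.vtx p = some v → ∀ x, D.e v • pr p x = pr p x
  ord : ∀ {p a}, S.lt p (D.sgn (.inv a)) = some (.inv a) → ∀ x,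
    pr (S.nx p (D.sgn (.inv a))) (D.arr a • pr p x) = D.arr a • pr p x
  ord_surj : ∀ {p a}, S.lt p (D.sgn (.inv a)) = some (.inv a) → ∀ y,
    ∃ x, D.arr a • pr p x = pr (S.nx p (D.sgn (.inv a))) y
  ord_inj : ∀ {p a}, S.lt p (D.sgn (.inv a)) = some (.inv a) → ∀ x,
    D.arr a • pr p x = 0 → pr p x = 0
  ord_zero : ∀ {p a}, a ∉ D.Sp → S.lt p (D.sgn (.inv a)) ≠ some (.inv a) → ∀ x,
    D.arr a • pr p x = 0
  spec : ∀ {p δ s}, S.lt p δ = some (.star s) →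
    (SeqLe (S.half p (-δ)) (S.half (S.nx p δ) (-δ)) ∧
      (∀ x, pr (S.nx p δ) (D.arr s • pr p x) = D.arr s • pr p x) ∧
      ∀ y, ∃ x, D.arr s • pr p x = pr (S.nx p δ) y) ∨
    (SeqLe (S.half (S.nx p δ) (-δ)) (S.half p (-δ)) ∧
      (∀ x, pr p (D.arr s • pr (S.nx p δ) x) = D.arr s • pr (S.nx p δ) x) ∧
      ∀ y, ∃ x, D.arr s • pr (S.nx p δ) x = pr p y)

namespace PointSystem

namespace Rep

variable {S : PointSystem D P} {N : Type*} [AddCommGroup N] [Module D.Alg N] (R : S.Rep N)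

/-- The special loop `s` maps the summand of `p` onto that of the neighbour of `p`. -/
structure To (p : P) (δ : ℤˣ) (s : Q₁) : Prop where
  le : SeqLe (S.half p (-δ)) (S.half (S.nx p δ) (-δ))
  mem : ∀ x, R.pr (S.nx p δ) (D.arr s • R.pr p x) = D.arr s • R.pr p x
  surj : ∀ y, ∃ x, D.arr s • R.pr p x = R.pr (S.nx p δ) y

lemma to_or {p : P} {δ : ℤˣ} {s : Q₁} (h : S.lt p δ = some (.star s)) :
    R.To p δ s ∨ R.To (S.nx p δ) δ s := by
  rcases R.spec h with ⟨h1, h2, h3⟩ | ⟨h1, h2, h3⟩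
  · exact Or.inl ⟨h1, h2, h3⟩
  · refine Or.inr ⟨?_, ?_, ?_⟩ <;> rwa [(star_back h).2]

lemma addHom_ext {N' : Type*} [AddCommGroup N'] {f g : N →+ N'}
    (h : ∀ p x, f (R.pr p x) = g (R.pr p x)) (x : N) : f x = g x :=
  R.span (f.eqLocus g) h x

/-- The elements with finite support which are the sum of their components form a subgroup
containing every summand, so `span` applies. -/
lemma exists_finset (x : N) : ∃ s : Finset P, (∀ q ∉ s, R.pr q x = 0) ∧
    x = ∑ q ∈ s, R.pr q x := by
  classical
  let G : AddSubgroup N :=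
    { carrier := {x | ∃ s : Finset P, (∀ q ∉ s, R.pr q x = 0) ∧ x = ∑ q ∈ s, R.pr q x}
      zero_mem' := ⟨∅, by simp, by simp⟩
      add_mem' := by
        rintro x y ⟨s, hs, hx⟩ ⟨t, ht, hy⟩
        refine ⟨s ∪ t, fun q hq => ?_, ?_⟩
        · rw [Finset.mem_union, not_or] at hq
          rw [map_add, hs q hq.1, ht q hq.2, add_zero]
        · simp only [map_add, Finset.sum_add_distrib]
          congr 1
          · rw [hx]
            conv_rhs => rw [← hx]
            exact Finset.sum_subset Finset.subset_union_left fun q _ hq => hs q hq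
          · rw [hy]
            conv_rhs => rw [← hy]
            exact Finset.sum_subset Finset.subset_union_right fun q _ hq => ht q hq
      neg_mem' := by
        rintro x ⟨s, hs, hx⟩
        refine ⟨s, fun q hq => by rw [map_neg, hs q hq, neg_zero], ?_⟩
        simp only [map_neg, Finset.sum_neg_distrib]
        rw [← hx] }
  refine R.span G (fun p x => ⟨{p}, fun q hq => R.pr_ne ?_ x, ?_⟩) x
  · rintro rfl; simp at hq
  · rw [Finset.sum_singleton, R.pr_pr]

lemma mem_of_pr {G : AddSubgroup N} {x : N} (h : ∀ q, R.pr q x ∈ G) : x ∈ G := by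
  obtain ⟨s, -, hx⟩ := R.exists_finset x
  rw [hx]
  exact sum_mem fun q _ => h q

lemma e_pr {p : P} {v : Q₀} (h : S.vtx p ≠ some v) (x : N) : D.e v • R.pr p x = 0 := by
  rcases hp : S.vtx p with _ | w
  · rw [R.none hp, smul_zero]
  · rw [← R.vtx hp, ← mul_smul, D.e_mul_ne (by rintro rfl; exact h hp), zero_smul]

lemma pr_e {p : P} {v : Q₀} (h : S.vtx p ≠ some v) (x : N) : R.pr p (D.e v • x) = 0 := by
  refine R.addHom_ext (f := (R.pr p).comp (DistribSMul.toAddMonoidHom N (D.e v)))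
    (g := 0) (fun q y => ?_) x
  change R.pr p (D.e v • R.pr q y) = 0
  by_cases hq : S.vtx q = some v
  · rw [R.vtx hq]
    exact R.pr_ne (by rintro rfl; exact h hq) y
  · rw [R.e_pr hq, map_zero]

/-- Distinct points with the letter `a⁻¹` have distinct neighbours along it, and `a` kills the
summands of all other points, so only the summand of `p` contributes at its neighbour. -/
lemma pr_ord {p : P} {a : Q₁} (h : S.lt p (D.sgn (.inv a)) = some (.inv a)) (x : N) :
    R.pr (S.nx p (D.sgn (.inv a))) (D.arr a • x) = D.arr a • R.pr p x := by
  refine R.addHom_ext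
    (f := (R.pr _).comp (DistribSMul.toAddMonoidHom N (D.arr a)))
    (g := (DistribSMul.toAddMonoidHom N (D.arr a)).comp (R.pr p)) (fun q y => ?_) x
  change R.pr _ (D.arr a • R.pr q y) = D.arr a • R.pr p (R.pr q y)
  by_cases hq : q = p
  · subst hq; rw [R.ord h, R.pr_pr]
  · rw [R.pr_ne hq, smul_zero]
    by_cases hl : S.lt q (D.sgn (.inv a)) = some (.inv a)
    · rw [← R.ord hl]
      refine R.pr_ne (fun e => hq ?_) _
      rw [← S.back_nx hl, ← S.back_nx h, e]
    · rw [R.ord_zero (S.allowed h) hl, map_zero]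

lemma pr_ord_zero {q : P} {a : Q₁} (ha : a ∉ D.Sp)
    (h : S.lt q (D.sgn (.dir a)) ≠ some (.dir a)) (x : N) : R.pr q (D.arr a • x) = 0 := by
  refine R.addHom_ext (f := (R.pr q).comp (DistribSMul.toAddMonoidHom N (D.arr a)))
    (g := 0) (fun p y => ?_) x
  change R.pr q (D.arr a • R.pr p y) = 0
  by_cases hl : S.lt p (D.sgn (.inv a)) = some (.inv a)
  · rw [← R.ord hl]
    refine R.pr_ne ?_ _
    rintro rfl
    exact h (S.back hl)
  · rw [R.ord_zero ha hl, map_zero]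

lemma ord_eq_zero {a : Q₁} {x : N} {p : P} (h : S.lt p (D.sgn (.inv a)) = some (.inv a))
    (hx : D.arr a • x = 0) : R.pr p x = 0 :=
  R.ord_inj h x (by rw [← R.pr_ord h, hx, map_zero])

/-- The action of a special loop on the summand at the target of its arrow. -/
lemma To.quad {p : P} {δ : ℤˣ} {s : Q₁} (h : S.lt p δ = some (.star s)) (x : N) :
    D.arr s • D.arr s • R.pr p x =
      D.inK (D.β s) • D.arr s • R.pr p x - D.inK (D.γ s) • R.pr p x :=
  arr_arr_smul (S.allowed h) (R.vtx (S.head h) x)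

lemma arr_pr {p : P} {a : Q₁} (h : S.vtx p ≠ some (D.tail a)) (x : N) :
    D.arr a • R.pr p x = 0 := by
  rw [← arr_mul_e, mul_smul, R.e_pr h, smul_zero]

lemma pr_e_self {p : P} {v : Q₀} (h : S.vtx p = some v) (x : N) :
    R.pr p (D.e v • x) = R.pr p x := by
  refine R.addHom_ext (f := (R.pr p).comp (DistribSMul.toAddMonoidHom N (D.e v)))
    (g := R.pr p) (fun q y => ?_) x
  change R.pr p (D.e v • R.pr q y) = _
  by_cases hq : S.vtx q = some v
  · rw [R.vtx hq]
  · rw [R.e_pr hq, map_zero, R.pr_ne]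
    rintro rfl; exact hq h

/-- A special loop preserves the sum of the summands of a point and its neighbour: it carries one of
them onto the other, and the quadratic relation expresses its action on the latter through both.
Other summands therefore contribute nothing at `p`. -/
lemma pr_star_far {p r : P} {δ : ℤˣ} {s : Q₁} (h : S.lt p δ = some (.star s)) (h1 : r ≠ p)
    (h2 : r ≠ S.nx p δ) (x : N) : R.pr p (D.arr s • R.pr r x) = 0 := by
  by_cases hr : S.vtx r = some (D.head s)
  · have hs := S.star (S.allowed h) hr
    rw [S.sign h] at hs
    have hb := star_back hs
    have hne : S.nx r δ ≠ p := by
      intro e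
      rw [e] at hb
      exact h2 hb.2.symm
    rcases R.to_or hs with hT | hT
    · rw [← hT.mem]
      exact R.pr_ne hne _
    · obtain ⟨z, hz⟩ := hT.surj x
      rw [hb.2] at hz
      rw [← hz, To.quad R hb.1, map_sub, R.smul, R.smul, hz, R.pr_ne h1, R.pr_ne hne, smul_zero,
        smul_zero, sub_zero]
  · rw [R.arr_pr, map_zero]
    rwa [← D.loop s (S.allowed h)]

open Classical in
-- A point on which a symmetry is centred is its own neighbour after folding. The case distinction
-- avoids counting its summand twice.
lemma pr_star {p : P} {δ : ℤˣ} {s : Q₁} (h : S.lt p δ = some (.star s)) (x : N) :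
    R.pr p (D.arr s • x) = R.pr p (D.arr s • R.pr p x) +
      if S.nx p δ = p then 0 else R.pr p (D.arr s • R.pr (S.nx p δ) x) := by
  let t : N →+ N := (R.pr p).comp (DistribSMul.toAddMonoidHom N (D.arr s))
  refine R.addHom_ext (f := t)
    (g := t.comp (R.pr p) + if S.nx p δ = p then 0 else t.comp (R.pr (S.nx p δ)))
    (fun r y => ?_) x |>.trans ?_
  · by_cases h1 : r = p
    · subst h1
      by_cases h2 : S.nx r δ = r
      · simp [t, h2, R.pr_pr]
      · simp [t, h2, R.pr_pr, R.pr_ne (Ne.symm h2)]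
    · by_cases h2 : r = S.nx p δ
      · subst h2
        simp [t, h1, R.pr_pr, R.pr_ne h1]
      · have := R.pr_star_far h h1 h2 y
        by_cases h3 : S.nx p δ = p <;>
          simp [t, h3, this, R.pr_ne h1, R.pr_ne h2]
  · by_cases h3 : S.nx p δ = p <;> simp [t, h3]

lemma pr_star_zero {p : P} {δ : ℤˣ} {s : Q₁} (h : S.lt p δ = some (.star s)) {x : N}
    (h1 : R.pr p x = 0) (h2 : R.pr (S.nx p δ) x = 0) : R.pr p (D.arr s • x) = 0 := by
  rw [R.pr_star h, h1, h2]
  simp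

variable {R} in
-- When the loop leads from `p` to a different point, the component at `p` itself is moved away, so
-- only the neighbour can contribute at `p`.
lemma To.pr_source_zero {p : P} {δ : ℤˣ} {s : Q₁} (hT : R.To p δ s)
    (h : S.lt p δ = some (.star s)) (hne : S.nx p δ ≠ p) {x : N}
    (hx : R.pr (S.nx p δ) x = 0) : R.pr p (D.arr s • x) = 0 := by
  rw [R.pr_star h, if_neg hne, hx, smul_zero, map_zero, add_zero, ← hT.mem]
  exact R.pr_ne hne _

variable {R} in
-- If `s y = 0` on such a summand, the quadratic relation leaves `γ_s y = 0`, and `γ_s` is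
-- invertible.
lemma To.inj (hS : D.NonSingular) {p : P} {δ : ℤˣ} {s : Q₁}
    (h : S.lt p δ = some (.star s)) {x : N} (hx : D.arr s • R.pr p x = 0) : R.pr p x = 0 := by
  have := To.quad R h x
  rw [hx, smul_zero, smul_zero, zero_sub, eq_comm, neg_eq_zero] at this
  exact inK_smul_eq_zero (hS s (S.allowed h)) this

/-- A component of `s x` at `p` comes from one of `x` at the neighbour of `p` or, if `s` maps the
summand there to that of `p`, at `p` itself. -/
lemma pr_star_ne {p : P} {δ : ℤˣ} {s : Q₁} (h : S.lt p δ = some (.star s)) {x : N}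
    (hx : R.pr p (D.arr s • x) ≠ 0) :
    R.pr (S.nx p δ) x ≠ 0 ∨ (R.To (S.nx p δ) δ s ∧ R.pr p x ≠ 0) := by
  by_contra hc
  rw [not_or, not_not, not_and, not_not] at hc
  obtain ⟨h1, h2⟩ := hc
  apply hx
  rcases R.to_or h with hT | hT
  · by_cases hne : S.nx p δ = p
    · rw [hne] at h1
      exact R.pr_star_zero h h1 (by rwa [hne])
    · exact hT.pr_source_zero h hne h1
  · exact R.pr_star_zero h (h2 hT) h1

/-- If the loop leads from `p` to its neighbour, it is injective on the summand of `p`. If it leads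
back to `p`, write the component at `p` as `s z` with `z` at the neighbour; the component of `s s z`
there is `-γ_s z`, so `z = 0`. -/
lemma pr_eq_zero_of_nx (hS : D.NonSingular) {p : P} {δ : ℤˣ} {s : Q₁}
    (h : S.lt p δ = some (.star s)) {x : N} (h1 : R.pr (S.nx p δ) x = 0)
    (h2 : R.pr (S.nx p δ) (D.arr s • x) = 0) : R.pr p x = 0 := by
  by_cases hne : S.nx p δ = p
  · rwa [hne] at h1
  have hb := star_back h
  rw [R.pr_star hb.1, h1, smul_zero, map_zero, zero_add, hb.2, if_neg (Ne.symm hne)] at h2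
  rcases R.to_or h with hT | hT
  · rw [hT.mem] at h2
    exact To.inj hS h h2
  · obtain ⟨z, hz⟩ := hT.surj x
    have hm := hT.mem z
    rw [hb.2] at hz hm
    rw [← hz, To.quad R hb.1, map_sub, R.smul, R.smul, ← hm, R.pr_pr, R.pr_ne (Ne.symm hne),
      smul_zero, zero_sub, neg_eq_zero] at h2
    rw [← hz, inK_smul_eq_zero (hS s (S.allowed h)) h2, smul_zero]

/-- Apply `s` once more: the relation `s s x = β_s s x - γ_s x` at `p` leaves only `γ_s` times the
component of `x`. -/
lemma pr_eq_zero_of_star (hS : D.NonSingular) {p : P} {δ : ℤˣ} {s : Q₁}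
    (h : S.lt p δ = some (.star s)) {x : N} (h1 : R.pr p (D.arr s • x) = 0)
    (h2 : R.pr (S.nx p δ) (D.arr s • x) = 0) : R.pr p x = 0 := by
  have h3 := R.pr_star_zero h h1 h2
  rw [← mul_smul, D.arr_sq s (S.allowed h), sub_smul, mul_smul, mul_smul, map_sub, R.smul,
    R.smul, h1, smul_zero, zero_sub, neg_eq_zero, R.pr_e_self (lt_star_eq h).2.2] at h3
  exact inK_smul_eq_zero (hS s (S.allowed h)) h3

end Rep
end PointSystem
end Decomposition
end Clannish
end SLC
end

noncomputable section
namespace SLC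
namespace Clannish

/-! ### Families of elements indexed by a system of points -/

section Families

variable {K Q₀ Q₁ : Type*} [DivisionRing K] {D : Clannish K Q₀ Q₁} {P I : Type*}

namespace PointSystem

/-- A choice of directions of the special letters of a system of points, compatible with the order
on half-words. -/
structure Orientation (A : PointSystem D I) where
  fwd : I → ℤˣ → Prop
  le : ∀ {i δ s}, A.lt i δ = some (.star s) → fwd i δ →
    SeqLe (A.half i (-δ)) (A.half (A.nx i δ) (-δ))
  ge : ∀ {i δ s}, A.lt i δ = some (.star s) → ¬ fwd i δ →
    SeqLe (A.half (A.nx i δ) (-δ)) (A.half i (-δ))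
  symm : ∀ {i δ s}, A.lt i δ = some (.star s) → (fwd (A.nx i δ) δ ↔ ¬ fwd i δ)

variable (A : PointSystem D I) (S : PointSystem D P)

/-- Both half-words at `q` are bounded by those at `i`. -/
def Low (i : I) (q : P) : Prop :=
  S.vtx q = A.vtx i ∧ ∀ δ, SeqLe (S.half q δ) (A.half i δ)

/-- The half-words at `q` and at `i` agree. -/
def Mat (i : I) (q : P) : Prop :=
  S.vtx q = A.vtx i ∧ ∀ δ, S.half q δ = A.half i δ

variable {A S}

lemma forall_sign {p : ℤˣ → Prop} (δ : ℤˣ) : (∀ ε, p ε) ↔ p δ ∧ p (-δ) := by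
  refine ⟨fun h => ⟨h _, h _⟩, fun ⟨h1, h2⟩ ε => ?_⟩
  rcases Int.units_eq_one_or δ with rfl | rfl <;> rcases Int.units_eq_one_or ε with rfl | rfl <;>
    simp_all

/-- Both sides compare the same two pairs of half-words: those beyond the common letter on one side
and those beyond it on the other. Prefixing both members of a pair by the same letter does not
affect the order. -/
lemma low_nx {i : I} {q : P} {δ : ℤˣ} {x : Letter Q₁} (hi : A.lt i δ = some x)
    (hq : S.lt q δ = some x) : A.Low S (A.nx i δ) (S.nx q δ) ↔ A.Low S i q := by
  unfold Low
  rw [forall_sign (D.sgn x.bar), forall_sign δ, vtx_nx hi, vtx_nx hq, A.head hi, S.head hq,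
    seqLe_iff_tl ((half_back_zero hq).trans (half_back_zero hi).symm), tl_half_back hi,
    tl_half_back hq, ← S.tl_half hq, ← A.tl_half hi,
    seqLe_iff_tl (show S.half q δ 0 = A.half i δ 0 from hq.trans hi.symm)]
  tauto

lemma mat_nx {i : I} {q : P} {δ : ℤˣ} {x : Letter Q₁} (hi : A.lt i δ = some x)
    (hq : S.lt q δ = some x) : A.Mat S (A.nx i δ) (S.nx q δ) ↔ A.Mat S i q := by
  have e1 : ∀ {f g : ℕ → Option (Letter Q₁)}, f 0 = g 0 → (f = g ↔ tl f = tl g) :=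
    fun h => by rw [eq_iff_tl]; simp [h]
  unfold Mat
  rw [forall_sign (D.sgn x.bar), forall_sign δ, vtx_nx hi, vtx_nx hq, A.head hi, S.head hq,
    e1 ((half_back_zero hq).trans (half_back_zero hi).symm), tl_half_back hi,
    tl_half_back hq, ← S.tl_half hq, ← A.tl_half hi,
    e1 (show S.half q δ 0 = A.half i δ 0 from hq.trans hi.symm)]
  tauto

/-- At a special letter it is convenient to compare the outer half-words at the two ends of the
loop. They all have sign `-δ`, so that exchanging `i` with its neighbour, or `q` with its neighbour,
merely permutes the comparisons. -/
lemma low_star_iff {i : I} {q : P} {δ : ℤˣ} {s : Q₁} (hi : A.lt i δ = some (.star s))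
    (hq : S.lt q δ = some (.star s)) : A.Low S i q ↔
      SeqLe (S.half q (-δ)) (A.half i (-δ)) ∧
        SeqLe (S.half (S.nx q δ) (-δ)) (A.half (A.nx i δ) (-δ)) := by
  unfold Low
  rw [forall_sign δ, A.head hi, S.head hq,
    seqLe_iff_tl (show S.half q δ 0 = A.half i δ 0 from hq.trans hi.symm), tl_half_star hi,
    tl_half_star hq]
  tauto

lemma mat_star_iff {i : I} {q : P} {δ : ℤˣ} {s : Q₁} (hi : A.lt i δ = some (.star s))
    (hq : S.lt q δ = some (.star s)) : A.Mat S i q ↔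
      S.half q (-δ) = A.half i (-δ) ∧
        S.half (S.nx q δ) (-δ) = A.half (A.nx i δ) (-δ) := by
  unfold Mat
  rw [forall_sign δ, A.head hi, S.head hq, eq_iff_tl (f := S.half q δ), tl_half_star hi,
    tl_half_star hq, half_zero, half_zero, hq, hi]
  tauto

/-- Special letters at points with the same vertex agree. -/
lemma lt_star_of_vtx {i : I} {q : P} {δ : ℤˣ} {s : Q₁} (hi : A.lt i δ = some (.star s))
    (h : S.vtx q = A.vtx i) : S.lt q δ = some (.star s) := by
  obtain ⟨h1, h2, h3⟩ := lt_star_eq hi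
  rw [← h1]
  exact S.star h2 (h.trans h3)

/-- Direct letters are minimal, so a half-word bounded by one that starts with `a` must itself start
with `a`. Dually, inverse letters are maximal, which gives `Low.inv`. -/
lemma Low.dir {i : I} {q : P} {δ : ℤˣ} {a : Q₁} (h : A.Low S i q)
    (hi : A.lt i δ = some (.dir a)) : S.lt q δ = some (.dir a) := by
  have := (h.2 δ).head
  rw [half_zero, half_zero, hi] at this
  simpa [LetterLt] using this

lemma Low.inv {i : I} {q : P} {δ : ℤˣ} {a : Q₁} (h : A.Low S i q)
    (hq : S.lt q δ = some (.inv a)) : A.lt i δ = some (.inv a) := by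
  have := (h.2 δ).head
  rw [half_zero, half_zero, hq] at this
  simpa [LetterLt, eq_comm] using this

variable [Fintype Q₀] {N : Type*} [AddCommGroup N] [Module D.Alg N]

variable (A) in
/-- The relation between the elements at a point and its neighbour in a compatible family. -/
def Orientation.Rel (O : A.Orientation) (i : I) (δ : ℤˣ) (x y : N) : Prop :=
  match A.lt i δ with
  | none => True
  | some (.dir a) => D.arr a • y = x
  | some (.inv a) => D.arr a • x = y
  | some (.star s) => (O.fwd i δ ∧ D.arr s • x = y) ∨ (¬ O.fwd i δ ∧ D.arr s • y = x)

variable {O : A.Orientation}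

lemma rel_dir {i : I} {δ : ℤˣ} {a : Q₁} (h : A.lt i δ = some (.dir a)) {x y : N} :
    O.Rel A i δ x y ↔ D.arr a • y = x := by
  unfold Orientation.Rel; rw [h]

lemma rel_inv {i : I} {δ : ℤˣ} {a : Q₁} (h : A.lt i δ = some (.inv a)) {x y : N} :
    O.Rel A i δ x y ↔ D.arr a • x = y := by
  unfold Orientation.Rel; rw [h]

lemma rel_star {i : I} {δ : ℤˣ} {s : Q₁} (h : A.lt i δ = some (.star s)) {x y : N} :
    O.Rel A i δ x y ↔
      (O.fwd i δ ∧ D.arr s • x = y) ∨ (¬ O.fwd i δ ∧ D.arr s • y = x) := by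
  unfold Orientation.Rel; rw [h]

/-- A relation belongs to an edge rather than to a directed step; for special letters this is the
condition `symm` on orientations. -/
lemma rel_symm {i : I} {δ : ℤˣ} {l : Letter Q₁} (h : A.lt i δ = some l) {x y : N} :
    O.Rel A (A.nx i δ) (D.sgn l.bar) y x ↔ O.Rel A i δ x y := by
  have hb := A.back h
  cases l with
  | dir a => rw [rel_dir h, rel_inv hb]
  | inv a => rw [rel_inv h, rel_dir hb]
  | star s =>
    change A.lt (A.nx i δ) (D.sgn (.star s)) = some (.star s) at hb
    change O.Rel A (A.nx i δ) (D.sgn (.star s)) y x ↔ _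
    rw [A.sign h] at hb ⊢
    rw [rel_star h, rel_star hb, O.symm h]
    tauto

lemma rel_zero (i : I) (δ : ℤˣ) : O.Rel A i δ (0 : N) 0 := by
  unfold Orientation.Rel
  split <;> simp
  exact em _

lemma rel_add {i : I} {δ : ℤˣ} {x y x' y' : N} (h : O.Rel A i δ x y) (h' : O.Rel A i δ x' y') :
    O.Rel A i δ (x + x') (y + y') := by
  unfold Orientation.Rel at *
  split <;> simp_all
  grind

lemma rel_neg {i : I} {δ : ℤˣ} {x y : N} (h : O.Rel A i δ x y) : O.Rel A i δ (-x) (-y) := by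
  unfold Orientation.Rel at *
  split <;> simp_all

/-- Families of elements which satisfy the defining relations. -/
structure Orientation.Compatible (O : A.Orientation) (θ : I → N) : Prop where
  out : ∀ i, A.vtx i = Option.none → θ i = 0
  vtx : ∀ i v, A.vtx i = some v → D.e v • θ i = θ i
  rel : ∀ i δ l, A.lt i δ = some l → O.Rel A i δ (θ i) (θ (A.nx i δ))
  zero : ∀ i a, a ∉ D.Sp → A.vtx i = some (D.tail a) →
    A.lt i (D.sgn (.inv a)) ≠ some (.inv a) → D.arr a • θ i = 0

variable (R : S.Rep N)

variable (A) in
/-- The elements whose components are at points with half-words bounded by those at `i`. -/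
def Rep.lowSub (i : I) : AddSubgroup N where
  carrier := {x | ∀ q, ¬ A.Low S i q → R.pr q x = 0}
  zero_mem' q _ := map_zero _
  add_mem' hx hy q hq := by rw [map_add, hx q hq, hy q hq, add_zero]
  neg_mem' hx q hq := by rw [map_neg, hx q hq, neg_zero]

namespace Rep

variable {R}

lemma pr_mem_lowSub {i : I} {q : P} (h : A.Low S i q) (x : N) : R.pr q x ∈ R.lowSub A i :=
  fun q' hq' => R.pr_ne (by rintro rfl; exact hq' h) x

lemma mem_lowSub_of_pr {i : I} {q : P} (h : A.Low S i q) {x : N} (hx : R.pr q x = x) :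
    x ∈ R.lowSub A i := hx ▸ pr_mem_lowSub h x

lemma mem_of_lowSub {i : I} {x : N} (hx : x ∈ R.lowSub A i) {G : AddSubgroup N}
    (h : ∀ q, A.Low S i q → R.pr q x ∈ G) : x ∈ G := by
  refine R.mem_of_pr fun q => ?_
  by_cases hq : A.Low S i q
  · exact h q hq
  · rw [hx q hq]; exact G.zero_mem

lemma low_of_ne {i : I} {x : N} (hx : x ∈ R.lowSub A i) {q : P} (h : R.pr q x ≠ 0) :
    A.Low S i q := by
  by_contra hq
  exact h (hx q hq)

lemma smul_mem_lowSub {i : I} {x : N} (l : K) (hx : x ∈ R.lowSub A i) :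
    D.inK l • x ∈ R.lowSub A i := fun q hq => by rw [R.smul, hx q hq, smul_zero]

/-- Elements bounded at `i` satisfy the zero relations there. -/
lemma arr_lowSub {i : I} {x : N} (hx : x ∈ R.lowSub A i) {a : Q₁} (ha : a ∉ D.Sp)
    (h : A.lt i (D.sgn (.inv a)) ≠ some (.inv a)) : D.arr a • x = 0 := by
  refine mem_of_lowSub (G := (DistribSMul.toAddMonoidHom N (D.arr a)).ker) hx fun q hq => ?_
  exact R.ord_zero ha (fun hl => h (hq.inv hl)) x

lemma e_lowSub {i : I} {x : N} (hx : x ∈ R.lowSub A i) {v : Q₀} (h : A.vtx i = some v) :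
    D.e v • x = x := by
  have := mem_of_lowSub (G := (DistribSMul.toAddMonoidHom N (D.e v) - AddMonoidHom.id N).ker) hx
    fun q hq => by
      change D.e v • R.pr q x - R.pr q x = 0
      rw [R.vtx (hq.1.trans h), sub_self]
  exact sub_eq_zero.1 this

lemma lowSub_none {i : I} {x : N} (hx : x ∈ R.lowSub A i) (h : A.vtx i = Option.none) : x = 0 := by
  have := mem_of_lowSub (G := ⊥) hx fun q hq => by
    rw [R.none (hq.1.trans h)]; exact AddSubgroup.zero_mem _
  simpa using this

variable (O) in
/-- Elements bounded at a point can be continued along the letters there. -/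
lemma exists_rel (hS : D.NonSingular) (hN : D.NormallyBound) {i : I} {δ : ℤˣ} {l : Letter Q₁}
    (hi : A.lt i δ = some l) {x : N} (hx : x ∈ R.lowSub A i) :
    ∃ y ∈ R.lowSub A (A.nx i δ), O.Rel A i δ x y := by
  -- The elements that can be continued form a subgroup, so a single summand at a bounded point `q`
  -- suffices.
  let G : AddSubgroup N :=
    { carrier := {x | ∃ y ∈ R.lowSub A (A.nx i δ), O.Rel A i δ x y}
      zero_mem' := ⟨0, AddSubgroup.zero_mem _, rel_zero i δ⟩
      add_mem' := by
        rintro x x' ⟨y, hy, h⟩ ⟨y', hy', h'⟩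
        exact ⟨y + y', AddSubgroup.add_mem _ hy hy', rel_add h h'⟩
      neg_mem' := by
        rintro x ⟨y, hy, h⟩
        exact ⟨-y, AddSubgroup.neg_mem _ hy, rel_neg h⟩ }
  refine mem_of_lowSub (G := G) hx fun q hq => ?_
  change ∃ y ∈ R.lowSub A (A.nx i δ), O.Rel A i δ (R.pr q x) y
  cases l with
  | dir a =>
    have hl := hq.dir hi
    have hb : S.lt (S.nx q δ) (D.sgn (.inv a)) = some (.inv a) := S.back hl
    have hbn : S.nx (S.nx q δ) (D.sgn (.inv a)) = q := S.back_nx hl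
    obtain ⟨z, hz⟩ := R.ord_surj hb x
    rw [hbn] at hz
    exact ⟨_, pr_mem_lowSub ((low_nx hi hl).2 hq) z, (rel_dir hi).2 hz⟩
  | inv a =>
    refine ⟨D.arr a • R.pr q x, ?_, (rel_inv hi).2 rfl⟩
    by_cases hl : S.lt q δ = some (.inv a)
    · have hs : D.sgn (.inv a) = δ := S.sign hl
      have := R.ord (p := q) (a := a) (by rw [hs]; exact hl) x
      rw [hs] at this
      exact mem_lowSub_of_pr ((low_nx hi hl).2 hq) this
    · rw [R.ord_zero (A.allowed hi)]
      · exact AddSubgroup.zero_mem _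
      · rwa [show D.sgn (.inv a) = δ from A.sign hi]
  | star s =>
    have hl := lt_star_of_vtx hi hq.1
    obtain ⟨h1, h2⟩ := (low_star_iff hi hl).1 hq
    have hi' := (star_back hi)
    have hl' := (star_back hl)
    have hq1 : A.Low S (A.nx i δ) (S.nx q δ) := (low_nx hi hl).2 hq
    have low_q : SeqLe (S.half q (-δ)) (A.half (A.nx i δ) (-δ)) →
        SeqLe (S.half (S.nx q δ) (-δ)) (A.half i (-δ)) → A.Low S (A.nx i δ) q := by
      intro h3 h4
      rw [low_star_iff hi'.1 hl, hi'.2]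
      exact ⟨h3, h4⟩
    by_cases hf : O.fwd i δ
    · have hle := O.le hi hf
      refine ⟨D.arr s • R.pr q x, ?_, (rel_star hi).2 (Or.inl ⟨hf, rfl⟩)⟩
      rcases R.to_or hl with hT | hT
      · exact mem_lowSub_of_pr hq1 (hT.mem x)
      · have hTle := hT.le
        rw [hl'.2] at hTle
        obtain ⟨z, hz⟩ := hT.surj x
        rw [hl'.2] at hz
        -- The loop goes forward at `i` but towards `q` in the module. The quadratic relation
        -- produces components at `q` and at its neighbour, and the two orientations together show
        -- that `q` is bounded at the neighbour of `i` as well.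
        rw [← hz, To.quad R hl'.1, hz]
        exact AddSubgroup.sub_mem _
          (smul_mem_lowSub _ (pr_mem_lowSub (low_q (h1.trans hle) (hTle.trans h1)) x))
          (smul_mem_lowSub _ (pr_mem_lowSub hq1 z))
    · have hle := O.ge hi hf
      rcases R.to_or hl with hT | hT
      · have hTle := hT.le
        obtain ⟨hβ, hγ, -, -⟩ := normal_quad (hN s (S.allowed hl))
        have hγ0 := hS s (S.allowed hl)
        -- The preimage of the component under `s` is `γ_s⁻¹ (β_s - s)` applied to it. That this is
        -- a preimage uses that `σ_s` fixes `β_s` and `γ_s`.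
        refine ⟨D.inK (D.γ s)⁻¹ • (D.inK (D.β s) • R.pr q x - D.arr s • R.pr q x), ?_,
          (rel_star hi).2 (Or.inr ⟨hf, ?_⟩)⟩
        · refine smul_mem_lowSub _ (AddSubgroup.sub_mem _ (smul_mem_lowSub _ (pr_mem_lowSub
            (low_q (hTle.trans h2) (h2.trans hle)) x)) (mem_lowSub_of_pr hq1 (hT.mem x)))
        · rw [arr_smul, smul_sub, arr_smul, hβ, To.quad R hl, sub_sub_cancel, map_inv₀, hγ,
            inK_smul_inv hγ0]
      · obtain ⟨z, hz⟩ := hT.surj x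
        rw [hl'.2] at hz
        exact ⟨_, pr_mem_lowSub hq1 z, (rel_star hi).2 (Or.inr ⟨hf, hz⟩)⟩

variable (A) in
/-- Components at points whose half-words agree with those at `i`. -/
def MatZero (R : S.Rep N) (i : I) (x : N) : Prop := ∀ q, A.Mat S i q → R.pr q x = 0

/-- The vanishing of the components at points with matching half-words propagates. -/
lemma matZero_rel (hS : D.NonSingular) {i : I} {δ : ℤˣ} {l : Letter Q₁}
    (hi : A.lt i δ = some l) {x y : N} (hx : x ∈ R.lowSub A i) (hy : y ∈ R.lowSub A (A.nx i δ))
    (h : O.Rel A i δ x y) (h0 : R.MatZero A i x) : R.MatZero A (A.nx i δ) y := by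
  intro r hr
  have hr1 : S.lt r (D.sgn l.bar) = some l.bar := by
    have h1 := congrFun (hr.2 (D.sgn l.bar)) 0
    rw [half_zero, half_zero, A.back hi] at h1
    exact h1
  obtain ⟨q, hq, rfl⟩ : ∃ q, S.lt q δ = some l ∧ S.nx q δ = r := by
    refine ⟨S.nx r (D.sgn l.bar), ?_, ?_⟩
    · have := S.back hr1
      rwa [Letter.bar_bar, A.sign hi] at this
    · have := S.back_nx hr1
      rwa [Letter.bar_bar, A.sign hi] at this
  have hm : A.Mat S i q := (mat_nx hi hq).1 hr
  cases l with
  | dir a =>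
    rw [rel_dir hi] at h
    have hb : S.lt (S.nx q δ) (D.sgn (.inv a)) = some (.inv a) := S.back hq
    have hbn : S.nx (S.nx q δ) (D.sgn (.inv a)) = q := S.back_nx hq
    refine R.ord_inj hb y ?_
    rw [← R.pr_ord hb, hbn, h, h0 q hm]
  | inv a =>
    rw [rel_inv hi] at h
    have hs : D.sgn (.inv a) = δ := S.sign hq
    have := R.pr_ord (p := q) (a := a) (by rw [hs]; exact hq) x
    rw [hs, h, h0 q hm, smul_zero] at this
    exact this
  | star s =>
    have hi' := star_back hi
    have hq' := star_back hq
    obtain ⟨m1, m2⟩ := (mat_star_iff hi hq).1 hm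
    rw [rel_star hi] at h
    rcases h with ⟨hf, rfl⟩ | ⟨hf, rfl⟩
    · have hle := O.le hi hf
      by_contra hne
      rcases R.pr_star_ne hq'.1 hne with h1 | ⟨hT, h1⟩
      · rw [hq'.2] at h1; exact h1 (h0 q hm)
      · rw [hq'.2] at hT
        have hlow := low_of_ne hx h1
        rw [low_star_iff hi hq'.1] at hlow
        -- The orientation at `i` and the bound on the neighbour of `q` are opposite inequalities
        -- between the outer half-words at `i`. Their equality makes the neighbour of `q` match `i`
        -- too, where the component vanishes by assumption.
        have e : A.half i (-δ) = A.half (A.nx i δ) (-δ) :=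
          hle.antisymm (m2 ▸ hlow.1)
        refine h1 (h0 _ ((mat_star_iff hi hq'.1).2 ⟨m2.trans e.symm, ?_⟩))
        rw [hq'.2, m1, e]
    · have hle := O.ge hi hf
      by_contra hne
      -- Without a component at `q`, the vanishing of `s y` at `q` would already kill the component
      -- of `y` at the neighbour of `q`.
      have h1 : R.pr q y ≠ 0 := by
        intro h1
        refine hne (R.pr_eq_zero_of_nx hS hq'.1 ?_ ?_) <;> rw [hq'.2]
        · exact h1
        · exact h0 q hm
      have hlow := low_of_ne hy h1
      rw [low_star_iff hi'.1 hq, hi'.2] at hlow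
      have e : A.half (A.nx i δ) (-δ) = A.half i (-δ) := hle.antisymm (m1 ▸ hlow.1)
      refine hne (R.pr_eq_zero_of_star hS hq'.1 (h0 _ ?_) ?_)
      · rw [mat_star_iff hi hq'.1, hq'.2, m2, m1, e]
        exact ⟨rfl, rfl⟩
      · rw [hq'.2]; exact h0 q hm

/-- Induction on the place of the first difference. If the difference is in the next letter, either
the value lies in the image of an arrow which does not reach `q`, or an arrow kills the value but is
injective on the summand of `q`. Otherwise the statement is transported across the common letter. At
a special letter it may also be applied to the other outer half-word, since the orientation does not
delay the first difference. -/
lemma compatible_aux (hS : D.NonSingular) {θ : I → N} (hθ : O.Compatible θ) (k : ℕ) :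
    ∀ i δ q, LtAt k (A.half i δ) (S.half q δ) → S.vtx q = A.vtx i → R.pr q (θ i) = 0 := by
  induction k using Nat.strong_induction_on with
  | _ k ih =>
  intro i δ q hlt hv
  cases k with
  | zero =>
    have hlt := hlt.2
    rw [half_zero, half_zero] at hlt
    rcases hlt with ⟨⟨y, h1⟩, z, h2⟩ | ⟨⟨y, h1⟩, h2⟩ | ⟨h1, z, h2⟩
    · rw [← (rel_dir h1).1 (hθ.rel i δ _ h1)]
      refine R.pr_ord_zero (A.allowed h1) ?_ _
      rw [show D.sgn (.dir y) = δ from A.sign h1, h2]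
      simp
    · rw [← (rel_dir h1).1 (hθ.rel i δ _ h1)]
      refine R.pr_ord_zero (A.allowed h1) ?_ _
      rw [show D.sgn (.dir y) = δ from A.sign h1, h2]
      simp
    -- The half-word at `i` has ended, so the zero relation `z θ_i = 0` holds, while `z` is
    -- injective on the summand of `q`.
    · have hs : D.sgn (.inv z) = δ := S.sign h2
      refine R.ord_eq_zero (a := z) (p := q) (by rw [hs]; exact h2) ?_
      refine hθ.zero i z (S.allowed h2) (hv.symm.trans (S.head h2)) ?_
      rw [hs, h1]; simp
  | succ k =>
    rw [ltAt_succ] at hlt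
    obtain ⟨h0, hlt⟩ := hlt
    rw [half_zero, half_zero] at h0
    rcases hi : A.lt i δ with _ | l
    · rw [A.half_none hi, S.half_none (h0 ▸ hi)] at hlt
      exact hlt.irrefl.elim
    have hq : S.lt q δ = some l := h0 ▸ hi
    have hrel := hθ.rel i δ l hi
    have hv1 : S.vtx (S.nx q δ) = A.vtx (A.nx i δ) := (vtx_nx hq).trans (vtx_nx hi).symm
    cases l with
    | dir a =>
      rw [A.tl_half hi, S.tl_half hq] at hlt
      have h1 := ih k (by omega) _ _ _ hlt hv1
      have hb : S.lt (S.nx q δ) (D.sgn (.inv a)) = some (.inv a) := S.back hq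
      have hbn : S.nx (S.nx q δ) (D.sgn (.inv a)) = q := S.back_nx hq
      rw [← (rel_dir hi).1 hrel, ← hbn, R.pr_ord hb, h1, smul_zero]
    | inv a =>
      rw [A.tl_half hi, S.tl_half hq] at hlt
      have h1 := ih k (by omega) _ _ _ hlt hv1
      have hs : D.sgn (.inv a) = δ := S.sign hq
      have := R.pr_ord (p := q) (a := a) (by rw [hs]; exact hq) (θ i)
      rw [hs, (rel_inv hi).1 hrel, h1] at this
      exact R.ord_inj (by rw [hs]; exact hq) _ this.symm
    | star s =>
      rw [tl_half_star hi, tl_half_star hq] at hlt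
      have hi' := star_back hi
      have hq' := star_back hq
      have hvq : S.vtx q = A.vtx (A.nx i δ) := by
        rw [hv]; exact (A.head hi).trans (A.head hi'.1).symm
      have h1 := ih k (by omega) _ _ _ hlt hv1
      rcases (rel_star hi).1 hrel with ⟨hf, hr⟩ | ⟨hf, hr⟩
      -- The outer half-word at `i` is at most that at its neighbour, hence below the outer
      -- half-word at the neighbour of `q`. So both `θ_i` and `s θ_i` have no component there.
      · obtain ⟨l, hl, h2⟩ := (O.le hi hf).ltAt hlt
        have h3 := ih l (by omega) i (-δ) (S.nx q δ) h2
          ((S.head hq'.1).trans ((S.head hq).symm.trans hv))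
        exact R.pr_eq_zero_of_nx hS hq h3 (by rw [hr, h1])
      · by_contra hne
        rw [← hr] at hne
        -- A component of `s y` at `q` comes from the neighbour of `q`, which induction excludes, or
        -- from `q` itself. In the latter case the loop leads towards `q`, and induction applies to
        -- the larger outer half-word of `q`.
        rcases R.pr_star_ne hq hne with h2 | ⟨hT, h2⟩
        · exact h2 h1
        · have hTle := hT.le
          rw [hq'.2] at hTle
          obtain ⟨l, hl, h3⟩ := hlt.seqLe hTle
          exact h2 (ih l (by omega) _ _ _ h3 hvq)

/-- The elements of a compatible family are bounded. -/
lemma compatible_mem (hS : D.NonSingular) {θ : I → N} (hθ : O.Compatible θ) (i : I) :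
    θ i ∈ R.lowSub A i := by
  intro q hq
  by_cases hv : S.vtx q = A.vtx i
  · have : ∃ δ, ¬ SeqLe (S.half q δ) (A.half i δ) := by
      by_contra h
      push Not at h
      exact hq ⟨hv, h⟩
    obtain ⟨δ, hδ⟩ := this
    rcases half_cmp (S := S) (S' := A) δ hv with h | ⟨k, h⟩
    · exact absurd h hδ
    · exact compatible_aux hS hθ k i δ q h hv
  · rcases hi : A.vtx i with _ | v
    · rw [hθ.out i hi, map_zero]
    · rw [← hθ.vtx i v hi, R.pr_e (by rwa [← hi])]

/-- Bounded families which satisfy the relations along the letters are compatible. -/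
lemma compatible_of_mem {θ : I → N} (h : ∀ i, θ i ∈ R.lowSub A i)
    (hrel : ∀ i δ l, A.lt i δ = some l → O.Rel A i δ (θ i) (θ (A.nx i δ))) :
    O.Compatible θ where
  out i hi := lowSub_none (h i) hi
  vtx i _ hi := e_lowSub (h i) hi
  rel := hrel
  zero i _ ha _ h' := arr_lowSub (h i) ha h'

/-- Subgroups of bounded elements which contain those that can be killed in one step and which
are preserved along the letters contain all summands of points with half-words that do not
match. -/
lemma pr_mem_of_ltAt (hS : D.NonSingular) {U : I → AddSubgroup N}
    (hU : ∀ i, U i ≤ R.lowSub A i)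
    (hrel : ∀ i δ l, A.lt i δ = some l → ∀ x ∈ U i, ∃ y ∈ U (A.nx i δ), O.Rel A i δ x y)
    (hsmul : ∀ i l, ∀ x ∈ U i, D.inK l • x ∈ U i)
    (hbase : ∀ i δ q, A.Low S i q → LtAt 0 (S.half q δ) (A.half i δ) → ∀ x, R.pr q x ∈ U i)
    (k : ℕ) : ∀ i δ q, A.Low S i q → LtAt k (S.half q δ) (A.half i δ) → ∀ x, R.pr q x ∈ U i := by
  induction k using Nat.strong_induction_on with
  | _ k ih =>
  intro i δ q hq hlt x
  cases k with
  | zero => exact hbase i δ q hq hlt x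
  | succ k =>
    rw [ltAt_succ] at hlt
    obtain ⟨h0, hlt⟩ := hlt
    rw [half_zero, half_zero] at h0
    rcases hl : S.lt q δ with _ | l
    · rw [S.half_none hl, A.half_none (h0 ▸ hl)] at hlt
      exact hlt.irrefl.elim
    have hi : A.lt i δ = some l := h0 ▸ hl
    have hq1 : A.Low S (A.nx i δ) (S.nx q δ) := (low_nx hi hl).2 hq
    -- a relation can be used in both directions
    have back : ∀ y ∈ U (A.nx i δ), ∃ z ∈ U i, O.Rel A i δ z y := by
      intro y hy
      obtain ⟨z, hz, h⟩ := hrel _ _ _ (A.back hi) y hy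
      rw [A.back_nx hi] at hz
      exact ⟨z, hz, (rel_symm hi).1 h⟩
    cases l with
    | dir a =>
      rw [A.tl_half hi, S.tl_half hl] at hlt
      have hb : S.lt (S.nx q δ) (D.sgn (.inv a)) = some (.inv a) := S.back hl
      have hbn : S.nx (S.nx q δ) (D.sgn (.inv a)) = q := S.back_nx hl
      obtain ⟨y, hy⟩ := R.ord_surj hb x
      rw [hbn] at hy
      obtain ⟨z, hz, h⟩ := back _ (ih k (by omega) _ _ _ hq1 hlt y)
      rw [rel_dir hi, hy] at h
      rwa [h]
    | inv a =>
      rw [A.tl_half hi, S.tl_half hl] at hlt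
      have hs : D.sgn (.inv a) = δ := S.sign hl
      have h1 := ih k (by omega) _ _ _ hq1 hlt (D.arr a • R.pr q x)
      have h2 := R.ord (p := q) (a := a) (by rw [hs]; exact hl) x
      rw [hs] at h2
      rw [h2] at h1
      obtain ⟨z, hz, h⟩ := back _ h1
      rw [rel_inv hi] at h
      -- The difference is killed by `a`, so it has no component at points with the letter `a⁻¹`.
      -- All its other components are at points whose next letter is already smaller, where the base
      -- case applies.
      have h3 : R.pr q x - z ∈ U i := by
        refine mem_of_lowSub (A := A) (R := R) (i := i)
          (AddSubgroup.sub_mem _ (pr_mem_lowSub hq x) (hU i hz)) fun r hr => ?_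
        by_cases hr' : S.lt r δ = some (.inv a)
        · rw [R.ord_eq_zero (a := a) (by rw [hs]; exact hr') (by rw [smul_sub, h, sub_self])]
          exact AddSubgroup.zero_mem _
        · refine hbase i δ r hr ⟨fun j hj => absurd hj (by omega), ?_⟩ _
          have := (hr.2 δ).head
          rw [half_zero, half_zero, hi] at this
          rw [half_zero, half_zero, hi]
          exact this.resolve_left hr'
      have := AddSubgroup.add_mem _ h3 hz
      rwa [sub_add_cancel] at this
    | star s =>
      rw [tl_half_star hi, tl_half_star hl] at hlt
      have hi' := star_back hi
      have hl' := star_back hl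
      obtain ⟨h1, h2⟩ := (low_star_iff hi hl).1 hq
      have ih1 : ∀ y, R.pr (S.nx q δ) y ∈ U (A.nx i δ) := fun y =>
        ih k (by omega) _ _ _ hq1 hlt y
      by_cases hf : O.fwd i δ
      · have hle := O.le hi hf
        -- A relation backwards yields `z ∈ U i` with the same image under `s`, and `s` is injective
        -- on elements bounded at `i`.
        have suff : D.arr s • R.pr q x ∈ U (A.nx i δ) → R.pr q x ∈ U i := by
          intro h
          obtain ⟨z, hz, h⟩ := back _ h
          rw [rel_star hi] at h
          have h := h.resolve_right fun h' => h'.1 hf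
          have e : R.pr q x - z = 0 := by
            have hm : R.pr q x - z ∈ R.lowSub A i :=
              AddSubgroup.sub_mem _ (pr_mem_lowSub hq x) (hU i hz)
            refine (AddSubgroup.mem_bot).1 (mem_of_lowSub hm fun r hr => ?_)
            have hrl := lt_star_of_vtx hi hr.1
            have h0 : D.arr s • (R.pr q x - z) = 0 := by rw [smul_sub, h.2, sub_self]
            rw [R.pr_eq_zero_of_star hS hrl (by rw [h0, map_zero]) (by rw [h0, map_zero])]
            exact AddSubgroup.zero_mem _
          rw [sub_eq_zero] at e
          rwa [e]
        apply suff
        rcases R.to_or hl with hT | hT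
        · rw [← hT.mem]; exact ih1 _
        · have hTle := hT.le
          rw [hl'.2] at hTle
          obtain ⟨z, hz⟩ := hT.surj x
          rw [hl'.2] at hz
          have key : R.pr q x ∈ U (A.nx i δ) := by
            -- Either the neighbour of `q` is strictly below `i` in the outer half-word, and then
            -- `z` lies in `U i` and is moved forward by `s`; or `q` is strictly below the neighbour
            -- of `i`, and induction applies to `q` directly.
            rcases hlt.split (hTle.trans h1) h1 with ⟨m, hm, h3⟩ | ⟨m, hm, h3⟩
            · have hlow : A.Low S i (S.nx q δ) := by
                rw [low_star_iff hi hl'.1, hl'.2]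
                exact ⟨hTle.trans h1, h1.trans hle⟩
              obtain ⟨y, hy, h4⟩ := hrel i δ _ hi _ (ih m (by omega) i (-δ) _ hlow h3 z)
              rw [rel_star hi] at h4
              have h4 := (h4.resolve_right fun h' => h'.1 hf).2
              rwa [← hz, h4]
            · have hlow : A.Low S (A.nx i δ) q := by
                rw [low_star_iff hi'.1 hl, hi'.2]
                exact ⟨h1.trans hle, hTle.trans h1⟩
              exact ih m (by omega) _ (-δ) _ hlow h3 x
          rw [← hz, To.quad R hl'.1, hz]
          exact AddSubgroup.sub_mem _ (hsmul _ _ _ key) (hsmul _ _ _ (ih1 z))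
      · have hle := O.ge hi hf
        have act : ∀ y ∈ U (A.nx i δ), D.arr s • y ∈ U i := by
          intro y hy
          obtain ⟨z, hz, h⟩ := back y hy
          rw [rel_star hi] at h
          have h := (h.resolve_left fun h' => hf h'.1).2
          rwa [h]
        rcases R.to_or hl with hT | hT
        · have hTle := hT.le
          -- Both `s x` and `s s x` turn out to lie in `U i`, where `x` stands for its component at
          -- `q`. Then so does `γ_s x = β_s s x - s s x`, and `γ_s` is invertible.
          have m1 := act _ (ih1 (D.arr s • R.pr q x))
          rw [hT.mem, To.quad R hl] at m1
          have m2 : D.arr s • R.pr q x ∈ U i := by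
            obtain ⟨m, hm, h3⟩ := hlt.seqLe hle
            rw [← hT.mem]
            refine ih m (by omega) i (-δ) _ ?_ h3 _
            rw [low_star_iff hi hl'.1, hl'.2]
            exact ⟨h2.trans hle, hTle.trans h2⟩
          have m3 := AddSubgroup.sub_mem _ (hsmul _ (D.β s) _ m2) m1
          rw [sub_sub_cancel] at m3
          have := hsmul _ (D.γ s)⁻¹ _ m3
          rwa [inK_smul_inv (hS s (S.allowed hl))] at this
        · obtain ⟨z, hz⟩ := hT.surj x
          rw [hl'.2] at hz
          rw [← hz]
          exact act _ (ih1 z)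

/-- Under the same conditions all bounded elements without components at points with matching
half-words are contained in the subgroups. -/
lemma mem_of_matZero (hS : D.NonSingular) {U : I → AddSubgroup N}
    (hU : ∀ i, U i ≤ R.lowSub A i)
    (hrel : ∀ i δ l, A.lt i δ = some l → ∀ x ∈ U i, ∃ y ∈ U (A.nx i δ), O.Rel A i δ x y)
    (hsmul : ∀ i l, ∀ x ∈ U i, D.inK l • x ∈ U i)
    (hbase : ∀ i δ q, A.Low S i q → LtAt 0 (S.half q δ) (A.half i δ) → ∀ x, R.pr q x ∈ U i)
    {i : I} {x : N} (hx : x ∈ R.lowSub A i) (h0 : R.MatZero A i x) : x ∈ U i := by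
  refine mem_of_lowSub hx fun q hq => ?_
  by_cases hm : A.Mat S i q
  · rw [h0 q hm]; exact AddSubgroup.zero_mem _
  · have : ∃ δ, S.half q δ ≠ A.half i δ := by
      by_contra h
      push Not at h
      exact hm ⟨hq.1, h⟩
    obtain ⟨δ, hδ⟩ := this
    obtain ⟨k, hk⟩ := (hq.2 δ).resolve_left hδ
    exact pr_mem_of_ltAt hS hU hrel hsmul hbase k i δ q hq hk x

end Rep
end PointSystem
end Families
end Clannish
end SLC
end

noncomputable section
namespace SLC
namespace Clannish

/-! ### Words as systems of points -/

section WordPoints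

variable {K Q₀ Q₁ : Type*} [DivisionRing K] {D : Clannish K Q₀ Q₁}

lemma neg_eq_of_ne {δ ε : ℤˣ} (h : δ ≠ ε) : δ = -ε := by
  rcases Int.units_eq_one_or δ with rfl | rfl <;> rcases Int.units_eq_one_or ε with rfl | rfl <;>
    simp_all

lemma Letter.Allowed.bar {Sp : Set Q₁} {x : Letter Q₁} (h : x.Allowed Sp) : x.bar.Allowed Sp := by
  cases x <;> exact h

namespace Word

variable (w : D.Word)

/-- The sign of the letters which continue a word forward at the vertex `i`. -/
def fsgn (i : ℤ) : ℤˣ :=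
  match w.letter (i + 1) with
  | some x => D.sgn x
  | none => match w.letter i with
    | some x => - D.sgn x.bar
    | none => w.sign

variable {w}

lemma sgn_next {i : ℤ} {x : Letter Q₁} (h : w.letter (i + 1) = some x) : D.sgn x = w.fsgn i := by
  unfold fsgn; rw [h]

lemma sgn_prev {i : ℤ} {x : Letter Q₁} (h : w.letter i = some x) :
    D.sgn x.bar = - w.fsgn i := by
  unfold fsgn
  rcases hy : w.letter (i + 1) with _ | y
  · rw [h]; simp
  · exact w.opp i x y h hy

lemma letter_nonpos {n : ℕ} (h : w.idx = .fin n) {i : ℤ} (hi : i ≤ 0) : w.letter i = none := by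
  rw [letter_none_iff, w.mem_I'_fin h]; omega

lemma letter_gt {n : ℕ} (h : w.idx = .fin n) {i : ℤ} (hi : n < i) : w.letter i = none := by
  rw [letter_none_iff, w.mem_I'_fin h]; omega

lemma fsgn_zero {n : ℕ} (h : w.idx = .fin n) : w.fsgn 0 = w.sign := by
  unfold fsgn
  rw [zero_add]
  rcases hx : w.letter 1 with _ | x
  · rw [letter_nonpos h le_rfl]
  · exact w.sign_one x hx

lemma fsgn_last {n : ℕ} (h : w.idx = .fin n) : w.fsgn n = - w.inv.sign := by
  change _ = - (match w.letter w.flip with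
    | some x => D.sgn x.bar
    | none => - w.sign)
  unfold fsgn
  rw [letter_gt h (by omega), w.flip_fin h]
  rcases w.letter n with _ | x <;> simp

lemma mem_I_of_letter {i : ℤ} {x : Letter Q₁} (h : w.letter i = some x) :
    i ∈ w.idx.I ∧ i - 1 ∈ w.idx.I := (w.letter_some_iff i).1 ⟨x, h⟩

variable (w) in
/-- The letter with sign `δ` at the vertex `i`. -/
def lt (i : ℤ) (δ : ℤˣ) : Option (Letter Q₁) :=
  if δ = w.fsgn i then w.letter (i + 1) else (w.letter i).map Letter.bar

variable (w) in
/-- The neighbour in the direction with sign `δ` of the vertex `i`. -/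
def nx (i : ℤ) (δ : ℤˣ) : ℤ := if δ = w.fsgn i then i + 1 else i - 1

lemma lt_fsgn (i : ℤ) : w.lt i (w.fsgn i) = w.letter (i + 1) := if_pos rfl

lemma lt_neg_fsgn (i : ℤ) : w.lt i (- w.fsgn i) = (w.letter i).map Letter.bar :=
  if_neg (units_ne_neg _).symm

lemma nx_fsgn (i : ℤ) : w.nx i (w.fsgn i) = i + 1 := if_pos rfl

lemma nx_neg_fsgn (i : ℤ) : w.nx i (- w.fsgn i) = i - 1 := if_neg (units_ne_neg _).symm

lemma dir_cases {i : ℤ} {δ : ℤˣ} {x : Letter Q₁} (h : w.lt i δ = some x) :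
    (δ = w.fsgn i ∧ w.letter (i + 1) = some x) ∨ (δ = - w.fsgn i ∧ w.letter i = some x.bar) := by
  by_cases hδ : δ = w.fsgn i
  · subst hδ; rw [lt_fsgn] at h; exact Or.inl ⟨rfl, h⟩
  · obtain rfl := neg_eq_of_ne hδ
    rw [lt_neg_fsgn] at h
    obtain ⟨y, hy, rfl⟩ := Option.map_eq_some_iff.1 h
    exact Or.inr ⟨rfl, by rw [Letter.bar_bar]; exact hy⟩

lemma letter_isSome_or {i : ℤ} (hi : i ∈ w.idx.I) (h : w.letter (i + 1) = none) :
    ∃ n : ℕ, w.idx = .fin n ∧ i = n := by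
  rcases hx : w.idx with n | _
  · rw [letter_none_iff, w.mem_I'_fin hx] at h
    rw [hx] at hi
    simp only [Idx.I, Set.mem_Icc] at hi
    exact ⟨n, rfl, by omega⟩
  · exact absurd (w.mem_I'_int hx _) ((w.letter_none_iff _).1 h)

lemma letter_isSome_or' {i : ℤ} (hi : i ∈ w.idx.I) (h : w.letter i = none) :
    ∃ n : ℕ, w.idx = .fin n ∧ i = 0 := by
  rcases hx : w.idx with n | _
  · rw [letter_none_iff, w.mem_I'_fin hx] at h
    rw [hx] at hi
    simp only [Idx.I, Set.mem_Icc] at hi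
    exact ⟨n, rfl, by omega⟩
  · exact absurd (w.mem_I'_int hx _) ((w.letter_none_iff _).1 h)

variable (w) in
/-- The system of points given by the vertices of a word. -/
def points (hw : w.EndAdmissible) : PointSystem D ℤ where
  vtx := w.vert
  lt := w.lt
  nx := w.nx
  allowed {i δ x} h := by
    rcases dir_cases h with ⟨-, h⟩ | ⟨-, h⟩
    · exact w.allowed _ _ h
    · simpa using Letter.Allowed.bar (w.allowed _ _ h)
  head {i δ x} h := by
    rcases dir_cases h with ⟨-, h⟩ | ⟨-, h⟩
    · simpa using w.head_eq _ _ h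
    · simpa using w.tail_eq _ _ h
  sign {i δ x} h := by
    rcases dir_cases h with ⟨rfl, h₁⟩ | ⟨rfl, h₁⟩
    · exact sgn_next h₁
    · simpa using sgn_prev h₁
  back {i δ x} h := by
    rcases dir_cases h with ⟨rfl, h₁⟩ | ⟨rfl, h₁⟩
    · rw [nx_fsgn, sgn_prev h₁, lt_neg_fsgn, h₁]; rfl
    · have h' : w.letter (i - 1 + 1) = some x.bar := by rwa [sub_add_cancel]
      rw [nx_neg_fsgn, sgn_next h', lt_fsgn, h']
  back_nx {i δ x} h := by
    rcases dir_cases h with ⟨rfl, h₁⟩ | ⟨rfl, h₁⟩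
    · rw [nx_fsgn, sgn_prev h₁, nx_neg_fsgn]; ring
    · have h' : w.letter (i - 1 + 1) = some x.bar := by rwa [sub_add_cancel]
      rw [nx_neg_fsgn, sgn_next h', nx_fsgn]; ring
  star {i s} hs hv := by
    have hi : i ∈ w.idx.I := by rw [← w.vert_dom, hv]; rfl
    -- The only distinct letters which may share head and sign are `a⁻¹` and `b` with `a`, `b`
    -- ordinary, so `s^*` has no competitor.
    have key : ∀ x : Letter Q₁, x.Allowed D.Sp → D.hd x = D.head s →
        D.sgn x = D.sgn (.star s) → x = .star s := by
      intro x h1 h2 h3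
      by_contra hne
      obtain ⟨a, b, -, ⟨-, h⟩ | ⟨-, h⟩⟩ := D.sgn_spec x (.star s) h1 hs hne h2 h3 <;> cases h
    by_cases hδ : D.sgn (.star s) = w.fsgn i
    · rw [hδ, lt_fsgn]
      rcases hx : w.letter (i + 1) with _ | x
      -- A missing letter places `i` at the end of a finite word, which could then be continued by
      -- `s^*`, contrary to end-admissibility.
      · obtain ⟨n, hn, rfl⟩ := letter_isSome_or hi hx
        refine (hw.1 n hn ⟨s, hs, ?_, by rw [hδ, fsgn_last hn]⟩).elim
        rw [inv_vert, w.flip_fin hn, sub_zero, hv]; rfl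
      · have := w.head_eq _ _ hx
        rw [add_sub_cancel_right, hv] at this
        rw [key x (w.allowed _ _ hx) (Option.some.inj this).symm (by rw [hδ, sgn_next hx])]
    · have hδ := neg_eq_of_ne hδ
      rw [hδ, lt_neg_fsgn]
      rcases hx : w.letter i with _ | x
      · obtain ⟨n, hn, rfl⟩ := letter_isSome_or' hi hx
        refine (hw.2 n hn ⟨s, hs, ?_, by rw [hδ, w.inv_inv_sign hn, fsgn_zero hn]⟩).elim
        rw [inv_vert, inv_vert, inv_flip, sub_zero, sub_self, hv]; rfl
      · have := w.tail_eq _ _ hx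
        rw [hv] at this
        rw [Option.map_some, key x.bar (Letter.Allowed.bar (w.allowed _ _ hx)) (Option.some.inj this).symm
          (by rw [hδ, sgn_prev hx])]

/-- The sign condition on consecutive letters means that a forward step is followed by the forward
sign at the next vertex, and similarly backward. So the abstract half-words are the words `w_{>i}`
and `(w_{≤i})⁻¹` whose comparison defines the walk. -/
lemma half_points (hw : w.EndAdmissible) (k : ℕ) : ∀ i ∈ w.idx.I,
    (w.points hw).half i (w.fsgn i) k = w.after i k ∧
      (w.points hw).half i (- w.fsgn i) k = w.before i k := by
  induction k with
  | zero =>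
    intro i _
    refine ⟨(lt_fsgn i).trans ?_, (lt_neg_fsgn i).trans ?_⟩
    · unfold after; simp
    · unfold before; simp
  | succ k ih =>
    intro i hi
    constructor
    · rcases hx : w.letter (i + 1) with _ | x
      · obtain ⟨n, hn, rfl⟩ := letter_isSome_or hi hx
        rw [PointSystem.half_none _ ((lt_fsgn _).trans hx)]
        exact (letter_gt hn (by omega)).symm
      · have h := congrFun ((w.points hw).tl_half ((lt_fsgn i).trans hx)) k
        refine h.trans ?_
        change (w.points hw).half (w.nx i _) _ k = _
        rw [nx_fsgn, sgn_prev hx, neg_neg, (ih _ (mem_I_of_letter hx).1).1]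
        unfold after
        push_cast
        ring_nf
    · rcases hx : w.letter i with _ | x
      · obtain ⟨n, hn, rfl⟩ := letter_isSome_or' hi hx
        rw [PointSystem.half_none _ ((lt_neg_fsgn _).trans (by rw [hx]; rfl))]
        unfold before
        rw [letter_nonpos hn (by omega)]; rfl
      · have h := congrFun ((w.points hw).tl_half ((lt_neg_fsgn i).trans (by rw [hx]; rfl))) k
        refine h.trans ?_
        change (w.points hw).half (w.nx i _) _ k = _
        have hx' : w.letter (i - 1 + 1) = some x := by rwa [sub_add_cancel]
        rw [nx_neg_fsgn, Letter.bar_bar, sgn_next hx', (ih _ (mem_I_of_letter hx).2).2]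
        unfold before
        push_cast
        ring_nf

lemma half_fsgn (hw : w.EndAdmissible) {i : ℤ} (hi : i ∈ w.idx.I) :
    (w.points hw).half i (w.fsgn i) = w.after i := funext fun k => (half_points hw k i hi).1

lemma half_neg_fsgn (hw : w.EndAdmissible) {i : ℤ} (hi : i ∈ w.idx.I) :
    (w.points hw).half i (- w.fsgn i) = w.before i := funext fun k => (half_points hw k i hi).2

lemma canon_star {i : ℤ} {s : Q₁} (h : w.letter i = some (.star s)) :
    (w.canon.letter i = some (.dir s) ↔ w.CanonDirect i) ∧
      (w.canon.letter i = some (.inv s) ↔ ¬ w.CanonDirect i) := by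
  rw [canon_letter, h, Option.map_some, Word.orient]
  split <;> simp_all

lemma canon_dir {i : ℤ} {a : Q₁} (ha : a ∉ D.Sp) :
    w.canon.letter i = some (.dir a) ↔ w.letter i = some (.dir a) := by
  rw [canon_letter]
  rcases h : w.letter i with _ | x
  · simp
  · have := w.allowed _ _ h
    cases x with
    | dir b => simp [Word.orient]
    | inv b => simp [Word.orient]
    | star s =>
      simp only [Word.orient, Option.map_some, Option.some.injEq, reduceCtorEq, iff_false]
      have hne : a ≠ s := by rintro rfl; exact ha this
      split <;> simp_all [eq_comm]

lemma canon_inv {i : ℤ} {a : Q₁} (ha : a ∉ D.Sp) :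
    w.canon.letter i = some (.inv a) ↔ w.letter i = some (.inv a) := by
  rw [canon_letter]
  rcases h : w.letter i with _ | x
  · simp
  · have := w.allowed _ _ h
    cases x with
    | dir b => simp [Word.orient]
    | inv b => simp [Word.orient]
    | star s =>
      simp only [Word.orient, Option.map_some, Option.some.injEq, reduceCtorEq, iff_false]
      have hne : a ≠ s := by rintro rfl; exact ha this
      split <;> simp_all [eq_comm]

lemma canon_special {i : ℤ} {s : Q₁} (hs : s ∈ D.Sp)
    (h : w.canon.letter i = some (.dir s) ∨ w.canon.letter i = some (.inv s)) :
    w.letter i = some (.star s) := by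
  have hst : D.st s = .star s := if_pos hs
  rw [← show w.canon.word = w from rfl, ← w.canon.spec]
  rcases h with h | h <;> rw [h] <;> simp [under, hst, Letter.bar]

lemma arrow_iff {i j : ℤ} {a : Q₁} (ha : a ∉ D.Sp) : w.canon.Arrow i j a ↔
    w.lt i (D.sgn (.inv a)) = some (.inv a) ∧ j = w.nx i (D.sgn (.inv a)) := by
  unfold Walk.Arrow
  rw [canon_dir ha, canon_inv ha]
  constructor
  · rintro (⟨h, rfl⟩ | ⟨h, rfl⟩)
    · have := sgn_prev h
      change D.sgn (.inv a) = _ at this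
      rw [this, lt_neg_fsgn, nx_neg_fsgn, h]
      exact ⟨rfl, rfl⟩
    · have h' : w.letter (j - 1 + 1) = some (.inv a) := by rwa [sub_add_cancel]
      rw [sgn_next h', lt_fsgn, nx_fsgn, h']
      exact ⟨rfl, by ring⟩
  · rintro ⟨h, rfl⟩
    rcases dir_cases h with ⟨h1, h2⟩ | ⟨h1, h2⟩
    · rw [h1, nx_fsgn]; exact Or.inr ⟨h2, by ring⟩
    · rw [h1, nx_neg_fsgn]; exact Or.inl ⟨h2, rfl⟩

variable (w) in
/-- The special letter with sign `δ` at the vertex `i` is directed away from `i`. -/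
def Fwd (i : ℤ) (δ : ℤˣ) : Prop := ∃ s ∈ D.Sp, w.canon.Arrow i (w.nx i δ) s

/-- A direct letter at the place `j` is an arrow `j → j - 1`. Hence the forward step from `i`,
through the place `i + 1`, follows the arrow if that letter is not direct, and the backward step,
through the place `i`, does so if that letter is direct. -/
lemma fwd_iff {i : ℤ} {δ : ℤˣ} {s : Q₁} (h : w.lt i δ = some (.star s)) :
    w.Fwd i δ ↔ (δ = w.fsgn i ∧ w.letter (i + 1) = some (.star s) ∧ ¬ w.CanonDirect (i + 1)) ∨
      (δ = - w.fsgn i ∧ w.letter i = some (.star s) ∧ w.CanonDirect i) := by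
  rcases dir_cases h with ⟨rfl, h1⟩ | ⟨rfl, h1⟩
  · have hs : s ∈ D.Sp := w.allowed _ _ h1
    have e := units_ne_neg (w.fsgn i)
    simp only [h1, e, false_and, or_false, true_and]
    rw [← (canon_star h1).2]
    unfold Fwd Walk.Arrow
    rw [nx_fsgn]
    constructor
    · rintro ⟨t, ht, ⟨-, h⟩ | ⟨h, -⟩⟩
      · omega
      · have := canon_special ht (Or.inr h)
        rw [h1] at this; cases this; exact h
    · exact fun h => ⟨s, hs, Or.inr ⟨h, by ring⟩⟩
  · change w.letter i = some (.star s) at h1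
    have hs : s ∈ D.Sp := w.allowed _ _ h1
    have e := (units_ne_neg (w.fsgn i)).symm
    simp only [h1, e, false_and, false_or, true_and]
    rw [← (canon_star h1).1]
    unfold Fwd Walk.Arrow
    rw [nx_neg_fsgn]
    constructor
    · rintro ⟨t, ht, ⟨h, -⟩ | ⟨-, h⟩⟩
      · have := canon_special ht (Or.inl h)
        rw [h1] at this; cases this; exact h
      · omega
    · exact fun h => ⟨s, hs, Or.inl ⟨h, rfl⟩⟩

lemma arrow_special_iff {i j : ℤ} {s : Q₁} (hs : s ∈ D.Sp) : w.canon.Arrow i j s ↔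
    w.lt i (D.sgn (.star s)) = some (.star s) ∧ j = w.nx i (D.sgn (.star s)) ∧
      w.Fwd i (D.sgn (.star s)) := by
  constructor
  · intro h
    have h0 : w.lt i (D.sgn (.star s)) = some (.star s) ∧ j = w.nx i (D.sgn (.star s)) := by
      rcases h with ⟨h, rfl⟩ | ⟨h, rfl⟩
      · have h := canon_special hs (Or.inl h)
        have h1 := sgn_prev h
        change D.sgn (.star s) = _ at h1
        rw [h1, lt_neg_fsgn, nx_neg_fsgn, h]
        exact ⟨rfl, rfl⟩
      · have h := canon_special hs (Or.inr h)
        have h' : w.letter (j - 1 + 1) = some (.star s) := by rwa [sub_add_cancel]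
        rw [sgn_next h', lt_fsgn, nx_fsgn, h']
        exact ⟨rfl, by ring⟩
    exact ⟨h0.1, h0.2, s, hs, h0.2 ▸ h⟩
  · rintro ⟨h, rfl, hf⟩
    rw [fwd_iff h] at hf
    rcases hf with ⟨h1, h2, h3⟩ | ⟨h1, h2, h3⟩
    · rw [h1, nx_fsgn]
      exact Or.inr ⟨(canon_star h2).2.2 h3, by ring⟩
    · rw [h1, nx_neg_fsgn]
      exact Or.inl ⟨(canon_star h2).1.2 h3, rfl⟩

lemma seqLt_le {f g : ℕ → Option (Letter Q₁)} (h : SeqLt f g) : SeqLe f g := by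
  obtain ⟨k, h1, h2⟩ := h
  exact Or.inr ⟨k, h1, h2⟩

lemma canonDirect_le {c : ℤ} (h : w.CanonDirect c) :
    SeqLe (w.after c) (w.before (c - 1)) := by
  rcases h with h | ⟨h, -⟩
  · exact seqLt_le h
  · exact Or.inl h.symm

/-- The two sides of a `*`-letter are comparable, so a letter which is not direct has the reverse
inequality; at a symmetry the two sides are equal and either direction is compatible with the order.
-/
lemma canonDirect_ge (hw : w.EndAdmissible) {c : ℤ} {s : Q₁} (hs : w.letter c = some (.star s))
    (h : ¬ w.CanonDirect c) : SeqLe (w.before (c - 1)) (w.after c) := by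
  rcases w.trichotomy hw hs with h1 | h1 | h1
  · exact seqLt_le h1
  · exact Or.inl h1
  · exact absurd (Or.inl h1) h

lemma half_star_next (hw : w.EndAdmissible) {i : ℤ} {s : Q₁}
    (h : w.letter (i + 1) = some (.star s)) :
    (w.points hw).half i (- w.fsgn i) = w.before (i + 1 - 1) ∧
      (w.points hw).half (i + 1) (- w.fsgn i) = w.after (i + 1) := by
  have hI := mem_I_of_letter h
  rw [add_sub_cancel_right] at *
  refine ⟨half_neg_fsgn hw hI.2, ?_⟩
  have h1 := sgn_prev h
  change D.sgn (.star s) = _ at h1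
  rw [← sgn_next h, h1, neg_neg, half_fsgn hw hI.1]

lemma half_star_prev (hw : w.EndAdmissible) {i : ℤ} {s : Q₁}
    (h : w.letter i = some (.star s)) :
    (w.points hw).half i (- - w.fsgn i) = w.after i ∧
      (w.points hw).half (i - 1) (- - w.fsgn i) = w.before (i - 1) := by
  have hI := mem_I_of_letter h
  rw [neg_neg]
  refine ⟨half_fsgn hw hI.1, ?_⟩
  have h1 := sgn_prev h
  change D.sgn (.star s) = _ at h1
  have h' : w.letter (i - 1 + 1) = some (.star s) := by rwa [sub_add_cancel]
  have h2 := sgn_next h'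
  rw [← half_neg_fsgn hw hI.2, ← h2, h1, neg_neg]

variable (w) in
/-- The directions of special letters in the canonically associated walk. -/
def orientation (hw : w.EndAdmissible) : (w.points hw).Orientation where
  fwd := w.Fwd
  le {i δ s} h hf := by
    rw [fwd_iff h] at hf
    change SeqLe _ ((w.points hw).half (w.nx i δ) _)
    rcases hf with ⟨rfl, h2, h3⟩ | ⟨rfl, h2, h3⟩
    · rw [nx_fsgn, (half_star_next hw h2).1, (half_star_next hw h2).2]
      exact canonDirect_ge hw h2 h3
    · rw [nx_neg_fsgn, (half_star_prev hw h2).1, (half_star_prev hw h2).2]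
      exact canonDirect_le h3
  ge {i δ s} h hf := by
    rw [fwd_iff h] at hf
    change SeqLe ((w.points hw).half (w.nx i δ) _) _
    rcases dir_cases h with ⟨rfl, h2⟩ | ⟨rfl, h2⟩
    · rw [nx_fsgn, (half_star_next hw h2).1, (half_star_next hw h2).2]
      refine canonDirect_le ?_
      by_contra h3
      exact hf (Or.inl ⟨rfl, h2, h3⟩)
    · change w.letter i = some (.star s) at h2
      rw [nx_neg_fsgn, (half_star_prev hw h2).1, (half_star_prev hw h2).2]
      refine canonDirect_ge hw h2 fun h3 => hf (Or.inr ⟨rfl, h2, h3⟩)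
  symm {i δ s} h := by
    change w.Fwd (w.nx i δ) δ ↔ _
    have hb := (PointSystem.star_back (S := w.points hw) h).1
    change w.lt (w.nx i δ) δ = _ at hb
    rw [fwd_iff hb, fwd_iff h]
    rcases dir_cases h with ⟨rfl, h2⟩ | ⟨rfl, h2⟩
    · have h1 := sgn_prev h2
      change D.sgn (.star s) = _ at h1
      rw [sgn_next h2] at h1
      have e := units_ne_neg (w.fsgn (i + 1))
      rw [nx_fsgn, h1]
      simp [h2, e.symm]
    · change w.letter i = some (.star s) at h2
      have h' : w.letter (i - 1 + 1) = some (.star s) := by rwa [sub_add_cancel]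
      have h1 := sgn_prev h2
      change D.sgn (.star s) = _ at h1
      rw [sgn_next h'] at h1
      have e := units_ne_neg (w.fsgn i)
      rw [nx_neg_fsgn, h1]
      simp [h2, e.symm]

variable [Fintype Q₀] {N : Type*} [AddCommGroup N] [Module D.Alg N]

/-- Compatible families are the images of the generators under homomorphisms. -/
lemma compat_iff (hw : w.EndAdmissible) {θ : ℤ → N} :
    Compat w.canon θ ↔ (w.orientation hw).Compatible θ := by
  have e : ∀ i (a : Q₁), a ∉ D.Sp → ((∀ j, ¬ w.canon.Arrow i j a) ↔
      (w.points hw).lt i (D.sgn (.inv a)) ≠ some (.inv a)) := by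
    intro i a ha
    simp only [arrow_iff ha, not_and]
    exact ⟨fun h h' => h _ h' rfl, fun h j h' => absurd h' h⟩
  constructor
  · intro h
    refine ⟨h.out, h.vertex, fun i δ l hl => ?_, fun i a ha hv h' => h.zero i a ha hv ((e i a ha).2 h')⟩
    cases l with
    | dir a =>
      rw [PointSystem.rel_dir hl]
      have ha : a ∉ D.Sp := (w.points hw).allowed hl
      refine h.arrow _ _ _ ((arrow_iff ha).2 ⟨(w.points hw).back hl, ?_⟩)
      exact ((w.points hw).back_nx hl).symm
    | inv a =>
      rw [PointSystem.rel_inv hl]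
      have ha : a ∉ D.Sp := (w.points hw).allowed hl
      have hs : D.sgn (.inv a) = δ := (w.points hw).sign hl
      refine h.arrow _ _ _ ((arrow_iff ha).2 ?_)
      rw [hs]
      exact ⟨hl, rfl⟩
    | star s =>
      rw [PointSystem.rel_star hl]
      have ha : s ∈ D.Sp := (w.points hw).allowed hl
      have hs : D.sgn (.star s) = δ := (w.points hw).sign hl
      by_cases hf : (w.orientation hw).fwd i δ
      · refine Or.inl ⟨hf, h.arrow _ _ _ ((arrow_special_iff ha).2 ?_)⟩
        rw [hs]; exact ⟨hl, rfl, hf⟩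
      · refine Or.inr ⟨hf, h.arrow _ _ _ ((arrow_special_iff ha).2 ?_)⟩
        rw [hs]
        have hb := PointSystem.star_back hl
        exact ⟨hb.1, hb.2.symm, ((w.orientation hw).symm hl).2 hf⟩
  · intro h
    refine ⟨h.out, h.vtx, fun i j a ha => ?_, fun i a ha hv h' => h.zero i a ha hv ((e i a ha).1 h')⟩
    by_cases hs : a ∈ D.Sp
    · obtain ⟨h1, rfl, h2⟩ := (arrow_special_iff hs).1 ha
      have := h.rel i _ _ h1
      rw [PointSystem.rel_star h1] at this
      exact (this.resolve_right fun h' => h'.1 h2).2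
    · obtain ⟨h1, rfl⟩ := (arrow_iff hs).1 ha
      have := h.rel i _ _ h1
      rwa [PointSystem.rel_inv h1] at this

end Word

end WordPoints
end Clannish
end SLC
end

noncomputable section
namespace SLC
namespace Clannish

/-! ### Homomorphisms from string and band modules to decomposed modules -/

section Kernel

/-- Continuation of an element to a sequence in both directions. -/
lemma exists_two_sided {N : Type*} {r : ℤ → N → N → Prop} {G : ℤ → Set N} {i₀ : ℤ}
    (up : ∀ i, i₀ ≤ i → ∀ x ∈ G i, ∃ y ∈ G (i + 1), r i x y)
    (down : ∀ i, i < i₀ → ∀ y ∈ G (i + 1), ∃ x ∈ G i, r i x y) {x : N} (hx : x ∈ G i₀) :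
    ∃ θ : ℤ → N, θ i₀ = x ∧ (∀ i, θ i ∈ G i) ∧ ∀ i, r i (θ i) (θ (i + 1)) := by
  have up' : ∀ (k : ℕ) (x : G (i₀ + k)), ∃ y : G (i₀ + (k + 1 : ℕ)), r (i₀ + k) x y := by
    intro k x
    obtain ⟨y, hy, h⟩ := up (i₀ + k) (by omega) x x.2
    refine ⟨⟨y, ?_⟩, h⟩
    push_cast
    rwa [← add_assoc]
  have down' : ∀ (k : ℕ) (y : G (i₀ - k)), ∃ x : G (i₀ - (k + 1 : ℕ)),
      r (i₀ - (k + 1 : ℕ)) x y := by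
    intro k y
    obtain ⟨x, hx, h⟩ := down (i₀ - (k + 1 : ℕ)) (by omega) y (by
      have := y.2
      push_cast
      rwa [show i₀ - ((k : ℤ) + 1) + 1 = i₀ - k by ring])
    exact ⟨⟨x, hx⟩, h⟩
  choose fu hu using up'
  choose fd hd using down'
  let f : (k : ℕ) → G (i₀ + k) := fun k =>
    Nat.rec ⟨x, by simpa using hx⟩ (fun k y => fu k y) k
  let g : (k : ℕ) → G (i₀ - k) := fun k =>
    Nat.rec ⟨x, by simpa using hx⟩ (fun k y => fd k y) k
  let θ : ℤ → N := fun i => if i₀ ≤ i then (f (i - i₀).toNat).1 else (g (i₀ - i).toNat).1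
  have hf : ∀ k : ℕ, θ (i₀ + k) = (f k).1 := by
    intro k
    change (if _ then _ else _) = _
    rw [if_pos (by omega), show (i₀ + k - i₀).toNat = k by omega]
  have hg : ∀ k : ℕ, θ (i₀ - k) = (g k).1 := by
    intro k
    rcases Nat.eq_zero_or_pos k with rfl | hk
    · have := hf 0
      simp only [Nat.cast_zero, add_zero, sub_zero] at this ⊢
      exact this
    · change (if _ then _ else _) = _
      rw [if_neg (by omega), show (i₀ - (i₀ - (k : ℤ))).toNat = k by omega]
  refine ⟨θ, ?_, fun i => ?_, fun i => ?_⟩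
  · have : θ (i₀ + (0 : ℕ)) = x := hf 0
    simpa using this
  · rcases le_or_gt i₀ i with h | h
    · obtain ⟨k, rfl⟩ : ∃ k : ℕ, i = i₀ + k := ⟨(i - i₀).toNat, by omega⟩
      rw [hf]; exact (f k).2
    · obtain ⟨k, rfl⟩ : ∃ k : ℕ, i = i₀ - k := ⟨(i₀ - i).toNat, by omega⟩
      rw [hg]; exact (g k).2
  · rcases le_or_gt i₀ i with h | h
    · obtain ⟨k, rfl⟩ : ∃ k : ℕ, i = i₀ + k := ⟨(i - i₀).toNat, by omega⟩
      have e := hf (k + 1)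
      push_cast at e
      rw [hf, add_assoc, e]
      exact hu k (f k)
    · obtain ⟨k, rfl⟩ : ∃ k : ℕ, i = i₀ - (k + 1 : ℕ) := ⟨(i₀ - i - 1).toNat, by omega⟩
      rw [hg, show i₀ - ((k + 1 : ℕ) : ℤ) + 1 = i₀ - k by push_cast; ring, hg]
      exact hd k (g k)

variable {K Q₀ Q₁ : Type*} [DivisionRing K] {D : Clannish K Q₀ Q₁} [Fintype Q₀]
  {P N : Type*} [AddCommGroup N] [Module D.Alg N] {S : PointSystem D P} {R : S.Rep N}

namespace Word

open PointSystem PointSystem.Rep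

variable {w : D.Word} (hw : w.EndAdmissible)

/-- The relation between the elements at the vertices `i` and `i + 1`. -/
abbrev Step (i : ℤ) (x y : N) : Prop :=
  ∀ l, w.letter (i + 1) = some l → (w.orientation hw).Rel (w.points hw) i (w.fsgn i) x y

/-- Backward relations are forward relations seen from the other end, so it is enough to build
sequences by forward steps. -/
lemma step_rel {θ : ℤ → N} (h : ∀ i, Step hw i (θ i) (θ (i + 1))) (i : ℤ) (δ : ℤˣ)
    (l : Letter Q₁) (hl : (w.points hw).lt i δ = some l) :
    (w.orientation hw).Rel (w.points hw) i δ (θ i) (θ ((w.points hw).nx i δ)) := by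
  rcases dir_cases hl with ⟨rfl, h1⟩ | ⟨rfl, h1⟩
  · change Orientation.Rel _ _ _ _ _ (θ (w.nx i _))
    rw [nx_fsgn]; exact h i l h1
  · have h2 : w.letter (i - 1 + 1) = some l.bar := by rwa [sub_add_cancel]
    have h3 := h (i - 1) l.bar h2
    rw [← rel_symm ((lt_fsgn _).trans h2)] at h3
    change Orientation.Rel _ _ (w.nx (i - 1) (w.fsgn (i - 1))) _ _ _ at h3
    rw [nx_fsgn, sub_add_cancel, Letter.bar_bar, (w.points hw).sign hl] at h3
    change Orientation.Rel _ _ _ _ _ (θ (w.nx i _))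
    rwa [nx_neg_fsgn]

lemma rel_step {θ : ℤ → N} (h : (w.orientation hw).Compatible θ) (i : ℤ) :
    Step hw i (θ i) (θ (i + 1)) := by
  intro l hl
  have := h.rel i (w.fsgn i) l ((lt_fsgn _).trans hl)
  change Orientation.Rel _ _ _ _ _ (θ (w.nx i _)) at this
  rwa [nx_fsgn] at this

lemma step_zero (i : ℤ) : Step hw i (0 : N) 0 := fun _ _ => rel_zero i _

/-- Where the word has no letter there is nothing to satisfy, and the sequence goes on with zero;
elsewhere this is `exists_rel`. -/
lemma step_up (hS : D.NonSingular) (hN : D.NormallyBound) (i : ℤ) {x : N}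
    (hx : x ∈ R.lowSub (w.points hw) i) :
    ∃ y ∈ R.lowSub (w.points hw) (i + 1), Step hw i x y := by
  rcases h : w.letter (i + 1) with _ | l
  · exact ⟨0, AddSubgroup.zero_mem _, fun l hl => by rw [h] at hl; cases hl⟩
  · obtain ⟨y, hy, h1⟩ := exists_rel (w.orientation hw) hS hN ((lt_fsgn _).trans h) hx
    change y ∈ R.lowSub (w.points hw) (w.nx i _) at hy
    rw [nx_fsgn] at hy
    exact ⟨y, hy, fun _ _ => h1⟩

lemma step_down (hS : D.NonSingular) (hN : D.NormallyBound) (i : ℤ) {y : N}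
    (hy : y ∈ R.lowSub (w.points hw) (i + 1)) :
    ∃ x ∈ R.lowSub (w.points hw) i, Step hw i x y := by
  rcases h : w.letter (i + 1) with _ | l
  · exact ⟨0, AddSubgroup.zero_mem _, fun l hl => by rw [h] at hl; cases hl⟩
  · have hl := (lt_fsgn i).trans h
    have hb := (w.points hw).back hl
    have hbn := (w.points hw).back_nx hl
    change w.nx (w.nx i _) _ = i at hbn
    change (w.points hw).lt (w.nx i _) _ = _ at hb
    rw [nx_fsgn] at hb hbn
    obtain ⟨x, hx, h1⟩ := exists_rel (w.orientation hw) hS hN hb hy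
    change x ∈ R.lowSub (w.points hw) (w.nx _ _) at hx
    rw [hbn] at hx
    refine ⟨x, hx, fun _ _ => ?_⟩
    rw [← rel_symm hl]
    change Orientation.Rel _ _ (w.nx i _) _ _ _
    rwa [nx_fsgn]

variable (π : TwistFamily w.canon)

lemma ev_compatible (θ : T π N) : (w.orientation hw).Compatible θ.ev := by
  rw [← compat_iff]
  refine ⟨fun i hi => ?_, fun i v hv => ?_, fun i j a ha => ?_, fun i a ha hv h => ?_⟩
  · exact (congrArg θ.hom (b_out w.canon hi)).trans (map_zero _)
  · exact (map_smul θ.hom _ _).symm.trans (congrArg θ.hom (b_vertex w.canon hv))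
  · exact (map_smul θ.hom _ _).symm.trans (congrArg θ.hom (b_arrow w.canon ha))
  · exact (map_smul θ.hom _ _).symm.trans ((congrArg θ.hom (b_zero w.canon ha hv h)).trans
      (map_zero _))

lemma exists_ev {θ : ℤ → N} (h : ∀ i, θ i ∈ R.lowSub (w.points hw) i)
    (hs : ∀ i, Step hw i (θ i) (θ (i + 1))) : ∃ η : T π N, ∀ i, η.ev i = θ i := by
  have hc := (compat_iff hw).2 (compatible_of_mem h (step_rel hw hs))
  exact ⟨M.lift w.canon θ hc, fun i => M.lift_b w.canon θ hc i⟩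

/-- Every bounded element at a vertex is the value of a homomorphism. -/
lemma exists_ev_eq (hS : D.NonSingular) (hN : D.NormallyBound) {i : ℤ} {x : N}
    (hx : x ∈ R.lowSub (w.points hw) i) : ∃ η : T π N, η.ev i = x := by
  obtain ⟨θ, h1, h2, h3⟩ := exists_two_sided (r := Step hw)
    (G := fun i => (R.lowSub (w.points hw) i : Set N)) (fun i _ x hx => step_up hw hS hN i hx)
    (fun i _ y hy => step_down hw hS hN i hy) hx
  obtain ⟨η, hη⟩ := exists_ev hw π h2 h3
  exact ⟨η, by rw [hη, h1]⟩

/-- The admissible values are prescribed as `0` before `i`, as `x` at `i`, and as arbitrary bounded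
elements after `i`. The only step not already available is the one from `0` to `x`, which is the
hypothesis `h0`. -/
lemma exists_ev_zero_before (hS : D.NonSingular) (hN : D.NormallyBound) {i : ℤ} {x : N}
    (hx : x ∈ R.lowSub (w.points hw) i) (h0 : Step hw (i - 1) 0 x) :
    ∃ η : T π N, η.ev i = x ∧ ∀ j < i, η.ev j = 0 := by
  classical
  let G : ℤ → Set N := fun j =>
    if j < i then {0} else if j = i then {x} else (R.lowSub (w.points hw) j : Set N)
  have G0 : ∀ j < i, G j = {0} := fun j hj => if_pos hj
  have G1 : G i = {x} := (if_neg (lt_irrefl i)).trans (if_pos rfl)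
  have G2 : ∀ j, i < j → G j = R.lowSub (w.points hw) j := fun j hj =>
    (if_neg hj.not_gt).trans (if_neg hj.ne')
  have hG : ∀ j, ∀ y ∈ G j, y ∈ R.lowSub (w.points hw) j := by
    intro j y hy
    rcases lt_trichotomy j i with h | rfl | h
    · rw [G0 j h] at hy; rw [Set.mem_singleton_iff.1 hy]; exact AddSubgroup.zero_mem _
    · rw [G1] at hy; rw [Set.mem_singleton_iff.1 hy]; exact hx
    · rwa [G2 j h] at hy
  have up : ∀ j, i ≤ j → ∀ y ∈ G j, ∃ z ∈ G (j + 1), Step hw j y z := by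
    intro j hj y hy
    rw [G2 (j + 1) (by omega)]
    exact step_up hw hS hN j (hG j y hy)
  have down : ∀ j, j < i → ∀ y ∈ G (j + 1), ∃ z ∈ G j, Step hw j z y := by
    intro j hj y hy
    refine ⟨0, by rw [G0 j hj]; rfl, ?_⟩
    rcases lt_or_ge (j + 1) i with h | h
    · rw [G0 _ h] at hy
      rw [Set.mem_singleton_iff.1 hy]; exact step_zero hw j
    · obtain rfl : i = j + 1 := by omega
      rw [G1] at hy
      rw [add_sub_cancel_right] at h0
      rw [Set.mem_singleton_iff.1 hy]; exact h0
  obtain ⟨θ, h1, h2, h3⟩ := exists_two_sided up down (x := x) (by rw [G1]; rfl)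
  obtain ⟨η, hη⟩ := exists_ev hw π (fun j => hG j _ (h2 j)) h3
  refine ⟨η, by rw [hη, h1], fun j hj => ?_⟩
  have := h2 j
  rw [G0 j hj] at this
  rw [hη, Set.mem_singleton_iff.1 this]

lemma exists_ev_zero_after (hS : D.NonSingular) (hN : D.NormallyBound) {i : ℤ} {x : N}
    (hx : x ∈ R.lowSub (w.points hw) i) (h0 : Step hw i x 0) :
    ∃ η : T π N, η.ev i = x ∧ ∀ j > i, η.ev j = 0 := by
  classical
  let G : ℤ → Set N := fun j =>
    if i < j then {0} else if j = i then {x} else (R.lowSub (w.points hw) j : Set N)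
  have G0 : ∀ j > i, G j = {0} := fun j hj => if_pos hj
  have G1 : G i = {x} := (if_neg (lt_irrefl i)).trans (if_pos rfl)
  have G2 : ∀ j, j < i → G j = R.lowSub (w.points hw) j := fun j hj =>
    (if_neg hj.not_gt).trans (if_neg hj.ne)
  have hG : ∀ j, ∀ y ∈ G j, y ∈ R.lowSub (w.points hw) j := by
    intro j y hy
    rcases lt_trichotomy i j with h | rfl | h
    · rw [G0 j h] at hy; rw [Set.mem_singleton_iff.1 hy]; exact AddSubgroup.zero_mem _
    · rw [G1] at hy; rw [Set.mem_singleton_iff.1 hy]; exact hx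
    · rwa [G2 j h] at hy
  have down : ∀ j, j < i → ∀ y ∈ G (j + 1), ∃ z ∈ G j, Step hw j z y := by
    intro j hj y hy
    rw [G2 j hj]
    exact step_down hw hS hN j (hG _ y hy)
  have up : ∀ j, i ≤ j → ∀ y ∈ G j, ∃ z ∈ G (j + 1), Step hw j y z := by
    intro j hj y hy
    refine ⟨0, by rw [G0 _ (by omega)]; rfl, ?_⟩
    rcases hj.lt_or_eq with h | rfl
    · rw [G0 _ h] at hy
      rw [Set.mem_singleton_iff.1 hy]; exact step_zero hw j
    · rw [G1] at hy
      rw [Set.mem_singleton_iff.1 hy]; exact h0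
  obtain ⟨θ, h1, h2, h3⟩ := exists_two_sided up down (x := x) (by rw [G1]; rfl)
  obtain ⟨η, hη⟩ := exists_ev hw π (fun j => hG j _ (h2 j)) h3
  refine ⟨η, by rw [hη, h1], fun j hj => ?_⟩
  have := h2 j
  rw [G0 j hj] at this
  rw [hη, Set.mem_singleton_iff.1 this]

variable (w) in
lemma Bplus_fin {n : ℕ} (h : w.idx = .fin n) : Bplus π N = endCond π N 0 (- w.sign) := by
  unfold Bplus
  rw [show w.canon.word = w from rfl, h]

variable (w) in
lemma Bplus_int (h : w.idx = .int) : Bplus π N = vanish π N Filter.atBot := by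
  unfold Bplus
  rw [show w.canon.word = w from rfl, h]

variable (w) in
lemma Bminus_fin {n : ℕ} (h : w.idx = .fin n) :
    Bminus π N = endCond π N n (- w.inv.sign) := by
  unfold Bminus
  rw [show w.canon.word = w from rfl, h]

variable (w) in
lemma Bminus_int (h : w.idx = .int) : Bminus π N = vanish π N Filter.atTop := by
  unfold Bminus
  rw [show w.canon.word = w from rfl, h]

lemma mem_trivMinus {v : Q₀} {δ : ℤˣ} {a : Q₁} (hv : D.head a = v) (hs : D.sgn (D.st a) = δ)
    (y : N) : D.arr a • y ∈ trivMinus D v δ N := by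
  have : imageArr (D := D) N a ≤ trivMinus D v δ N :=
    le_iSup (fun a : {a : Q₁ // D.head a = v ∧ D.sgn (D.st a) = δ} => imageArr (D := D) N a)
      ⟨a, hv, hs⟩
  exact this ⟨y, rfl⟩

/-- The values at a vertex of the elements of `B⁺ + B⁻`. -/
def valSub (i : ℤ) : AddSubgroup N where
  carrier := {x | ∃ θ ∈ Bplus π N ⊔ Bminus π N, θ.ev i = x}
  zero_mem' := ⟨0, Submodule.zero_mem _, T.ev_zero i⟩
  add_mem' := by
    rintro _ _ ⟨θ, hθ, rfl⟩ ⟨η, hη, rfl⟩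
    exact ⟨θ + η, Submodule.add_mem _ hθ hη, T.ev_add θ η i⟩
  neg_mem' := by
    rintro _ ⟨θ, hθ, rfl⟩
    exact ⟨-θ, Submodule.neg_mem _ hθ, rfl⟩

omit [Fintype Q₀] in
lemma letterLt_end {i : ℤ} {δ : ℤˣ} {q : P} (hi : w.lt i δ = Option.none)
    (h : LtAt 0 (S.half q δ) ((w.points hw).half i δ)) : ∃ y, S.lt q δ = some (.dir y) := by
  have h := h.2
  rw [half_zero, half_zero] at h
  change LetterLt _ (w.lt i δ) at h
  rw [hi] at h
  rcases h with ⟨-, b, h⟩ | ⟨h, -⟩ | ⟨-, b, h⟩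
  · cases h
  · exact h
  · cases h

lemma pr_mem_trivMinus (R : S.Rep N) {q : P} {δ : ℤˣ} {y : Q₁} {v : Q₀}
    (hy : S.lt q δ = some (.dir y)) (hv : S.vtx q = some v) (x : N) :
    R.pr q x ∈ trivMinus D v δ N := by
  have hb : S.lt (S.nx q δ) (D.sgn (.inv y)) = some (.inv y) := S.back hy
  have hbn : S.nx (S.nx q δ) (D.sgn (.inv y)) = q := S.back_nx hy
  obtain ⟨z, hz⟩ := R.ord_surj hb x
  rw [hbn] at hz
  rw [← hz]
  have hst : D.st y = .dir y := if_neg (S.allowed hy)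
  have h1 := S.head hy
  rw [hv] at h1
  exact mem_trivMinus (Option.some.inj h1).symm (by rw [hst]; exact S.sign hy) _

/-- If `q` is smaller already in the next letter and the word goes on, that letter must be an
inverse letter `b⁻¹` which `q` does not have. So `b` kills the component and zero is a legitimate
continuation. -/
lemma rel_base {i : ℤ} {δ : ℤˣ} {q : P}
    (h : LtAt 0 (S.half q δ) ((w.points hw).half i δ)) (x : N) :
    ∀ l, w.lt i δ = some l →
      (w.orientation hw).Rel (w.points hw) i δ (R.pr q x) 0 := by
  intro l hl
  have h := h.2
  rw [half_zero, half_zero] at h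
  change LetterLt _ (w.lt i δ) at h
  rcases h with ⟨⟨y, h1⟩, b, h2⟩ | ⟨⟨y, h1⟩, h2⟩ | ⟨h1, b, h2⟩
  · have ha : b ∉ D.Sp := (w.points hw).allowed h2
    have hs : D.sgn (.inv b) = δ := (w.points hw).sign h2
    rw [rel_inv h2]
    refine R.ord_zero ha ?_ x
    rw [hs, h1]; simp
  · rw [h2] at hl; cases hl
  · have ha : b ∉ D.Sp := (w.points hw).allowed h2
    have hs : D.sgn (.inv b) = δ := (w.points hw).sign h2
    rw [rel_inv h2]
    refine R.ord_zero ha ?_ x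
    rw [hs, h1]; simp

/-- Continue the component by zero on the side where `q` is smaller and arbitrarily on the other
side. For a band the resulting homomorphism lies in `B⁺` or `B⁻`. For a string it vanishes at the
end in question, unless `i` is that end; then `q` starts with a direct letter, and the component
lies in the image of the corresponding arrow. -/
lemma pr_mem_valSub (hS : D.NonSingular) (hN : D.NormallyBound) {i : ℤ} {δ : ℤˣ} {q : P}
    (hq : (w.points hw).Low S i q) (h : LtAt 0 (S.half q δ) ((w.points hw).half i δ)) (x : N) :
    R.pr q x ∈ valSub π i := by
  rcases hv : w.vert i with _ | v
  · rw [R.none (hq.1.trans hv)]; exact AddSubgroup.zero_mem _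
  have hiI : i ∈ w.idx.I := by rw [← w.vert_dom, hv]; rfl
  have hx := pr_mem_lowSub (R := R) hq x
  by_cases hδ : δ = w.fsgn i
  · subst hδ
    obtain ⟨η, h1, h2⟩ := exists_ev_zero_after hw π hS hN hx fun l hl =>
      rel_base hw h x l ((lt_fsgn i).trans hl)
    refine ⟨η, (le_sup_right : Bminus π N ≤ _) ?_, h1⟩
    rcases hidx : w.idx with n | _
    · rw [Bminus_fin w π hidx]
      intro v' hv'
      have hin : i ≤ n := by rw [hidx] at hiI; exact hiI.2
      rcases hin.lt_or_eq with hlt | rfl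
      · rw [h2 _ hlt]; exact Submodule.zero_mem _
      · rw [h1]
        obtain ⟨y, hy⟩ := letterLt_end hw ((lt_fsgn _).trans (letter_gt hidx (by omega))) h
        rw [← fsgn_last hidx]
        exact pr_mem_trivMinus R hy (hq.1.trans hv') x
    · rw [Bminus_int w π hidx]
      filter_upwards [Filter.eventually_gt_atTop i] with j hj using h2 j hj
  · obtain rfl := neg_eq_of_ne hδ
    obtain ⟨η, h1, h2⟩ := exists_ev_zero_before hw π hS hN hx fun l hl => by
      have hl' : w.lt i (- w.fsgn i) = some l.bar := by
        rw [lt_neg_fsgn, show w.letter i = some l by rwa [sub_add_cancel] at hl]; rfl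
      have hr := rel_base (R := R) hw h x _ hl'
      rw [← rel_symm hl'] at hr
      change Orientation.Rel _ _ (w.nx i _) _ _ _ at hr
      rwa [nx_neg_fsgn, Letter.bar_bar, sgn_next hl] at hr
    refine ⟨η, (le_sup_left : Bplus π N ≤ _) ?_, h1⟩
    rcases hidx : w.idx with n | _
    · rw [Bplus_fin w π hidx]
      intro v' hv'
      have hin : 0 ≤ i := by rw [hidx] at hiI; exact hiI.1
      rcases hin.lt_or_eq with hlt | rfl
      · rw [h2 _ hlt]; exact Submodule.zero_mem _
      · rw [h1]
        obtain ⟨y, hy⟩ := letterLt_end hw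
          ((lt_neg_fsgn _).trans (by rw [letter_nonpos hidx le_rfl]; rfl)) h
        rw [← fsgn_zero hidx]
        exact pr_mem_trivMinus R hy (hq.1.trans hv') x
    · rw [Bplus_int w π hidx]
      filter_upwards [Filter.eventually_lt_atBot i] with j hj using h2 j hj

lemma ev_mem_lowSub (hS : D.NonSingular) (θ : T π N) (i : ℤ) :
    θ.ev i ∈ R.lowSub (w.points hw) i := compatible_mem hS (ev_compatible hw π θ) i

/-- The values of elements of `B⁺ + B⁻` are bounded, are related along letters and are stable under
scalars, so they satisfy the closure conditions of `mem_of_matZero`, with `pr_mem_valSub` as the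
base case. -/
lemma valSub_of_matZero (hS : D.NonSingular) (hN : D.NormallyBound) {i : ℤ} {x : N}
    (hx : x ∈ R.lowSub (w.points hw) i) (h0 : R.MatZero (w.points hw) i x) :
    x ∈ valSub π i := by
  refine mem_of_matZero (O := w.orientation hw) hS (U := valSub π) ?_ ?_ ?_ ?_ hx h0
  · rintro i _ ⟨θ, -, rfl⟩
    exact ev_mem_lowSub hw π hS θ i
  · rintro i δ l hl _ ⟨θ, hθ, rfl⟩
    exact ⟨_, ⟨θ, hθ, rfl⟩, (ev_compatible hw π θ).rel i δ l hl⟩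
  · rintro i l _ ⟨θ, hθ, rfl⟩
    refine ⟨(π.toFun i).symm l • θ, Submodule.smul_mem _ _ hθ, ?_⟩
    rw [T.ev_smul, RingEquiv.apply_symm_apply]
  · exact fun i δ q hq h x => pr_mem_valSub hw π hS hN hq h x

lemma matZero_step (hS : D.NonSingular) (θ : T π N) {i : ℤ} {l : Letter Q₁}
    (hl : w.letter (i + 1) = some l) :
    R.MatZero (w.points hw) i (θ.ev i) ↔ R.MatZero (w.points hw) (i + 1) (θ.ev (i + 1)) := by
  have h1 := (lt_fsgn i).trans hl
  have hr := rel_step hw (ev_compatible hw π θ) i l hl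
  have hx := ev_mem_lowSub (R := R) hw π hS θ
  constructor
  · intro h
    have := matZero_rel hS h1 (hx i) (y := θ.ev (i + 1)) (by
      change _ ∈ R.lowSub _ (w.nx i _)
      rw [nx_fsgn]; exact hx _) hr h
    change MatZero _ _ (w.nx i _) _ at this
    rwa [nx_fsgn] at this
  · intro h
    have hb := (w.points hw).back h1
    have hbn := (w.points hw).back_nx h1
    change w.nx (w.nx i _) _ = i at hbn
    change (w.points hw).lt (w.nx i _) _ = _ at hb
    rw [← rel_symm h1] at hr
    change Orientation.Rel _ _ (w.nx i _) _ _ _ at hr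
    rw [nx_fsgn] at hb hbn hr
    have := matZero_rel hS hb (hx (i + 1)) (y := θ.ev i) (by
      change _ ∈ R.lowSub _ (w.nx _ _)
      rw [hbn]; exact hx _) hr h
    change MatZero _ _ (w.nx _ _) _ at this
    rwa [hbn] at this

/-- By `matZero_rel`, used in both directions of each letter, the condition is constant along the
word. It may therefore be tested wherever membership in `B⁺` or `B⁻` gives information. -/
lemma matZero_iff (hS : D.NonSingular) (θ : T π N) {i j : ℤ} (hi : i ∈ w.idx.I)
    (hj : j ∈ w.idx.I) :
    R.MatZero (w.points hw) i (θ.ev i) ↔ R.MatZero (w.points hw) j (θ.ev j) := by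
  refine w.canon.induct (S := fun j => R.MatZero (w.points hw) i (θ.ev i) ↔
    R.MatZero (w.points hw) j (θ.ev j)) hi Iff.rfl (fun k l a ha => iff_congr Iff.rfl ?_) j hj
  rcases ha with ⟨h, rfl⟩ | ⟨h, rfl⟩
  · have hs := w.canon.spec k
    rw [h] at hs
    have := matZero_step (R := R) hw π hS θ (i := k - 1) (by rw [sub_add_cancel]; exact hs.symm)
    rw [sub_add_cancel] at this
    exact this.symm
  · have hs := w.canon.spec l
    rw [h] at hs
    have := matZero_step (R := R) hw π hS θ (i := l - 1) (by rw [sub_add_cancel]; exact hs.symm)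
    rwa [sub_add_cancel] at this

lemma matZero_zero (i : ℤ) : R.MatZero (w.points hw) i 0 := fun _ _ => map_zero _

/-- A matching point has no letter of sign `δ` either, hence no ordinary arrow with that sign maps
onto its summand. A special loop of sign `δ` cannot occur, since it would give a letter at `i`. -/
lemma matZero_of_trivMinus {i : ℤ} {δ : ℤˣ} {v : Q₀} (hv : w.vert i = some v)
    (hi : w.lt i δ = Option.none) {x : N} (hx : x ∈ trivMinus D v δ N) :
    R.MatZero (w.points hw) i x := by
  intro q hq
  refine Submodule.iSup_induction (M := Restrict D.inK N) _
    (motive := fun x => R.pr q (x : N) = 0) hx ?_ (map_zero (R.pr q))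
    fun x y hx hy => (map_add (R.pr q) x y).trans ((congrArg₂ (· + ·) hx hy).trans (add_zero _))
  rintro ⟨a, ha1, ha2⟩ _ ⟨y, rfl⟩
  by_cases ha : a ∈ D.Sp
  · rw [show D.st a = .star a from if_pos ha] at ha2
    have := (w.points hw).star ha (hv.trans (by rw [ha1]))
    rw [ha2] at this
    exact absurd (hi.symm.trans this) (by simp)
  · rw [show D.st a = .dir a from if_neg ha] at ha2
    refine R.pr_ord_zero ha ?_ y
    have h1 := congrFun (hq.2 δ) 0
    rw [half_zero, half_zero] at h1
    rw [ha2, h1, show (w.points hw).lt i δ = none from hi]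
    simp

omit [Fintype Q₀] in
lemma zero_mem_I (hsb : w.IsString ∨ w.IsBand) : (0 : ℤ) ∈ w.idx.I := by
  rcases hsb with ⟨⟨n, hn⟩, -⟩ | ⟨h, -⟩
  · rw [hn]; exact ⟨le_rfl, by omega⟩
  · rw [h]; trivial

/-- The elements of `B⁺ + B⁻` are those whose value at the vertex `0` has no components at points
with matching half-words. -/
lemma mem_sup_iff (hsb : w.IsString ∨ w.IsBand) (hS : D.NonSingular) (hN : D.NormallyBound) (R : S.Rep N) (θ : T π N) :
    θ ∈ Bplus π N ⊔ Bminus π N ↔ R.MatZero (w.points hw) 0 (θ.ev 0) := by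
  have h0I := zero_mem_I hsb
  constructor
  · intro h
    obtain ⟨θ, hθ, η, hη, rfl⟩ := Submodule.mem_sup.1 h
    have h1 : R.MatZero (w.points hw) 0 (θ.ev 0) := by
      rcases hidx : w.idx with n | _
      · rw [Bplus_fin w π hidx] at hθ
        obtain ⟨v, hv⟩ := Option.isSome_iff_exists.1 ((w.vert_dom 0).2 h0I)
        refine matZero_of_trivMinus hw hv ?_ (hθ v hv)
        rw [← fsgn_zero hidx, lt_neg_fsgn, letter_nonpos hidx le_rfl]; rfl
      · rw [Bplus_int w π hidx] at hθ
        -- Far out the homomorphism vanishes, so the condition holds there trivially and is carried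
        -- back to `0`.
        obtain ⟨m, hm⟩ := (hθ : ∀ᶠ i in Filter.atBot, θ.ev i = 0).exists
        rw [matZero_iff hw π hS θ h0I (j := m) (by rw [hidx]; trivial), hm]
        exact matZero_zero hw m
    have h2 : R.MatZero (w.points hw) 0 (η.ev 0) := by
      rcases hidx : w.idx with n | _
      · rw [Bminus_fin w π hidx] at hη
        have hnI : (n : ℤ) ∈ w.idx.I := by rw [hidx]; exact ⟨by omega, le_rfl⟩
        obtain ⟨v, hv⟩ := Option.isSome_iff_exists.1 ((w.vert_dom n).2 hnI)
        rw [matZero_iff hw π hS η h0I hnI]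
        refine matZero_of_trivMinus hw hv ?_ (hη v hv)
        rw [← fsgn_last hidx, lt_fsgn, letter_gt hidx (by omega)]
      · rw [Bminus_int w π hidx] at hη
        obtain ⟨m, hm⟩ := (hη : ∀ᶠ i in Filter.atTop, η.ev i = 0).exists
        rw [matZero_iff hw π hS η h0I (j := m) (by rw [hidx]; trivial), hm]
        exact matZero_zero hw m
    intro q hq
    rw [T.ev_add, map_add, h1 q hq, h2 q hq, add_zero]
  · intro h
    -- Subtracting an element of `B⁺ + B⁻` with the same value at `0` reduces to a homomorphism
    -- vanishing at `b_0`.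
    obtain ⟨η, hη, he⟩ := valSub_of_matZero hw π hS hN (ev_mem_lowSub hw π hS θ 0) h
    suffices hz : θ - η ∈ Bplus π N ⊔ Bminus π N by
      have := Submodule.add_mem _ hz hη
      rwa [sub_add_cancel] at this
    have hz0 : (θ - η).ev 0 = 0 := by
      change θ.ev 0 - η.ev 0 = 0
      rw [he, sub_self]
    generalize θ - η = ζ at hz0
    rcases hidx : w.idx with n | _
    · refine (le_sup_left : Bplus π N ≤ _) ?_
      rw [Bplus_fin w π hidx]
      intro v _
      rw [hz0]; exact Submodule.zero_mem _
    · have hζ := ev_mem_lowSub (R := R) hw π hS ζ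
      have hst := rel_step hw (ev_compatible hw π ζ)
      -- Since `ζ` vanishes at `0`, it can be cut there: the part supported on positive places lies
      -- in `B⁺` and the remainder in `B⁻`. For a string no cut is needed, because the zero value at
      -- `b_0` already gives `B⁺`.
      obtain ⟨ζ₁, h1⟩ := exists_ev (R := R) hw π (θ := fun i => if 0 < i then ζ.ev i else 0)
        (fun i => by
          split_ifs
          · exact hζ i
          · exact AddSubgroup.zero_mem _) (fun i => by
          rcases lt_trichotomy i 0 with hi | rfl | hi
          · rw [if_neg (by omega), if_neg (by omega)]; exact step_zero hw i
          · rw [if_neg (by omega), if_pos (by omega), ← hz0]; exact hst 0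
          · rw [if_pos (by omega), if_pos (by omega)]; exact hst i)
      have h2 : ζ = ζ₁ + (ζ - ζ₁) := (add_sub_cancel _ _).symm
      rw [h2]
      refine Submodule.add_mem_sup ?_ ?_
      · rw [Bplus_int w π hidx]
        filter_upwards [Filter.eventually_le_atBot 0] with i hi
        rw [h1, if_neg (by omega)]
      · rw [Bminus_int w π hidx]
        filter_upwards [Filter.eventually_gt_atTop 0] with i hi
        change ζ.ev i - ζ₁.ev i = 0
        rw [h1, if_pos hi, sub_self]

end Word
end Kernel
end Clannish
end SLC
end

noncomputable section
namespace SLC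
namespace Clannish

/-! ### The module with basis a system of points -/

section Basis

variable {K Q₀ Q₁ : Type*} [DivisionRing K] {D : Clannish K Q₀ Q₁} {I : Type*}

namespace PointSystem

variable (A : PointSystem D I)

/-- The points which lie at a vertex. -/
abbrev Pts : Type _ := {i : I // (A.vtx i).isSome}

/-- The `K`-module with basis the points which lie at a vertex. -/
def Space : Type _ := A.Pts →₀ K

instance : AddCommGroup A.Space := inferInstanceAs (AddCommGroup (A.Pts →₀ K))

instance : Module K A.Space := inferInstanceAs (Module K (A.Pts →₀ K))

open Classical in
/-- The basis element of a point. -/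
def gen (i : I) : A.Space := if h : (A.vtx i).isSome then Finsupp.single ⟨i, h⟩ 1 else 0

lemma gen_none {i : I} (h : A.vtx i = none) : A.gen i = 0 := by
  exact dif_neg (by simp [h])

lemma gen_some (i : A.Pts) : A.gen i.1 = (Finsupp.single i 1 : A.Pts →₀ K) := by
  exact dif_pos i.2

variable {A} in
lemma hom_ext {B : Type*} [AddCommMonoid B] {f g : A.Space →+ B}
    (h : ∀ i v, A.vtx i = some v → ∀ l : K, f (l • A.gen i) = g (l • A.gen i)) : f = g := by
  refine Finsupp.addHom_ext (M := K) fun i l => ?_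
  obtain ⟨v, hv⟩ := Option.isSome_iff_exists.1 i.2
  have h1 := h i.1 v hv l
  have h2 : l • A.gen i.1 = (Finsupp.single i l : A.Pts →₀ K) := by
    rw [gen_some]
    exact (Finsupp.smul_single l i (1 : K)).trans (by rw [smul_eq_mul, mul_one])
  rwa [h2] at h1

/-- The semilinear map with given values on the basis. -/
def semi (τ : RingAut K) (f : I → A.Space) : AddMonoid.End A.Space :=
  Finsupp.liftAddHom (N := A.Space) fun i : A.Pts =>
    ((smulAddHom K A.Space).flip (f i.1)).comp (τ : K →+* K).toAddMonoidHom

lemma semi_gen (τ : RingAut K) {f : I → A.Space} (hf : ∀ i, A.vtx i = none → f i = 0) (i : I)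
    (l : K) : A.semi τ f (l • A.gen i) = τ l • f i := by
  rcases h : A.vtx i with _ | v
  · rw [gen_none _ h, hf i h, smul_zero, map_zero, smul_zero]
  · have hi : (A.vtx i).isSome := by rw [h]; rfl
    have h2 : l • A.gen i = (Finsupp.single (⟨i, hi⟩ : A.Pts) l : A.Pts →₀ K) := by
      rw [show A.gen i = _ from A.gen_some ⟨i, hi⟩]
      exact (Finsupp.smul_single l _ (1 : K)).trans (by rw [smul_eq_mul, mul_one])
    rw [h2]
    exact Finsupp.liftAddHom_apply_single (N := A.Space) _ _ _

variable (fwd : I → ℤˣ → Prop)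

open Classical in
/-- The action of an arrow on the basis. -/
def arrGen (a : Q₁) (i : I) : A.Space :=
  if a ∈ D.Sp then
    if A.vtx i = some (D.head a) then
      if fwd i (D.sgn (.star a)) then A.gen (A.nx i (D.sgn (.star a)))
      else D.β a • A.gen i - D.γ a • A.gen (A.nx i (D.sgn (.star a)))
    else 0
  else if A.lt i (D.sgn (.inv a)) = some (.inv a) then A.gen (A.nx i (D.sgn (.inv a))) else 0

open Classical in
/-- The action of a trivial path on the basis. -/
def eGen (v : Q₀) (i : I) : A.Space := if A.vtx i = some v then A.gen i else 0

/-- The action of an arrow. -/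
def arrEnd (a : Q₁) : AddMonoid.End A.Space := A.semi (D.σ a) (A.arrGen fwd a)

/-- The action of a trivial path. -/
def eEnd (v : Q₀) : AddMonoid.End A.Space := A.semi 1 (A.eGen v)

variable {A fwd}

lemma arrGen_ord {a : Q₁} (ha : a ∉ D.Sp) {i : I}
    (h : A.lt i (D.sgn (.inv a)) = some (.inv a)) :
    A.arrGen fwd a i = A.gen (A.nx i (D.sgn (.inv a))) := by
  unfold arrGen; rw [if_neg ha, if_pos h]

lemma arrGen_zero {a : Q₁} (ha : a ∉ D.Sp) {i : I}
    (h : A.lt i (D.sgn (.inv a)) ≠ some (.inv a)) : A.arrGen fwd a i = 0 := by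
  unfold arrGen; rw [if_neg ha, if_neg h]

lemma arrGen_fwd {s : Q₁} (hs : s ∈ D.Sp) {i : I} (hv : A.vtx i = some (D.head s))
    (h : fwd i (D.sgn (.star s))) : A.arrGen fwd s i = A.gen (A.nx i (D.sgn (.star s))) := by
  unfold arrGen; rw [if_pos hs, if_pos hv, if_pos h]

lemma arrGen_not_fwd {s : Q₁} (hs : s ∈ D.Sp) {i : I} (hv : A.vtx i = some (D.head s))
    (h : ¬ fwd i (D.sgn (.star s))) : A.arrGen fwd s i =
      D.β s • A.gen i - D.γ s • A.gen (A.nx i (D.sgn (.star s))) := by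
  unfold arrGen; rw [if_pos hs, if_pos hv, if_neg h]

lemma arrGen_ne {a : Q₁} {i : I} (hv : A.vtx i ≠ some (D.tail a)) :
    A.arrGen fwd a i = 0 := by
  by_cases ha : a ∈ D.Sp
  · unfold arrGen; rw [if_pos ha, if_neg (by rwa [D.loop a ha])]
  · exact arrGen_zero ha fun h => hv (A.head h)

lemma arrEnd_gen (a : Q₁) (i : I) (l : K) :
    A.arrEnd fwd a (l • A.gen i) = D.σ a l • A.arrGen fwd a i :=
  A.semi_gen _ (fun i hi => arrGen_ne (by rw [hi]; simp)) i l

lemma arrEnd_gen_one (a : Q₁) (i : I) : A.arrEnd fwd a (A.gen i) = A.arrGen fwd a i := by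
  have := arrEnd_gen (A := A) (fwd := fwd) a i (1 : K)
  rwa [one_smul, map_one, one_smul] at this

lemma arrEnd_smul (a : Q₁) (l : K) (x : A.Space) :
    A.arrEnd fwd a (l • x) = D.σ a l • A.arrEnd fwd a x := by
  have : (A.arrEnd fwd a).comp (Module.toAddMonoidEnd K _ l) =
      AddMonoidHom.comp (Module.toAddMonoidEnd K _ (D.σ a l)) (A.arrEnd fwd a) := by
    refine hom_ext fun i v _ m => ?_
    change A.arrEnd fwd a (l • m • A.gen i) = D.σ a l • A.arrEnd fwd a (m • A.gen i)
    rw [← mul_smul, arrEnd_gen, arrEnd_gen, ← mul_smul, map_mul]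
  exact DFunLike.congr_fun this x

lemma eEnd_gen (v : Q₀) (i : I) (l : K) : A.eEnd v (l • A.gen i) = l • A.eGen v i :=
  A.semi_gen 1 (fun i hi => if_neg (by rw [hi]; simp)) i l

lemma eEnd_smul (v : Q₀) (l : K) (x : A.Space) :
    A.eEnd v (l • x) = l • A.eEnd v x := by
  have : (A.eEnd v).comp (Module.toAddMonoidEnd K _ l) =
      AddMonoidHom.comp (Module.toAddMonoidEnd K _ l) (A.eEnd v) := by
    refine hom_ext fun i v _ m => ?_
    change A.eEnd _ (l • m • A.gen i) = l • A.eEnd _ (m • A.gen i)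
    rw [← mul_smul, eEnd_gen, eEnd_gen, ← mul_smul]
  exact DFunLike.congr_fun this x

lemma eEnd_self {v : Q₀} {i : I} (h : A.vtx i = some v) : A.eEnd v (A.gen i) = A.gen i := by
  have := eEnd_gen (A := A) v i 1
  rw [one_smul, one_smul] at this
  rw [this]; exact if_pos h

lemma eEnd_ne {v : Q₀} {i : I} (h : A.vtx i ≠ some v) : A.eEnd v (A.gen i) = 0 := by
  have := eEnd_gen (A := A) v i 1
  rw [one_smul, one_smul] at this
  rw [this]; exact if_neg h

lemma e_arrGen (a : Q₁) (i : I) :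
    A.eEnd (D.head a) (A.arrGen fwd a i) = A.arrGen fwd a i := by
  by_cases ha : a ∈ D.Sp
  · by_cases hv : A.vtx i = some (D.head a)
    · have h1 := A.star ha hv
      have h2 : A.vtx (A.nx i (D.sgn (.star a))) = some (D.head a) := vtx_nx h1
      by_cases hf : fwd i (D.sgn (.star a))
      · rw [arrGen_fwd ha hv hf, eEnd_self h2]
      · rw [arrGen_not_fwd ha hv hf, map_sub, eEnd_smul, eEnd_smul, eEnd_self h2, eEnd_self hv]
    · rw [arrGen_ne (by rwa [← D.loop a ha]), map_zero]
  · by_cases h : A.lt i (D.sgn (.inv a)) = some (.inv a)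
    · rw [arrGen_ord ha h, eEnd_self (v := D.head a) (vtx_nx h)]
    · rw [arrGen_zero ha h, map_zero]

variable [Fintype Q₀]

lemma sum_eEnd : ∑ v : Q₀, A.eEnd v = 1 := by
  classical
  refine hom_ext fun i v hv l => ?_
  refine (AddMonoidHom.finsetSum_apply _ _ _).trans ?_
  rw [Finset.sum_eq_single v]
  · exact (eEnd_smul v l _).trans (by rw [eEnd_self hv]; rfl)
  · intro v' _ hne
    exact (eEnd_smul v' l _).trans
      (by rw [eEnd_ne (by rw [hv]; simpa using hne.symm), smul_zero])
  · simp

/-- The images of the generators of the path algebra. -/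
def genEnd (A : PointSystem D I) (fwd : I → ℤˣ → Prop) :
    Gen K Q₀ Q₁ → AddMonoid.End A.Space
  | .k a => Module.toAddMonoidEnd K _ a
  | .e v => A.eEnd v
  | .arr a => A.arrEnd fwd a

variable (A fwd) in
/-- The action of the path algebra. -/
def pathEnd : D.PathAlg →+* AddMonoid.End A.Space :=
  RingQuot.lift ⟨(FreeAlgebra.lift ℤ (genEnd A fwd) :
      FreeAlgebra ℤ (Gen K Q₀ Q₁) →ₐ[ℤ] AddMonoid.End A.Space), by
    rintro _ _ (⟨a, b⟩ | ⟨a, b⟩ | _ | ⟨v⟩ | ⟨v, w, h⟩ | _ | ⟨a⟩ | ⟨a⟩ | ⟨v, l⟩ | ⟨a, l⟩) <;>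
      simp only [RingHom.coe_coe, map_add, map_mul, FreeAlgebra.lift_ι_apply, map_one, map_sum,
        map_zero, genEnd]
    · refine hom_ext fun i u hu l => ?_
      change A.eEnd v (A.eEnd v _) = A.eEnd v _
      rw [eEnd_gen, eEnd_smul]
      unfold eGen
      split_ifs with h
      · rw [eEnd_self h]
      · rw [map_zero]
    · refine hom_ext fun i u hu l => ?_
      change A.eEnd v (A.eEnd w _) = 0
      rw [eEnd_gen, eEnd_smul]
      unfold eGen
      split_ifs with h'
      · rw [eEnd_ne (by rw [h']; simpa using h.symm), smul_zero]
      · rw [map_zero, smul_zero]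
    · exact sum_eEnd
    · refine hom_ext fun i u hu l => ?_
      change A.eEnd _ (A.arrEnd fwd a _) = A.arrEnd fwd a _
      rw [arrEnd_gen, eEnd_smul, e_arrGen]
    · refine hom_ext fun i u hu l => ?_
      change A.arrEnd fwd a (A.eEnd _ _) = A.arrEnd fwd a _
      rw [eEnd_gen, arrEnd_smul, arrEnd_gen]
      unfold eGen
      split_ifs with h
      · rw [arrEnd_gen_one]
      · rw [map_zero, arrGen_ne h]
    · refine AddMonoidHom.ext fun x => ?_
      exact eEnd_smul v l x
    · refine AddMonoidHom.ext fun x => ?_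
      exact arrEnd_smul a l x⟩

lemma pathEnd_K (a : K) : A.pathEnd fwd (D.pathK a) = Module.toAddMonoidEnd K _ a := by
  unfold pathEnd
  refine (RingQuot.lift_mkRingHom_apply _ _ _).trans ?_
  simp [genEnd]

lemma pathEnd_E (v : Q₀) : A.pathEnd fwd (D.pathE v) = A.eEnd v := by
  unfold pathEnd
  refine (RingQuot.lift_mkRingHom_apply _ _ _).trans ?_
  simp [genEnd]

lemma pathEnd_A (a : Q₁) : A.pathEnd fwd (D.pathA a) = A.arrEnd fwd a := by
  unfold pathEnd
  refine (RingQuot.lift_mkRingHom_apply _ _ _).trans ?_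
  simp [genEnd]

omit [Fintype Q₀] in
-- On the two basis elements at the ends of a loop `s` acts by the companion matrix of its
-- quadratic. Normality moves the coefficients past the semilinear twists.
lemma quad_gen (hN : D.NormallyBound)
    (symm : ∀ {i δ s}, A.lt i δ = some (.star s) → (fwd (A.nx i δ) δ ↔ ¬ fwd i δ))
    {s : Q₁} (hs : s ∈ D.Sp) {i : I} (hv : A.vtx i = some (D.head s)) (l : K) :
    A.arrEnd fwd s (A.arrEnd fwd s (l • A.gen i)) - D.β s • A.arrEnd fwd s (l • A.gen i) +
      D.γ s • l • A.gen i = 0 := by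
  obtain ⟨h1, h2, h3, h4⟩ := normal_quad (hN s hs)
  have hl := A.star hs hv
  obtain ⟨hl', hnn⟩ := star_back hl
  have hv' : A.vtx (A.nx i (D.sgn (.star s))) = some (D.head s) := vtx_nx hl
  have hsy := symm hl
  rw [arrEnd_gen, arrEnd_smul]
  by_cases hf : fwd i (D.sgn (.star s))
  · rw [arrGen_fwd hs hv hf, arrEnd_gen_one, arrGen_not_fwd hs hv' (by tauto), hnn, smul_sub]
    simp only [← mul_smul]
    rw [h3, h4]
    abel
  · rw [arrGen_not_fwd hs hv hf, map_sub, arrEnd_smul, arrEnd_smul, arrEnd_gen_one,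
      arrEnd_gen_one, arrGen_fwd hs hv' (hsy.2 hf), hnn, arrGen_not_fwd hs hv hf, h1, h2]
    have e1 : D.β s * (D.σ s l * D.β s) = D.σ s (D.σ s l) * (D.β s * D.β s) := by
      rw [← mul_assoc, h3, mul_assoc]
    have e2 : D.β s * (D.σ s l * D.γ s) = D.σ s (D.σ s l) * (D.β s * D.γ s) := by
      rw [← mul_assoc, h3, mul_assoc]
    simp only [smul_sub, ← mul_smul, h4, e1, e2]
    abel

/-- The path `r` ends at the point `j`. -/
def Spells (A : PointSystem D I) (r : List Q₁) (j : I) : Prop :=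
  ∃ δ, ∀ (k : ℕ) (h : k < r.length), A.half j δ k = some (D.st r[k])

omit [Fintype Q₀] in
-- The letter `x` differs from the first letter of the path read at `j`, so it has the opposite
-- sign. From the neighbour across `x` one reads `c` and then the whole path at `j`.
lemma spells_cons {c a : Q₁} {l : List Q₁} {j : I} {δ : ℤˣ}
    (h : ∀ (k : ℕ) (h : k < (a :: l).length), A.half j δ k = some (D.st (a :: l)[k]))
    {x : Letter Q₁} (hx : A.lt j (D.sgn x) = some x) (hc : x.bar = D.st c) (hne : x ≠ D.st a) :
    ∀ (k : ℕ) (h : k < (c :: a :: l).length), A.half (A.nx j (D.sgn x)) (D.sgn x.bar) k =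
      some (D.st (c :: a :: l)[k]) := by
  intro k hk
  cases k with
  | zero => rw [half_back_zero hx, hc]; rfl
  | succ k =>
    have := congrFun (tl_half_back hx) k
    refine this.trans ?_
    have hδ : D.sgn x ≠ δ := by
      intro e
      have h0 := h 0 (by simp)
      rw [half_zero, ← e, hx] at h0
      exact hne (Option.some.inj h0)
    rw [neg_eq_of_ne hδ, neg_neg]
    exact h k (by simpa using hk)

omit [Fintype Q₀] in
-- Since `s²` is not a subpath of a zero relation, `a ≠ b`; then `a`, `b` and `c` would be three
-- different arrows with the same head.
lemma not_special_pair {r : List Q₁} (hr : r ∈ D.Z) {l' l : List Q₁} {a b c : Q₁}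
    (h : l' ++ a :: b :: c :: l = r) (ha : a ∈ D.Sp) (hb : b ∈ D.Sp) (hc : c ∉ D.Sp) : False := by
  have hch := D.Z_path r hr
  rw [← h] at hch
  have h1 := (List.isChain_append.1 hch).2.1
  rw [List.isChain_cons_cons, List.isChain_cons_cons] at h1
  obtain ⟨h1, h2, -⟩ := h1
  have hab : a ≠ b := by
    rintro rfl
    exact D.Z_square r hr a ha ⟨l', c :: l, by rw [← h]; simp⟩
  have hac : a ≠ c := by rintro rfl; exact hc ha
  have hbc : b ≠ c := by rintro rfl; exact hc hb
  have e1 : D.head b = D.head a := by rw [← h1, D.loop a ha]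
  have e2 : D.head c = D.head a := by rw [← h2, ← D.loop b hb, e1]
  have h3 := D.head_le_two (D.head a)
  have h4 : ({a, b, c} : Set Q₁) ⊆ {x | D.head x = D.head a} := by
    rintro x (rfl | rfl | rfl)
    · rfl
    · exact e1
    · exact e2
  have h5 : ({a, b, c} : Set Q₁).encard = 3 := by
    rw [Set.encard_insert_of_notMem (by simp [hab, hac]), Set.encard_pair hbc]; rfl
  have h6 := (Set.encard_le_encard h4).trans h3
  rw [h5] at h6
  exact absurd h6 (by decide)

omit [Fintype Q₀] in
/-- The result of the action of a subpath of a zero relation on a basis element. -/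
lemma prod_gen {r : List Q₁} (hr : r ∈ D.Z) (i : I) (m : K) (l : List Q₁) : ∀ (a : Q₁)
    (l' : List Q₁), l' ++ a :: l = r →
    (a ∈ D.Sp → ∃ b l₁, l = b :: l₁ ∧ b ∉ D.Sp) ∧
    (((a :: l).map (A.arrEnd fwd)).prod (m • A.gen i) = 0 ∨
      ∃ (j : I) (δ : ℤˣ) (n n' : K), (∀ (k : ℕ) (h : k < (a :: l).length),
        A.half j δ k = some (D.st (a :: l)[k])) ∧
        ((a :: l).map (A.arrEnd fwd)).prod (m • A.gen i) =
          n • A.gen j + n' • A.gen (A.nx j (D.sgn (.star a))) ∧ (a ∉ D.Sp → n' = 0)) := by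
  induction l with
  | nil =>
    intro a l' h
    have ha : a ∉ D.Sp := D.Z_last r hr a (by rw [← h]; simp)
    refine ⟨fun h => absurd h ha, ?_⟩
    have e : ([a].map (A.arrEnd fwd)).prod (m • A.gen i) = D.σ a m • A.arrGen fwd a i := by
      rw [← arrEnd_gen]; simp
    rw [e]
    by_cases hl : A.lt i (D.sgn (.inv a)) = some (.inv a)
    · refine Or.inr ⟨A.nx i (D.sgn (.inv a)), D.sgn (.dir a), D.σ a m, 0, fun k hk => ?_, ?_,
        fun _ => rfl⟩
      · obtain rfl : k = 0 := by simpa using hk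
        exact (half_back_zero hl).trans (congrArg some (if_neg ha).symm)
      · rw [arrGen_ord ha hl, zero_smul, add_zero]
    · left
      rw [arrGen_zero ha hl, smul_zero]
  | cons b l ih =>
    intro a l' h
    have h' : (l' ++ [a]) ++ b :: l = r := by rw [← h]; simp
    obtain ⟨ih1, ih2⟩ := ih b (l' ++ [a]) h'
    have first : a ∈ D.Sp → b ∉ D.Sp := by
      intro ha hb
      obtain ⟨c, l₁, rfl, hc⟩ := ih1 hb
      exact not_special_pair hr h ha hb hc
    have hta : D.tail a = D.head b := by
      have hch := D.Z_path r hr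
      rw [← h] at hch
      exact (List.isChain_cons_cons.1 (List.isChain_append.1 hch).2.1).1
    refine ⟨fun ha => ⟨b, l, rfl, first ha⟩, ?_⟩
    have e : ((a :: b :: l).map (A.arrEnd fwd)).prod (m • A.gen i) =
        A.arrEnd fwd a (((b :: l).map (A.arrEnd fwd)).prod (m • A.gen i)) := by
      rw [List.map_cons, List.prod_cons]; rfl
    rw [e]
    rcases ih2 with h0 | ⟨j, δ, n, n', hsp, hx, hn'⟩
    · left; rw [h0, map_zero]
    have hb0 : A.lt j δ = some (D.st b) := hsp 0 (by simp)
    have hvj : A.vtx j = some (D.tail a) := by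
      rw [A.head hb0, hta]
      unfold st
      split_ifs <;> rfl
    rw [hx, map_add, arrEnd_smul, arrEnd_smul, arrEnd_gen_one, arrEnd_gen_one]
    by_cases ha : a ∈ D.Sp
    · have hb := first ha
      rw [hn' hb, map_zero, zero_smul, add_zero]
      rw [← D.loop a ha] at hvj
      have hl := A.star ha hvj
      have hst : D.st b = .dir b := if_neg hb
      have hg := spells_cons hsp hl (c := a) (if_pos ha).symm (by rw [hst]; simp)
      right
      refine ⟨A.nx j (D.sgn (.star a)), D.sgn (.star a), ?_⟩
      by_cases hf : fwd j (D.sgn (.star a))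
      · refine ⟨D.σ a n, 0, hg, ?_, fun h => absurd ha h⟩
        rw [arrGen_fwd ha hvj hf, zero_smul, add_zero]
      -- Against its direction the loop leaves a second term at the old point. This is the only
      -- source of the coefficient `n'`, which is why it vanishes after an ordinary arrow.
      · refine ⟨-(D.σ a n * D.γ a), D.σ a n * D.β a, hg, ?_, fun h => absurd ha h⟩
        rw [arrGen_not_fwd ha hvj hf, (star_back hl).2, smul_sub, neg_smul, mul_smul, mul_smul]
        abel
    -- The second term left by a loop `b` dies under the next arrow: at its point the letter of sign
    -- `δ` is `b^*` and the letter of sign `-δ` is the direct letter of the next arrow `c` of the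
    -- path, so `a⁻¹` is not a letter there.
    · have hz : D.σ a n' • A.arrGen fwd a (A.nx j (D.sgn (.star b))) = 0 := by
        by_cases hb : b ∈ D.Sp
        · obtain ⟨c, l₁, rfl, hc⟩ := ih1 hb
          have hst : D.st b = .star b := if_pos hb
          rw [hst] at hb0
          have hδ := A.sign hb0
          have h1 := hsp 1 (by simp)
          have h2 := congrFun (tl_half_star hb0) 0
          rw [half_zero] at h2
          have h3 := h2.symm.trans h1
          have hb1 := (star_back hb0).1
          rw [hδ, arrGen_zero ha, smul_zero]
          intro h4
          by_cases h5 : D.sgn (.inv a) = δ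
          · rw [h5, hb1] at h4; cases h4
          · rw [neg_eq_of_ne h5, h3] at h4
            have : D.st c = .dir c := if_neg hc
            simp only [List.getElem_cons_succ, List.getElem_cons_zero, this] at h4
            cases h4
        · rw [hn' hb, map_zero, zero_smul]
      rw [hz, add_zero]
      by_cases hl : A.lt j (D.sgn (.inv a)) = some (.inv a)
      · have hne : Letter.inv a ≠ D.st b := by
          unfold st
          split_ifs <;> simp
        have hg := spells_cons hsp hl (c := a) (if_neg ha).symm hne
        refine Or.inr ⟨_, _, D.σ a n, 0, hg, ?_, fun _ => rfl⟩
        rw [arrGen_ord ha hl, zero_smul, add_zero]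
      · left
        rw [arrGen_zero ha hl, smul_zero]

variable (A fwd) in
/-- The action of the algebra on the module with basis a system of points in which no zero
relation can be read off. -/
def algEnd (hN : D.NormallyBound)
    (symm : ∀ {i δ s}, A.lt i δ = some (.star s) → (fwd (A.nx i δ) δ ↔ ¬ fwd i δ))
    (hZ : ∀ r ∈ D.Z, ∀ j, ¬ A.Spells r j) : D.Alg →+* AddMonoid.End A.Space :=
  RingQuot.lift ⟨A.pathEnd fwd, by
    rintro _ _ (⟨r, hr⟩ | ⟨s, hs⟩)
    · rw [map_zero, map_list_prod, List.map_map]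
      have e : (A.pathEnd fwd : D.PathAlg → _) ∘ D.pathA = A.arrEnd fwd :=
        funext fun a => pathEnd_A a
      rw [e]
      refine hom_ext fun i v hv m => ?_
      rcases r with _ | ⟨a, l⟩
      · have := D.Z_length _ hr
        simp at this
      · rcases (prod_gen (A := A) (fwd := fwd) hr i m l a [] rfl).2 with h | ⟨j, δ, n, n', h, -, -⟩
        · exact h
        · exact (hZ _ hr j ⟨δ, h⟩).elim
    · rw [map_zero, map_add, map_sub, map_mul, map_mul, pow_two, map_mul, pathEnd_A, pathEnd_K,
        pathEnd_K, pathEnd_E]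
      refine hom_ext fun i v hv m => ?_
      change A.arrEnd fwd s (A.arrEnd fwd s (m • A.gen i)) - D.β s • A.arrEnd fwd s (m • A.gen i) +
        D.γ s • A.eEnd _ (m • A.gen i) = 0
      by_cases h : A.vtx i = some (D.head s)
      · rw [eEnd_smul, eEnd_self h]
        exact quad_gen hN symm hs h m
      · rw [eEnd_smul, eEnd_ne h, arrEnd_gen, arrGen_ne (by rwa [← D.loop s hs])]
        simp⟩

section

variable (hN : D.NormallyBound)
    (symm : ∀ {i δ s}, A.lt i δ = some (.star s) → (fwd (A.nx i δ) δ ↔ ¬ fwd i δ))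
    (hZ : ∀ r ∈ D.Z, ∀ j, ¬ A.Spells r j)

lemma algEnd_K (a : K) (x : A.Space) : A.algEnd fwd hN symm hZ (D.inK a) x = a • x := by
  have : A.algEnd fwd hN symm hZ (D.inK a) = A.pathEnd fwd (D.pathK a) :=
    RingQuot.lift_mkRingHom_apply _ _ _
  rw [this, pathEnd_K]; rfl

lemma algEnd_e (v : Q₀) : A.algEnd fwd hN symm hZ (D.e v) = A.eEnd v := by
  have : A.algEnd fwd hN symm hZ (D.e v) = A.pathEnd fwd (D.pathE v) :=
    RingQuot.lift_mkRingHom_apply _ _ _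
  rw [this, pathEnd_E]

lemma algEnd_arr (a : Q₁) : A.algEnd fwd hN symm hZ (D.arr a) = A.arrEnd fwd a := by
  have : A.algEnd fwd hN symm hZ (D.arr a) = A.pathEnd fwd (D.pathA a) :=
    RingQuot.lift_mkRingHom_apply _ _ _
  rw [this, pathEnd_A]

end

end PointSystem

end Basis
end Clannish
end SLC
end

noncomputable section
namespace SLC
namespace Clannish

/-! ### Bases of string and band modules -/

section Coordinates

variable {K Q₀ Q₁ : Type*} [DivisionRing K] {D : Clannish K Q₀ Q₁} [Fintype Q₀]

/-- Subgroups which are stable under the generators of the algebra are submodules. -/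
lemma smul_mem_of_gen {N : Type*} [AddCommGroup N] [Module D.Alg N] {G : AddSubgroup N}
    (hk : ∀ l : K, ∀ x ∈ G, D.inK l • x ∈ G) (he : ∀ v, ∀ x ∈ G, D.e v • x ∈ G)
    (ha : ∀ a, ∀ x ∈ G, D.arr a • x ∈ G) (r : D.Alg) : ∀ x ∈ G, r • x ∈ G := by
  obtain ⟨p, rfl⟩ := RingQuot.mkRingHom_surjective D.ClanRel r
  obtain ⟨q, rfl⟩ := RingQuot.mkRingHom_surjective D.PathRel p
  change ∀ x ∈ G, D.quo (RingQuot.mkRingHom D.PathRel q) • x ∈ G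
  induction q using FreeAlgebra.induction with
  | grade0 n =>
    intro x hx
    rw [eq_intCast, map_intCast, map_intCast, Int.cast_smul_eq_zsmul]
    exact AddSubgroup.zsmul_mem _ hx n
  | grade1 g =>
    cases g with
    | k l => exact hk l
    | e v => exact he v
    | arr a => exact ha a
  | mul p q hp hq =>
    intro x hx
    rw [map_mul, map_mul, mul_smul]
    exact hp _ (hq x hx)
  | add p q hp hq =>
    intro x hx
    rw [map_add, map_add, add_smul]
    exact AddSubgroup.add_mem _ (hp x hx) (hq x hx)

lemma arr_smul_ne {N : Type*} [AddCommGroup N] [Module D.Alg N] {a : Q₁} {v : Q₀} {x : N}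
    (hx : D.e v • x = x) (hv : v ≠ D.tail a) : D.arr a • x = 0 := by
  rw [← hx, ← arr_mul_e, ← mul_smul, mul_assoc, e_mul_ne _ hv.symm, mul_zero, zero_smul]

namespace Word

variable {w : D.Word} (hw : w.EndAdmissible)

omit [Fintype Q₀] in
-- A path read off along a half-word is a subword of `w` or of `w⁻¹`, according to the sign.
lemma not_spells (hr : w.RelAdmissible) : ∀ r ∈ D.Z, ∀ j, ¬ (w.points hw).Spells r j := by
  rintro r hr0 j ⟨δ, h⟩
  have hlen := D.Z_length r hr0
  have h0 := h 0 (by omega)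
  have hj : j ∈ w.idx.I := by
    rw [← w.vert_dom]
    have := (w.points hw).head h0
    change w.vert j = _ at this
    rw [this]; rfl
  by_cases hδ : δ = w.fsgn j
  · subst hδ
    refine (hr r hr0).1 ⟨j + 1, fun k hk => ?_⟩
    rw [← h k hk, half_fsgn hw hj]; rfl
  · obtain rfl := neg_eq_of_ne hδ
    refine (hr r hr0).2 ⟨w.flip + 1 - j, fun k hk => ?_⟩
    rw [← h k hk, half_neg_fsgn hw hj, inv_letter]
    change _ = (w.letter (j - k)).map Letter.bar
    ring_nf

lemma arr_b_ne {a : Q₁} {i : ℤ} (hv : w.vert i ≠ some (D.tail a)) :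
    D.arr a • b w.canon i = 0 := by
  rcases h : w.vert i with _ | v
  · rw [b_out w.canon h, smul_zero]
  · exact arr_smul_ne (b_vertex w.canon h) (by rintro rfl; exact hv h)

lemma arr_b_ord {a : Q₁} (ha : a ∉ D.Sp) {i : ℤ} (h : w.lt i (D.sgn (.inv a)) = some (.inv a)) :
    D.arr a • b w.canon i = b w.canon (w.nx i (D.sgn (.inv a))) :=
  b_arrow w.canon ((arrow_iff ha).2 ⟨h, rfl⟩)

lemma arr_b_zero {a : Q₁} (ha : a ∉ D.Sp) {i : ℤ}
    (h : w.lt i (D.sgn (.inv a)) ≠ some (.inv a)) : D.arr a • b w.canon i = 0 := by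
  by_cases hv : w.vert i = some (D.tail a)
  · exact b_zero w.canon ha hv fun j hj => h ((arrow_iff ha).1 hj).1
  · exact arr_b_ne hv

include hw in
lemma arr_b_fwd {s : Q₁} (hs : s ∈ D.Sp) {i : ℤ} (hv : w.vert i = some (D.head s))
    (h : w.Fwd i (D.sgn (.star s))) :
    D.arr s • b w.canon i = b w.canon (w.nx i (D.sgn (.star s))) :=
  b_arrow w.canon ((arrow_special_iff hs).2 ⟨(w.points hw).star hs hv, rfl, h⟩)

include hw in
lemma arr_b_not_fwd {s : Q₁} (hs : s ∈ D.Sp) {i : ℤ} (hv : w.vert i = some (D.head s))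
    (h : ¬ w.Fwd i (D.sgn (.star s))) :
    D.arr s • b w.canon i = D.inK (D.β s) • b w.canon i -
      D.inK (D.γ s) • b w.canon (w.nx i (D.sgn (.star s))) := by
  have hl := (w.points hw).star hs hv
  have hb := PointSystem.star_back hl
  have hf : w.Fwd (w.nx i (D.sgn (.star s))) (D.sgn (.star s)) :=
    ((w.orientation hw).symm hl).2 h
  have hv' := PointSystem.vtx_nx hl
  have h1 : D.arr s • b w.canon (w.nx i (D.sgn (.star s))) = b w.canon i :=
    b_arrow w.canon ((arrow_special_iff hs).2 ⟨hb.1, hb.2.symm, hf⟩)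
  rw [← h1, arr_arr_smul hs]
  exact b_vertex w.canon hv'

include hw in
/-- The module of a string or band is spanned by the multiples of its generators. -/
lemma span_b (G : AddSubgroup (M w.canon)) (h : ∀ i (l : K), D.inK l • b w.canon i ∈ G) (m : M w.canon) :
    m ∈ G := by
  let H : AddSubgroup (M w.canon) :=
    AddSubgroup.closure {x | ∃ i, ∃ l : K, x = D.inK l • b w.canon i}
  have hb : ∀ i (l : K), D.inK l • b w.canon i ∈ H := fun i l =>
    AddSubgroup.subset_closure ⟨i, l, rfl⟩
  have hHG : H ≤ G := by
    rw [AddSubgroup.closure_le]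
    rintro _ ⟨i, l, rfl⟩
    exact h i l
  refine hHG ?_
  -- It suffices to check stability of `H` on the generators `λ b_i`, for each generator of the
  -- algebra in turn. This makes `H` a submodule containing all `b_i`.
  have lift : ∀ r : D.Alg, (∀ i (l : K), r • D.inK l • b w.canon i ∈ H) → ∀ x ∈ H, r • x ∈ H := by
    intro r hr x hx
    induction hx using AddSubgroup.closure_induction with
    | mem x hx => obtain ⟨i, l, rfl⟩ := hx; exact hr i l
    | zero => rw [smul_zero]; exact H.zero_mem
    | add x y _ _ hx hy => rw [smul_add]; exact H.add_mem hx hy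
    | neg x _ hx => rw [smul_neg]; exact H.neg_mem hx
  have hk : ∀ l : K, ∀ x ∈ H, D.inK l • x ∈ H := fun l => lift _ fun i m => by
    rw [← mul_smul, ← map_mul]; exact hb i _
  have he : ∀ v, ∀ x ∈ H, D.e v • x ∈ H := fun v => lift _ fun i m => by
    rw [e_smul]
    refine hk _ _ ?_
    rcases hv : w.vert i with _ | u
    · rw [b_out w.canon hv, smul_zero]; exact H.zero_mem
    · by_cases hu : v = u
      · subst hu
        rw [b_vertex w.canon hv]
        simpa using hb i 1
      · rw [← b_vertex w.canon hv, ← mul_smul, e_mul_ne _ hu, zero_smul]; exact H.zero_mem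
  have hb1 : ∀ i, b w.canon i ∈ H := fun i => by simpa using hb i 1
  have ha : ∀ a, ∀ x ∈ H, D.arr a • x ∈ H := fun a => lift _ fun i m => by
    rw [arr_smul]
    refine hk _ _ ?_
    by_cases hv : w.vert i = some (D.tail a)
    · by_cases ha : a ∈ D.Sp
      · rw [← D.loop a ha] at hv
        by_cases hf : w.Fwd i (D.sgn (.star a))
        · rw [arr_b_fwd hw ha hv hf]; exact hb1 _
        · rw [arr_b_not_fwd hw ha hv hf]
          exact H.sub_mem (hb _ _) (hb _ _)
      · by_cases hl : w.lt i (D.sgn (.inv a)) = some (.inv a)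
        · rw [arr_b_ord ha hl]; exact hb1 _
        · rw [arr_b_zero ha hl]; exact H.zero_mem
    · rw [arr_b_ne hv]; exact H.zero_mem
  have key := smul_mem_of_gen hk he ha
  obtain ⟨x, rfl⟩ := Submodule.Quotient.mk_surjective _ m
  induction x using Finsupp.induction_linear with
  | zero => exact H.zero_mem
  | add x y hx hy => exact H.add_mem hx hy
  | single i r => rw [mk_single]; exact key r _ (hb1 i)

variable (hN : D.NormallyBound) (hr : w.RelAdmissible)

/-- The action of the algebra on the module with basis the vertices of a word. -/
abbrev spaceModule : Module D.Alg (w.points hw).Space :=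
  Module.compHom _ ((w.points hw).algEnd w.Fwd hN (w.orientation hw).symm (not_spells hw hr))

/-- This yields a homomorphism from `M(C)` sending the `b_i` to basis elements, so the spanning set
of multiples of the `b_i` is independent over `K`. -/
lemma gen_compat :
    letI := spaceModule hw hN hr
    Compat w.canon fun i => (w.points hw).gen i := by
  let := spaceModule hw hN hr
  have harr : ∀ a i, D.arr a • (w.points hw).gen i = (w.points hw).arrGen w.Fwd a i := by
    intro a i
    refine Eq.trans ?_ (PointSystem.arrEnd_gen_one a i)
    exact DFunLike.congr_fun (PointSystem.algEnd_arr (A := w.points hw) (fwd := w.Fwd) hN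
      (w.orientation hw).symm (not_spells hw hr) a) _
  refine ⟨fun i hi => (w.points hw).gen_none hi, fun i v hv => ?_, fun i j a ha => ?_,
    fun i a ha _ hno => ?_⟩
  · refine Eq.trans ?_ (PointSystem.eEnd_self (A := w.points hw) hv)
    exact DFunLike.congr_fun (PointSystem.algEnd_e (A := w.points hw) (fwd := w.Fwd) hN
      (w.orientation hw).symm (not_spells hw hr) v) _
  · rw [harr]
    by_cases hs : a ∈ D.Sp
    · obtain ⟨h1, rfl, h2⟩ := (arrow_special_iff hs).1 ha
      exact PointSystem.arrGen_fwd hs ((w.points hw).head h1) h2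
    · obtain ⟨h1, rfl⟩ := (arrow_iff hs).1 ha
      exact PointSystem.arrGen_ord (A := w.points hw) hs h1
  · rw [harr]
    exact PointSystem.arrGen_zero ha fun h => hno _ ((arrow_iff ha).2 ⟨h, rfl⟩)

/-- The coordinates of elements of the module of a string or band. -/
def coord : M w.canon →+ (w.points hw).Space :=
  letI := spaceModule hw hN hr
  (M.lift w.canon _ (gen_compat hw hN hr)).toAddMonoidHom

lemma coord_b (i : ℤ) (l : K) :
    coord hw hN hr (D.inK l • b w.canon i) = l • (w.points hw).gen i := by
  let := spaceModule hw hN hr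
  change M.lift w.canon _ (gen_compat hw hN hr) (D.inK l • b w.canon i) = _
  rw [map_smul, M.lift_b]
  exact PointSystem.algEnd_K (A := w.points hw) (fwd := w.Fwd) hN (w.orientation hw).symm
    (not_spells hw hr) l _

include hw hN hr in
/-- Additive maps out of the module of a string or band. -/
lemma exists_addHom {B : Type*} [AddCommGroup B] (f : ℤ → K →+ B)
    (hf : ∀ i, w.vert i = none → f i = 0) :
    ∃ g : M w.canon →+ B, ∀ i l, g (D.inK l • b w.canon i) = f i l := by
  let f' : (w.points hw).Space →+ B := Finsupp.liftAddHom (N := B) fun i => f i.1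
  refine ⟨f'.comp (coord hw hN hr), fun i l => ?_⟩
  rw [AddMonoidHom.comp_apply, coord_b]
  rcases h : w.vert i with _ | v
  · rw [(w.points hw).gen_none h, smul_zero, map_zero, hf i h]; rfl
  · have hi : ((w.points hw).vtx i).isSome := by
      change (w.vert i).isSome
      rw [h]; rfl
    have h2 : l • (w.points hw).gen i =
        (Finsupp.single (⟨i, hi⟩ : (w.points hw).Pts) l : (w.points hw).Pts →₀ K) := by
      rw [show (w.points hw).gen i = _ from (w.points hw).gen_some ⟨i, hi⟩]
      exact (Finsupp.smul_single l _ (1 : K)).trans (by rw [smul_eq_mul, mul_one])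
    rw [h2]
    exact Finsupp.liftAddHom_apply_single (N := B) _ _ _

end Word

end Coordinates
end Clannish
end SLC
end

noncomputable section
namespace SLC
namespace Clannish

/-! ### Tensor products over the parameterizing rings -/

section TensorProducts

universe u v₀ v₁

variable {K : Type u} {Q₀ : Type v₀} {Q₁ : Type v₁} [DivisionRing K] {D : Clannish K Q₀ Q₁}
  [Fintype Q₀] {C : D.Walk} {S : ParamRing C} {V : Type*} [AddCommGroup V] [Module S.carrier V]

variable (S) in
/-- The class of a pure tensor. -/
def tmk (m : M C) (v : V) : tensor S V :=
  Submodule.Quotient.mk (M := M C ⊗[ℤ] V) (m ⊗ₜ[ℤ] v)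

lemma tmk_add_left (m m' : M C) (v : V) : tmk S (m + m') v = tmk S m v + tmk S m' v :=
  congrArg (Submodule.Quotient.mk (M := M C ⊗[ℤ] V)) (TensorProduct.add_tmul m m' v)

lemma tmk_add_right (m : M C) (v v' : V) : tmk S m (v + v') = tmk S m v + tmk S m v' :=
  congrArg (Submodule.Quotient.mk (M := M C ⊗[ℤ] V)) (TensorProduct.tmul_add m v v')

lemma tmk_zero_left (v : V) : tmk S (0 : M C) v = 0 :=
  congrArg (Submodule.Quotient.mk (M := M C ⊗[ℤ] V)) (TensorProduct.zero_tmul _ v)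

lemma tmk_zero_right (m : M C) : tmk S m (0 : V) = 0 :=
  congrArg (Submodule.Quotient.mk (M := M C ⊗[ℤ] V)) (TensorProduct.tmul_zero _ m)

lemma smul_tmk (r : D.Alg) (m : M C) (v : V) : r • tmk S m v = tmk S (r • m) v := rfl

lemma tmk_act (s : S.carrier) (m : M C) (v : V) :
    tmk S ((S.act s).unop m) v = tmk S m (s • v) :=
  (Submodule.Quotient.eq _).2 (Submodule.subset_span ⟨m, s, v, rfl⟩)

/-- The additive map `v ↦ m ⊗ v`. -/
def tmkHom (m : M C) : V →+ tensor S V where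
  toFun := tmk S m
  map_zero' := tmk_zero_right m
  map_add' := tmk_add_right m

lemma tensor_induction {G : AddSubgroup (tensor S V)} (h : ∀ m v, tmk S m v ∈ G)
    (x : tensor S V) : x ∈ G := by
  obtain ⟨y, rfl⟩ := Submodule.Quotient.mk_surjective _ x
  induction y using TensorProduct.induction_on with
  | zero => exact G.zero_mem
  | tmul m v => exact h m v
  | add x y hx hy => exact G.add_mem hx hy

/-- The relations span an `R`-submodule although `g` is only additive. Because the right action
commutes with `R`, a balanced `g` kills every multiple of a relation, and the induction is run for
all multiples at once. -/
lemma exists_tensor_hom {B : Type*} [AddCommGroup B] (g : M C →+ V →+ B)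
    (hg : ∀ (s : S.carrier) m v, g ((S.act s).unop m) v = g m (s • v)) :
    ∃ h : tensor S V →+ B, ∀ m v, h (tmk S m v) = g m v := by
  let g' : M C ⊗[ℤ] V →ₗ[ℤ] B := TensorProduct.liftAddHom g
    (fun n m v => by rw [map_zsmul, map_zsmul]; rfl) |>.toIntLinearMap
  have hg' : ∀ m v, g' (m ⊗ₜ v) = g m v := fun m v => rfl
  let N := Submodule.span D.Alg
    {x : M C ⊗[ℤ] V | ∃ (m : M C) (s : S.carrier) (v : V),
      x = (S.act s).unop m ⊗ₜ[ℤ] v - m ⊗ₜ[ℤ] (s • v)}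
  have hN : ∀ x ∈ N, ∀ r : D.Alg, g' (r • x) = 0 := by
    intro x hx
    induction hx using Submodule.span_induction with
    | mem x hx =>
      obtain ⟨m, s, v, rfl⟩ := hx
      intro r
      rw [smul_sub, TensorProduct.smul_tmul', TensorProduct.smul_tmul', map_sub, hg', hg',
        ← map_smul, hg, sub_self]
    | zero => intro r; rw [smul_zero, map_zero]
    | add x y _ _ hx hy => intro r; rw [smul_add, map_add, hx, hy, add_zero]
    | smul a x _ hx => intro r; rw [← mul_smul, hx]
  let h : (M C ⊗[ℤ] V) ⧸ N.toAddSubgroup →+ B := QuotientAddGroup.lift N.toAddSubgroup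
    g'.toAddMonoidHom fun x hx => by
      have := hN x hx 1
      rw [one_smul] at this
      exact this
  exact ⟨h, fun m v => rfl⟩

end TensorProducts

/-! ### Foldings -/

section Foldings

universe u v₀ v₁

variable {K : Type u} {Q₀ : Type v₀} {Q₁ : Type v₁} [DivisionRing K] {D : Clannish K Q₀ Q₁}
  [Fintype Q₀]

/-- The identification of the vertices of a word `w` along its symmetries, the units of `R_w` which
relate the generators of `M(C_w)` at identified vertices, and the resulting coordinates on
`M(C_w)`. -/
structure Folding (w : D.Word) (hw : w.EndAdmissible) (π : TwistFamily w.canon)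
    (S : ParamRing w.canon) where
  f : ℤ → ℤ
  unit : ℤ → S.carrierˣ
  idem : ∀ i, f (f i) = f i
  vert : ∀ i, w.vert (f i) = w.vert i
  lt : ∀ i δ, w.lt (f i) δ = w.lt i δ
  nx : ∀ i δ x, w.lt i δ = some x → f (w.nx (f i) δ) = f (w.nx i δ)
  one : ∀ i, f i = i → unit i = 1
  incl_act : ∀ l, S.act (S.incl l) = kAct π l
  act_b : ∀ i, (S.act (unit i)).unop (b w.canon (f i)) = b w.canon i
  coeff : ℤ → M w.canon →+ S.carrier
  coeff_b : ∀ i v l, w.vert i = some v →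
    coeff (f i) (D.inK l • b w.canon i) = S.incl ((π.toFun (f i))⁻¹ l) * unit i
  coeff_b_ne : ∀ i j l, f i ≠ j → coeff j (D.inK l • b w.canon i) = 0
  coeff_act : ∀ j s m, coeff j ((S.act s).unop m) = coeff j m * s
  sep : ∀ i j, i ∈ w.idx.I → j ∈ w.idx.I →
    (∀ δ, (w.points hw).half i δ = (w.points hw).half j δ) → f i = f j

namespace Folding

variable {w : D.Word} {hw : w.EndAdmissible} {π : TwistFamily w.canon} {S : ParamRing w.canon}
  (F : Folding w hw π S)

open Classical in
/-- The system of points obtained by identification of vertices. -/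
def points : PointSystem D ℤ where
  vtx i := if F.f i = i then w.vert i else none
  lt i δ := if F.f i = i then w.lt i δ else none
  nx i δ := F.f (w.nx i δ)
  allowed {i δ x} h := by
    split_ifs at h with hi
    exact (w.points hw).allowed h
  head {i δ x} h := by
    split_ifs at h ⊢ with hi
    exact (w.points hw).head h
  sign {i δ x} h := by
    split_ifs at h with hi
    exact (w.points hw).sign h
  back {i δ x} h := by
    split_ifs at h with hi
    rw [if_pos (F.idem _), F.lt]
    exact (w.points hw).back h
  back_nx {i δ x} h := by
    split_ifs at h with hi
    have h1 := (w.points hw).back h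
    have h2 := (w.points hw).back_nx h
    change w.lt (w.nx i δ) _ = _ at h1
    change w.nx (w.nx i δ) _ = _ at h2
    rw [F.nx _ _ _ h1, h2, hi]
  star {i s} hs h := by
    split_ifs at h with hi
    rw [if_pos hi]
    exact (w.points hw).star hs h

lemma vtx_eq {i : ℤ} (hi : F.f i = i) : F.points.vtx i = w.vert i := if_pos hi

lemma lt_eq {i : ℤ} (hi : F.f i = i) (δ : ℤˣ) : F.points.lt i δ = w.lt i δ := if_pos hi

lemma of_vtx {i : ℤ} {v : Q₀} (h : F.points.vtx i = some v) : F.f i = i ∧ w.vert i = some v := by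
  change (if _ then _ else _) = _ at h
  split_ifs at h with hi
  exact ⟨hi, h⟩

lemma of_lt {i : ℤ} {δ : ℤˣ} {x : Letter Q₁} (h : F.points.lt i δ = some x) :
    F.f i = i ∧ w.lt i δ = some x := by
  change (if _ then _ else _) = _ at h
  split_ifs at h with hi
  exact ⟨hi, h⟩

/-- Half-words are unchanged by the identification. -/
lemma half_eq {i : ℤ} (h : w.vert i ≠ none) (δ : ℤˣ) :
    F.points.half (F.f i) δ = (w.points hw).half i δ := by
  refine PointSystem.half_map (S := w.points hw) (S' := F.points) F.f (fun p δ _ => ?_)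
    (fun p δ x hx => ?_) h δ
  · rw [F.lt_eq (F.idem p), F.lt]; rfl
  · exact F.nx p δ x hx

variable {V : Type*} [AddCommGroup V] [Module S.carrier V]

/-- The coordinates on the tensor product. -/
lemma exists_proj (j : ℤ) : ∃ κ : tensor S V →+ V, ∀ m v, κ (tmk S m v) = F.coeff j m • v := by
  obtain ⟨h, hh⟩ := exists_tensor_hom (S := S) (V := V)
    ((AddMonoidHom.comp (smulAddHom S.carrier V) (F.coeff j)) : M w.canon →+ V →+ V)
    (fun s m v => by
      change F.coeff j _ • v = F.coeff j m • s • v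
      rw [F.coeff_act, mul_smul])
  exact ⟨h, hh⟩

/-- The `j`-th coordinate on the tensor product. -/
def proj (j : ℤ) : tensor S V →+ V := (F.exists_proj j).choose

lemma proj_tmk (j : ℤ) (m : M w.canon) (v : V) : F.proj j (tmk S m v) = F.coeff j m • v :=
  (F.exists_proj j).choose_spec m v

lemma coeff_self {i : ℤ} {v : Q₀} (hi : F.f i = i) (hv : w.vert i = some v) :
    F.coeff i (b w.canon i) = 1 := by
  have := F.coeff_b i v 1 hv
  rw [hi, map_one, one_smul, map_one, map_one, F.one i hi] at this
  simpa using this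

lemma proj_self {i : ℤ} {v : Q₀} (hi : F.f i = i) (hv : w.vert i = some v) (x : V) :
    F.proj i (tmk S (b w.canon i) x) = x := by
  rw [proj_tmk, F.coeff_self hi hv, one_smul]

lemma proj_ne {i j : ℤ} (h : F.f i ≠ j) (x : V) : F.proj j (tmk S (b w.canon i) x) = 0 := by
  have := F.coeff_b_ne i j 1 h
  rw [map_one, one_smul] at this
  rw [proj_tmk, this, zero_smul]

lemma tmk_b (i : ℤ) (x : V) :
    tmk S (b w.canon i) x = tmk S (b w.canon (F.f i)) (F.unit i • x) := by
  conv_lhs => rw [← F.act_b i]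
  rw [tmk_act]; rfl

include F in
lemma tmk_inK (i : ℤ) (l : K) (x : V) :
    D.inK l • tmk S (b w.canon i) x = tmk S (b w.canon i) (S.incl ((π.toFun i)⁻¹ l) • x) := by
  rw [← tmk_act, F.incl_act, kAct_b, smul_tmk]
  congr 3
  exact (RingEquiv.apply_symm_apply _ _).symm

include hw in
-- Scalars and units can be moved across the tensor sign, which leaves pure tensors `b_i ⊗ x` at
-- representatives.
lemma span_tmk {G : AddSubgroup (tensor S V)} (h : ∀ i x, F.f i = i → tmk S (b w.canon i) x ∈ G)
    (x : tensor S V) : x ∈ G := by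
  refine tensor_induction (fun m v => ?_) x
  let H : AddSubgroup (M w.canon) :=
    { carrier := {m | ∀ v : V, tmk S m v ∈ G}
      zero_mem' := fun v => by rw [tmk_zero_left]; exact G.zero_mem
      add_mem' := fun h h' v => by rw [tmk_add_left]; exact G.add_mem (h v) (h' v)
      neg_mem' := fun {m} h v => by
        have e : tmk S (-m) v + tmk S m v = 0 := by
          rw [← tmk_add_left, neg_add_cancel, tmk_zero_left]
        rw [eq_neg_of_add_eq_zero_left e]
        exact G.neg_mem (h v) }
  refine Word.span_b hw H (fun i l v => ?_) m v
  rw [← smul_tmk, F.tmk_b, F.tmk_inK]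
  exact h _ _ (F.idem i)

lemma hom_ext_tmk {B : Type*} [AddCommGroup B] {f g : tensor S V →+ B}
    (h : ∀ i x, F.f i = i → f (tmk S (b w.canon i) x) = g (tmk S (b w.canon i) x))
    (x : tensor S V) : f x = g x := F.span_tmk (G := f.eqLocus g) h x

lemma proj_inK (i : ℤ) (l : K) (x : tensor S V) :
    F.proj i (D.inK l • x) = S.incl ((π.toFun i)⁻¹ l) • F.proj i x := by
  refine F.hom_ext_tmk (f := (F.proj i).comp (DistribSMul.toAddMonoidHom (tensor S V) (D.inK l)))
    (g := (DistribSMul.toAddMonoidHom V (S.incl ((π.toFun i)⁻¹ l))).comp (F.proj i))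
    (fun j y hj => ?_) x
  change F.proj i (D.inK l • tmk S (b w.canon j) y) =
    S.incl ((π.toFun i)⁻¹ l) • F.proj i (tmk S (b w.canon j) y)
  rw [F.tmk_inK]
  by_cases hji : j = i
  · subst hji
    rcases hv : w.vert j with _ | v
    · rw [b_out w.canon hv, tmk_zero_left, tmk_zero_left, map_zero, smul_zero]
    · rw [F.proj_self hj hv, F.proj_self hj hv]
  · rw [F.proj_ne (by rwa [hj]), F.proj_ne (by rwa [hj]), smul_zero]

open Classical in
/-- The projection onto the summand of a point. -/
def comp (i : ℤ) : tensor S V →+ tensor S V :=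
  if F.f i = i then (tmkHom (b w.canon i)).comp (F.proj i) else 0

lemma comp_apply {i : ℤ} (hi : F.f i = i) (x : tensor S V) :
    F.comp i x = tmk S (b w.canon i) (F.proj i x) := by
  unfold comp; rw [if_pos hi]; rfl

lemma comp_zero {i : ℤ} (hi : F.f i ≠ i) (x : tensor S V) : F.comp i x = 0 := by
  unfold comp; rw [if_neg hi]; rfl

lemma comp_tmk {i : ℤ} (hi : F.f i = i) (y : V) :
    F.comp i (tmk S (b w.canon i) y) = tmk S (b w.canon i) y := by
  rw [F.comp_apply hi]
  rcases hv : w.vert i with _ | v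
  · rw [b_out w.canon hv, tmk_zero_left, tmk_zero_left]
  · rw [F.proj_self hi hv]

/-- The coordinate at `i` is a left inverse of `y ↦ b_i ⊗ y`. -/
lemma tmk_eq_zero {i : ℤ} {v : Q₀} (hi : F.f i = i) (hv : w.vert i = some v) {y : V}
    (h : tmk S (b w.canon i) y = 0) : y = 0 := by
  rw [← F.proj_self hi hv y, h, map_zero]

lemma arr_tmk_nx {i j : ℤ} {a : Q₁} (h : D.arr a • b w.canon i = b w.canon j) (y : V) :
    D.arr a • tmk S (b w.canon i) y = tmk S (b w.canon (F.f j)) (F.unit j • y) := by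
  rw [smul_tmk, h, F.tmk_b]

lemma arr_tmk_back {i j : ℤ} {a : Q₁} (h : D.arr a • b w.canon j = b w.canon i) (y : V) :
    D.arr a • tmk S (b w.canon (F.f j)) y = tmk S (b w.canon i) ((F.unit j)⁻¹ • y) := by
  rw [← h, ← smul_tmk, F.tmk_b j, smul_inv_smul]

/-- The tensor product decomposes along the folded word. -/
def rep (V : Type*) [AddCommGroup V] [Module S.carrier V] : F.points.Rep (tensor S V) where
  pr := F.comp
  pr_pr i x := by
    by_cases hi : F.f i = i
    · rw [F.comp_apply hi x, F.comp_tmk hi]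
    · rw [F.comp_zero hi, F.comp_zero hi]
  pr_ne {i j} hij x := by
    by_cases hj : F.f j = j
    · by_cases hi : F.f i = i
      · rw [F.comp_apply hi, F.comp_apply hj, F.proj_ne (by rwa [hi]), tmk_zero_right]
      · rw [F.comp_zero hi, map_zero]
    · exact F.comp_zero hj _
  span G h x := F.span_tmk (fun i y hi => F.comp_tmk hi y ▸ h i _) x
  none {i} h x := by
    by_cases hi : F.f i = i
    · rw [F.vtx_eq hi] at h
      rw [F.comp_apply hi, b_out w.canon h, tmk_zero_left]
    · exact F.comp_zero hi x
  smul i l x := by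
    by_cases hi : F.f i = i
    · rw [F.comp_apply hi, F.comp_apply hi, F.proj_inK, F.tmk_inK]
    · rw [F.comp_zero hi, F.comp_zero hi, smul_zero]
  vtx {i v} h x := by
    obtain ⟨hi, hv⟩ := F.of_vtx h
    rw [F.comp_apply hi, smul_tmk, b_vertex w.canon hv]
  ord {i a} h x := by
    obtain ⟨hi, hl⟩ := F.of_lt h
    have ha : a ∉ D.Sp := (w.points hw).allowed hl
    rw [F.comp_apply hi, F.arr_tmk_nx (Word.arr_b_ord ha hl)]
    exact F.comp_tmk (F.idem _) _
  ord_surj {i a} h y := by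
    obtain ⟨hi, hl⟩ := F.of_lt h
    have ha : a ∉ D.Sp := (w.points hw).allowed hl
    refine ⟨tmk S (b w.canon i) ((F.unit (w.nx i (D.sgn (.inv a))))⁻¹ •
      F.proj (F.f (w.nx i (D.sgn (.inv a)))) y), ?_⟩
    rw [F.comp_tmk hi, F.arr_tmk_nx (Word.arr_b_ord ha hl), smul_inv_smul]
    exact (F.comp_apply (F.idem _) y).symm
  ord_inj {i a} h x hx := by
    obtain ⟨hi, hl⟩ := F.of_lt h
    have ha : a ∉ D.Sp := (w.points hw).allowed hl
    rw [F.comp_apply hi, F.arr_tmk_nx (Word.arr_b_ord ha hl)] at hx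
    have h1 := F.tmk_eq_zero (F.idem _) ((F.vert _).trans ((w.points hw).head
      ((w.points hw).back hl))) hx
    rw [F.comp_apply hi, (smul_eq_zero_iff_eq _).1 h1, tmk_zero_right]
  ord_zero {i a} ha h x := by
    by_cases hi : F.f i = i
    · rw [F.lt_eq hi] at h
      rw [F.comp_apply hi, smul_tmk, Word.arr_b_zero ha h, tmk_zero_left]
    · rw [F.comp_zero hi, smul_zero]
  spec {i δ s} h := by
    obtain ⟨hi, hl⟩ := F.of_lt h
    obtain ⟨hs1, hs, hv⟩ := PointSystem.lt_star_eq (S := w.points hw) hl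
    change w.vert i = _ at hv
    have hvn : w.vert (w.nx i δ) = some (D.head s) :=
      PointSystem.vtx_nx (S := w.points hw) hl
    have e1 : ∀ δ', F.points.half i δ' = (w.points hw).half i δ' := fun δ' => by
      have := F.half_eq (i := i) (by rw [hv]; simp) δ'
      rwa [hi] at this
    have e2 : ∀ δ', F.points.half (F.points.nx i δ) δ' = (w.points hw).half (w.nx i δ) δ' :=
      fun δ' => F.half_eq (by rw [hvn]; simp) δ'
    rw [e1, e2]
    by_cases hf : w.Fwd i δ
    · refine Or.inl ⟨(w.orientation hw).le hl hf, fun x => ?_, fun y => ?_⟩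
      · rw [F.comp_apply hi, F.arr_tmk_nx (j := w.nx i δ)
          (by rw [← hs1]; exact Word.arr_b_fwd hw hs hv (by rwa [hs1]))]
        exact F.comp_tmk (F.idem _) _
      · refine ⟨tmk S (b w.canon i) ((F.unit (w.nx i δ))⁻¹ • F.proj (F.f (w.nx i δ)) y), ?_⟩
        rw [F.comp_tmk hi, F.arr_tmk_nx (j := w.nx i δ)
          (by rw [← hs1]; exact Word.arr_b_fwd hw hs hv (by rwa [hs1])), smul_inv_smul]
        exact (F.comp_apply (F.idem _) y).symm
    -- The arrow now starts at the neighbour, whose representative differs from it by a unit, so the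
    -- inverse of that unit enters.
    · have hf' : w.Fwd (w.nx i δ) δ := ((w.orientation hw).symm hl).2 hf
      have hnn : w.nx (w.nx i δ) δ = i := (PointSystem.star_back (S := w.points hw) hl).2
      have hb : D.arr s • b w.canon (w.nx i δ) = b w.canon i := by
        have := Word.arr_b_fwd hw hs hvn (by rwa [hs1])
        rwa [hs1, hnn] at this
      refine Or.inr ⟨(w.orientation hw).ge hl hf, fun x => ?_, fun y => ?_⟩
      · change F.comp i (D.arr s • F.comp (F.f (w.nx i δ)) x) =
          D.arr s • F.comp (F.f (w.nx i δ)) x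
        rw [F.comp_apply (F.idem _), F.arr_tmk_back hb, F.comp_tmk hi]
      · refine ⟨tmk S (b w.canon (F.f (w.nx i δ))) (F.unit (w.nx i δ) • F.proj i y), ?_⟩
        change D.arr s • F.comp (F.f (w.nx i δ)) _ = _
        rw [F.comp_tmk (F.idem _), F.arr_tmk_back hb, inv_smul_smul, F.comp_apply hi]

end Folding

end Foldings
end Clannish
end SLC
end

noncomputable section
namespace SLC
namespace Clannish

/-! ### Comparison of words by their half-words -/

section Comparison

variable {K Q₀ Q₁ : Type*} [DivisionRing K] {D : Clannish K Q₀ Q₁}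

namespace Word

variable {u w : D.Word}

/-- The two half-words together contain all letters: those after `i` with the forward sign, and the
inverses of those up to `i` with the other. -/
lemma letter_of_half (hu : u.EndAdmissible) (hw : w.EndAdmissible) {i j : ℤ}
    (hi : i ∈ u.idx.I) (hj : j ∈ w.idx.I) (hs : u.fsgn i = w.fsgn j)
    (h : ∀ δ, (u.points hu).half i δ = (w.points hw).half j δ) (m : ℤ) :
    u.letter (i + m) = w.letter (j + m) := by
  have h1 := h (u.fsgn i)
  have h2 := h (- u.fsgn i)
  rw [half_fsgn hu hi, hs, half_fsgn hw hj] at h1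
  rw [half_neg_fsgn hu hi, hs, half_neg_fsgn hw hj] at h2
  rcases le_or_gt m 0 with hm | hm
  · obtain ⟨k, hk⟩ := Int.eq_ofNat_of_zero_le (show 0 ≤ -m by omega)
    have := congrFun h2 k
    change (u.letter (i - k)).map Letter.bar = (w.letter (j - k)).map Letter.bar at this
    obtain rfl : m = -(k : ℤ) := by omega
    refine Option.map_injective (f := Letter.bar) (fun x y e => ?_) this
    rw [← x.bar_bar, e, y.bar_bar]
  · obtain ⟨k, hk⟩ := Int.eq_ofNat_of_zero_le (show 0 ≤ m - 1 by omega)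
    have := congrFun h1 k
    change u.letter (i + 1 + k) = w.letter (j + 1 + k) at this
    rwa [show i + m = i + 1 + k by omega, show j + m = j + 1 + k by omega]

/-- With opposite forward signs, the forward half-word of one word is the backward half-word of the
other, so letters correspond under a reflection. -/
lemma letter_of_half_neg (hu : u.EndAdmissible) (hw : w.EndAdmissible) {i j : ℤ}
    (hi : i ∈ u.idx.I) (hj : j ∈ w.idx.I) (hs : u.fsgn i = - w.fsgn j)
    (h : ∀ δ, (u.points hu).half i δ = (w.points hw).half j δ) (m : ℤ) :
    u.letter (i + m) = (w.letter (j + 1 - m)).map Letter.bar := by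
  have h1 := h (u.fsgn i)
  have h2 := h (- u.fsgn i)
  rw [half_fsgn hu hi, hs, half_neg_fsgn hw hj] at h1
  rw [half_neg_fsgn hu hi, hs, neg_neg, half_fsgn hw hj] at h2
  rcases le_or_gt m 0 with hm | hm
  · obtain ⟨k, hk⟩ := Int.eq_ofNat_of_zero_le (show 0 ≤ -m by omega)
    have := congrFun h2 k
    change (u.letter (i - k)).map Letter.bar = w.letter (j + 1 + k) at this
    rw [show j + 1 - m = j + 1 + k by omega, ← this, show i + m = i - k by omega, Option.map_map]
    simp [Function.comp_def]
  · obtain ⟨k, hk⟩ := Int.eq_ofNat_of_zero_le (show 0 ≤ m - 1 by omega)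
    have := congrFun h1 k
    change u.letter (i + 1 + k) = (w.letter (j - k)).map Letter.bar at this
    rwa [show i + m = i + 1 + k by omega, show j + 1 - m = j - k by omega]

/-- Index sets, and places in finite index sets, are determined by where letters exist. -/
lemma idx_eq_of_dom {J J' : Idx} {i j : ℤ} (hi : i ∈ J.I) (hj : j ∈ J'.I)
    (h : ∀ m, i + m ∈ J.I' ↔ j + m ∈ J'.I') : J = J' ∧ ∀ n : ℕ, J = .fin n → i = j := by
  cases J with
  | fin n =>
    simp only [Idx.I, Set.mem_Icc] at hi
    cases J' with
    | fin n' =>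
      simp only [Idx.I, Set.mem_Icc] at hj
      simp only [Idx.I', Idx.I, Set.mem_ofPred_eq, Set.mem_Icc] at h
      have h1 := h (1 - i)
      have h2 := h (n - i)
      have h3 := h (1 - j)
      have h4 := h (n' - j)
      have e : n = n' ∧ i = j := by omega
      exact ⟨by rw [e.1], fun _ _ => e.2⟩
    | int =>
      have := (h (-i)).2 ⟨trivial, trivial⟩
      simp only [Idx.I', Idx.I, Set.mem_ofPred_eq, Set.mem_Icc] at this
      omega
  | int =>
    cases J' with
    | fin n' =>
      have := (h (-j)).1 ⟨trivial, trivial⟩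
      simp only [Idx.I', Idx.I, Set.mem_ofPred_eq, Set.mem_Icc] at this
      omega
    | int => exact ⟨rfl, fun n hn => by cases hn⟩

/-- Vertices and sign can be read off from letters, except in a word of length `0`. -/
lemma ext_fin {n : ℕ} (hu : u.idx = .fin n) (hw : w.idx = .fin n)
    (h : ∀ i, u.letter i = w.letter i) (hv : n = 0 → u.vert 0 = w.vert 0)
    (hs : n = 0 → u.sign = w.sign) : u = w := by
  have hI : ∀ i : ℤ, i ∈ u.idx.I ↔ 0 ≤ i ∧ i ≤ n := fun i => by
    rw [hu]; simp [Idx.I]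
  refine Word.ext (hu.trans hw.symm) (funext fun i => ?_) (funext h) ?_
  · by_cases hi : i ∈ u.idx.I
    · have hi' := (hI i).1 hi
      rcases Nat.eq_zero_or_pos n with rfl | hn
      · obtain rfl : i = 0 := by push_cast at hi'; omega
        exact hv rfl
      · rcases lt_or_ge 0 i with h0 | h0
        · obtain ⟨x, hx⟩ := (u.letter_some_iff i).2 ((u.mem_I'_fin hu i).2 ⟨h0, hi'.2⟩)
          rw [u.tail_eq i x hx, w.tail_eq i x (by rw [← h, hx])]
        · obtain ⟨x, hx⟩ := (u.letter_some_iff (i + 1)).2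
            ((u.mem_I'_fin hu (i + 1)).2 ⟨by omega, by omega⟩)
          have h1 := u.head_eq _ x hx
          have h2 := w.head_eq _ x (by rw [← h, hx])
          rw [add_sub_cancel_right] at h1 h2
          rw [h1, h2]
    · rw [(u.vert_none_iff i).2 hi, eq_comm, w.vert_none_iff, hw, ← hu]
      exact hi
  · rcases Nat.eq_zero_or_pos n with rfl | hn
    · exact hs rfl
    · obtain ⟨x, hx⟩ := (u.letter_some_iff 1).2 ((u.mem_I'_fin hu 1).2 ⟨le_rfl, by omega⟩)
      rw [← u.sign_one x hx, ← w.sign_one x (by rw [← h, hx])]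

lemma dom_of_letter {i j : ℤ} (h : ∀ m, u.letter (i + m) = w.letter (j + m)) (m : ℤ) :
    i + m ∈ u.idx.I' ↔ j + m ∈ w.idx.I' := by
  rw [← u.letter_dom, ← w.letter_dom, h]

lemma inv_letter_add (j m : ℤ) :
    w.inv.letter (w.flip - j + m) = (w.letter (j + 1 - m)).map Letter.bar := by
  rw [inv_letter]; ring_nf

lemma shift_fin {n : ℕ} (h : w.idx = .fin n) (m : ℤ) : w.shift m = w := by
  unfold shift
  split
  · rfl
  · rename_i h'; rw [h] at h'; cases h'

/-- A word is determined, up to shifts, by its half-words at a vertex, the vertex and the sign. -/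
lemma eq_shift_of_letter {i j : ℤ} (hi : i ∈ u.idx.I) (hj : j ∈ w.idx.I)
    (hv : u.vert i = w.vert j) (hs : ∀ n : ℕ, u.idx = .fin n → u.sign = w.sign ∨ 0 < n)
    (h : ∀ m, u.letter (i + m) = w.letter (j + m)) : w = u.shift (i - j) := by
  obtain ⟨hJ, hij⟩ := idx_eq_of_dom hi hj (dom_of_letter h)
  rcases hu : u.idx with n | _
  · have hw := hJ ▸ hu
    obtain rfl := hij n hu
    rw [shift_fin hu]
    refine (ext_fin hu hw (fun m => ?_) (fun h0 => ?_) (fun h0 => ?_)).symm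
    · have := h (m - i)
      rwa [show i + (m - i) = m by ring] at this
    · rw [hu, h0] at hi
      simp only [Idx.I, Set.mem_Icc, Nat.cast_zero] at hi
      obtain rfl : i = 0 := by omega
      exact hv
    · exact (hs n hu).resolve_right (by omega)
  · refine ext_int (hJ ▸ hu) (by rw [shift_idx, hu]) fun m => ?_
    rw [u.shift_letter hu]
    have := h (m - j)
    rw [show j + (m - j) = m by ring] at this
    rw [← this]; ring_nf

lemma eq_shift_of_half (hu : u.EndAdmissible) (hw : w.EndAdmissible) {i j : ℤ}
    (hi : i ∈ u.idx.I) (hj : j ∈ w.idx.I) (hv : u.vert i = w.vert j) (hs : u.fsgn i = w.fsgn j)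
    (h : ∀ δ, (u.points hu).half i δ = (w.points hw).half j δ) : w = u.shift (i - j) := by
  have hl := letter_of_half hu hw hi hj hs h
  refine eq_shift_of_letter hi hj hv (fun n hn => ?_) hl
  obtain ⟨hJ, hij⟩ := idx_eq_of_dom hi hj (dom_of_letter hl)
  rcases Nat.eq_zero_or_pos n with rfl | h0
  · left
    have hi' := hi
    rw [hn] at hi'
    simp only [Idx.I, Set.mem_Icc, Nat.cast_zero] at hi'
    obtain rfl : i = 0 := by omega
    obtain rfl := hij 0 hn
    rw [fsgn_zero hn, fsgn_zero (hJ ▸ hn)] at hs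
    exact hs
  · exact Or.inr h0

lemma inv_eq_shift_of_half (hu : u.EndAdmissible) (hw : w.EndAdmissible) {i j : ℤ}
    (hi : i ∈ u.idx.I) (hj : j ∈ w.idx.I) (hv : u.vert i = w.vert j) (hs : u.fsgn i = - w.fsgn j)
    (h : ∀ δ, (u.points hu).half i δ = (w.points hw).half j δ) :
    w.inv = u.shift (i - (w.flip - j)) := by
  have hl : ∀ m, u.letter (i + m) = w.inv.letter (w.flip - j + m) := fun m => by
    rw [letter_of_half_neg hu hw hi hj hs h, inv_letter_add]
  have hj' : w.flip - j ∈ w.inv.idx.I := by rwa [inv_idx, w.mem_flip]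
  refine eq_shift_of_letter hi hj' (by rw [inv_vert, sub_sub_cancel, hv]) (fun n hn => ?_) hl
  obtain ⟨hJ, hij⟩ := idx_eq_of_dom hi hj' (dom_of_letter hl)
  rcases Nat.eq_zero_or_pos n with rfl | h0
  · left
    have hn' : w.idx = .fin 0 := hJ ▸ hn
    rw [hn] at hi
    rw [hn'] at hj
    simp only [Idx.I, Set.mem_Icc, Nat.cast_zero] at hi hj
    obtain rfl : i = 0 := by omega
    obtain rfl : j = 0 := by omega
    have := fsgn_last hn'
    rw [Nat.cast_zero] at this
    rw [fsgn_zero hn, this, neg_neg] at hs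
    exact hs
  · exact Or.inr h0

lemma half_of_letter (hu : u.EndAdmissible) (hw : w.EndAdmissible) {i j : ℤ}
    (hi : i ∈ u.idx.I) (hj : j ∈ w.idx.I) (hs : u.fsgn i = w.fsgn j)
    (h : ∀ m, u.letter (i + m) = w.letter (j + m)) (δ : ℤˣ) :
    (u.points hu).half i δ = (w.points hw).half j δ := by
  by_cases hδ : δ = u.fsgn i
  · rw [hδ, half_fsgn hu hi, hs, half_fsgn hw hj]
    funext k
    change u.letter (i + 1 + k) = w.letter (j + 1 + k)
    rw [add_assoc, h, add_assoc]
  · rw [neg_eq_of_ne hδ, half_neg_fsgn hu hi, hs, half_neg_fsgn hw hj]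
    funext k
    change (u.letter (i - k)).map Letter.bar = (w.letter (j - k)).map Letter.bar
    rw [sub_eq_add_neg, h, ← sub_eq_add_neg]

lemma half_of_letter_neg (hu : u.EndAdmissible) (hw : w.EndAdmissible) {i j : ℤ}
    (hi : i ∈ u.idx.I) (hj : j ∈ w.idx.I) (hs : u.fsgn i = - w.fsgn j)
    (h : ∀ m, u.letter (i + m) = (w.letter (j + 1 - m)).map Letter.bar) (δ : ℤˣ) :
    (u.points hu).half i δ = (w.points hw).half j δ := by
  by_cases hδ : δ = u.fsgn i
  · rw [hδ, half_fsgn hu hi, hs, half_neg_fsgn hw hj]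
    funext k
    change u.letter (i + 1 + k) = (w.letter (j - k)).map Letter.bar
    rw [add_assoc, h]; ring_nf
  · rw [neg_eq_of_ne hδ, half_neg_fsgn hu hi, hs, neg_neg, half_fsgn hw hj]
    funext k
    change (u.letter (i - k)).map Letter.bar = w.letter (j + 1 + k)
    rw [sub_eq_add_neg, h, Option.map_map]
    simp [Function.comp_def]

lemma inv_inv : w.inv.inv = w := by
  have hl : ∀ i, w.inv.inv.letter i = w.letter i := fun i => by
    rw [inv_letter, inv_letter, Option.map_map, inv_flip]
    simp [Function.comp_def]
  rcases h : w.idx with n | _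
  · exact ext_fin (n := n) h h hl (fun _ => by rw [inv_vert, inv_vert, inv_flip]; ring_nf)
      (fun _ => w.inv_inv_sign h)
  · exact ext_int h h hl

/-- Two words have the same vertex and half-words at suitable vertices if and only if they are
equivalent. -/
lemma equiv_iff_exists (hu : u.EndAdmissible) (hw : w.EndAdmissible) (h0 : 0 ∈ u.idx.I) :
    w.Equiv u ↔ ∃ j ∈ w.idx.I, u.vert 0 = w.vert j ∧
      ∀ δ, (u.points hu).half 0 δ = (w.points hw).half j δ := by
  constructor
  · rintro ⟨n, h | h⟩
    · rcases hJ : u.idx with m | _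
      · rw [shift_fin hJ] at h
        subst h
        exact ⟨0, h0, rfl, fun _ => rfl⟩
      · have hwJ : w.idx = .int := by rw [h, shift_idx, hJ]
        have hl : ∀ m, u.letter (0 + m) = w.letter (-n + m) := fun m => by
          rw [h, shift_letter u hJ]; ring_nf
        have hj : -n ∈ w.idx.I := by rw [hwJ]; trivial
        obtain ⟨x, hx⟩ := (u.letter_some_iff 0).2 (u.mem_I'_int hJ 0)
        have hx' := hl 0
        rw [add_zero, add_zero, hx] at hx'
        refine ⟨-n, hj, ?_, half_of_letter hu hw h0 hj ?_ hl⟩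
        · rw [u.tail_eq _ _ hx, w.tail_eq _ _ hx'.symm]
        · rw [← neg_inj, ← sgn_prev hx, ← sgn_prev hx'.symm]
    · rcases hJ : u.idx with m | _
      · rw [shift_fin (w := u.inv) hJ] at h
        have hwJ : w.idx = .fin m := by rw [h, inv_idx, hJ]
        have huw : u = w.inv := by rw [h, inv_inv]
        have hj : (m : ℤ) ∈ w.idx.I := by rw [hwJ]; simp [Idx.I]
        refine ⟨m, hj, ?_, half_of_letter_neg hu hw h0 hj ?_ fun k => ?_⟩
        · rw [huw, inv_vert, flip_fin _ hwJ, sub_zero]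
        · rw [fsgn_zero hJ, fsgn_last hwJ, neg_neg, huw]
        · conv_lhs => rw [huw]
          rw [inv_letter, flip_fin _ hwJ, zero_add]
      · have hwJ : w.idx = .int := by rw [h, shift_idx, inv_idx, hJ]
        have hl : ∀ m, u.letter (0 + m) = (w.letter (-1 - n + 1 - m)).map Letter.bar := fun m => by
          rw [h, shift_letter u.inv hJ, inv_letter, flip_int _ hJ, Option.map_map]
          simp only [Function.comp_def, Letter.bar_bar, Option.map_id_fun', id_eq]
          ring_nf
        have hj : -1 - n ∈ w.idx.I := by rw [hwJ]; trivial
        obtain ⟨x, hx⟩ := (u.letter_some_iff 0).2 (u.mem_I'_int hJ 0)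
        have hx' := hl 0
        rw [add_zero, hx, sub_zero] at hx'
        obtain ⟨y, hy, rfl⟩ := Option.map_eq_some_iff.1 hx'.symm
        refine ⟨-1 - n, hj, ?_, half_of_letter_neg hu hw h0 hj ?_ hl⟩
        · have := w.head_eq _ _ hy
          rw [add_sub_cancel_right] at this
          rw [u.tail_eq _ _ hx, this, Letter.bar_bar]
        · rw [← neg_inj, ← sgn_prev hx, neg_neg, ← sgn_next hy, Letter.bar_bar]
  · rintro ⟨j, hj, hv, h⟩
    by_cases hs : u.fsgn 0 = w.fsgn j
    · exact ⟨_, Or.inl (eq_shift_of_half hu hw h0 hj hv hs h)⟩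
    · have e := inv_eq_shift_of_half hu hw h0 hj hv (neg_eq_of_ne hs) h
      rcases hJ : u.idx with m | _
      · rw [shift_fin hJ] at e
        refine ⟨0, Or.inr ?_⟩
        rw [← e, shift_fin (w := w.inv.inv) (n := m) (by rw [inv_idx, e, hJ]), inv_inv]
      · have hwJ : w.idx = .int := by rw [← inv_idx, e, shift_idx, hJ]
        -- Here `w⁻¹` is `u` shifted by `j + 1`, since `flip = -1`; inverting both sides turns this
        -- into the shift of `u⁻¹` by `-(j + 1)`.
        refine ⟨-1 - j, Or.inr (ext_int hwJ (by rw [shift_idx, inv_idx, hJ])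
          fun m => ?_)⟩
        have e1 : w.letter m = (w.inv.letter (w.flip + 1 - m)).map Letter.bar := by
          conv_lhs => rw [← inv_inv (w := w)]
          rw [inv_letter, inv_flip]
        rw [e1, shift_letter u.inv hJ, inv_letter u, e, shift_letter u hJ, flip_int _ hJ,
          flip_int _ hwJ]
        ring_nf

end Word

end Comparison
end Clannish
end SLC
end

noncomputable section
namespace SLC
namespace Clannish

/-! ### Construction of foldings -/

section FoldingData

universe u v₀ v₁

variable {K : Type u} {Q₀ : Type v₀} {Q₁ : Type v₁} [DivisionRing K] {D : Clannish K Q₀ Q₁}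

namespace Word

variable {w : D.Word}

/-- Reflection about a symmetry preserves the letters at a vertex and exchanges neighbours. -/
lemma lt_reflect_of {c : ℤ} (hc : w.IsSymmetry c) {i : ℤ} {δ : ℤˣ} {x : Letter Q₁}
    (h : w.lt i δ = some x) :
    w.lt (2 * c - 1 - i) δ = some x ∧ w.nx (2 * c - 1 - i) δ = 2 * c - 1 - w.nx i δ := by
  rcases dir_cases h with ⟨rfl, h1⟩ | ⟨rfl, h1⟩
  · have h2 := hc.reflect (i + 1)
    rw [h1, show 2 * c - (i + 1) = 2 * c - 1 - i by ring] at h2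
    have h3 := sgn_prev h2
    rw [Letter.bar_bar, sgn_next h1] at h3
    rw [nx_fsgn, h3, lt_neg_fsgn, nx_neg_fsgn, h2, Option.map_some, Option.map_some,
      Letter.bar_bar]
    exact ⟨rfl, by ring⟩
  · have h2 := hc.reflect i
    rw [h1, show 2 * c - i = 2 * c - 1 - i + 1 by ring, Option.map_some, Letter.bar_bar] at h2
    have h3 := sgn_next h2
    have h4 := sgn_prev h1
    rw [Letter.bar_bar, h3] at h4
    rw [nx_neg_fsgn, ← h4, lt_fsgn, nx_fsgn, h2]
    exact ⟨rfl, by ring⟩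

lemma lt_reflect {c : ℤ} (hc : w.IsSymmetry c) (i : ℤ) (δ : ℤˣ) :
    w.lt (2 * c - 1 - i) δ = w.lt i δ := by
  rcases h : w.lt i δ with _ | x
  · rcases h' : w.lt (2 * c - 1 - i) δ with _ | y
    · rfl
    · have := (lt_reflect_of hc h').1
      rw [show 2 * c - 1 - (2 * c - 1 - i) = i by ring, h] at this
      cases this
  · exact (lt_reflect_of hc h).1

lemma fsgn_shift {n : ℤ} (hl : ∀ i, w.letter (i + n) = w.letter i) (i : ℤ) :
    w.fsgn (i + n) = w.fsgn i := by
  unfold fsgn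
  rw [hl, show i + n + 1 = i + 1 + n by ring, hl]

lemma lt_shift {n : ℤ} (hl : ∀ i, w.letter (i + n) = w.letter i) (i : ℤ) (δ : ℤˣ) :
    w.lt (i + n) δ = w.lt i δ := by
  unfold lt
  rw [hl, show i + n + 1 = i + 1 + n by ring, hl, fsgn_shift hl]

lemma nx_shift {n : ℤ} (hl : ∀ i, w.letter (i + n) = w.letter i) (i : ℤ) (δ : ℤˣ) :
    w.nx (i + n) δ = w.nx i δ + n := by
  unfold nx
  rw [fsgn_shift hl]
  split <;> ring

end Word

variable [Fintype Q₀] {w : D.Word} {hw : w.EndAdmissible} {π : TwistFamily w.canon} {S : ParamRing w.canon}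

/-- The compatibilities of an identification of vertices and a choice of units at a vertex. -/
structure FoldAt (w : D.Word) (π : TwistFamily w.canon) (S : ParamRing w.canon) (f : ℤ → ℤ)
    (unit : ℤ → S.carrierˣ) (i : ℤ) : Prop where
  vert : w.vert (f i) = w.vert i
  lt : ∀ δ, w.lt (f i) δ = w.lt i δ
  nx : ∀ δ x, w.lt i δ = some x → f (w.nx (f i) δ) = f (w.nx i δ)
  act_b : (S.act (unit i)).unop (b w.canon (f i)) = b w.canon i
  -- This is forced by `b_{f i} · unit i = b_i` together with `b_i λ = π_i(λ) b_i` at both vertices.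
  comm : ∀ v l, w.vert i = some v →
    unit i * S.incl l = S.incl ((π.toFun (f i))⁻¹ (π.toFun i l)) * unit i

lemma FoldAt.base {f : ℤ → ℤ} {unit : ℤ → S.carrierˣ} {i : ℤ} (h : f i = i) (h1 : unit i = 1) :
    FoldAt w π S f unit i where
  vert := by rw [h]
  lt δ := by rw [h]
  nx δ x _ := by rw [h]
  act_b := by rw [h, h1, Units.val_one, map_one]; rfl
  comm v l _ := by
    rw [h, h1, Units.val_one, one_mul, mul_one]
    congr 1
    exact ((π.toFun i).symm_apply_apply l).symm

/-- The compatibilities carry over to the reflected vertex. -/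
lemma FoldAt.reflect {f : ℤ → ℤ} {unit : ℤ → S.carrierˣ} {i c k k' : ℤ} {s : Q₁} {P : Set ℤ}
    (h : FoldAt w π S f unit i) (hc : w.IsSymmetry c) (hm : IsMirror w.canon s k k' P)
    (hk : k + k' = 2 * c - 1) (hi : i ∈ P) (x : S.carrierˣ)
    (hf : ∀ j, f (k + k' - j) = f j) (hu : unit (k + k' - i) = unit i * x)
    (hx : ∀ l, (x : S.carrier) * S.incl l = S.incl (mirrorAut π hm l) * x)
    (hb : (S.act x).unop (b w.canon i) = b w.canon (k + k' - i)) :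
    FoldAt w π S f unit (k + k' - i) where
  vert := by rw [hf, h.vert]; exact (hm.vert i).symm
  lt δ := by rw [hf, h.lt, hk, Word.lt_reflect hc]
  nx δ x hx := by
    rw [hk, Word.lt_reflect hc] at hx
    rw [hf, h.nx δ x hx, hk, (Word.lt_reflect_of hc hx).2, ← hk, hf]
  act_b := by
    rw [hf, hu, Units.val_mul, map_mul, MulOpposite.unop_mul, Module.End.mul_apply, h.act_b, hb]
  comm v l hv := by
    have hv' : w.vert i = some v := (hm.vert i).symm.trans hv
    have hI : i ∈ w.canon.word.idx.I := Walk.mem_of_vert _ hv'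
    rw [hu, hf, Units.val_mul, mul_assoc, hx, ← mul_assoc, h.comm v _ hv',
      mirror_twist π hm hI hi, mul_assoc]

/-- The data from which a folding is built. -/
structure FoldingData (w : D.Word) (hw : w.EndAdmissible) (π : TwistFamily w.canon)
    (S : ParamRing w.canon) where
  f : ℤ → ℤ
  unit : ℤ → S.carrierˣ
  idem : ∀ i, f (f i) = f i
  foldAt : ∀ i, FoldAt w π S f unit i
  one : ∀ i, f i = i → unit i = 1
  incl_act : ∀ l, S.act (S.incl l) = kAct π l
  gens : Set S.carrier
  gens_top : ∀ G : Subring S.carrier, (∀ l, S.incl l ∈ G) → gens ⊆ G → ∀ s, s ∈ G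
  gens_act : ∀ x ∈ gens, ∀ i, ∃ i', f i' = f i ∧ w.vert i' = w.vert i ∧
    (((S.act x).unop (b w.canon i) = b w.canon i' ∧ (unit i' : S.carrier) = unit i * x) ∨
      ∃ β γ, (S.act x).unop (b w.canon i) =
          D.inK (π.toFun i β) • b w.canon i - D.inK (π.toFun i' γ) • b w.canon i' ∧
        (unit i : S.carrier) = unit i' * x ∧ x * x - S.incl β * x + S.incl γ = 0 ∧
        x * S.incl β = S.incl β * x)
  sep : ∀ i j, i ∈ w.idx.I → j ∈ w.idx.I →
    (∀ δ, (w.points hw).half i δ = (w.points hw).half j δ) → f i = f j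

namespace FoldingData

variable (F : FoldingData w hw π S)

open Classical in
/-- The coefficient at `f i = j` of `λ b_i`. -/
def coeffFun (j i : ℤ) : K →+ S.carrier :=
  if F.f i = j ∧ w.vert i ≠ none then
    ((AddMonoidHom.mulRight (F.unit i : S.carrier)).comp S.incl.toAddMonoidHom).comp
      ((π.toFun j)⁻¹ : RingAut K).toRingHom.toAddMonoidHom
  else 0

lemma exists_coeff (hN : D.NormallyBound) (hr : w.RelAdmissible) (j : ℤ) :
    ∃ g : M w.canon →+ S.carrier, ∀ i l, g (D.inK l • b w.canon i) = F.coeffFun j i l :=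
  Word.exists_addHom hw hN hr (F.coeffFun j) fun _ hi => if_neg fun h => h.2 hi

lemma coeffFun_eq {i : ℤ} (h : w.vert i ≠ none) (l : K) :
    F.coeffFun (F.f i) i l = S.incl ((π.toFun (F.f i))⁻¹ l) * F.unit i := by
  unfold coeffFun
  rw [if_pos ⟨rfl, h⟩]; rfl

lemma coeffFun_ne {i j : ℤ} (h : F.f i ≠ j) (l : K) : F.coeffFun j i l = 0 := by
  unfold coeffFun
  rw [if_neg fun h' => h h'.1]; rfl

/-- Coordinates are linear over the parameterizing ring. -/
lemma coeff_act {j : ℤ} {g : M w.canon →+ S.carrier}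
    (hg : ∀ i l, g (D.inK l • b w.canon i) = F.coeffFun j i l) (s : S.carrier) (m : M w.canon) :
    g ((S.act s).unop m) = g m * s := by
  -- The elements over which `g` is linear form a subring, so only scalars and the chosen generators
  -- have to be checked, and these only on multiples of the `b_i`.
  let G : Subring S.carrier :=
    { carrier := {s | ∀ m, g ((S.act s).unop m) = g m * s}
      mul_mem' := fun {s t} hs ht m => by
        rw [map_mul, MulOpposite.unop_mul, Module.End.mul_apply, ht, hs, mul_assoc]
      one_mem' := fun m => by rw [map_one, mul_one]; rfl
      add_mem' := fun {s t} hs ht m => by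
        rw [map_add, MulOpposite.unop_add, LinearMap.add_apply, map_add, ht, hs, mul_add]
      zero_mem' := fun m => by
        rw [map_zero, mul_zero, MulOpposite.unop_zero, LinearMap.zero_apply, map_zero]
      neg_mem' := fun {s} hs m => by
        rw [map_neg, MulOpposite.unop_neg, LinearMap.neg_apply, map_neg, hs, mul_neg] }
  have key : ∀ s, (∀ i l, w.vert i ≠ none →
      g (D.inK l • (S.act s).unop (b w.canon i)) = F.coeffFun j i l * s) → s ∈ G := by
    intro s hs m
    refine Word.span_b hw ((g.comp (S.act s).unop.toAddMonoidHom).eqLocus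
      ((AddMonoidHom.mulRight s).comp g)) (fun i l => ?_) m
    change g ((S.act s).unop (D.inK l • b w.canon i)) = g (D.inK l • b w.canon i) * s
    rcases hv : w.vert i with _ | v
    · rw [b_out w.canon hv, smul_zero, map_zero, map_zero, zero_mul]
    · rw [map_smul, hs i l (by rw [hv]; simp), hg]
  refine F.gens_top G (fun c => key _ fun i l hv => ?_) (fun x hx => key _ fun i l hv => ?_) s m
  · obtain ⟨v, hv'⟩ := Option.ne_none_iff_exists'.1 hv
    rw [F.incl_act, kAct_b, ← mul_smul, ← map_mul, hg]
    by_cases hj : F.f i = j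
    · subst hj
      rw [F.coeffFun_eq hv, F.coeffFun_eq hv, mul_assoc, (F.foldAt i).comm v c hv', map_mul,
        map_mul, mul_assoc]
    · rw [F.coeffFun_ne hj, F.coeffFun_ne hj, zero_mul]
  · obtain ⟨i', hf, hv', ⟨h1, h2⟩ | ⟨β, γ, h1, h2, h3, h4⟩⟩ := F.gens_act x hx i
    · rw [h1, hg]
      by_cases hj : F.f i = j
      · subst hj
        rw [F.coeffFun_eq hv, ← hf, F.coeffFun_eq (hv' ▸ hv), h2, mul_assoc]
      · rw [F.coeffFun_ne hj, F.coeffFun_ne (hf ▸ hj), zero_mul]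
    · rw [h1, smul_sub, ← mul_smul, ← mul_smul, ← map_mul, ← map_mul, map_sub, hg, hg]
      by_cases hj : F.f i = j
      · subst hj
        obtain ⟨v, hv1⟩ := Option.ne_none_iff_exists'.1 hv
        have e1 := (F.foldAt i).comm v β hv1
        have e2 := (F.foldAt i').comm v γ (hv'.trans hv1)
        have e3 : F.coeffFun (F.f i) i' (l * π.toFun i' γ) =
            S.incl ((π.toFun (F.f i))⁻¹ (l * π.toFun i' γ)) * F.unit i' := by
          rw [← hf, F.coeffFun_eq (hv' ▸ hv)]
        have e4 : x * x = S.incl β * x - S.incl γ := by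
          rw [eq_sub_iff_add_eq, ← sub_eq_zero, ← h3]; abel
        rw [hf] at e2
        -- With `unit i = unit i' · x`, the coefficient becomes `unit i' (x β - γ) = unit i' (β x -
        -- γ) = unit i' x²`, which is `unit i · x`.
        rw [F.coeffFun_eq hv, F.coeffFun_eq hv, e3, map_mul, map_mul, map_mul, map_mul, mul_assoc,
          mul_assoc, mul_assoc, ← e1, ← e2, ← mul_sub, h2]
        congr 1
        rw [mul_assoc, mul_assoc, h4, e4, mul_sub]
      · rw [F.coeffFun_ne hj, F.coeffFun_ne hj, F.coeffFun_ne (hf ▸ hj), zero_mul, sub_zero]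

/-- The folding built from the data. -/
def folding (hN : D.NormallyBound) (hr : w.RelAdmissible) : Folding w hw π S where
  f := F.f
  unit := F.unit
  idem := F.idem
  vert i := (F.foldAt i).vert
  lt i := (F.foldAt i).lt
  nx i := (F.foldAt i).nx
  one := F.one
  incl_act := F.incl_act
  act_b i := (F.foldAt i).act_b
  coeff j := (F.exists_coeff hN hr j).choose
  coeff_b i v l hv := by
    rw [(F.exists_coeff hN hr (F.f i)).choose_spec, F.coeffFun_eq (by rw [hv]; simp)]
  coeff_b_ne i j l h := by rw [(F.exists_coeff hN hr j).choose_spec, F.coeffFun_ne h]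
  coeff_act j s m := F.coeff_act (F.exists_coeff hN hr j).choose_spec s m
  sep := F.sep

end FoldingData

end FoldingData
end Clannish
end SLC
end

noncomputable section
namespace SLC

/-! ### The variables of the parameterizing rings -/

section Variables

variable {K : Type*} [DivisionRing K]

/-- The variable of `K[x;τ]/(x² - β x + γ)`. -/
def quadX (τ : RingAut K) (β γ : K) : QuadRing τ β γ :=
  RingQuot.mkRingHom (QuadRel τ β γ) SkewPolynomial.X

lemma skewX_mul_C (τ : RingAut K) (a : K) :
    SkewPolynomial.X * skewC τ a = skewC τ (τ a) * SkewPolynomial.X := by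
  have h1 : SkewPolynomial.X * skewC τ a = mon τ 1 (τ a) :=
    (SkewPolynomial.X_mul_monomial (R := Tw τ) 0 a)
  have h2 : skewC τ (τ a) * SkewPolynomial.X = mon τ 1 (τ a) := SkewPolynomial.C_mul_X_eq_monomial
  rw [h1, h2]

lemma quadX_mul_C (τ : RingAut K) (β γ a : K) :
    quadX τ β γ * quadC τ β γ a = quadC τ β γ (τ a) * quadX τ β γ := by
  unfold quadX quadC
  rw [RingHom.comp_apply, RingHom.comp_apply, ← map_mul, ← map_mul, skewX_mul_C]

lemma quadX_quad (τ : RingAut K) (β γ : K) :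
    quadX τ β γ * quadX τ β γ - quadC τ β γ β * quadX τ β γ + quadC τ β γ γ = 0 := by
  have h := RingQuot.mkRingHom_rel (QuadRel.quad (τ := τ) (β := β) (γ := γ))
  rw [quad, pow_two, map_zero] at h
  rw [← h, map_add, map_sub, map_mul, map_mul]
  rfl

lemma quadLift_X {E : Type*} [Ring E] (τ : RingAut K) (β γ : K) (κ : K →+* E) (ξ : E)
    (h : ∀ a, κ (τ a) * ξ = ξ * κ a) (hq : ξ * ξ - κ β * ξ + κ γ = 0) :
    quadLift τ β γ κ ξ h hq (quadX τ β γ) = ξ := by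
  unfold quadLift quadX
  rw [RingQuot.lift_mkRingHom_apply]
  exact (skewLift_mon τ κ ξ h 1 1).trans (by simp)

lemma quad_gen (τ : RingAut K) (β γ : K) (G : Subring (QuadRing τ β γ))
    (hC : ∀ a, quadC τ β γ a ∈ G) (hX : quadX τ β γ ∈ G) (s : QuadRing τ β γ) : s ∈ G := by
  obtain ⟨p, rfl⟩ := RingQuot.mkRingHom_surjective _ s
  refine SkewMonoidAlgebra.induction_on (k := Tw τ) (G := Multiplicative ℕ)
    (p := fun p => RingQuot.mkRingHom (QuadRel τ β γ) p ∈ G) p ?_ (fun n a => ?_)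
    (fun p q hp hq => ?_)
  · rw [map_zero]; exact G.zero_mem
  · have h : (SkewMonoidAlgebra.single n a : SkewPoly τ) =
        skewC τ a * SkewPolynomial.X ^ Multiplicative.toAdd n :=
      (SkewPolynomial.C_mul_X_pow_eq_monomial (n := Multiplicative.toAdd n)).symm
    rw [h, map_mul, map_pow]
    exact G.mul_mem (hC a) (G.pow_mem hX _)
  · rw [map_add]; exact G.add_mem hp hq

/-- In a ring over `K`, a root of a normal quadratic with non-zero constant term is a unit. -/
lemma isUnit_of_quad {E : Type*} [Ring E] (κ : K →+* E) {β γ : K} {ξ : E} (hγ : γ ≠ 0)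
    (hβ : ξ * κ β = κ β * ξ) (hq : ξ * ξ - κ β * ξ + κ γ = 0) : IsUnit ξ := by
  have e1 : (κ β - ξ) * ξ = κ γ := by
    rw [sub_mul, ← sub_eq_zero, ← neg_eq_zero, ← hq]; abel
  have e2 : ξ * (κ β - ξ) = κ γ := by rw [← e1, mul_sub, sub_mul, hβ]
  refine isUnit_iff_exists_and_exists.2
    ⟨⟨(κ β - ξ) * κ γ⁻¹, ?_⟩, κ γ⁻¹ * (κ β - ξ), ?_⟩
  · rw [← mul_assoc, e2, ← map_mul, mul_inv_cancel₀ hγ, map_one]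
  · rw [mul_assoc, e1, ← map_mul, inv_mul_cancel₀ hγ, map_one]

/-- Powers of the variable of `K[x,x⁻¹;τ]`. -/
def laurentX (τ : RingAut K) : Multiplicative ℤ →* (SkewLaurent τ)ˣ :=
  (SkewMonoidAlgebra.of (Tw τ) (Multiplicative ℤ)).toHomUnits

lemma laurentX_mul_C (τ : RingAut K) (m : ℤ) (a : K) :
    (laurentX τ (.ofAdd m) : SkewLaurent τ) * laurentC τ a =
      laurentC τ ((τ ^ m) a) * laurentX τ (.ofAdd m) := by
  have h1 : (laurentX τ (.ofAdd m) : SkewLaurent τ) * laurentC τ a =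
      SkewMonoidAlgebra.single (Multiplicative.ofAdd m) ((τ ^ m) a : Tw τ) := by
    refine (SkewMonoidAlgebra.single_mul_single (k := Tw τ) (a₁ := Multiplicative.ofAdd m)
      (a₂ := 1) (b₁ := 1) (b₂ := a)).trans ?_
    rw [mul_one, one_mul]; rfl
  have h2 : laurentC τ ((τ ^ m) a) * laurentX τ (.ofAdd m) =
      SkewMonoidAlgebra.single (Multiplicative.ofAdd m) ((τ ^ m) a : Tw τ) := by
    refine (SkewMonoidAlgebra.single_mul_single (k := Tw τ) (a₁ := 1)
      (a₂ := Multiplicative.ofAdd m) (b₁ := (τ ^ m) a) (b₂ := 1)).trans ?_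
    rw [one_mul, one_smul]
    exact congrArg _ (mul_one (M := K) _)
  rw [h1, h2]

lemma laurentLift_C {E : Type*} [Ring E] (τ : RingAut K) (κ : K →+* E)
    (g : Multiplicative ℤ →* E) (h) (a : K) : laurentLift τ κ g h (laurentC τ a) = κ a := by
  refine (SkewMonoidAlgebra.liftNC_single (k := Tw τ)
    (RingHom.toAddMonoidHom (show Tw τ →+* E from κ)) g 1 a).trans ?_
  rw [map_one, mul_one]; rfl

lemma laurentLift_X {E : Type*} [Ring E] (τ : RingAut K) (κ : K →+* E)
    (g : Multiplicative ℤ →* E) (h) (m : ℤ) :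
    laurentLift τ κ g h (laurentX τ (.ofAdd m)) = g (.ofAdd m) := by
  refine (SkewMonoidAlgebra.liftNC_single (k := Tw τ)
    (RingHom.toAddMonoidHom (show Tw τ →+* E from κ)) g (.ofAdd m) 1).trans ?_
  exact (congrArg (· * g (.ofAdd m)) (map_one κ)).trans (one_mul _)

lemma laurent_gen (τ : RingAut K) (G : Subring (SkewLaurent τ)) (hC : ∀ a, laurentC τ a ∈ G)
    (hX : ∀ m, (laurentX τ (.ofAdd m) : SkewLaurent τ) ∈ G) (s : SkewLaurent τ) : s ∈ G := by
  refine SkewMonoidAlgebra.induction_on (k := Tw τ) (G := Multiplicative ℤ)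
    (p := fun p => p ∈ G) s G.zero_mem (fun n a => ?_) (fun p q hp hq => G.add_mem hp hq)
  have h : laurentC τ a * laurentX τ (.ofAdd n.toAdd) = SkewMonoidAlgebra.single n (a : Tw τ) := by
    refine (SkewMonoidAlgebra.single_mul_single (k := Tw τ) (a₁ := 1)
      (a₂ := n) (b₁ := a) (b₂ := 1)).trans ?_
    rw [one_mul, one_smul]
    exact congrArg _ (mul_one (M := K) _)
  rw [← h]
  exact G.mul_mem (hC a) (hX _)

end Variables

/-! ### Generation and mapping properties of free products. -/

section FreeProducts

variable {K S T : Type*} [Ring K] [Ring S] [Ring T]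

/-- The map `T → S *_K T`. -/
def FreeProd.inr (i : K →+* S) (j : K →+* T) : T →+* FreeProd i j where
  toFun a := RingQuot.mkRingHom (FreeProdRel i j) (FreeAlgebra.ι ℤ (.inr a))
  map_one' := by rw [RingQuot.mkRingHom_rel FreeProdRel.oner, map_one]
  map_mul' a b := by rw [RingQuot.mkRingHom_rel (FreeProdRel.mulr a b), map_mul]
  map_add' a b := by rw [RingQuot.mkRingHom_rel (FreeProdRel.addr a b), map_add]
  map_zero' := by
    have h := RingQuot.mkRingHom_rel (FreeProdRel.addr (i := i) (j := j) 0 0)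
    rw [add_zero, map_add] at h
    simpa using h

lemma FreeProd.inl_eq_inr (i : K →+* S) (j : K →+* T) (a : K) :
    FreeProd.inl i j (i a) = FreeProd.inr i j (j a) :=
  RingQuot.mkRingHom_rel (FreeProdRel.glue a)

lemma FreeProd.lift_inl {E : Type*} [Ring E] (i : K →+* S) (j : K →+* T) (f : S →+* E)
    (g : T →+* E) (h : ∀ a, f (i a) = g (j a)) (s : S) :
    FreeProd.lift i j f g h (FreeProd.inl i j s) = f s := by
  unfold FreeProd.lift FreeProd.inl
  refine (RingQuot.lift_mkRingHom_apply _ _ _).trans ?_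
  simp

lemma FreeProd.lift_inr {E : Type*} [Ring E] (i : K →+* S) (j : K →+* T) (f : S →+* E)
    (g : T →+* E) (h : ∀ a, f (i a) = g (j a)) (s : T) :
    FreeProd.lift i j f g h (FreeProd.inr i j s) = g s := by
  unfold FreeProd.lift FreeProd.inr
  refine (RingQuot.lift_mkRingHom_apply _ _ _).trans ?_
  simp

lemma FreeProd.gen (i : K →+* S) (j : K →+* T) (G : Subring (FreeProd i j))
    (hl : ∀ a, FreeProd.inl i j a ∈ G) (hr : ∀ a, FreeProd.inr i j a ∈ G) (s : FreeProd i j) :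
    s ∈ G := by
  obtain ⟨p, rfl⟩ := RingQuot.mkRingHom_surjective _ s
  induction p using FreeAlgebra.induction with
  | grade0 n =>
    rw [show algebraMap ℤ (FreeAlgebra ℤ (S ⊕ T)) n = (n : FreeAlgebra ℤ (S ⊕ T)) from
      eq_intCast _ n, map_intCast]
    exact intCast_mem G n
  | grade1 x =>
    rcases x with a | a
    · exact hl a
    · exact hr a
  | mul a b ha hb => rw [map_mul]; exact G.mul_mem ha hb
  | add a b ha hb => rw [map_add]; exact G.add_mem ha hb

end FreeProducts

namespace Clannish

/-! ### Units attached to reflections. -/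

section MirrorUnits

universe u v₀ v₁

variable {K : Type u} {Q₀ : Type v₀} {Q₁ : Type v₁} [DivisionRing K] {D : Clannish K Q₀ Q₁}
  [Fintype Q₀] {w : D.Word} {π : TwistFamily w.canon} {S : ParamRing w.canon}
  {k k' : ℤ} {s : Q₁} {P : Set ℤ}

/-- A unit of the parameterizing ring which acts on `M(C)` through a reflection. -/
structure IsMirrorUnit (S : ParamRing w.canon) (hm : IsMirror w.canon s k k' P)
    (x : S.carrierˣ) : Prop where
  comm : ∀ l, (x : S.carrier) * S.incl l = S.incl (mirrorAut π hm l) * x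
  quad : (x : S.carrier) * x - S.incl (mirrorβ π hm) * x + S.incl (mirrorγ π hm) = 0
  act : ∀ i, (S.act x).unop (b w.canon i) = mirrorFun π hm i

/-- The variable is a root of a quadratic with non-zero constant term, and it commutes with `β`
because the twist fixes `β`, so it is invertible. The map `φ` allows the reflection ring to be a
factor of a free product. -/
lemma exists_mirrorUnit (hN : D.NormallyBound) (hS : D.NonSingular)
    (hm : IsMirror w.canon s k k' P) (φ : MirrorRing π hm →+* S.carrier)
    (hφ : ∀ l, φ (mirrorC π hm l) = S.incl l)
    (hact : ∀ r, S.act (φ r) = mirrorAct hN π hm r) :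
    ∃ x : S.carrierˣ, IsMirrorUnit (π := π) S hm x ∧ x = φ (quadX _ _ _) := by
  have hc : ∀ l, φ (quadX _ _ _) * S.incl l = S.incl (mirrorAut π hm l) * φ (quadX _ _ _) :=
    fun l => by rw [← hφ, ← hφ, ← map_mul, ← map_mul, quadX_mul_C]
  have hq : φ (quadX _ _ _) * φ (quadX _ _ _) - S.incl (mirrorβ π hm) * φ (quadX _ _ _) +
      S.incl (mirrorγ π hm) = 0 := by
    rw [← hφ, ← hφ, ← map_mul, ← map_mul, ← map_sub, ← map_add, quadX_quad, map_zero]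
  have hγ : mirrorγ π hm ≠ 0 := by
    intro h
    apply hS s hm.special
    rw [← mirror_γ π hm, h, map_zero]
  have hβ : φ (quadX _ _ _) * S.incl (mirrorβ π hm) =
      S.incl (mirrorβ π hm) * φ (quadX _ _ _) := by
    rw [hc, (mirror_facts hN π hm).1]
  obtain ⟨x, hx⟩ := isUnit_of_quad S.incl hγ hβ hq
  refine ⟨x, ⟨fun l => ?_, ?_, fun i => ?_⟩, hx⟩
  · rw [hx, hc]
  · rw [hx, hq]
  · rw [hx, hact]
    unfold mirrorAct
    rw [quadLift_X]
    exact mirrorEnd_b hN π hm i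

/-- The clause on generators in the construction of foldings, for a mirror unit. -/
lemma IsMirrorUnit.gens_act {hm : IsMirror w.canon s k k' P} (hN : D.NormallyBound)
    {x : S.carrierˣ} (hx : IsMirrorUnit (π := π) S hm x) {f : ℤ → ℤ} {unit : ℤ → S.carrierˣ}
    (hf : ∀ j, f (k + k' - j) = f j) (hu : ∀ i ∈ P, unit (k + k' - i) = unit i * x) (i : ℤ) :
    ∃ i', f i' = f i ∧ w.vert i' = w.vert i ∧
    (((S.act x).unop (b w.canon i) = b w.canon i' ∧ (unit i' : S.carrier) = unit i * x) ∨
      ∃ β γ, (S.act x).unop (b w.canon i) =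
          D.inK (π.toFun i β) • b w.canon i - D.inK (π.toFun i' γ) • b w.canon i' ∧
        (unit i : S.carrier) = unit i' * x ∧
        (x : S.carrier) * x - S.incl β * x + S.incl γ = 0 ∧
        x * S.incl β = S.incl β * x) := by
  refine ⟨k + k' - i, hf i, hm.vert i, ?_⟩
  by_cases hi : i ∈ P
  · exact Or.inl ⟨by rw [hx.act, mirrorFun_pos π hm hi], by rw [hu i hi, Units.val_mul]⟩
  · refine Or.inr ⟨mirrorβ π hm, mirrorγ π hm, by rw [hx.act, mirrorFun_neg π hm hi], ?_, hx.quad,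
      by rw [hx.comm, (mirror_facts hN π hm).1]⟩
    rw [← Units.val_mul, ← hu _ ((hm.side i).2 hi), sub_sub_cancel]

lemma IsMirrorUnit.foldAt {hm : IsMirror w.canon s k k' P} {x : S.carrierˣ}
    (hx : IsMirrorUnit (π := π) S hm x) {f : ℤ → ℤ} {unit : ℤ → S.carrierˣ} {i c : ℤ}
    (h : FoldAt w π S f unit i) (hc : w.IsSymmetry c) (hk : k + k' = 2 * c - 1) (hi : i ∈ P)
    (hf : ∀ j, f (k + k' - j) = f j) (hu : ∀ i ∈ P, unit (k + k' - i) = unit i * x) :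
    FoldAt w π S f unit (k + k' - i) :=
  h.reflect hc hm hk hi x hf (hu i hi) hx.comm (by rw [hx.act, mirrorFun_pos π hm hi])

end MirrorUnits
end Clannish
end SLC
end

noncomputable section
namespace SLC
namespace Clannish

/-! ### Foldings of strings and bands -/

section Kinds

universe u v₀ v₁

variable {K : Type u} {Q₀ : Type v₀} {Q₁ : Type v₁} [DivisionRing K] {D : Clannish K Q₀ Q₁}

namespace Word

variable {w : D.Word}

lemma fsgn_eq_or (u w : D.Word) (i j : ℤ) : u.fsgn i = w.fsgn j ∨ u.fsgn i = - w.fsgn j := by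
  by_cases h : u.fsgn i = w.fsgn j
  · exact Or.inl h
  · exact Or.inr (neg_eq_of_ne h)

/-- Places of a finite word with the same half-words are equal or opposite. -/
lemma eq_or_add_eq_of_half (hw : w.EndAdmissible) {n : ℕ} (hn : w.idx = .fin n) {i j : ℤ}
    (hi : i ∈ w.idx.I) (hj : j ∈ w.idx.I)
    (h : ∀ δ, (w.points hw).half i δ = (w.points hw).half j δ) :
    i = j ∨ (i + j = n ∧ w.fsgn i = - w.fsgn j) := by
  rcases fsgn_eq_or w w i j with hs | hs
  · exact Or.inl ((idx_eq_of_dom hi hj (dom_of_letter (letter_of_half hw hw hi hj hs h))).2 n hn)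
  · right
    have hl : ∀ m, w.letter (i + m) = w.inv.letter (w.flip - j + m) := fun m => by
      rw [letter_of_half_neg hw hw hi hj hs h, inv_letter_add]
    have hj' : w.flip - j ∈ w.inv.idx.I := by rwa [inv_idx, w.mem_flip]
    have := (idx_eq_of_dom hi hj' (dom_of_letter hl)).2 n hn
    rw [flip_fin _ hn] at this
    exact ⟨by omega, hs⟩

/-- Equal half-words with the same forward sign mean that the letters are invariant under the
translation taking `i` to `j`. -/
lemma letter_translate (hw : w.EndAdmissible) (hI : w.idx = .int) {i j : ℤ}
    (hs : w.fsgn i = w.fsgn j) (h : ∀ δ, (w.points hw).half i δ = (w.points hw).half j δ) (m : ℤ) :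
    w.letter (m + (j - i)) = w.letter m := by
  have := letter_of_half hw hw (i := i) (j := j) (by rw [hI]; trivial) (by rw [hI]; trivial) hs h
    (m - i)
  rw [show i + (m - i) = m by ring] at this
  rw [this]; ring_nf

/-- Equal half-words with opposite forward signs mean that the letters are inverted by the
reflection exchanging the vertices `i` and `j`; on places it is `m ↦ i + j + 1 - m`, since a letter
lies between two vertices. -/
lemma letter_opposite (hw : w.EndAdmissible) (hI : w.idx = .int) {i j : ℤ}
    (hs : w.fsgn i = - w.fsgn j) (h : ∀ δ, (w.points hw).half i δ = (w.points hw).half j δ)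
    (m : ℤ) : w.letter (i + j + 1 - m) = (w.letter m).map Letter.bar := by
  have := letter_of_half_neg hw hw (i := i) (j := j) (by rw [hI]; trivial) (by rw [hI]; trivial)
    hs h (j + 1 - m)
  rw [show j + 1 - (j + 1 - m) = m by ring] at this
  rw [← this]; ring_nf

lemma letter_period {n : ℕ} (h : w.idx = .int) (hn : w.shift n = w) (i : ℤ) :
    w.letter (i + n) = w.letter i := by
  conv_rhs => rw [← hn]
  rw [w.shift_letter h, add_comm]

lemma letter_period_mul {n : ℤ} (hn : ∀ i, w.letter (i + n) = w.letter i) (m i : ℤ) :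
    w.letter (i + n * m) = w.letter i := by
  induction m using Int.induction_on with
  | zero => simp
  | succ m ih => rw [← ih, ← hn (i + n * m)]; ring_nf
  | pred m ih => rw [← ih, ← hn (i + n * (-m - 1))]; ring_nf

/-- The period of a band divides every shift that preserves the letters. -/
lemma period_dvd {n : ℕ} (h : w.idx = .int) (hn : IsLeast {n : ℕ | 0 < n ∧ w.shift n = w} n)
    {d : ℤ} (hd : ∀ m, w.letter (m + d) = w.letter m) : (n : ℤ) ∣ d := by
  have hn0 : (0 : ℤ) < n := by exact_mod_cast hn.1.1
  rw [Int.dvd_iff_emod_eq_zero]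
  by_contra hne
  have h0 := Int.emod_nonneg d hn0.ne'
  have h1 := Int.emod_lt_of_pos d hn0
  obtain ⟨r, hr⟩ := Int.eq_ofNat_of_zero_le h0
  -- The remainder of `d` modulo `n` would be a smaller positive period.
  have hl : ∀ m, w.letter (m + r) = w.letter m := fun m => by
    rw [← letter_period_mul (letter_period h hn.1.2) (d / n) (m + r), ← hd m]
    congr 1
    have := Int.emod_add_mul_ediv d n
    rw [hr] at this
    linear_combination this
  have : n ≤ r := hn.2 ⟨by omega, ext_int (by rw [shift_idx, h]) h fun m => by
    rw [w.shift_letter h, add_comm, hl]⟩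
  omega

/-- A reflection of the letters of a band is about a symmetry. -/
lemma symmetry_of_opposite (h : w.idx = .int) {e : ℤ}
    (he : ∀ m, w.letter (e - m) = (w.letter m).map Letter.bar) :
    ∃ c, e = 2 * c ∧ w.IsSymmetry c := by
  have hx : ∀ i, ∃ x, w.letter i = some x := fun i => (w.letter_some_iff i).2 (w.mem_I'_int h i)
  rcases Int.even_or_odd' e with ⟨c, rfl | rfl⟩
  · obtain ⟨x, hx⟩ := hx c
    exact ⟨c, rfl, w.isSymmetry_of_reflect hx he⟩
  -- A reflection about the midpoint between two places would make the letters at `c` and `c + 1`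
  -- inverse to each other, which is impossible in a word.
  · exfalso
    obtain ⟨x, hx⟩ := hx c
    refine w.not_bar_consecutive c x hx ?_
    have := he c
    rw [show 2 * c + 1 - c = c + 1 by ring, hx] at this
    exact this

/-- The symmetries of a band are equally spaced. -/
lemma symmetry_dvd {p r : ℕ} (hr : IsLeast {i : ℤ | 0 < i ∧ w.IsSymmetry i} (r + 1))
    (hp : IsGreatest {i : ℤ | i ≤ 0 ∧ w.IsSymmetry i} (-p)) {c : ℤ} (hc : w.IsSymmetry c) :
    (p + r + 1 : ℤ) ∣ c + p := by
  -- The composite of the reflections about `-p` and `r + 1` is the translation by `2 (p + r + 1)`.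
  have up : ∀ c, w.IsSymmetry c → w.IsSymmetry (c + 2 * (p + r + 1)) := fun c hc => by
    have := symmetry_reflect hr.1.2 (symmetry_reflect hp.1.2 hc)
    rwa [show 2 * ((r : ℤ) + 1) - (2 * -p - c) = c + 2 * (p + r + 1) by ring] at this
  have down : ∀ c, w.IsSymmetry c → w.IsSymmetry (c - 2 * (p + r + 1)) := fun c hc => by
    have := symmetry_reflect hp.1.2 (symmetry_reflect hr.1.2 hc)
    rwa [show 2 * -(p : ℤ) - (2 * (r + 1) - c) = c - 2 * (p + r + 1) by ring] at this
  have all : ∀ q : ℤ, w.IsSymmetry (c + 2 * (p + r + 1) * q) := by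
    intro q
    induction q using Int.induction_on with
    | zero => simpa using hc
    | succ q ih => have := up _ ih; ring_nf at this ⊢; exact this
    | pred q ih => have := down _ ih; ring_nf at this ⊢; exact this
  set L : ℤ := p + r + 1 with hL
  have hL0 : 0 < 2 * L := by omega
  have gap : ∀ c, w.IsSymmetry c → -p < c → c < r + 1 → False := fun c hc h1 h2 => by
    rcases lt_or_ge 0 c with h0 | h0
    · have : (r : ℤ) + 1 ≤ c := hr.2 ⟨h0, hc⟩
      omega
    · have : c ≤ -(p : ℤ) := hp.2 ⟨h0, hc⟩
      omega
  have hq := all (-((c + p) / (2 * L)))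
  have h0 := Int.emod_nonneg (c + p) hL0.ne'
  have h1 := Int.emod_lt_of_pos (c + p) hL0
  have h2 := Int.emod_add_mul_ediv (c + p) (2 * L)
  set a := (c + p) % (2 * L)
  set q := (c + p) / (2 * L)
  rw [show c + 2 * L * -q = a - p by linarith] at hq
  -- After translation the symmetry is `a - p` with `0 ≤ a < 2 L`. None lies strictly between `-p`
  -- and `r + 1`, and one beyond `r + 1` would be reflected into that gap.
  have h3 : a = 0 ∨ a = L := by
    rcases lt_trichotomy a L with h | h | h
    · by_contra hne
      exact gap _ hq (by omega) (by omega)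
    · exact Or.inr h
    · exfalso
      refine gap _ (symmetry_reflect hr.1.2 hq) (by omega) (by omega)
  rcases h3 with h3 | h3
  · exact ⟨2 * q, by rw [← h2, h3]; ring⟩
  · exact ⟨1 + 2 * q, by rw [← h2, h3]; ring⟩

lemma isSymmetry_center {k : ℕ} {s : Q₁} (hk : w.idx = .fin (2 * k + 1)) (hw : w.inv = w)
    (hs : w.letter (k + 1) = some (.star s)) : w.IsSymmetry (k + 1) := by
  refine w.isSymmetry_of_reflect hs fun i => ?_
  conv_lhs => rw [← hw]
  rw [inv_letter, w.flip_fin hk]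
  push_cast
  ring_nf

end Word

/-! ### The combinatorics of two reflections -/

/-- The vertex in `[-p, r]` related to `i` by the reflections about `-p` and `r + 1`. -/
def dihedral (p r i : ℤ) : ℤ :=
  (if Even ((i + p) / (p + r + 1)) then (i + p) % (p + r + 1)
    else p + r - (i + p) % (p + r + 1)) - p

/-- Alternating products ending with the first argument. -/
def alternating {U : Type*} [Monoid U] (x y : U) : ℕ → U
  | 0 => 1
  | n + 1 => alternating y x n * x

/-- Alternating products indexed by integers. -/
def alternatingZ {U : Type*} [Monoid U] (x y : U) (t : ℤ) : U :=
  if 0 ≤ t then alternating x y t.toNat else alternating y x (-t).toNat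

lemma alternatingZ_zero {U : Type*} [Monoid U] (x y : U) : alternatingZ x y 0 = 1 := rfl

lemma alternatingZ_nonpos {U : Type*} [Monoid U] (x y : U) {t : ℤ} (ht : t ≤ 0) :
    alternatingZ x y t = alternating y x (-t).toNat := by
  unfold alternatingZ
  split
  · obtain rfl : t = 0 := by omega
    rfl
  · rfl

/-- Reflection about `r + 1` exchanges the blocks `t` and `1 - t` of length `p + r + 1`. For `t ≤ 0`
it moves away from the block `0`, which appends one factor `x`. -/
lemma alternatingZ_right {U : Type*} [Monoid U] (x y : U) {t : ℤ} (ht : t ≤ 0) :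
    alternatingZ x y (1 - t) = alternatingZ x y t * x := by
  rw [alternatingZ_nonpos x y ht]
  unfold alternatingZ
  rw [if_pos (by omega), show (1 - t).toNat = (-t).toNat + 1 by omega]
  rfl

/-- Likewise reflection about `-p` exchanges the blocks `t` and `-1 - t` and appends `y` for `t ≥
0`. -/
lemma alternatingZ_left {U : Type*} [Monoid U] (x y : U) {t : ℤ} (ht : 0 ≤ t) :
    alternatingZ x y (-1 - t) = alternatingZ x y t * y := by
  rw [alternatingZ_nonpos x y (by omega)]
  unfold alternatingZ
  rw [if_pos ht, show (-(-1 - t)).toNat = t.toNat + 1 by omega]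
  rfl

section Dihedral

variable {p r : ℤ}

lemma dihedral_div (hL : 0 < p + r + 1) {i a t : ℤ} (h : i + p = a + (p + r + 1) * t) (h0 : 0 ≤ a)
    (h1 : a < p + r + 1) : (i + p) / (p + r + 1) = t ∧ (i + p) % (p + r + 1) = a := by
  rw [h, Int.add_mul_ediv_left _ _ hL.ne', Int.add_mul_emod_self_left,
    Int.ediv_eq_zero_of_lt h0 h1, Int.emod_eq_of_lt h0 h1, zero_add]
  exact ⟨rfl, rfl⟩

lemma dihedral_cases (hL : 0 < p + r + 1) (i : ℤ) : ∃ a t, i + p = a + (p + r + 1) * t ∧ 0 ≤ a ∧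
    a < p + r + 1 :=
  ⟨_, _, (Int.emod_add_mul_ediv _ _).symm, Int.emod_nonneg _ hL.ne', Int.emod_lt_of_pos _ hL⟩

lemma dihedral_of (hL : 0 < p + r + 1) {i a t : ℤ} (h : i + p = a + (p + r + 1) * t) (h0 : 0 ≤ a)
    (h1 : a < p + r + 1) : dihedral p r i = (if Even t then a else p + r - a) - p := by
  unfold dihedral
  rw [(dihedral_div hL h h0 h1).1, (dihedral_div hL h h0 h1).2]

lemma dihedral_mem (hL : 0 < p + r + 1) (i : ℤ) : -p ≤ dihedral p r i ∧ dihedral p r i ≤ r := by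
  obtain ⟨a, t, h, h0, h1⟩ := dihedral_cases hL i
  rw [dihedral_of hL h h0 h1]
  split <;> omega

lemma dihedral_self (hL : 0 < p + r + 1) {i : ℤ} (h0 : -p ≤ i) (h1 : i ≤ r) :
    dihedral p r i = i := by
  rw [dihedral_of (t := 0) hL (show i + p = (i + p) + (p + r + 1) * 0 by ring) (by omega)
    (by omega), if_pos Even.zero]
  ring

/-- The reflection takes the block `t` to the block `2 q - 1 - t` and reverses positions within
blocks. The parity of the block changes, which compensates the reversal. -/
lemma dihedral_reflect (hL : 0 < p + r + 1) (i q : ℤ) :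
    dihedral p r (2 * (-p + (p + r + 1) * q) - 1 - i) = dihedral p r i := by
  obtain ⟨a, t, h, h0, h1⟩ := dihedral_cases hL i
  rw [dihedral_of hL h h0 h1, dihedral_of (t := 2 * q - 1 - t) (a := p + r - a) hL
    (by linear_combination -h) (by omega) (by omega)]
  have : Even (2 * q - 1 - t) ↔ ¬ Even t := by
    rw [Int.even_sub, Int.even_sub]; simp
  by_cases ht : Even t
  · rw [if_pos ht, if_neg fun h => this.1 h ht]; ring
  · rw [if_neg ht, if_pos (this.2 ht)]

/-- An even translation is a composite of two of these reflections. -/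
lemma dihedral_translate (hL : 0 < p + r + 1) (i q : ℤ) :
    dihedral p r (i + 2 * ((p + r + 1) * q)) = dihedral p r i := by
  rw [← dihedral_reflect hL i 0, ← dihedral_reflect hL _ q]
  congr 1
  ring

end Dihedral

end Kinds
end Clannish
end SLC
end

noncomputable section
namespace SLC
namespace Clannish

/-! ### The foldings for the four types of strings and bands. -/

section KindFoldings

universe u v₀ v₁

variable {K : Type u} {Q₀ : Type v₀} {Q₁ : Type v₁} [DivisionRing K] {D : Clannish K Q₀ Q₁}
  [Fintype Q₀] {w : D.Word} {π : TwistFamily w.canon}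

lemma mirrorAct_C {k k' : ℤ} {s : Q₁} {P : Set ℤ} (hN : D.NormallyBound) (π : TwistFamily w.canon)
    (hm : IsMirror w.canon s k k' P) (l : K) :
    mirrorAct hN π hm (mirrorC π hm l) = kAct π l :=
  quadLift_C _ _ _ _ _ (mirror_comm hN π hm) (mirror_quad hN π hm) l

lemma periodAct_C {n : ℤ} (π : TwistFamily w.canon) (hP : IsPeriodic w.canon n) (l : K) :
    periodAct π hP (laurentC _ l) = kAct π l := by
  unfold periodAct; rw [laurentLift_C]

lemma periodAct_X {n : ℤ} (π : TwistFamily w.canon) (hP : IsPeriodic w.canon n) (m : ℤ) :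
    periodAct π hP (laurentX (periodAut π hP) (.ofAdd m)) = .op (shiftEnd hP m) := by
  unfold periodAct; rw [laurentLift_X]; rfl

/-- The trivial folding of an asymmetric string. -/
def foldingAsymString (hN : D.NormallyBound) (π : TwistFamily w.canon) (h : w.IsString)
    (hw : w.inv ≠ w) : FoldingData w h.2.1 π (ofKind hN w π (.asymString h hw)) where
  f := id
  unit _ := 1
  idem _ := rfl
  foldAt _ := FoldAt.base rfl rfl
  one _ _ := rfl
  incl_act _ := rfl
  gens := ∅
  gens_top G hG _ s := hG s
  gens_act x hx := hx.elim
  sep i j hi hj hs := by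
    obtain ⟨n, hn⟩ := h.1
    rcases Word.eq_or_add_eq_of_half h.2.1 hn hi hj hs with h1 | ⟨h1, h2⟩
    · exact h1
    -- Opposite signs would make `w⁻¹` a shift of the finite word `w`, hence equal to `w`. The
    -- comparison lemma also asks for equal vertices, which are read off from an adjacent letter
    -- unless the length is `0`.
    · refine absurd ?_ hw
      have hl := Word.letter_of_half_neg h.2.1 h.2.1 hi hj h2 hs
      have hv : w.vert i = w.vert j := by
        rcases Nat.eq_zero_or_pos n with rfl | hn0
        · rw [hn] at hi hj
          simp only [Idx.I, Set.mem_Icc, Nat.cast_zero] at hi hj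
          rw [show i = j by omega]
        · by_cases hi0 : 0 < i
          · obtain ⟨x, hx⟩ := (w.letter_some_iff i).2 ((w.mem_I'_fin hn i).2 ⟨hi0, by
              rw [hn] at hi; exact hi.2⟩)
            have hx' := hl 0
            rw [add_zero, sub_zero, hx] at hx'
            obtain ⟨y, hy, rfl⟩ := Option.map_eq_some_iff.1 hx'.symm
            have := w.head_eq _ _ hy
            rw [add_sub_cancel_right] at this
            rw [w.tail_eq _ _ hx, this, Letter.bar_bar]
          · have hi1 : i = 0 := by
              rw [hn] at hi
              exact le_antisymm (by omega) hi.1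
            obtain ⟨x, hx⟩ := (w.letter_some_iff (i + 1)).2 ((w.mem_I'_fin hn _).2 (by omega))
            have hx' := hl 1
            rw [add_sub_cancel_right, hx] at hx'
            obtain ⟨y, hy, rfl⟩ := Option.map_eq_some_iff.1 hx'.symm
            have := w.head_eq _ _ hx
            rw [add_sub_cancel_right] at this
            rw [w.tail_eq _ _ hy, this]
      rw [Word.inv_eq_shift_of_half h.2.1 h.2.1 hi hj hv h2 hs, Word.shift_fin hn]

/-- The folding of a symmetric string. -/
lemma nonempty_foldingSymString (hN : D.NormallyBound) (hS : D.NonSingular)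
    (π : TwistFamily w.canon) (k : ℕ) (s : Q₁) (h : w.IsString) (hk : w.idx = .fin (2 * k + 1))
    (hw : w.inv = w) (hs : w.letter (k + 1) = some (.star s)) :
    Nonempty (FoldingData w h.2.1 π (ofKind hN w π (.symString k s h hk hw hs))) := by
  classical
  set S := ofKind hN w π (.symString k s h hk hw hs)
  have hm := Word.mirror_string h hk hw hs
  have hc := Word.isSymmetry_center hk hw hs
  obtain ⟨x, hx, hxe⟩ := exists_mirrorUnit (S := S) hN hS hm (RingHom.id _) (fun _ => rfl)
    (fun _ => rfl)
  let f : ℤ → ℤ := fun i => if i ≤ k then i else 2 * k + 1 - i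
  let unit : ℤ → S.carrierˣ := fun i => if i ≤ k then 1 else x
  have hkk : (k : ℤ) + (k + 1) = 2 * (k + 1) - 1 := by ring
  have hf : ∀ j, f ((k : ℤ) + (k + 1) - j) = f j := fun j => by
    simp only [f]; split_ifs <;> omega
  have hu : ∀ i ∈ {i : ℤ | i ≤ k}, unit ((k : ℤ) + (k + 1) - i) = unit i * x := fun i hi => by
    simp only [Set.mem_ofPred_eq] at hi
    simp only [unit]
    rw [if_neg (by omega), if_pos hi, one_mul]
  have base : ∀ i : ℤ, i ≤ k → FoldAt w π S f unit i := fun i hi =>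
    FoldAt.base (if_pos hi) (if_pos hi)
  refine ⟨⟨f, unit, fun i => ?_, fun i => ?_, fun i hi => ?_, fun l => ?_, {(x : S.carrier)},
    fun G hC hG => quad_gen _ _ _ G hC ?_, ?_, ?_⟩⟩
  · simp only [f]; split_ifs <;> omega
  · rcases le_or_gt i k with hi | hi
    · exact base i hi
    · have := hx.foldAt (i := k + (k + 1) - i) (base _ (by omega)) hc hkk
        (show (k : ℤ) + (k + 1) - i ≤ k by omega) hf hu
      rwa [sub_sub_cancel] at this
  -- No vertex is fixed by the reflection, because `2 k + 1` is odd.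
  · refine if_pos ?_
    by_contra hne
    have : f i = 2 * k + 1 - i := if_neg hne
    omega
  · exact mirrorAct_C hN π hm l
  · have := hG (Set.mem_singleton (x : S.carrier))
    rw [hxe] at this
    exact this
  · rintro _ rfl i
    exact hx.gens_act hN hf hu i
  · intro i j hi hj hs
    rcases Word.eq_or_add_eq_of_half h.2.1 hk hi hj hs with h1 | ⟨h1, -⟩
    · rw [h1]
    · push_cast at h1
      rw [← hf j, show i = k + (k + 1) - j by omega]

/-- Since `b_i X^m = b_{i - nm}`, residues modulo `n` serve as representatives, and `b_i` is
obtained from that of its residue by the power `-(i / n)` of `X`. Only these properties of the ring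
enter, so it is kept abstract. -/
lemma nonempty_foldingData_of_periodic {S : ParamRing w.canon} {n : ℕ} (h : w.IsBand)
    (hn : IsLeast {n : ℕ | 0 < n ∧ w.shift n = w} n) (hw : ¬ ∃ m, w.inv = w.shift m)
    (hP : IsPeriodic w.canon n) (X : ℤ → S.carrierˣ) (X_zero : X 0 = 1)
    (X_add : ∀ l m, X (l + m) = X l * X m) (incl_act : ∀ l, S.act (S.incl l) = kAct π l)
    (act : ∀ m i, (S.act (X m)).unop (b w.canon i) = b w.canon (i - n * m))
    (comm : ∀ m l, (X m : S.carrier) * S.incl l = S.incl ((periodAut π hP ^ m) l) * X m)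
    (gen : ∀ G : Subring S.carrier, (∀ l, S.incl l ∈ G) → (∀ m, (X m : S.carrier) ∈ G) →
      ∀ s, s ∈ G) :
    Nonempty (FoldingData w h.endAdmissible π S) := by
  have hn0 : (0 : ℤ) < n := by exact_mod_cast hn.1.1
  have hl := Word.letter_period_mul (Word.letter_period h.1 hn.1.2)
  have hmod : ∀ i : ℤ, i % n = i + n * (-(i / n)) := fun i => by
    rw [Int.emod_def, mul_neg, sub_eq_add_neg]
  refine ⟨⟨fun i => i % n, fun i => X (-(i / n)), fun i => Int.emod_emod ..,
    fun i => ⟨?_, fun δ => ?_, fun δ x _ => ?_, ?_, fun v l _ => ?_⟩, fun i hi => ?_, incl_act,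
    Set.range fun m => (X m : S.carrier), fun G hC hG => gen G hC fun m => hG ⟨m, rfl⟩, ?_,
    fun i j _ _ hs => ?_⟩⟩
  · rw [Int.emod_def]
    exact (period_all hP (i / n)).vert i
  · rw [hmod, Word.lt_shift (hl _)]
  · rw [hmod i, Word.nx_shift (hl _), Int.add_mul_emod_self_left]
  · rw [act]
    congr 1
    rw [hmod]; ring
  · have e := period_twist_pow π hP (-(i / n)) (i % n)
    rw [show i % n - n * -(i / n) = i by rw [hmod]; ring] at e
    rw [comm, e]
    congr 2
    exact ((π.toFun (i % n)).symm_apply_apply _).symm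
  · have e := hmod i
    rw [hi, left_eq_add, mul_eq_zero] at e
    rw [e.resolve_left hn0.ne', X_zero]
  · rintro _ ⟨m, rfl⟩ i
    have e : i - n * m = i + n * (-m) := by ring
    refine ⟨i - n * m, ?_, (period_all hP m).vert i, Or.inl ⟨act m i, ?_⟩⟩
    · rw [e, Int.add_mul_emod_self_left]
    · rw [e, Int.add_mul_ediv_left _ _ hn0.ne', neg_add, neg_neg, X_add, Units.val_mul]
  -- The same sign gives a translation, which is a multiple of the period; opposite signs give a
  -- symmetry, which an asymmetric band does not have.
  · rcases Word.fsgn_eq_or w w i j with h1 | h1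
    · exact Int.modEq_iff_dvd.2
        (Word.period_dvd h.1 hn (Word.letter_translate h.endAdmissible h.1 h1 hs))
    · obtain ⟨c, -, hc⟩ := Word.symmetry_of_opposite h.1
        (Word.letter_opposite h.endAdmissible h.1 h1 hs)
      exact absurd ⟨_, w.inv_eq_shift h.1 hc⟩ hw

/-- The folding of an asymmetric band. -/
lemma nonempty_foldingAsymBand (hN : D.NormallyBound) (π : TwistFamily w.canon) (n : ℕ)
    (h : w.IsBand) (hn : IsLeast {n : ℕ | 0 < n ∧ w.shift n = w} n)
    (hw : ¬ ∃ m, w.inv = w.shift m) :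
    Nonempty (FoldingData w h.endAdmissible π (ofKind hN w π (.asymBand n h hn hw))) := by
  have hP := Word.periodic h hn.1.2 hw
  refine nonempty_foldingData_of_periodic h hn hw hP
    (fun m => laurentX (periodAut π hP) (.ofAdd m)) (map_one _)
    (fun l m => map_mul (laurentX (periodAut π hP)) (.ofAdd l) (.ofAdd m)) (fun l => ?_)
    (fun m i => ?_) (fun m l => laurentX_mul_C _ m l) (fun G => laurent_gen _ G)
  · exact periodAct_C π hP l
  · change (periodAct π hP (laurentX (periodAut π hP) (.ofAdd m))).unop (b w.canon i) = _
    rw [periodAct_X]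
    exact shiftEnd_b hP m i

/-- The folding of a symmetric band. -/
lemma nonempty_foldingSymBand (hN : D.NormallyBound) (hS : D.NonSingular)
    (π : TwistFamily w.canon) (p r : ℕ) (s t : Q₁) (h : w.IsBand)
    (hw : ∃ m, w.inv = w.shift m) (hr : IsLeast {i : ℤ | 0 < i ∧ w.IsSymmetry i} (r + 1))
    (hp : IsGreatest {i : ℤ | i ≤ 0 ∧ w.IsSymmetry i} (-p))
    (hs : w.letter (r + 1) = some (.star s)) (ht : w.letter (-p) = some (.star t)) :
    Nonempty (FoldingData w h.endAdmissible π
      (ofKind hN w π (.symBand p r s t h hw hr hp hs ht))) := by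
  set S := ofKind hN w π (.symBand p r s t h hw hr hp hs ht)
  have hml := Word.mirror_left h hp ht
  have hmr := Word.mirror_right h hr hs
  have glue : ∀ a, mirrorAct hN π hml (mirrorC π hml a) = mirrorAct hN π hmr (mirrorC π hmr a) :=
    fun a => (mirrorAct_C hN π hml a).trans (mirrorAct_C hN π hmr a).symm
  obtain ⟨y, hy, hye⟩ := exists_mirrorUnit (S := S) hN hS hml
    (FreeProd.inl (mirrorC π hml) (mirrorC π hmr)) (fun _ => rfl)
    (fun a => FreeProd.lift_inl _ _ _ _ glue a)
  obtain ⟨x, hx, hxe⟩ := exists_mirrorUnit (S := S) hN hS hmr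
    (FreeProd.inr (mirrorC π hml) (mirrorC π hmr))
    (fun _ => (FreeProd.inl_eq_inr _ _ _).symm) (fun a => FreeProd.lift_inr _ _ _ _ glue a)
  have hL : (0 : ℤ) < p + r + 1 := by omega
  let f : ℤ → ℤ := dihedral p r
  -- The block containing `i` records which alternating sequence of reflections leads from `[-p, r]`
  -- to `i`. The unit is the corresponding alternating product of the two variables.
  let unit : ℤ → S.carrierˣ := fun i => alternatingZ x y ((i + p) / (p + r + 1))
  have hfr : ∀ j, f ((r : ℤ) + (r + 1) - j) = f j := fun j => by
    rw [show (r : ℤ) + (r + 1) - j = 2 * (-p + (p + r + 1) * 1) - 1 - j by ring]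
    exact dihedral_reflect hL j 1
  have hfl : ∀ j, f (-(p : ℤ) + (-p - 1) - j) = f j := fun j => by
    rw [show -(p : ℤ) + (-p - 1) - j = 2 * (-p + (p + r + 1) * 0) - 1 - j by ring]
    exact dihedral_reflect hL j 0
  have hur : ∀ i ∈ {i : ℤ | i ≤ r}, unit ((r : ℤ) + (r + 1) - i) = unit i * x := fun i hi => by
    obtain ⟨a, t, e, h0, h1⟩ := dihedral_cases hL i
    have ht : t ≤ 0 := by
      by_contra hc
      have : i ≤ r := hi
      nlinarith
    simp only [unit]
    rw [(dihedral_div hL e h0 h1).1, ← alternatingZ_right x y ht,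
      (dihedral_div (i := r + (r + 1) - i) (a := p + r - a) (t := 1 - t) hL
        (by linear_combination -e) (by omega) (by omega)).1]
  have hul : ∀ i ∈ {i : ℤ | -(p : ℤ) ≤ i}, unit (-(p : ℤ) + (-p - 1) - i) = unit i * y :=
      fun i hi => by
    obtain ⟨a, t, e, h0, h1⟩ := dihedral_cases hL i
    have ht : 0 ≤ t := by
      by_contra hc
      have : -(p : ℤ) ≤ i := hi
      nlinarith
    simp only [unit]
    rw [(dihedral_div hL e h0 h1).1, ← alternatingZ_left x y ht,
      (dihedral_div (i := -p + (-p - 1) - i) (a := p + r - a) (t := -1 - t) hL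
        (by linear_combination -e) (by omega) (by omega)).1]
  have one : ∀ i : ℤ, -p ≤ i → i ≤ r → unit i = 1 := fun i h0 h1 => by
    simp only [unit]
    rw [Int.ediv_eq_zero_of_lt (by omega) (by omega), alternatingZ_zero]
  -- Induction on the distance from the block `0`: a vertex to the right is reflected about `r + 1`
  -- and one to the left about `-p`, and in both cases the absolute value of the block number drops
  -- by one.
  have fold : ∀ (m : ℕ) (i : ℤ), ((i + p) / (p + r + 1)).natAbs = m → FoldAt w π S f unit i := by
    intro m
    induction m with
    | zero =>
      intro i hi
      obtain ⟨a, t, e, h0, h1⟩ := dihedral_cases hL i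
      rw [(dihedral_div hL e h0 h1).1, Int.natAbs_eq_zero] at hi
      rw [hi] at e
      exact FoldAt.base (dihedral_self hL (by omega) (by omega)) (one i (by omega) (by omega))
    | succ m ih =>
      intro i hi
      obtain ⟨a, t, e, h0, h1⟩ := dihedral_cases hL i
      rw [(dihedral_div hL e h0 h1).1] at hi
      rcases lt_or_ge 0 t with ht | ht
      · have e' := (dihedral_div (i := r + (r + 1) - i) (a := p + r - a) (t := 1 - t) hL
          (by linear_combination -e) (by omega) (by omega)).1
        have hLt : (p + r + 1 : ℤ) ≤ (p + r + 1) * t := by nlinarith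
        have := hx.foldAt (i := r + (r + 1) - i) (ih _ (by rw [e']; omega)) hr.1.2 (by ring)
          (show (r : ℤ) + (r + 1) - i ≤ r by linarith) hfr hur
        rwa [sub_sub_cancel] at this
      · have e' := (dihedral_div (i := -p + (-p - 1) - i) (a := p + r - a) (t := -1 - t) hL
          (by linear_combination -e) (by omega) (by omega)).1
        have hLt : (p + r + 1 : ℤ) * t ≤ -(p + r + 1) := by
          nlinarith [show t ≤ -1 by omega]
        have := hy.foldAt (i := -p + (-p - 1) - i) (ih _ (by rw [e']; omega)) hp.1.2 (by ring)
          (show -(p : ℤ) ≤ -p + (-p - 1) - i by linarith) hfl hul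
        rwa [sub_sub_cancel] at this
  refine ⟨⟨f, unit, fun i => ?_, fun i => fold _ i rfl, fun i hi => ?_, fun l => ?_,
    {(x : S.carrier), (y : S.carrier)}, fun G hC hG => FreeProd.gen _ _ G ?_ ?_, ?_, ?_⟩⟩
  · exact dihedral_self hL (dihedral_mem hL i).1 (dihedral_mem hL i).2
  · have := dihedral_mem hL i
    exact one i (hi ▸ this.1) (hi ▸ this.2)
  · exact (FreeProd.lift_inl _ _ _ _ glue _).trans (mirrorAct_C hN π hml l)
  · exact quad_gen _ _ _ (G.comap (FreeProd.inl (mirrorC π hml) (mirrorC π hmr))) hC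
      (hye ▸ hG (Or.inr rfl) : FreeProd.inl (mirrorC π hml) (mirrorC π hmr) _ ∈ G)
  · exact quad_gen _ _ _ (G.comap (FreeProd.inr (mirrorC π hml) (mirrorC π hmr)))
      (fun a => (FreeProd.inl_eq_inr (mirrorC π hml) (mirrorC π hmr) a ▸ hC a :
        FreeProd.inr (mirrorC π hml) (mirrorC π hmr) _ ∈ G))
      (hxe ▸ hG (Or.inl rfl) : FreeProd.inr (mirrorC π hml) (mirrorC π hmr) _ ∈ G)
  · rintro _ (rfl | rfl) i
    · exact hx.gens_act hN hfr hur i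
    · exact hy.gens_act hN hfl hul i
  · intro i j _ _ hs
    -- Every reflection preserving the band is about a symmetry, and the symmetries are the points
    -- `-p + (p + r + 1) q`.
    have refl : ∀ {e : ℤ}, (∀ m, w.letter (e - m) = (w.letter m).map Letter.bar) →
        ∃ q, e = 2 * (-p + (p + r + 1) * q) := fun he => by
      obtain ⟨c, rfl, hc⟩ := Word.symmetry_of_opposite h.1 he
      obtain ⟨q, hq⟩ := Word.symmetry_dvd hr hp hc
      exact ⟨q, by linear_combination 2 * hq⟩
    rcases Word.fsgn_eq_or w w i j with h1 | h1
    · have := Word.letter_translate h.endAdmissible h.1 h1 hs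
      -- A translation is composed with the reflection about `-p` to give a reflection, which
      -- determines the translation.
      obtain ⟨q, hq⟩ := refl (e := 2 * -(p : ℤ) + (j - i)) fun m => by
        rw [show 2 * -(p : ℤ) + (j - i) - m = 2 * -(p : ℤ) - m + (j - i) by ring, this,
          hp.1.2.reflect]
      rw [show j = i + 2 * ((p + r + 1) * q) by linear_combination hq]
      exact (dihedral_translate hL i q).symm
    · obtain ⟨q, hq⟩ := refl (Word.letter_opposite h.endAdmissible h.1 h1 hs)
      rw [show j = 2 * (-p + (p + r + 1) * q) - 1 - i by linear_combination hq]
      exact (dihedral_reflect hL i q).symm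

lemma nonempty_folding (hN : D.NormallyBound) (hS : D.NonSingular) (hw : w.EndAdmissible)
    (π : TwistFamily w.canon) (κ : w.Kind) : Nonempty (Folding w hw π (ofKind hN w π κ)) := by
  cases κ with
  | asymString h hi => exact ⟨(foldingAsymString hN π h hi).folding hN h.2.2⟩
  | symString k s h hk hi hs =>
    exact (nonempty_foldingSymString hN hS π k s h hk hi hs).map fun F => F.folding hN h.2.2
  | asymBand n h hn hi =>
    exact (nonempty_foldingAsymBand hN π n h hn hi).map fun F => F.folding hN h.2.1
  | symBand p r s t h hi hr hp hs ht =>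
    exact (nonempty_foldingSymBand hN hS π p r s t h hi hr hp hs ht).map
      fun F => F.folding hN h.2.1

end KindFoldings
end Clannish
end SLC
end

noncomputable section
namespace SLC
namespace Clannish

/-! ### Direct sums of decomposed modules -/

section Sums

variable {K Q₀ Q₁ : Type*} [DivisionRing K] {D : Clannish K Q₀ Q₁} {P ι : Type*}

/-- The disjoint union of systems of points. -/
def PointSystem.sum (S : ι → PointSystem D P) : PointSystem D (ι × P) where
  vtx q := (S q.1).vtx q.2
  lt q := (S q.1).lt q.2
  nx q δ := (q.1, (S q.1).nx q.2 δ)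
  allowed {q _ _} h := (S q.1).allowed h
  head {q _ _} h := (S q.1).head h
  sign {q _ _} h := (S q.1).sign h
  back {q _ _} h := (S q.1).back h
  back_nx {q _ _} h := Prod.ext rfl ((S q.1).back_nx h)
  star {q _} hs h := (S q.1).star hs h

lemma PointSystem.half_sum (S : ι → PointSystem D P) (i : ι) {p : P} (h : (S i).vtx p ≠ none)
    (δ : ℤˣ) : (PointSystem.sum S).half (i, p) δ = (S i).half p δ :=
  PointSystem.half_map (S := S i) (S' := PointSystem.sum S) (Prod.mk i) (fun _ _ _ => rfl)
    (fun _ _ _ _ => rfl) h δ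

variable [Fintype Q₀] [DecidableEq ι] {S : ι → PointSystem D P} {N : ι → Type*}
  [∀ i, AddCommGroup (N i)] [∀ i, Module D.Alg (N i)]

/-- The component at a point of the `i`-th summand. -/
def PointSystem.Rep.sumPr (R : ∀ i, (S i).Rep (N i)) (q : ι × P) : (⨁ i, N i) →+ ⨁ i, N i :=
  ((DirectSum.lof D.Alg ι N q.1).toAddMonoidHom.comp ((R q.1).pr q.2)).comp
    (DirectSum.component D.Alg ι N q.1).toAddMonoidHom

variable (R : ∀ i, (S i).Rep (N i))

lemma PointSystem.Rep.sumPr_apply (i : ι) (p : P) (x : ⨁ i, N i) :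
    PointSystem.Rep.sumPr R (i, p) x = DirectSum.lof D.Alg ι N i ((R i).pr p (x i)) := rfl

lemma PointSystem.Rep.sumPr_lof (i : ι) (p : P) (y : N i) :
    PointSystem.Rep.sumPr R (i, p) (DirectSum.lof D.Alg ι N i y) =
      DirectSum.lof D.Alg ι N i ((R i).pr p y) := by
  rw [sumPr_apply, DirectSum.lof_apply]

lemma PointSystem.Rep.sumPr_lof_ne {i j : ι} (h : i ≠ j) (p : P) (y : N i) :
    PointSystem.Rep.sumPr R (j, p) (DirectSum.lof D.Alg ι N i y) = 0 := by
  have : DirectSum.lof D.Alg ι N i y j = 0 := DirectSum.of_eq_of_ne i j y h.symm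
  rw [sumPr_apply, this, map_zero, map_zero]

lemma PointSystem.Rep.sumPr_eq_zero {i : ι} {p : P} {x : ⨁ i, N i} :
    PointSystem.Rep.sumPr R (i, p) x = 0 ↔ (R i).pr p (x i) = 0 := by
  rw [sumPr_apply]
  refine ⟨fun h => ?_, fun h => by rw [h, map_zero]⟩
  have := congrFun (congrArg DFunLike.coe h) i
  rwa [DirectSum.lof_apply] at this

open PointSystem.Rep in
/-- A direct sum of decomposed modules is decomposed. -/
def PointSystem.Rep.sum : (PointSystem.sum S).Rep (⨁ i, N i) where
  pr := sumPr R
  pr_pr := fun ⟨i, p⟩ x => by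
    rw [sumPr_apply R i p x, sumPr_lof, (R i).pr_pr]
  pr_ne := by
    rintro ⟨i, p⟩ ⟨j, q⟩ h x
    rw [sumPr_apply R i p x]
    by_cases hij : i = j
    · subst hij
      rw [sumPr_lof, (R i).pr_ne (fun e => h (by rw [e])), map_zero]
    · rw [sumPr_lof_ne R hij]
  span G h x := by
    induction x using DirectSum.induction_on with
    | zero => exact G.zero_mem
    | of i y =>
      refine (R i).span (G.comap (DirectSum.of N i)) (fun p y => ?_) y
      have := h (i, p) (DirectSum.lof D.Alg ι N i y)
      rwa [sumPr_lof] at this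
    | add x y hx hy => exact G.add_mem hx hy
  none := fun {q} h x => by
    obtain ⟨i, p⟩ := q
    rw [sumPr_apply, (R i).none h, map_zero]
  smul := fun ⟨i, p⟩ l x => by
    rw [sumPr_apply, sumPr_apply, DirectSum.smul_apply, (R i).smul, map_smul]
  vtx := fun {q v} h x => by
    obtain ⟨i, p⟩ := q
    rw [sumPr_apply, ← map_smul, (R i).vtx h]
  ord := fun {q a} h x => by
    obtain ⟨i, p⟩ := q
    change sumPr R (i, (S i).nx p _) _ = _
    rw [sumPr_apply R i p x, ← map_smul, sumPr_lof, (R i).ord h]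
  ord_surj := fun {q a} h y => by
    obtain ⟨i, p⟩ := q
    obtain ⟨x, hx⟩ := (R i).ord_surj h (y i)
    refine ⟨DirectSum.lof D.Alg ι N i x, ?_⟩
    rw [sumPr_lof, ← map_smul, hx]
    rfl
  ord_inj := fun {q a} h x hx => by
    obtain ⟨i, p⟩ := q
    rw [sumPr_apply, ← map_smul] at hx
    have h0 := congrFun (congrArg DFunLike.coe hx) i
    rw [DirectSum.lof_apply] at h0
    rw [sumPr_apply, (R i).ord_inj h _ h0, map_zero]
  ord_zero := fun {q a} ha h x => by
    obtain ⟨i, p⟩ := q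
    rw [sumPr_apply, ← map_smul, (R i).ord_zero ha h, map_zero]
  spec := fun {q δ s} h => by
    obtain ⟨i, p⟩ := q
    have h' : (S i).lt p δ = some (.star s) := h
    have hv : (S i).vtx p ≠ Option.none := by rw [(PointSystem.lt_star_eq h').2.2]; simp
    have hv' : (S i).vtx ((S i).nx p δ) ≠ Option.none := by rw [PointSystem.vtx_nx h']; simp
    change (SeqLe _ ((PointSystem.sum S).half (i, (S i).nx p δ) _) ∧ _) ∨
      (SeqLe ((PointSystem.sum S).half (i, (S i).nx p δ) _) _ ∧ _)
    rw [PointSystem.half_sum S i hv, PointSystem.half_sum S i hv']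
    rcases (R i).spec h' with ⟨h1, h2, h3⟩ | ⟨h1, h2, h3⟩
    · refine Or.inl ⟨h1, fun x => ?_, fun y => ?_⟩
      · change sumPr R (i, (S i).nx p δ) _ = _
        rw [sumPr_apply R i p x, ← map_smul, sumPr_lof, h2]
      · obtain ⟨x, hx⟩ := h3 (y i)
        refine ⟨DirectSum.lof D.Alg ι N i x, ?_⟩
        rw [sumPr_lof, ← map_smul, hx]
        rfl
    · refine Or.inr ⟨h1, fun x => ?_, fun y => ?_⟩
      · change sumPr R (i, p) (D.arr s • sumPr R (i, (S i).nx p δ) x) =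
          D.arr s • sumPr R (i, (S i).nx p δ) x
        rw [sumPr_apply R i _ x, ← map_smul, sumPr_lof, h2]
      · obtain ⟨x, hx⟩ := h3 (y i)
        refine ⟨DirectSum.lof D.Alg ι N i x, ?_⟩
        change D.arr s • sumPr R (i, (S i).nx p δ) _ = _
        rw [sumPr_lof, ← map_smul, hx]
        rfl

end Sums
end Clannish
end SLC
end

noncomputable section
namespace SLC
namespace Clannish

/-! ### The functors on direct sums of string and band modules -/

section Evaluation

universe u v₀ v₁ v₂

variable {K : Type u} {Q₀ : Type v₀} {Q₁ : Type v₁} [DivisionRing K] {D : Clannish K Q₀ Q₁}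

lemma StringOrBand.endAdmissible (w : D.StringOrBand) : w.word.EndAdmissible :=
  w.prop.elim (fun h => h.2.1) fun h => h.endAdmissible

variable [Fintype Q₀]

/-- A folding of a string or band. -/
def StringOrBand.folding (hN : D.NormallyBound) (hS : D.NonSingular) (w : D.StringOrBand)
    (π : TwistFamily w.walk) : Folding w.word w.endAdmissible π (w.ringR hN π) :=
  (nonempty_folding hN hS w.endAdmissible π _).some

/-- The vertices of the folded word with the same half-words as a vertex of another word. -/
lemma Folding.mat_iff {w u : D.Word} {hw : w.EndAdmissible} {π : TwistFamily w.canon}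
    {S : ParamRing w.canon} (F : Folding w hw π S) (hu : u.EndAdmissible) {i : ℤ}
    (hi : i ∈ u.idx.I) (j : ℤ) : (u.points hu).Mat F.points i j ↔
      F.f j = j ∧ u.vert i = w.vert j ∧
        ∀ δ, (u.points hu).half i δ = (w.points hw).half j δ := by
  obtain ⟨v, hv⟩ := Option.isSome_iff_exists.1 ((u.vert_dom i).2 hi)
  constructor
  · rintro ⟨h1, h2⟩
    change _ = u.vert i at h1
    rw [hv] at h1
    obtain ⟨hj, hjv⟩ := F.of_vtx h1
    refine ⟨hj, by rw [hv, hjv], fun δ => ?_⟩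
    rw [← F.half_eq (i := j) (by rw [hjv]; simp), hj, h2]
  · rintro ⟨hj, h1, h2⟩
    refine ⟨(F.vtx_eq hj).trans h1.symm, fun δ => ?_⟩
    rw [h2, ← F.half_eq (i := j) (by rw [← h1, hv]; simp), hj]

/-- The matching vertex of the folded word exists and is unique for equivalent words. -/
lemma Folding.exists_mat {w u : D.Word} {hw : w.EndAdmissible} {π : TwistFamily w.canon}
    {S : ParamRing w.canon} (F : Folding w hw π S) (hu : u.EndAdmissible) (h0 : 0 ∈ u.idx.I) :
    w.Equiv u ↔ ∃ j, (u.points hu).Mat F.points 0 j := by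
  rw [Word.equiv_iff_exists hu hw h0]
  constructor
  · rintro ⟨j, hj, hv, hh⟩
    refine ⟨F.f j, (F.mat_iff hu h0 _).2 ⟨F.idem j, by rw [F.vert, hv], fun δ => ?_⟩⟩
    have hn : w.vert j ≠ none := by rw [Ne, w.vert_none_iff]; exact not_not.2 hj
    rw [hh, ← F.half_eq hn, ← F.half_eq (i := F.f j) (by rwa [F.vert]), F.idem]
  · rintro ⟨j, h⟩
    obtain ⟨-, hv, hh⟩ := (F.mat_iff hu h0 j).1 h
    exact ⟨j, by rw [← w.vert_dom, ← hv, u.vert_dom]; exact h0, hv, hh⟩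

/-- Vertices with the same half-words have the same representative by `sep`, and matching points of
the folded word are themselves representatives. -/
lemma Folding.mat_unique {w u : D.Word} {hw : w.EndAdmissible} {π : TwistFamily w.canon}
    {S : ParamRing w.canon} (F : Folding w hw π S) (hu : u.EndAdmissible) (h0 : 0 ∈ u.idx.I)
    {j j' : ℤ} (h : (u.points hu).Mat F.points 0 j) (h' : (u.points hu).Mat F.points 0 j') :
    j = j' := by
  obtain ⟨hj, hv, hh⟩ := (F.mat_iff hu h0 j).1 h
  obtain ⟨hj', hv', hh'⟩ := (F.mat_iff hu h0 j').1 h'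
  rw [← hj, ← hj']
  exact F.sep j j' (by rw [← w.vert_dom, ← hv, u.vert_dom]; exact h0)
    (by rw [← w.vert_dom, ← hv', u.vert_dom]; exact h0) fun δ => by rw [← hh, hh']

variable (hN : D.NormallyBound) (hS : D.NonSingular)
  (π : ∀ w : D.StringOrBand, TwistFamily w.walk) (u : D.StringOrBand)
  (W : Set D.StringOrBand) (V : W → Type v₂) [∀ w, AddCommGroup (V w)]
  [∀ w : W, Module (w.1.ringR hN (π w.1)).carrier (V w)]

/-- The matching vertex for a word equivalent to `u`. -/
lemma StringOrBand.exists_mat (w : {w : W // w.1.word.Equiv u.word}) : ∃ j,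
    (u.word.points u.endAdmissible).Mat (w.1.1.folding hN hS (π w.1.1)).points 0 j :=
  ((w.1.1.folding hN hS (π w.1.1)).exists_mat u.endAdmissible (Word.zero_mem_I u.prop)).1 w.2

/-- The place where a word equivalent to `u` looks like `u` at `0`. -/
def place (w : {w : W // w.1.word.Equiv u.word}) : ℤ :=
  (StringOrBand.exists_mat hN hS π u W w).choose

lemma place_mat (w : {w : W // w.1.word.Equiv u.word}) :
    (u.word.points u.endAdmissible).Mat (w.1.1.folding hN hS (π w.1.1)).points 0
      (place hN hS π u W w) :=
  (StringOrBand.exists_mat hN hS π u W w).choose_spec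

/-- The automorphism by which the `K`-structure is twisted. -/
def twistAut (w : {w : W // w.1.word.Equiv u.word}) : RingAut K :=
  -- Acting by `λ` on `θ` multiplies `θ(b_0)` by `π_0(λ)`, while `μ (b_j ⊗ v) = b_j ⊗ π_j⁻¹(μ) v` at
  -- the place `j`.
  ((π w.1.1).toFun (place hN hS π u W w))⁻¹ * (π u).toFun 0

open Classical in
/-- The coordinates of an element at the places that look like `u` at `0`. -/
def coordinates : (⨁ w : W, tensor (w.1.ringR hN (π w.1)) (V w)) →+
    ⨁ w : {w : W // w.1.word.Equiv u.word}, Restrict (twistAut hN hS π u W w).toRingHom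
      (Restrict (w.1.1.ringR hN (π w.1.1)).incl (V w.1)) :=
  (DFinsupp.mapRange.addMonoidHom
    (β₁ := fun w : {w : W // w.1.word.Equiv u.word} =>
      tensor (w.1.1.ringR hN (π w.1.1)) (V w.1))
    (β₂ := fun w : {w : W // w.1.word.Equiv u.word} =>
      Restrict (twistAut hN hS π u W w).toRingHom
        (Restrict (w.1.1.ringR hN (π w.1.1)).incl (V w.1)))
    fun w => (w.1.1.folding hN hS (π w.1.1)).proj (place hN hS π u W w)).comp
    (DFinsupp.subtypeDomainAddMonoidHom
      (fun w : W => tensor (w.1.ringR hN (π w.1)) (V w)) fun w => w.1.word.Equiv u.word)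

lemma coordinates_apply (x : ⨁ w : W, tensor (w.1.ringR hN (π w.1)) (V w))
    (w : {w : W // w.1.word.Equiv u.word}) : coordinates hN hS π u W V x w =
      ((w.1.1.folding hN hS (π w.1.1)).proj (place hN hS π u W w) (x w.1) : V w.1) := rfl

/-- Evaluation at `0` followed by coordinates. -/
def evCoordinates : T (π u) (⨁ w : W, tensor (w.1.ringR hN (π w.1)) (V w)) →ₗ[K]
    ⨁ w : {w : W // w.1.word.Equiv u.word}, Restrict (twistAut hN hS π u W w).toRingHom
      (Restrict (w.1.1.ringR hN (π w.1.1)).incl (V w.1)) where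
  toFun θ := coordinates hN hS π u W V (θ.ev 0)
  map_add' θ η := by rw [T.ev_add, map_add]
  map_smul' l θ := by
    refine DFinsupp.ext fun w => ?_
    rw [T.ev_smul, coordinates_apply, DirectSum.smul_apply, DirectSum.smul_apply,
      Folding.proj_inK]
    rfl

open Classical in
-- An element `b_j ⊗ y` at the matching place has half-words equal to those of `u` at `0`, in
-- particular bounded by them, so it is the value at `b_0` of a homomorphism. Its other coordinates
-- vanish.
lemma evCoordinates_surjective : Function.Surjective (evCoordinates hN hS π u W V) := by
  intro y
  suffices h : y ∈ LinearMap.range (evCoordinates hN hS π u W V) from h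
  induction y using DirectSum.induction_on with
  | zero => exact Submodule.zero_mem _
  | add x y hx hy => exact Submodule.add_mem _ hx hy
  | of w y =>
    let F := w.1.1.folding hN hS (π w.1.1)
    let R := PointSystem.Rep.sum fun w : W => (w.1.folding hN hS (π w.1)).rep (V w)
    have hm := place_mat hN hS π u W w
    obtain ⟨hj, hv, hh⟩ := (F.mat_iff u.endAdmissible (Word.zero_mem_I u.prop) _).1 hm
    obtain ⟨v, hv0⟩ := Option.isSome_iff_exists.1
      ((u.word.vert_dom 0).2 (Word.zero_mem_I u.prop))
    have hv1 : w.1.1.word.vert (place hN hS π u W w) = some v := hv.symm.trans hv0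
    let x : tensor (w.1.1.ringR hN (π w.1.1)) (V w.1) :=
      tmk _ (b w.1.1.word.canon (place hN hS π u W w)) (y : V w.1)
    have hx : R.pr (w.1, place hN hS π u W w) (DirectSum.lof D.Alg W
        (fun w : W => tensor (w.1.ringR hN (π w.1)) (V w)) w.1 x) =
        DirectSum.lof D.Alg W (fun w : W => tensor (w.1.ringR hN (π w.1)) (V w)) w.1 x := by
      change PointSystem.Rep.sumPr _ _ _ = _
      rw [PointSystem.Rep.sumPr_lof]
      congr 1
      exact F.comp_tmk hj _
    have hlow : (u.word.points u.endAdmissible).Low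
        (PointSystem.sum fun w : W => (w.1.folding hN hS (π w.1)).points) 0
        (w.1, place hN hS π u W w) := by
      refine ⟨hm.1, fun δ => Or.inl ?_⟩
      rw [PointSystem.half_sum, hm.2]
      rw [hm.1]
      change u.word.vert 0 ≠ none
      rw [hv0]; simp
    obtain ⟨η, hη⟩ := Word.exists_ev_eq u.endAdmissible (π u) hS hN
      (PointSystem.Rep.mem_lowSub_of_pr hlow hx)
    refine ⟨η, DFinsupp.ext fun w' => ?_⟩
    change coordinates hN hS π u W V (η.ev 0) w' = _
    rw [hη, coordinates_apply]
    by_cases hw : w = w'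
    · subst hw
      rw [DirectSum.lof_apply]
      have e := F.proj_self (V := V w.1) hj hv1 y
      exact e.trans (DirectSum.of_eq_same (β := fun w => Restrict (twistAut hN hS π u W w).toRingHom
        (Restrict (w.1.1.ringR hN (π w.1.1)).incl (V w.1))) w y).symm
    · have e : DirectSum.lof D.Alg W (fun w : W => tensor (w.1.ringR hN (π w.1)) (V w)) w.1 x w'.1
          = 0 := 
        DirectSum.of_eq_of_ne (β := fun w : W => tensor (w.1.ringR hN (π w.1)) (V w)) _ _ x
          fun e => hw (Subtype.ext e.symm)
      rw [e, map_zero]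
      exact (DirectSum.of_eq_of_ne (β := fun w => Restrict (twistAut hN hS π u W w).toRingHom
        (Restrict (w.1.1.ringR hN (π w.1.1)).incl (V w.1))) w w' y fun e => hw e.symm).symm

open Classical in
-- By `mem_sup_iff` membership in `B⁺ + B⁻` means that the matching components of `θ(b_0)` vanish.
-- The matching points are exactly the places chosen for the words equivalent to `u`, and a
-- component there vanishes together with its coordinate.
lemma ker_evCoordinates : LinearMap.ker (evCoordinates hN hS π u W V) =
    Bplus (π u) _ ⊔ Bminus (π u) _ := by
  let R := PointSystem.Rep.sum fun w : W => (w.1.folding hN hS (π w.1)).rep (V w)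
  have h0 := Word.zero_mem_I u.prop
  obtain ⟨v, hv0⟩ := Option.isSome_iff_exists.1 ((u.word.vert_dom 0).2 h0)
  ext θ
  rw [Word.mem_sup_iff u.endAdmissible (π u) u.prop hS hN R θ, LinearMap.mem_ker]
  have hpt : ∀ w : {w : W // w.1.word.Equiv u.word},
      (evCoordinates hN hS π u W V θ w : V w.1) =
        (w.1.1.folding hN hS (π w.1.1)).proj (place hN hS π u W w) (θ.ev 0 w.1) := fun _ => rfl
  constructor
  · rintro h ⟨w, j⟩ ⟨hq1, hq2⟩
    let F := w.1.folding hN hS (π w.1)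
    have hm : (u.word.points u.endAdmissible).Mat F.points 0 j := by
      refine ⟨hq1, fun δ => ?_⟩
      rw [← hq2, PointSystem.half_sum]
      change (F.points.vtx j) ≠ _
      rw [show F.points.vtx j = u.word.vert 0 from hq1, hv0]; simp
    have hE := (F.exists_mat u.endAdmissible h0).2 ⟨j, hm⟩
    have hj := F.mat_unique u.endAdmissible h0 hm (place_mat hN hS π u W ⟨w, hE⟩)
    obtain ⟨hjf, -, -⟩ := (F.mat_iff u.endAdmissible h0 j).1 hm
    have h1 := hpt ⟨w, hE⟩
    rw [h, ← hj] at h1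
    refine (PointSystem.Rep.sumPr_eq_zero _).2 ?_
    change F.comp j (θ.ev 0 w) = 0
    rw [F.comp_apply hjf, ← h1]
    exact tmk_zero_right _
  · intro h
    refine DFinsupp.ext fun w => (hpt w).trans ?_
    let F := w.1.1.folding hN hS (π w.1.1)
    have hm := place_mat hN hS π u W w
    obtain ⟨hj, hv, hh⟩ := (F.mat_iff u.endAdmissible h0 _).1 hm
    have h1 := h (w.1, place hN hS π u W w) ⟨hm.1, fun δ => by
      rw [PointSystem.half_sum, hm.2]
      rw [hm.1]
      change u.word.vert 0 ≠ none
      rw [hv0]; simp⟩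
    have h2 : F.comp (place hN hS π u W w) (θ.ev 0 w.1) = 0 :=
      (PointSystem.Rep.sumPr_eq_zero _).1 h1
    rw [F.comp_apply hj] at h2
    exact F.tmk_eq_zero (V := V w.1) hj (hv.symm.trans hv0) h2

end Evaluation
end Clannish
end SLC
end

theorem mainTheorem6 {K Q₀ Q₁ : Type*} [DivisionRing K] [Fintype Q₀]
    (D : SLC.Clannish K Q₀ Q₁) (hN : D.NormallyBound) (hS : D.NonSingular)
    (π : ∀ w : D.StringOrBand, SLC.Clannish.TwistFamily w.walk)
    (u : D.StringOrBand) (W : Set D.StringOrBand) (V : W → Type*)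
    [∀ w, AddCommGroup (V w)] [∀ w : W, Module (w.1.ringR hN (π w.1)).carrier (V w)]
    (hV : ∀ w : W, Module.Finite K (SLC.Restrict (w.1.ringR hN (π w.1)).incl (V w))) :
    ∃ ϖ : {w : W // w.1.word.Equiv u.word} → RingAut K,
      Nonempty
        (SLC.Clannish.F (π u) (⨁ w : W, SLC.Clannish.tensor (w.1.ringR hN (π w.1)) (V w)) ≃ₗ[K]
          ⨁ w : {w : W // w.1.word.Equiv u.word},
            SLC.Restrict (ϖ w).toRingHom
              (SLC.Restrict (w.1.1.ringR hN (π w.1.1)).incl (V w.1))) := by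
  refine ⟨SLC.Clannish.twistAut hN hS π u W, ⟨?_⟩⟩
  exact (Submodule.quotEquivOfEq _ _ (SLC.Clannish.ker_evCoordinates hN hS π u W V).symm).trans
    ((SLC.Clannish.evCoordinates hN hS π u W V).quotKerEquivOfSurjective
      (SLC.Clannish.evCoordinates_surjective hN hS π u W V))
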